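/- **Theorem (Non-frameability of TrollThrottle).** Let $\lambda$ be the security parameter; all algorithms receive $1^\lambda$. "PPT" means running in strict probabilistic polynomial time. *DAA scheme.* A direct anonymous attestation scheme consists of PPT algorithms $\mathsf{Setup}_{DAA}(1^\lambda)\to(pk_I,sk_I)$; sampling of a signer's key $sk_S$ from an efficiently decidable key space; $\mathsf{Join}_{DAA}(pk_I,sk_S;r)\to com$ with coins $r\in\{0,1\}^{\ell(\lambda)}$, $\ell$ a polynomial; $\mathsf{Issue}_{DAA}(sk_I,com)\to cred$; $\mathsf{Sign}_{DAA}(sk_S,cred,dom,m)\to\sigma$ with $dom\in\{0,1\}^*\cup\{\bot\}$; and deterministic $\mathsf{Verify}_{DAA}(pk_I,m,dom,\sigma,RL)\in\{0,1\}$, with $RL$ a finite list of keys, and $\mathsf{Link}_{DAA}(\sigma_0,\sigma_1)\in\{0,1,\bot\}$. The scheme is *correct* if: (a) for all keys $sk$, basenames $dom$ and messages $m$, and all lists $RL$ of keys with $sk\notin RL$, a signature made by $sk$ after honest setup and honest join/issue is accepted under $RL$, and, if $dom\ne\bot$, any two such signatures of the same signer for $dom$ are linked, each with probability $\ge 1-\mathrm{negl}(\lambda)$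 uniformly in $sk,dom,RL$ and the messages; (b) for $dom\neq\bot$, $\mathsf{Verify}_{DAA}(pk,m,dom,\sigma,RL)=1$ iff $\mathsf{Verify}_{DAA}(pk,m,dom,\sigma,\emptyset)=1$ and $\sigma$ was not created with a key in $RL$, where "created with $sk$" means that $\sigma$ is linked to some possible output of $\mathsf{Sign}_{DAA}(sk,\cdot,dom,\cdot)$. *User-controlled traceability.* Every PPT adversary wins the following game with negligible probability. She gets $pk_I$ and oracles: $\mathsf{HJoin}(S)$ (the challenger joins $S$ with a fresh secret key and returns $cred_S$); $\mathsf{Join}(S,sk,r)$ (the challenger runs join/issue for the given key $sk$ in the key space and coins $r\in\{0,1\}^{\ell(\lambda)}$, puts $sk$ into $RL$ and returns the credential); $\mathsf{Sign}(S,dom,m)$; $\mathsf{Corrupt}(S)$ (returns $sk_S$ and puts it into $RL$). Every identity joins at most once. She outputs $(S,\sigma,m,dom)$ and wins if (1) $\mathsf{Verify}_{DAA}(pk_I,m,dom,\sigma,RL)=1$ and $\sigma$ was not the response to a Sign query on $(dom,m)$; and/or (2) $dom\ne\bot$, and $\sigma$ and another signature $\sigma'$, both responses to Sign queries for $(S,dom)$,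 satisfy $\mathsf{Link}_{DAA}(\sigma,\sigma')=0$. *Instant linkability.* There are deterministic polynomial-time algorithms $\mathsf{NymGen},\mathsf{NymExtract},\mathsf{VerifyBsn}$ such that for $dom\neq\bot$: $\mathsf{NymGen}(sk,dom)=\mathsf{NymExtract}(\sigma)$ for every key $sk$ and every possible output $\sigma$ of $\mathsf{Sign}_{DAA}(sk,cred,dom,m)$, for any $cred$ and $m$; $\mathsf{Link}_{DAA}(\sigma_1,\sigma_2)=1$ iff $\mathsf{NymExtract}(\sigma_1)=\mathsf{NymExtract}(\sigma_2)$, for all $\sigma_1,\sigma_2$; and no PPT adversary outputs, with non-negligible probability, $(dom,dom',\sigma,pk,m)$ with $dom\ne dom'$, $\mathsf{VerifyBsn}(\sigma,dom)=\mathsf{VerifyBsn}(\sigma,dom')=1$ and $\mathsf{Verify}_{DAA}(pk,m,dom,\sigma,\emptyset)=1$. *Proof of knowledge.* Let $((com,pk),(sk,r))\in\mathcal R_{Join}$ iff $sk$ is in the key space, $r\in\{0,1\}^{\ell(\lambda)}$ and $com=\mathsf{Join}_{DAA}(pk,sk;r)$. A non-interactive proof system $(\mathsf{Setup}_{ZK},\mathsf{CreateProof},\mathsf{VerifyProof})$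 of PPT algorithms, with $\mathsf{VerifyProof}$ deterministic, is a proof of knowledge for $\mathcal R_{Join}$ if there are PPT $(E_1,E_2)$ such that, for every (even unbounded) algorithm $\mathcal A$, $|\Pr[\rho\leftarrow\mathsf{Setup}_{ZK}:\mathcal A(\rho)=1]-\Pr[(\rho,\tau)\leftarrow E_1:\mathcal A(\rho)=1]|$ is negligible, and, for $(\rho,\tau)\leftarrow E_1$, $(x,\pi)\leftarrow\mathcal A(\rho)$ and $w\leftarrow E_2(\rho,\tau,x,\pi)$, with probability $1$ either $\mathsf{VerifyProof}(\rho,x,\pi)=0$ or $(x,w)\in\mathcal R_{Join}$. *Protocol.* Let $h=(h_\lambda)$ be polynomial-time computable. $\mathsf{Setup}$ outputs $\rho=(1^\lambda,\rho_{Join})$ with $\rho_{Join}\leftarrow\mathsf{Setup}_{ZK}(1^\lambda)$; the issuer's keys are those of $\mathsf{Setup}_{DAA}$. $\mathsf{Join}$ sends $com=\mathsf{Join}_{DAA}(pk_I,sk_U;r)$, $r$ uniform, with a proof of knowledge of $(sk_U,r)$; $\mathsf{Issue}$ aborts if the proof is rejected, and otherwise returns $\mathsf{Issue}_{DAA}(sk_I,com)$.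 $\mathsf{Comment}(pk_I,sk_U,cred_U,dom,m)$, $dom\in\{0,1\}^*$, returns $nym=\mathsf{NymGen}(sk_U,dom)$ and $\gamma=(\sigma,nym,dom,h(m))$ with $\sigma\leftarrow\mathsf{Sign}_{DAA}(sk_U,cred_U,dom,h(m))$. $\mathsf{Verify}(pk_I,nym,dom,m,\gamma)=1$ iff $\gamma=(\sigma,nym,dom,h^*)$ with $h^*=h(m)$, $\mathsf{Verify}_{DAA}(pk_I,h^*,dom,\sigma,\emptyset)=1$, $\mathsf{NymExtract}(\sigma)=nym$ and $\mathsf{VerifyBsn}(\sigma,dom)=1$. *Experiment.* After setup and key generation, a PPT adversary gets $(\rho,pk_I)$ and access to: $\mathsf{CreateHonestUser}(U,V)$ (if $U$ is neither honest nor corrupted: sets $ver[V,U]=1$, runs join/issue with a fresh key $sk_U$ and, unless the issuer aborts, makes $U$ honest and returns $cred_U$); $\mathsf{CorruptUser}(U)$ (returns $(sk_U,cred_U)$ if present; $U$ becomes corrupted and is no longer honest); $\mathsf{CorruptVer}(U,V)$ (sets $ver[V,U]=1$); $\mathsf{JoinSystem}(U,V)$ (if $U$ is neither honest nor corrupted and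 $ver[V,U]=1$: runs $\mathsf{Issue}$ with the adversary); $\mathsf{CreateComment}(U,dom,m)$ for honest $U$ (returns $(nym,\gamma)$ from $\mathsf{Comment}$). She wins if she outputs $(nym^*,dom^*,m^*,\gamma^*)$ such that $\mathsf{Verify}(pk_I,nym^*,dom^*,m^*,\gamma^*)=1$, no $\mathsf{CreateComment}$ query on $(dom^*,m^*)$ (of any user) was answered by $(nym^*,\gamma^*)$, and some user $U^*$ that is honest at the end has $nym^*=nym_{U^*}$, where $(nym_{U^*},\cdot)\leftarrow\mathsf{Comment}(pk_I,sk_{U^*},cred_{U^*},dom^*,m^*)$. **Claim.** If the DAA scheme is correct, user-controlled traceable and instantly linkable, $h$ is collision-resistant (every PPT adversary, on input $1^\lambda$, outputs $m\ne m'$ with $h_\lambda(m)=h_\lambda(m')$ with negligible probability only), and the proof system is a proof of knowledge for $\mathcal R_{Join}$, then TrollThrottle is non-frameable: every PPT adversary wins the experiment with probability negligible in $\lambda$. -/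

import Mathlib

open Filter

noncomputable section

namespace TrollThrottle

/-! ## Data and encodings -/

/-- Bit strings. -/
abbrev Bits := List Bool

/-- The values on which programs operate: finite binary trees. -/
inductive Data where
  | nil : Data
  | cons : Data → Data → Data
  deriving DecidableEq

/-- Number of nodes and leaves of a tree. -/
def Data.size : Data → ℕ
  | .nil => 1
  | .cons a b => 1 + a.size + b.size

/-- An encoding of the elements of `α` as trees, with its decoder. -/
class Coding (α : Type) where
  encode : α → Data
  decode : Data → Option α
  decode_encode : ∀ a, decode (encode a) = some a

open Coding

instance : Coding Unit where
  encode _ := .nil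
  decode _ := some ()
  decode_encode _ := rfl

instance : Coding Bool where
  encode b := if b then .cons .nil .nil else .nil
  decode
    | .nil => some false
    | .cons _ _ => some true
  decode_encode b := by cases b <;> rfl

/-- Natural numbers are encoded in unary. -/
def encodeNat : ℕ → Data
  | 0 => .nil
  | n + 1 => .cons .nil (encodeNat n)

def decodeNat : Data → ℕ
  | .nil => 0
  | .cons _ d => decodeNat d + 1

instance : Coding ℕ where
  encode := encodeNat
  decode d := some (decodeNat d)
  decode_encode n := by
    congr 1
    induction n with
    | zero => rfl
    | succ n ih => simp [encodeNat, decodeNat, ih]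

def encodeList {α : Type} [Coding α] : List α → Data
  | [] => .nil
  | a :: l => .cons (encode a) (encodeList l)

def decodeList {α : Type} [Coding α] : Data → Option (List α)
  | .nil => some []
  | .cons a d => (decode a).bind fun x => (decodeList d).map fun l => x :: l

instance {α : Type} [Coding α] : Coding (List α) where
  encode := encodeList
  decode := decodeList
  decode_encode l := by
    induction l with
    | nil => rfl
    | cons a l ih => simp [encodeList, decodeList, decode_encode, ih]

/-- `⊥` is encoded as the empty tree. -/
instance {α : Type} [Coding α] : Coding (Option α) where
  encode
    | none => .nil
    | some a => .cons .nil (encode a)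
  decode
    | .nil => some none
    | .cons _ d => (decode d).map some
  decode_encode o := by cases o <;> simp [decode_encode]

instance {α β : Type} [Coding α] [Coding β] : Coding (α × β) where
  encode x := .cons (encode x.1) (encode x.2)
  decode
    | .nil => none
    | .cons a b => (decode a).bind fun x => (decode b).map fun y => (x, y)
  decode_encode x := by simp [decode_encode]

instance {α β : Type} [Coding α] [Coding β] : Coding (α ⊕ β) where
  encode
    | .inl a => .cons .nil (encode a)
    | .inr b => .cons (.cons .nil .nil) (encode b)
  decode
    | .nil => none
    | .cons .nil a => (decode a).map Sum.inl
    | .cons (.cons _ _) b => (decode b).map Sum.inr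
  decode_encode x := by cases x <;> simp [decode_encode]

/-! ## Probabilistic oracle programs with a running time -/

/-- While-programs over tree-valued variables `x₀, x₁, …`, with fair coins and oracle calls. -/
inductive Prog where
  /-- `x := nil` -/
  | setNil (x : ℕ)
  /-- `x := y` -/
  | copy (x y : ℕ)
  /-- `x := cons y z` -/
  | cons (x y z : ℕ)
  /-- `x := hd y` -/
  | hd (x y : ℕ)
  /-- `x := tl y` -/
  | tl (x y : ℕ)
  /-- `x := (y = z)` -/
  | eq (x y z : ℕ)
  /-- `x :=` a uniformly random bit -/
  | toss (x : ℕ)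
  /-- `x :=` the answer of the oracle to the query `y` -/
  | query (x y : ℕ)
  | seq (p q : Prog)
  /-- if `x ≠ nil` then `p` else `q` -/
  | ite (x : ℕ) (p q : Prog)
  /-- while `x ≠ nil` do `p` -/
  | loop (x : ℕ) (p : Prog)

def Data.head : Data → Data
  | .nil => .nil
  | .cons a _ => a

def Data.tail : Data → Data
  | .nil => .nil
  | .cons _ b => b

/-- The values of the variables of a program. -/
abbrev Store := ℕ → Data

/-- A stateful probabilistic oracle: from a state and a query, an answer and a new state. -/
abbrev Oracle (T : Type) := T → Data → PMF (Data × T)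

/-- A program state: variables, state of the oracle, and the number of remaining time units. -/
abbrev Config (T : Type) := Store × T × ℕ

/-- `x := v`, at the given cost; `none` means that the time is used up. -/
def assign {T : Type} (x : ℕ) (v : Data) (cost : ℕ) (s : Store) (t : T) (f : ℕ) :
    Option (Config T) :=
  if cost ≤ f then some (Function.update s x v, t, f - cost) else none

/-- At most `k` rounds of the loop "while `x ≠ nil` do `body`"; each test costs one time unit. -/
def execLoop {T : Type} (x : ℕ) (body : Config T → PMF (Option (Config T))) :
    ℕ → Config T → PMF (Option (Config T))
  | 0, _ => PMF.pure none
  | _ + 1, (_, _, 0) => PMF.pure none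
  | k + 1, (s, t, f + 1) =>
    if s x = .nil then PMF.pure (some (s, t, f))
    else (body (s, t, f)).bind fun r => match r with
      | none => PMF.pure none
      | some c => execLoop x body k c

/-- Execution of a program. An assignment costs one time unit plus the size of the value that is
written (comparisons: that are read); a test costs one time unit. Hence sizes are bounded by the
time spent, and time is polynomially related to time on Turing machines. A loop that starts with
`f` remaining time units makes at most `f` tests, so that the bound on the number of rounds is no
restriction. -/
def exec {T : Type} (O : Oracle T) : Prog → Config T → PMF (Option (Config T))
  | .setNil x, (s, t, f) => PMF.pure (assign x .nil 2 s t f)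
  | .copy x y, (s, t, f) => PMF.pure (assign x (s y) (1 + (s y).size) s t f)
  | .cons x y z, (s, t, f) =>
    PMF.pure (assign x (.cons (s y) (s z)) (1 + (Data.cons (s y) (s z)).size) s t f)
  | .hd x y, (s, t, f) => PMF.pure (assign x (s y).head (1 + (s y).head.size) s t f)
  | .tl x y, (s, t, f) => PMF.pure (assign x (s y).tail (1 + (s y).tail.size) s t f)
  | .eq x y z, (s, t, f) =>
    PMF.pure (assign x (encode (decide (s y = s z))) (1 + (s y).size + (s z).size) s t f)
  | .toss x, (s, t, f) =>
    (PMF.uniformOfFintype Bool).map fun b => assign x (encode b) (1 + (encode b).size) s t f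
  | .query x y, (s, t, f) =>
    (O t (s y)).map fun r => assign x r.1 (1 + r.1.size) s r.2 f
  | .seq p q, c =>
    (exec O p c).bind fun r => match r with
      | none => PMF.pure none
      | some c' => exec O q c'
  | .ite _ _ _, (_, _, 0) => PMF.pure none
  | .ite x p q, (s, t, f + 1) => if s x = .nil then exec O q (s, t, f) else exec O p (s, t, f)
  | .loop x p, (s, t, f) => execLoop x (exec O p) f (s, t, f)

/-- Run a program for at most `f` time units. Input and output are in the variable `x₀`, all other
variables start as `nil`. The result is the output and the final state of the oracle, or `none` if
the program did not stop in time. -/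
def run {T : Type} (O : Oracle T) (p : Prog) (input : Data) (t : T) (f : ℕ) :
    PMF (Option (Data × T)) :=
  (exec O p (Function.update (fun _ => Data.nil) 0 input, t, f)).map
    (Option.map fun c => (c.1 0, c.2.1))

/-- The oracle that always answers `nil`. -/
def noOracle : Oracle Unit := fun _ _ => PMF.pure (.nil, ())

/-- `f` is a PPT algorithm: some program outputs a sample of `f n a` on input `(1ⁿ, a)`, in time
polynomial in `n` and the size of `a`. -/
def IsPPT {α β : Type} [Coding α] [Coding β] (f : ℕ → α → PMF β) : Prop :=
  ∃ (p : Prog) (q : Polynomial ℕ), ∀ (n : ℕ) (a : α),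
    (run noOracle p (encode (n, a)) () (q.eval (n + (encode a).size))).map (Option.map Prod.fst) =
      (f n a).map fun b => some (encode b)

/-- `f` is computed by a deterministic polynomial-time algorithm. -/
def IsPolyTime {α β : Type} [Coding α] [Coding β] (f : ℕ → α → β) : Prop :=
  IsPPT fun n a => PMF.pure (f n a)

/-- A PPT adversary: a program that is stopped after `clock n` time units, where `n` is the
security parameter. -/
structure Adversary where
  prog : Prog
  clock : Polynomial ℕ

/-- Oracle access to a handler of queries of type `Q`; other queries are answered by `⊥`. -/
def handle {T Q : Type} [Coding Q] (H : T → Q → PMF (Data × T)) : Oracle T := fun t d =>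
  match (decode d : Option Q) with
  | none => PMF.pure (.nil, t)
  | some q => H t q

/-- Run the adversary; `none` if it exceeds its time or its output is not of type `β`. -/
def Adversary.play {T α β : Type} [Coding α] [Coding β] (A : Adversary) (O : Oracle T) (n : ℕ)
    (a : α) (t : T) : PMF (Option (β × T)) :=
  (run O A.prog (encode (n, a)) t (A.clock.eval n)).map fun r =>
    r.bind fun o => (decode o.1).map fun b => (b, o.2)

/-- Negligible functions of the security parameter. -/
def Negligible (f : ℕ → ℝ) : Prop :=
  Asymptotics.SuperpolynomialDecay atTop (fun n : ℕ => (n : ℝ)) f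

/-- The probability that an experiment returns `1`. -/
def Pr (e : PMF Bool) : ℝ := (e true).toReal

/-- Uniformly random bit strings of length `k`. -/
def randomBits (k : ℕ) : PMF Bits := (PMF.uniformOfFintype (Fin k → Bool)).map List.ofFn

/-! ## Collision resistance -/

/-- The adversary, on input `1ⁿ`, tries to output two messages with the same hash value. -/
def collisionExp (h : ℕ → Bits → Bits) (A : Adversary) (n : ℕ) : PMF Bool := do
  let r ← A.play (β := Bits × Bits) noOracle n () ()
  return match r with
    | none => false
    | some ((m, m'), _) => decide (m ≠ m' ∧ h n m = h n m')

def CollisionResistant (h : ℕ → Bits → Bits) : Prop :=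
  IsPolyTime h ∧ ∀ A : Adversary, Negligible fun n => Pr (collisionExp h A n)

/-! ## Non-interactive proofs of knowledge -/

/-- A non-interactive proof system for statements `X` and witnesses `W`; the security parameter is
an argument of all algorithms. -/
structure ProofSystem (X W : Type) [Coding X] [Coding W] where
  setup : ℕ → PMF Bits
  createProof : ℕ → Bits → X → W → PMF Bits
  verifyProof : ℕ → Bits → X → Bits → Bool
  setup_ppt : IsPPT fun n (_ : Unit) => setup n
  createProof_ppt : IsPPT fun n (a : Bits × X × W) => createProof n a.1 a.2.1 a.2.2
  verifyProof_poly : IsPolyTime fun n (a : Bits × X × Bits) => verifyProof n a.1 a.2.1 a.2.2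

open Classical in
/-- There is an efficient knowledge extractor `(E₁, E₂)`: no algorithm can tell the reference
strings of `E₁` from those of the setup, and from every accepted proof under a reference string of
`E₁` a witness is extracted with probability one. -/
def ProofSystem.IsProofOfKnowledge {X W : Type} [Coding X] [Coding W] (Pf : ProofSystem X W)
    (R : ℕ → X → W → Prop) : Prop :=
  ∃ (E₁ : ℕ → PMF (Bits × Bits)) (E₂ : ℕ → Bits → Bits → X → Bits → PMF W),
    IsPPT (fun n (_ : Unit) => E₁ n) ∧
    IsPPT (fun n (a : Bits × Bits × X × Bits) => E₂ n a.1 a.2.1 a.2.2.1 a.2.2.2) ∧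
    (∀ A : ℕ → Bits → PMF Bool, Negligible fun n =>
      |Pr (do let ρ ← Pf.setup n; A n ρ) - Pr (do let (ρ, _) ← E₁ n; A n ρ)|) ∧
    (∀ (A : ℕ → Bits → PMF (X × Bits)) (n : ℕ),
      Pr (do
        let (ρ, τ) ← E₁ n
        let (x, π) ← A n ρ
        let w ← E₂ n ρ τ x π
        return decide (Pf.verifyProof n ρ x π = false ∨ R n x w)) = 1)

/-! ## Direct anonymous attestation -/

/-- The algorithms of a DAA scheme. The security parameter is an argument of all algorithms,
basenames are `none` (that is `⊥`) or a bit string, revocation lists are lists of secret keys. The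
coins of `Join` are an explicit argument, a string of length `coins n`. `link` returns `none` for
`⊥`. -/
structure DAA where
  /-- `(pk_I, sk_I)` -/
  setup : ℕ → PMF (Bits × Bits)
  /-- membership in the key space of the signers -/
  isKey : ℕ → Bits → Bool
  /-- a fresh secret key of a signer -/
  freshKey : ℕ → PMF Bits
  coins : Polynomial ℕ
  /-- `com` from `pk_I`, `sk_S` and coins -/
  join : ℕ → Bits → Bits → Bits → Bits
  /-- `cred_S` from `sk_I` and `com` -/
  issue : ℕ → Bits → Bits → PMF Bits
  /-- `σ` from `sk_S`, `cred_S`, `dom` and `m` -/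
  sign : ℕ → Bits → Bits → Option Bits → Bits → PMF Bits
  /-- the verification of `(pk_I, m, dom, σ, RL)` -/
  verify : ℕ → Bits → Bits → Option Bits → Bits → List Bits → Bool
  link : ℕ → Bits → Bits → Option Bool
  isKey_of_freshKey : ∀ n, ∀ sk ∈ (freshKey n).support, isKey n sk = true
  setup_ppt : IsPPT fun n (_ : Unit) => setup n
  isKey_poly : IsPolyTime isKey
  freshKey_ppt : IsPPT fun n (_ : Unit) => freshKey n
  join_poly : IsPolyTime fun n (a : Bits × Bits × Bits) => join n a.1 a.2.1 a.2.2
  issue_ppt : IsPPT fun n (a : Bits × Bits) => issue n a.1 a.2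
  sign_ppt : IsPPT fun n (a : Bits × Bits × Option Bits × Bits) =>
    sign n a.1 a.2.1 a.2.2.1 a.2.2.2
  verify_poly : IsPolyTime fun n (a : Bits × Bits × Option Bits × Bits × List Bits) =>
    verify n a.1 a.2.1 a.2.2.1 a.2.2.2.1 a.2.2.2.2
  link_poly : IsPolyTime fun n (a : Bits × Bits) => link n a.1 a.2

namespace DAA

variable (D : DAA)

/-- The relation `R_Join`: the key and the coins in the witness produce the commitment. -/
def joinRel (n : ℕ) (x : Bits × Bits) (w : Bits × Bits) : Prop :=
  D.isKey n w.1 = true ∧ w.2.length = D.coins.eval n ∧ x.1 = D.join n x.2 w.1 w.2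

/-- `σ` counts as created with the key `sk` and the basename `dom`: it is linked to some signature
that is made with `sk` and `dom`. -/
def CreatedWith (n : ℕ) (sk dom σ : Bits) : Prop :=
  ∃ cred m, ∃ σ' ∈ (D.sign n sk cred (some dom) m).support, D.link n σ σ' = some true

/-- The honest execution of setup and `Join-Issue` for the key `sk`: `(pk_I, cred)`. -/
def honestCred (n : ℕ) (sk : Bits) : PMF (Bits × Bits) := do
  let (pk, skI) ← D.setup n
  let r ← randomBits (D.coins.eval n)
  let cred ← D.issue n skI (D.join n pk sk r)
  return (pk, cred)

/-- Correctness of a DAA scheme. -/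
structure Correct : Prop where
  /-- A revocation list invalidates exactly the signatures that are created with a listed key. -/
  revocation : ∀ (n : ℕ) (pk m dom σ : Bits) (RL : List Bits), (∀ sk ∈ RL, D.isKey n sk = true) →
    (D.verify n pk m (some dom) σ RL = true ↔
      D.verify n pk m (some dom) σ [] = true ∧ ∀ sk ∈ RL, ¬ D.CreatedWith n sk dom σ)
  /-- Signatures of an honest signer whose key is not revoked are accepted. -/
  accepted : ∃ ν : ℕ → ℝ, Negligible ν ∧
    ∀ (n : ℕ) (sk : Bits) (dom : Option Bits) (m : Bits) (RL : List Bits),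
      D.isKey n sk = true → (∀ sk' ∈ RL, D.isKey n sk' = true) → sk ∉ RL →
      1 - ν n ≤ Pr (do
        let (pk, cred) ← D.honestCred n sk
        let σ ← D.sign n sk cred dom m
        return D.verify n pk m dom σ RL)
  /-- Signatures of the same honest signer for the same basename are linked. -/
  linked : ∃ ν : ℕ → ℝ, Negligible ν ∧
    ∀ (n : ℕ) (sk dom m₀ m₁ : Bits), D.isKey n sk = true →
      1 - ν n ≤ Pr (do
        let (_, cred) ← D.honestCred n sk
        let σ₀ ← D.sign n sk cred (some dom) m₀
        let σ₁ ← D.sign n sk cred (some dom) m₁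
        return decide (D.link n σ₀ σ₁ = some true))

/-! ### User-controlled traceability -/

/-- The queries of the traceability game. -/
inductive TraceQuery where
  | sign (S : Bits) (dom : Option Bits) (m : Bits)
  /-- joining of an honest signer (case 1) -/
  | hjoin (S : Bits)
  /-- joining with a key and coins chosen by the adversary (case 2) -/
  | join (S sk coins : Bits)
  | corrupt (S : Bits)

/-- The queries as nested sums. -/
def TraceQuery.toSum :
    TraceQuery → ((Bits × Option Bits × Bits) ⊕ Bits) ⊕ ((Bits × Bits × Bits) ⊕ Bits)
  | .sign S dom m => .inl (.inl (S, dom, m))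
  | .hjoin S => .inl (.inr S)
  | .join S sk r => .inr (.inl (S, sk, r))
  | .corrupt S => .inr (.inr S)

def TraceQuery.ofSum :
    ((Bits × Option Bits × Bits) ⊕ Bits) ⊕ ((Bits × Bits × Bits) ⊕ Bits) → TraceQuery
  | .inl (.inl (S, dom, m)) => .sign S dom m
  | .inl (.inr S) => .hjoin S
  | .inr (.inl (S, sk, r)) => .join S sk r
  | .inr (.inr S) => .corrupt S

instance : Coding TraceQuery where
  encode q := encode q.toSum
  decode d := (decode d).map TraceQuery.ofSum
  decode_encode q := by cases q <;> simp [decode_encode, TraceQuery.toSum, TraceQuery.ofSum]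

/-- The state of the challenger: the joined signers `(S, sk, cred)`, the revocation list, and the
answered signing queries `(S, dom, m, σ)`. -/
structure TraceState where
  signers : List (Bits × Bits × Bits)
  RL : List Bits
  signed : List (Bits × Option Bits × Bits × Bits)

/-- The challenger. Every identity joins at most once, hence is not used for both cases of
joining. -/
def traceHandler (n : ℕ) (pk skI : Bits) (t : TraceState) : TraceQuery → PMF (Data × TraceState)
  | .sign S dom m =>
    match t.signers.find? fun e => e.1 == S with
    | none => return (encode (none : Option Bits), t)
    | some (_, sk, cred) => do
      let σ ← D.sign n sk cred dom m
      return (encode (some σ), { t with signed := (S, dom, m, σ) :: t.signed })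
  | .hjoin S =>
    match t.signers.find? fun e => e.1 == S with
    | some _ => return (encode (none : Option Bits), t)
    | none => do
      let sk ← D.freshKey n
      let r ← randomBits (D.coins.eval n)
      let cred ← D.issue n skI (D.join n pk sk r)
      return (encode (some cred), { t with signers := (S, sk, cred) :: t.signers })
  | .join S sk r =>
    match t.signers.find? fun e => e.1 == S with
    | some _ => return (encode (none : Option Bits), t)
    | none =>
      if D.isKey n sk = true ∧ r.length = D.coins.eval n then do
        let cred ← D.issue n skI (D.join n pk sk r)
        return (encode (some cred),
          { t with signers := (S, sk, cred) :: t.signers, RL := sk :: t.RL })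
      else return (encode (none : Option Bits), t)
  | .corrupt S =>
    match t.signers.find? fun e => e.1 == S with
    | none => return (encode (none : Option Bits), t)
    | some (_, sk, _) => return (encode (some sk), { t with RL := sk :: t.RL })

open Classical in
/-- The traceability game. The adversary outputs `(S, σ, m, dom)`. She wins if
1. `σ` is accepted on `m` and `dom` under the revocation list, but no signing query on `m` and
`dom` was answered by `σ`, or
2. `dom ≠ ⊥`, and `σ` and another signature `σ'`, both made for `S` and `dom`, are unlinked. -/
def traceExp (A : Adversary) (n : ℕ) : PMF Bool := do
  let (pk, skI) ← D.setup n
  let r ← A.play (β := Bits × Bits × Bits × Option Bits) (handle (D.traceHandler n pk skI)) n pk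
    (TraceState.mk [] [] [])
  return match r with
    | none => false
    | some ((S, σ, m, dom), t) => decide (
        (D.verify n pk m dom σ t.RL = true ∧ ¬ ∃ S', (S', dom, m, σ) ∈ t.signed) ∨
        (dom ≠ none ∧ (∃ m₀, (S, dom, m₀, σ) ∈ t.signed) ∧
          ∃ m' σ', (S, dom, m', σ') ∈ t.signed ∧ D.link n σ σ' = some false))

def UserControlledTraceable : Prop :=
  ∀ A : Adversary, Negligible fun n => Pr (D.traceExp A n)

end DAA

/-! ### Instant linkability -/

/-- A DAA scheme with the additional deterministic algorithms for pseudonyms and basenames. -/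
structure LinkableDAA extends DAA where
  /-- `nym` from `sk_S` and `dom` -/
  nymGen : ℕ → Bits → Bits → Bits
  /-- `nym` from `σ` -/
  nymExtract : ℕ → Bits → Bits
  /-- whether `σ` belongs to `dom` -/
  verifyBsn : ℕ → Bits → Bits → Bool
  nymGen_poly : IsPolyTime fun n (a : Bits × Bits) => nymGen n a.1 a.2
  nymExtract_poly : IsPolyTime nymExtract
  verifyBsn_poly : IsPolyTime fun n (a : Bits × Bits) => verifyBsn n a.1 a.2

namespace LinkableDAA

variable (D : LinkableDAA)

/-- The adversary outputs `(dom, dom', σ, pk, m)` and tries to make one signature valid for two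
basenames. -/
def bsnExp (A : Adversary) (n : ℕ) : PMF Bool := do
  let r ← A.play (β := Bits × Bits × Bits × Bits × Bits) noOracle n () ()
  return match r with
    | none => false
    | some ((dom, dom', σ, pk, m), _) => decide (dom ≠ dom' ∧
        D.verifyBsn n σ dom' = true ∧ D.verifyBsn n σ dom = true ∧
        D.verify n pk m (some dom) σ [] = true)

structure InstantlyLinkable : Prop where
  nymGen_eq : ∀ (n : ℕ) (sk cred dom m : Bits), D.isKey n sk = true →
    ∀ σ ∈ (D.sign n sk cred (some dom) m).support, D.nymGen n sk dom = D.nymExtract n σ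
  link_iff : ∀ (n : ℕ) (σ₁ σ₂ : Bits),
    D.link n σ₁ σ₂ = some true ↔ D.nymExtract n σ₁ = D.nymExtract n σ₂
  bsn_unique : ∀ A : Adversary, Negligible fun n => Pr (D.bsnExp A n)

end LinkableDAA

/-! ## Accountable commenting schemes -/

/-- The algorithms of an accountable commenting scheme, for parameters `P`, issuer's secret keys
`K`, messages `J` of `Join` to `Issue`, comments `Γ` and evidence `E`. The parameter `ρ` is an
argument of all algorithms. `Join-Issue` has two messages: `join` produces the message of the user,
and `issue` either aborts or returns the credential. The database `ver` is the list of the pairs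
`(V, U)` with `ver[V,U] = 1`. -/
structure CommentingScheme (P K J Γ E : Type) where
  setup : ℕ → PMF P
  /-- `(pk_I, sk_I)` -/
  keyGen : P → PMF (Bits × K)
  /-- a fresh secret key of a user -/
  freshKey : P → PMF Bits
  /-- from `pk_I`, `sk_U` and `U` -/
  join : P → Bits → Bits → Bits → PMF J
  /-- from `sk_I`, `ver`, `U` and the message of the user -/
  issue : P → K → List (Bits × Bits) → Bits → J → PMF (Option Bits)
  /-- `(nym, γ)` from `pk_I`, `sk_U`, `cred_U`, `dom` and `m` -/
  comment : P → Bits → Bits → Bits → Bits → Bits → PMF (Bits × Γ)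
  /-- from `pk_I`, `nym`, `dom`, `m` and `γ` -/
  verify : P → Bits → Bits → Bits → Bits → Γ → Bool
  /-- from `pk_I`, `sk_U`, `cred_U`, `dom`, `m` and `γ` -/
  claim : P → Bits → Bits → Bits → Bits → Bits → Γ → PMF E
  /-- from `pk_I`, `dom`, `m`, `γ` and the evidence -/
  verifyClaim : P → Bits → Bits → Bits → Γ → E → Bool

/-- The queries of the non-frameability experiment. -/
inductive FrameQuery (J : Type) where
  | corruptUser (U : Bits)
  | corruptVer (U V : Bits)
  | createHonestUser (U V : Bits)
  | joinSystem (U V : Bits) (j : J)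
  | createComment (U dom m : Bits)

/-- The queries as nested sums. -/
def FrameQuery.toSum {J : Type} : FrameQuery J →
    Bits ⊕ (((Bits × Bits) ⊕ (Bits × Bits)) ⊕ ((Bits × Bits × J) ⊕ (Bits × Bits × Bits)))
  | .corruptUser U => .inl U
  | .corruptVer U V => .inr (.inl (.inl (U, V)))
  | .createHonestUser U V => .inr (.inl (.inr (U, V)))
  | .joinSystem U V j => .inr (.inr (.inl (U, V, j)))
  | .createComment U dom m => .inr (.inr (.inr (U, dom, m)))

def FrameQuery.ofSum {J : Type} :
    Bits ⊕ (((Bits × Bits) ⊕ (Bits × Bits)) ⊕ ((Bits × Bits × J) ⊕ (Bits × Bits × Bits))) →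
    FrameQuery J
  | .inl U => .corruptUser U
  | .inr (.inl (.inl (U, V))) => .corruptVer U V
  | .inr (.inl (.inr (U, V))) => .createHonestUser U V
  | .inr (.inr (.inl (U, V, j))) => .joinSystem U V j
  | .inr (.inr (.inr (U, dom, m))) => .createComment U dom m

instance {J : Type} [Coding J] : Coding (FrameQuery J) where
  encode q := encode q.toSum
  decode d := (decode d).map FrameQuery.ofSum
  decode_encode q := by cases q <;> simp [decode_encode, FrameQuery.toSum, FrameQuery.ofSum]

/-- The global sets of the experiment: corrupted users, honest users, maliciously verified pairs
`(V, U)`, the database `ver`, the user data `(U, sk_U, cred_U, V)`, and the comments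
`(U, nym, dom, m, γ)`. -/
structure FrameState (Γ : Type) where
  CU : List Bits
  HU : List Bits
  VM : List (Bits × Bits)
  ver : List (Bits × Bits)
  USK : List (Bits × Bits × Bits × Bits)
  COMM : List (Bits × Bits × Bits × Bits × Γ)

namespace CommentingScheme

variable {P K J Γ E : Type} (C : CommentingScheme P K J Γ E)

/-- The honest execution of `Join-Issue` for a fresh key: `(sk_U, cred_U)`, or `none` if the issuer
aborts. -/
def joinIssue (ρ : P) (pk : Bits) (skI : K) (ver : List (Bits × Bits)) (U : Bits) :
    PMF (Option (Bits × Bits)) := do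
  let sk ← C.freshKey ρ
  let j ← C.join ρ pk sk U
  let cred ← C.issue ρ skI ver U j
  return cred.map fun c => (sk, c)

/-- The oracles `CorruptUser`, `CorruptVer`, `CreateHonestUser`, `JoinSystem` and
`CreateComment`. -/
def frameHandler [Coding Γ] (ρ : P) (pk : Bits) (skI : K) (t : FrameState Γ) :
    FrameQuery J → PMF (Data × FrameState Γ)
  | .corruptUser U =>
    let answer : Option (Bits × Bits) :=
      (t.USK.find? fun e => e.1 == U).map fun e => (e.2.1, e.2.2.1)
    return (encode answer, { t with CU := U :: t.CU, HU := t.HU.filter fun U' => U' ≠ U })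
  | .corruptVer U V =>
    return (encode (), { t with ver := (V, U) :: t.ver, VM := (V, U) :: t.VM })
  | .createHonestUser U V =>
    if U ∈ t.HU ∨ U ∈ t.CU then return (encode (none : Option Bits), t)
    else do
      let ver := (V, U) :: t.ver
      let r ← C.joinIssue ρ pk skI ver U
      match r with
      | none => return (encode (none : Option Bits), { t with ver := ver })
      | some (sk, cred) =>
        return (encode (some cred),
          { t with ver := ver, USK := (U, sk, cred, V) :: t.USK, HU := U :: t.HU })
  | .joinSystem U V j =>
    if U ∉ t.HU ∧ U ∉ t.CU ∧ (V, U) ∈ t.ver then do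
      let cred ← C.issue ρ skI t.ver U j
      return (encode cred, t)
    else return (encode (none : Option Bits), t)
  | .createComment U dom m =>
    match t.USK.find? fun e => e.1 == U && decide (U ∈ t.HU) with
    | none => return (encode (none : Option (Bits × Γ)), t)
    | some (_, sk, cred, _) => do
      let (nym, γ) ← C.comment ρ pk sk cred dom m
      return (encode (some (nym, γ)), { t with COMM := (U, nym, dom, m, γ) :: t.COMM })

/-- Whether a comment of some of the given users on `dom` and `m` has the pseudonym `nym`. -/
def matchesNym (ρ : P) (pk nym dom m : Bits) : List (Bits × Bits × Bits × Bits) → PMF Bool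
  | [] => return false
  | (_, sk, cred, _) :: l => do
    let (nym', _) ← C.comment ρ pk sk cred dom m
    let b ← matchesNym ρ pk nym dom m l
    return decide (nym = nym') || b

open Classical in
/-- The non-frameability experiment. -/
def frameExp [Coding P] [Coding J] [Coding Γ] (A : Adversary) (n : ℕ) : PMF Bool := do
  let ρ ← C.setup n
  let (pk, skI) ← C.keyGen ρ
  let r ← A.play (β := Bits × Bits × Bits × Γ) (handle (C.frameHandler ρ pk skI)) n (ρ, pk)
    (FrameState.mk [] [] [] [] [] [])
  match r with
  | none => return false
  | some ((nym, dom, m, γ), t) => do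
    let b ← C.matchesNym ρ pk nym dom m (t.USK.filter fun e => decide (e.1 ∈ t.HU))
    return C.verify ρ pk nym dom m γ && decide (¬ ∃ U, (U, nym, dom, m, γ) ∈ t.COMM) && b

def NonFrameable [Coding P] [Coding J] [Coding Γ] : Prop :=
  ∀ A : Adversary, Negligible fun n => Pr (C.frameExp A n)

end CommentingScheme

/-! ## The protocol -/

/-- The TrollThrottle protocol from an instantly linkable DAA scheme, a hash function and a proof
system for `R_Join`. The parameter is `ρ = (1ⁿ, ρ_Join)`, the secret key of the issuer is
`(pk_{I,DAA}, sk_{I,DAA})`, `Join` sends `(com, Π_Join)`, comments are `γ = (σ, nym, dom, h(m))`. -/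
def protocol (D : LinkableDAA) (h : ℕ → Bits → Bits)
    (Pf : ProofSystem (Bits × Bits) (Bits × Bits)) :
    CommentingScheme (ℕ × Bits) (Bits × Bits) (Bits × Bits) (Bits × Bits × Bits × Bits)
      (Bits × Bits × Bits × Bits) :=
  let verify : ℕ × Bits → Bits → Bits → Bits → Bits → Bits × Bits × Bits × Bits → Bool :=
    fun ρ pk nym dom m γ =>
      let (σ, nym', dom', hm) := γ
      decide (nym' = nym ∧ dom' = dom ∧
        D.verify ρ.1 pk hm (some dom) σ [] = true ∧ h ρ.1 m = hm ∧
        D.nymExtract ρ.1 σ = nym ∧ D.verifyBsn ρ.1 σ dom = true)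
  { setup := fun n => do
      let ρJ ← Pf.setup n
      return (n, ρJ)
    keyGen := fun ρ => do
      let (pk, sk) ← D.setup ρ.1
      return (pk, (pk, sk))
    freshKey := fun ρ => D.freshKey ρ.1
    join := fun ρ pk sk _ => do
      let r ← randomBits (D.coins.eval ρ.1)
      let com := D.join ρ.1 pk sk r
      let π ← Pf.createProof ρ.1 ρ.2 (com, pk) (sk, r)
      return (com, π)
    issue := fun ρ skI _ _ j =>
      if Pf.verifyProof ρ.1 ρ.2 (j.1, skI.1) j.2 = true then do
        let cred ← D.issue ρ.1 skI.2 j.1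
        return some cred
      else return none
    comment := fun ρ _ sk cred dom m => do
      let σ ← D.sign ρ.1 sk cred (some dom) (h ρ.1 m)
      let nym := D.nymGen ρ.1 sk dom
      return (nym, (σ, nym, dom, h ρ.1 m))
    verify := verify
    claim := fun _ _ _ _ _ _ γ => return γ
    verifyClaim := fun ρ pk dom m γ _ => verify ρ pk γ.2.1 dom m γ }

end TrollThrottle

end

/-! The proof is a reduction to traceability. The reduction guesses which creation of an honest user
produces the framed user, the target, and has the challenger create this user by `HJoin`. It plays
all other parties itself: it chooses the keys of the other honest users, and it extracts the key and
the coins behind a commitment of the adversary from the proof of knowledge, the reference string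
having been replaced by one of the extractor. Credentials for these known keys come from the
challenger's `Join` oracle, so that the keys land on the revocation list `RL`. Comments of the
target are answered with `Sign` queries.

Suppose that the target is honest at the end and framed with a signature `σ` for `dom` and the
message `m`. Then `σ` is accepted under the empty list and has the pseudonym of the target's key. By
correctness and instant linkability `σ` can be rejected under `RL` only if some listed key has the
same pseudonym for `dom`. Distinct keys have distinct pseudonyms (`nymInjective_of_accepted`), for
otherwise revoking one key would invalidate all signatures of another. Hence `σ` is accepted under
`RL`, provided that the target's key is not listed. It is a forgery unless a `Sign` query on `dom`
and the hash value of `m` was answered by `σ`. In that case the query belongs to a comment on some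
`x` with the same hash value, and `x` differs from `m` because the framing comment is new: a
collision (`framedAt_final`).

It remains to keep the target's key off the list. When the target is created, a fresh key hits one
of at most `N` listed keys with probability at most `N` times the largest probability `p` of a key.
This `p` is negligible: an adversary who has one signer join, samples a key herself and signs with
the received credential succeeds with probability at least `p ^ 2 / 2` (`exists_guess_adversary`,
`iSup_freshKey_le`). Before a key is listed later, the reduction signs with it and the target's
credential, for a basename longer than any that can be queried. If the result is accepted under
`RL`, it already is a forgery and the simulation stops. If the key is the target's, correctness
makes this test succeed up to the probability `rejectProb`, which is negligible on average
(`keyIssue_le`).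

The comparison is made query by query: `Sync` relates the states of the experiment and of the
simulation, `query_le` treats one query, and `ev_exec_le_wp` lifts this to executions. The error
`simError` is the expected rejection probability given the current state, together with the chance
of a key hit as long as the target does not exist; so it is paid once and not for each query. A
state in which the target can no longer be framed (`Dead`) has value `0`, and the simulation need
not be faithful from there on.

The second half of the work is to show that the reduction is a program with a polynomial clock. The
predicates `Eff` and `Det` form a calculus of efficient computations on clean stores,
`exists_reduction` compiles an adversary and a handler of her queries into one program, and
`exists_small` bounds the growth of the state. With the time `N` of the adversary this gives the
bound of `exists_frameExp_le`: a distinguishing advantage, `2 * N` times the success against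
traceability and collision resistance, and `N` times the simulation error. Each term is negligible.
-/

open Filter
open scoped ENNReal

noncomputable section

namespace TrollThrottle

open Coding

/-! ## Expectations -/

/-- The expected value of `g` under `μ`. -/
def ev {α : Type*} (μ : PMF α) (g : α → ℝ≥0∞) : ℝ≥0∞ := ∑' a, μ a * g a

section ev

variable {α β : Type*}

theorem ev_pure (a : α) (g : α → ℝ≥0∞) : ev (PMF.pure a) g = g a := by
  rw [ev, tsum_eq_single a]
  · simp
  · intro b hb; simp [PMF.pure_apply, hb]

theorem ev_bind (μ : PMF α) (κ : α → PMF β) (g : β → ℝ≥0∞) :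
    ev (μ.bind κ) g = ev μ fun a => ev (κ a) g := by
  simp only [ev, PMF.bind_apply, ← ENNReal.tsum_mul_right, ← ENNReal.tsum_mul_left]
  rw [ENNReal.tsum_comm]
  simp only [mul_assoc]

theorem ev_map (μ : PMF α) (k : α → β) (g : β → ℝ≥0∞) : ev (μ.map k) g = ev μ (g ∘ k) := by
  rw [← PMF.bind_pure_comp, ev_bind]
  simp [ev_pure, Function.comp_def]

theorem ev_mono {μ : PMF α} {g g' : α → ℝ≥0∞} (h : ∀ a ∈ μ.support, g a ≤ g' a) :
    ev μ g ≤ ev μ g' := by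
  refine ENNReal.tsum_le_tsum fun a => ?_
  by_cases ha : μ a = 0
  · simp [ha]
  · exact mul_le_mul_right (h a ha) _

theorem ev_congr {μ : PMF α} {g g' : α → ℝ≥0∞} (h : ∀ a ∈ μ.support, g a = g' a) :
    ev μ g = ev μ g' :=
  le_antisymm (ev_mono fun a ha => (h a ha).le) (ev_mono fun a ha => (h a ha).ge)

theorem ev_const (μ : PMF α) (c : ℝ≥0∞) : ev μ (fun _ => c) = c := by
  rw [ev, ENNReal.tsum_mul_right, μ.tsum_coe, one_mul]

theorem ev_add (μ : PMF α) (g g' : α → ℝ≥0∞) : ev μ (fun a => g a + g' a) = ev μ g + ev μ g' := by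
  simp only [ev, mul_add, ENNReal.tsum_add]

theorem ev_const_mul (μ : PMF α) (c : ℝ≥0∞) (g : α → ℝ≥0∞) :
    ev μ (fun a => c * g a) = c * ev μ g := by
  rw [ev, ev, ← ENNReal.tsum_mul_left]
  simp only [mul_left_comm]

theorem ev_sum {ι : Type*} (μ : PMF α) (s : Finset ι) (g : ι → α → ℝ≥0∞) :
    ev μ (fun a => ∑ i ∈ s, g i a) = ∑ i ∈ s, ev μ (g i) := by
  classical
  induction s using Finset.induction_on with
  | empty => simp [ev_const μ 0]
  | insert i s hi ih => simp [Finset.sum_insert hi, ev_add, ih]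

theorem ev_le_one {μ : PMF α} {g : α → ℝ≥0∞} (h : ∀ a, g a ≤ 1) : ev μ g ≤ 1 :=
  (ev_mono fun a _ => h a).trans (ev_const μ 1).le

theorem ev_comm (μ : PMF α) (ν : PMF β) (g : α → β → ℝ≥0∞) :
    (ev μ fun a => ev ν (g a)) = ev ν fun b => ev μ fun a => g a b := by
  simp only [ev, ← ENNReal.tsum_mul_left]
  rw [ENNReal.tsum_comm]
  simp only [mul_left_comm]

theorem mul_le_ev (μ : PMF α) (g : α → ℝ≥0∞) (a : α) : μ a * g a ≤ ev μ g :=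
  ENNReal.le_tsum a

theorem ev_indicator_eq [DecidableEq α] (μ : PMF α) (a : α) :
    ev μ (fun b => if b = a then 1 else 0) = μ a := by
  rw [ev, tsum_eq_single a]
  · simp
  · intro b hb; simp [hb]

/-- Executions are understood only on the outcomes that occur; for instance, one with enough time
never yields `none`. Hence continuations are compared on the support. -/
theorem bind_congr_support {μ : PMF α} {κ κ' : α → PMF β} (h : ∀ a ∈ μ.support, κ a = κ' a) :
    μ.bind κ = μ.bind κ' := by
  ext b
  simp only [PMF.bind_apply]
  refine tsum_congr fun a => ?_
  by_cases ha : μ a = 0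
  · simp [ha]
  · rw [h a ha]

theorem map_congr_support {μ : PMF α} {k k' : α → β} (h : ∀ a ∈ μ.support, k a = k' a) :
    μ.map k = μ.map k' := by
  simp only [← PMF.bind_pure_comp]
  exact bind_congr_support fun a ha => by simp [h a ha]

end ev

/-! ## Execution and fuel -/

/-- A bound on the indices of the variables of a program. -/
def Prog.width : Prog → ℕ
  | .setNil x => x + 1
  | .copy x y => x + y + 1
  | .cons x y z => x + y + z + 1
  | .hd x y => x + y + 1
  | .tl x y => x + y + 1
  | .eq x y z => x + y + z + 1
  | .toss x => x + 1
  | .query x y => x + y + 1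
  | .seq p q => p.width + q.width
  | .ite x p q => x + 1 + p.width + q.width
  | .loop x p => x + 1 + p.width

theorem Data.size_pos (d : Data) : 0 < d.size := by
  cases d <;> simp [Data.size]

theorem Data.size_head_le (d : Data) : d.head.size ≤ d.size := by
  cases d <;> simp [Data.size, Data.head]; omega

theorem Data.size_tail_le (d : Data) : d.tail.size ≤ d.size := by
  cases d <;> simp [Data.size, Data.tail]

theorem size_encode_bool_le (b : Bool) : (encode b).size ≤ 3 := by
  cases b <;> simp [encode, Data.size]

section exec

variable {T : Type} {O : Oracle T}

theorem mem_support_assign {x : ℕ} {v : Data} {c : ℕ} {s : Store} {t : T} {f : ℕ} {y : Config T}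
    (h : some y = assign x v c s t f) : c ≤ f ∧ y = (Function.update s x v, t, f - c) := by
  unfold assign at h
  split_ifs at h with hc
  exact ⟨hc, by simpa using h⟩

/-- A property that every elementary step preserves holds after the execution. -/
theorem exec_invariant {I : Store → T → ℕ → Prop} {m : ℕ}
    (hassign : ∀ s t f x v c, x < m → I s t f → v.size ≤ c → c ≤ f →
      I (Function.update s x v) t (f - c))
    (hquery : ∀ s t f x y r, x < m → I s t f → r ∈ (O t (s y)).support → 1 + r.1.size ≤ f →
      I (Function.update s x r.1) r.2 (f - (1 + r.1.size)))
    (htest : ∀ s t f, I s t (f + 1) → I s t f) (p : Prog) (hp : p.width ≤ m) (s : Store) (t : T)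
    (f : ℕ) (hI : I s t f) (y : Config T) (hy : some y ∈ (exec O p (s, t, f)).support) :
    I y.1 y.2.1 y.2.2 := by
  induction p generalizing s t f y with
  | setNil x | copy x _ | cons x _ _ | hd x _ | tl x _ | eq x _ _ =>
    simp only [exec, PMF.support_pure, Set.mem_singleton_iff] at hy
    obtain ⟨hc, rfl⟩ := mem_support_assign hy
    refine hassign _ _ _ _ _ _ (by simp [Prog.width] at hp; omega) hI ?_ hc
    first
    | simp [Data.size]
    | omega
    | exact (size_encode_bool_le _).trans (by
        have := Data.size_pos (s ‹_›)
        grind [Data.size_pos])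
  | toss x =>
    simp only [exec, PMF.support_map, Set.mem_image] at hy
    obtain ⟨b, -, hb⟩ := hy
    obtain ⟨hc, rfl⟩ := mem_support_assign hb.symm
    exact hassign _ _ _ _ _ _ (by simp [Prog.width] at hp; omega) hI (by omega) hc
  | query x z =>
    simp only [exec, PMF.support_map, Set.mem_image] at hy
    obtain ⟨r, hr, hb⟩ := hy
    obtain ⟨hc, rfl⟩ := mem_support_assign hb.symm
    exact hquery _ _ _ _ _ _ (by simp [Prog.width] at hp; omega) hI hr hc
  | seq p q ihp ihq =>
    simp only [Prog.width] at hp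
    simp only [exec, PMF.mem_support_bind_iff] at hy
    obtain ⟨r, hr, hy⟩ := hy
    cases r with
    | none => simp at hy
    | some c => exact ihq (by omega) _ _ _ (ihp (by omega) _ _ _ hI _ hr) _ hy
  | ite x p q ihp ihq =>
    simp only [Prog.width] at hp
    cases f with
    | zero => simp [exec] at hy
    | succ f =>
      simp only [exec] at hy
      split_ifs at hy
      · exact ihq (by omega) _ _ _ (htest _ _ _ hI) _ hy
      · exact ihp (by omega) _ _ _ (htest _ _ _ hI) _ hy
  | loop x p ih =>
    simp only [Prog.width] at hp
    simp only [exec] at hy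
    have key : ∀ (k : ℕ) (s : Store) (t : T) (f : ℕ), I s t f →
        some y ∈ (execLoop x (exec O p) k (s, t, f)).support → I y.1 y.2.1 y.2.2 := by
      intro k
      induction k with
      | zero => intro s t f _ h; simp [execLoop] at h
      | succ k ihk =>
        intro s t f hI h
        cases f with
        | zero => simp [execLoop] at h
        | succ f =>
          simp only [execLoop] at h
          split_ifs at h
          · simp only [PMF.support_pure, Set.mem_singleton_iff, Option.some.injEq] at h
            subst h; exact htest _ _ _ hI
          · simp only [PMF.mem_support_bind_iff] at h
            obtain ⟨r, hr, h⟩ := h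
            cases r with
            | none => simp at h
            | some c => exact ihk _ _ _ (ih (by omega) _ _ _ (htest _ _ _ hI) _ hr) h
    exact key _ _ _ _ hI hy

theorem exec_fuel_le {p : Prog} {s : Store} {t : T} {f : ℕ} {y : Config T}
    (hy : some y ∈ (exec O p (s, t, f)).support) : y.2.2 ≤ f :=
  exec_invariant (I := fun _ _ f' => f' ≤ f) (m := p.width) (by intros; omega) (by intros; omega)
    (by intros; omega) p le_rfl s t f le_rfl y hy

/-- Writing a value costs at least its size, so a common bound on size plus remaining time is
preserved. All bounds on the sizes of outputs come from this. -/
theorem exec_size_le {p : Prog} {s : Store} {t : T} {f M : ℕ} (hs : ∀ x, (s x).size + f ≤ M)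
    {y : Config T} (hy : some y ∈ (exec O p (s, t, f)).support) (x : ℕ) :
    (y.1 x).size + y.2.2 ≤ M := by
  refine exec_invariant (I := fun s _ f => ∀ x, (s x).size + f ≤ M) (m := p.width) ?_ ?_ ?_ p
    le_rfl s t f hs y hy x
  · intro s t f x v c _ h hv hc z
    by_cases hz : z = x
    · subst hz; have := h z; simp; omega
    · have := h z; simp [hz]; omega
  · intro s t f x y r _ h _ hc z
    by_cases hz : z = x
    · subst hz; have := h z; simp; omega
    · have := h z; simp [hz]; omega
  · intro s t f h z
    have := h z; omega

/-- Variables from `p.width` on are never written, so clearing finitely many variables restores a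
clean store after an arbitrary program. -/
theorem exec_frame {p : Prog} {s : Store} {t : T} {f : ℕ} {y : Config T}
    (hy : some y ∈ (exec O p (s, t, f)).support) (x : ℕ) (hx : p.width ≤ x) : y.1 x = s x := by
  refine exec_invariant (I := fun s' _ _ => s' x = s x) (m := p.width) ?_ ?_ ?_ p
    le_rfl s t f rfl y hy
  · intro s t f z v c hz h _ _
    rwa [Function.update_of_ne (by omega)]
  · intro s t f z _ r hz h _ _
    rwa [Function.update_of_ne (by omega)]
  · intro s t f h; exact h

/-- Each round spends at least the unit of its test, so the remaining time itself bounds the number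
of rounds and a larger bound is immaterial. This is why loops unfold without a counter in
`exec_loop_succ`. -/
theorem execLoop_of_le {x : ℕ} {p : Prog} {k : ℕ} {s : Store} {t : T} {f : ℕ} (h : f ≤ k) :
    execLoop x (exec O p) k (s, t, f) = execLoop x (exec O p) f (s, t, f) := by
  induction f using Nat.strong_induction_on generalizing k s t with
  | _ f ih =>
    cases f with
    | zero => cases k <;> rfl
    | succ f =>
      obtain ⟨k, rfl⟩ : ∃ k', k = k' + 1 := ⟨k - 1, by omega⟩
      simp only [execLoop]
      split_ifs
      · rfl
      · refine bind_congr_support fun r hr => ?_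
        cases r with
        | none => rfl
        | some c =>
          have hc := exec_fuel_le hr
          show execLoop x _ k (c.1, c.2.1, c.2.2) = execLoop x _ f (c.1, c.2.1, c.2.2)
          rw [ih c.2.2 (by omega) (by omega : c.2.2 ≤ k),
            ih c.2.2 (by omega) hc]

/-- Continue with `q` if the time is not used up. -/
def andThen (O : Oracle T) (q : Prog) : Option (Config T) → PMF (Option (Config T))
  | none => PMF.pure none
  | some c => exec O q c

theorem exec_seq (p q : Prog) (c : Config T) :
    exec O (.seq p q) c = (exec O p c).bind (andThen O q) := by
  rw [exec]
  congr 1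

theorem exec_loop_zero (x : ℕ) (p : Prog) (s : Store) (t : T) :
    exec O (.loop x p) (s, t, 0) = PMF.pure none := rfl

theorem exec_loop_succ (x : ℕ) (p : Prog) (s : Store) (t : T) (f : ℕ) :
    exec O (.loop x p) (s, t, f + 1) =
      if s x = .nil then PMF.pure (some (s, t, f))
      else (exec O p (s, t, f)).bind (andThen O (.loop x p)) := by
  simp only [exec, execLoop]
  split_ifs
  · rfl
  · refine bind_congr_support fun r hr => ?_
    cases r with
    | none => rfl
    | some c =>
      show execLoop x _ f (c.1, c.2.1, c.2.2) = exec O (.loop x p) (c.1, c.2.1, c.2.2)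
      simp only [exec]
      rw [execLoop_of_le (exec_fuel_le hr)]

/-- Additional fuel. -/
def addFuel (k : ℕ) (c : Config T) : Config T := (c.1, c.2.1, c.2.2 + k)

theorem assign_add_fuel {x : ℕ} {v : Data} {c : ℕ} {s : Store} {t : T} {f k : ℕ}
    (h : assign x v c s t f ≠ none) :
    assign x v c s t (f + k) = (assign x v c s t f).map (addFuel k) := by
  have hc : c ≤ f := by
    by_contra hc
    simp [assign, hc] at h
  simp only [assign, if_pos hc, if_pos (hc.trans (Nat.le_add_right f k)), Option.map, addFuel]
  simp only [Option.some.injEq, Prod.mk.injEq, true_and]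
  omega

/-- If the time is sufficient, additional time makes no difference. -/
theorem exec_add_fuel {p : Prog} {s : Store} {t : T} {f : ℕ} (k : ℕ)
    (h : none ∉ (exec O p (s, t, f)).support) :
    exec O p (s, t, f + k) = (exec O p (s, t, f)).map (Option.map (addFuel k)) := by
  induction p generalizing s t f with
  | setNil x | copy x _ | cons x _ _ | hd x _ | tl x _ | eq x _ _ =>
    simp only [exec, PMF.support_pure, Set.mem_singleton_iff] at h ⊢
    rw [PMF.pure_map, assign_add_fuel (Ne.symm h)]
  | toss x =>
    simp only [exec, PMF.support_map, Set.mem_image, not_exists, not_and] at h ⊢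
    rw [PMF.map_comp]
    exact map_congr_support fun b hb => assign_add_fuel (h b hb)
  | query x z =>
    simp only [exec, PMF.support_map, Set.mem_image, not_exists, not_and] at h ⊢
    rw [PMF.map_comp]
    exact map_congr_support fun b hb => assign_add_fuel (h b hb)
  | seq p q ihp ihq =>
    simp only [exec_seq, PMF.mem_support_bind_iff, not_exists, not_and] at h ⊢
    have h1 : none ∉ (exec O p (s, t, f)).support := fun hn => h none hn (by simp [andThen])
    rw [ihp h1, PMF.bind_map, PMF.map_bind]
    refine bind_congr_support fun r hr => ?_
    cases r with
    | none => exact absurd hr h1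
    | some c => exact ihq (h _ hr)
  | ite x p q ihp ihq =>
    cases f with
    | zero => simp [exec] at h
    | succ f =>
      rw [show f + 1 + k = f + k + 1 by omega]
      simp only [exec] at h ⊢
      split_ifs at h ⊢
      · exact ihq h
      · exact ihp h
  | loop x p ih =>
    -- After the test and the body less time remains than before, so the further rounds are covered
    -- by induction on the time.
    induction f using Nat.strong_induction_on generalizing s t with
    | _ f ihf =>
      cases f with
      | zero => simp [exec_loop_zero] at h
      | succ f =>
        rw [show f + 1 + k = f + k + 1 by omega]
        simp only [exec_loop_succ] at h ⊢
        split_ifs at h ⊢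
        · simp [PMF.pure_map, addFuel]
        · simp only [PMF.mem_support_bind_iff, not_exists, not_and] at h
          have h1 : none ∉ (exec O p (s, t, f)).support := fun hn => h none hn (by simp [andThen])
          rw [ih h1, PMF.bind_map, PMF.map_bind]
          refine bind_congr_support fun r hr => ?_
          cases r with
          | none => exact absurd hr h1
          | some c => exact ihf c.2.2 (by have := exec_fuel_le hr; omega) (h _ hr)

/-! ## Terminating executions -/

/-- From the store `s` and the oracle state `t`, the program stops within `c` time units, with a
final store and oracle state distributed according to `μ`. -/
def Runs (O : Oracle T) (p : Prog) (s : Store) (t : T) (c : ℕ) (μ : PMF (Store × T)) : Prop :=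
  ∃ ν : PMF ((Store × T) × ℕ), ν.map Prod.fst = μ ∧ (∀ x ∈ ν.support, x.2 ≤ c) ∧
    ∀ f, c ≤ f → exec O p (s, t, f) = ν.map fun x => some (x.1.1, x.1.2, f - x.2)

theorem Runs.mono {p : Prog} {s : Store} {t : T} {c c' : ℕ} {μ : PMF (Store × T)}
    (h : Runs O p s t c μ) (hc : c ≤ c') : Runs O p s t c' μ := by
  obtain ⟨ν, h1, h2, h3⟩ := h
  exact ⟨ν, h1, fun x hx => (h2 x hx).trans hc, fun f hf => h3 f (hc.trans hf)⟩

theorem Runs.congr {p : Prog} {s : Store} {t : T} {c : ℕ} {μ μ' : PMF (Store × T)}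
    (h : Runs O p s t c μ) (hμ : μ = μ') : Runs O p s t c μ' := hμ ▸ h

theorem Runs.seq {p q : Prog} {s : Store} {t : T} {c c' : ℕ} {μ : PMF (Store × T)}
    {κ : Store × T → PMF (Store × T)} (hp : Runs O p s t c μ)
    (hq : ∀ y ∈ μ.support, Runs O q y.1 y.2 c' (κ y)) :
    Runs O (.seq p q) s t (c + c') (μ.bind κ) := by
  classical
  obtain ⟨ν, rfl, h2, h3⟩ := hp
  -- Off the support there is no run of `q` to speak of; `ν` is a dummy that makes the choice of
  -- cost distributions total.
  have hq' : ∀ y : Store × T, ∃ ν' : PMF ((Store × T) × ℕ), y ∈ (ν.map Prod.fst).support →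
      ν'.map Prod.fst = κ y ∧ (∀ x ∈ ν'.support, x.2 ≤ c') ∧
      ∀ f, c' ≤ f → exec O q (y.1, y.2, f) = ν'.map fun x => some (x.1.1, x.1.2, f - x.2) := by
    intro y
    by_cases hy : y ∈ (ν.map Prod.fst).support
    · obtain ⟨ν', h⟩ := hq y hy; exact ⟨ν', fun _ => h⟩
    · exact ⟨ν, fun h => absurd h hy⟩
  choose N hN using hq'
  have hmem : ∀ x ∈ ν.support, x.1 ∈ (ν.map Prod.fst).support := fun x hx => by
    rw [PMF.support_map]; exact ⟨x, hx, rfl⟩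
  refine ⟨ν.bind fun x => (N x.1).map fun y => (y.1, x.2 + y.2), ?_, ?_, ?_⟩
  · rw [PMF.map_bind, PMF.bind_map]
    refine bind_congr_support fun x hx => ?_
    rw [PMF.map_comp]
    exact (hN _ (hmem x hx)).1
  · intro y hy
    simp only [PMF.mem_support_bind_iff, PMF.support_map, Set.mem_image] at hy
    obtain ⟨x, hx, z, hz, rfl⟩ := hy
    exact Nat.add_le_add (h2 x hx) ((hN _ (hmem x hx)).2.1 z hz)
  · intro f hf
    rw [exec_seq, h3 f (by omega), PMF.bind_map, PMF.map_bind]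
    refine bind_congr_support fun x hx => ?_
    have := h2 x hx
    show exec O q (x.1.1, x.1.2, f - x.2) = _
    rw [(hN _ (hmem x hx)).2.2 _ (by omega), PMF.map_comp]
    congr 1; funext z; simp [Nat.sub_sub]

theorem Runs.seq_pure {p q : Prog} {s s' : Store} {t t' : T} {c c' : ℕ} {μ : PMF (Store × T)}
    (hp : Runs O p s t c (PMF.pure (s', t'))) (hq : Runs O q s' t' c' μ) :
    Runs O (.seq p q) s t (c + c') μ := by
  have := Runs.seq (κ := fun _ => μ) hp (by simpa using hq)
  simpa using this

theorem runs_assign {p : Prog} {x : ℕ} {v : Data} {c : ℕ} {s : Store} {t : T}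
    (h : ∀ f, exec O p (s, t, f) = PMF.pure (assign x v c s t f)) :
    Runs O p s t c (PMF.pure (Function.update s x v, t)) := by
  refine ⟨PMF.pure ((Function.update s x v, t), c), by simp [PMF.pure_map], by simp, fun f hf => ?_⟩
  rw [h, PMF.pure_map]
  simp [assign, hf]

theorem runs_setNil (x : ℕ) (s : Store) (t : T) :
    Runs O (.setNil x) s t 2 (PMF.pure (Function.update s x .nil, t)) := runs_assign fun _ => rfl

theorem runs_copy (x y : ℕ) (s : Store) (t : T) :
    Runs O (.copy x y) s t (1 + (s y).size) (PMF.pure (Function.update s x (s y), t)) :=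
  runs_assign fun _ => rfl

theorem runs_cons (x y z : ℕ) (s : Store) (t : T) :
    Runs O (.cons x y z) s t (2 + (s y).size + (s z).size)
      (PMF.pure (Function.update s x (.cons (s y) (s z)), t)) :=
  Runs.mono (runs_assign fun _ => rfl) (by simp [Data.size]; omega)

theorem runs_hd (x y : ℕ) (s : Store) (t : T) :
    Runs O (.hd x y) s t (1 + (s y).size) (PMF.pure (Function.update s x (s y).head, t)) :=
  Runs.mono (runs_assign fun _ => rfl) (Nat.add_le_add_left (Data.size_head_le _) _)

theorem runs_tl (x y : ℕ) (s : Store) (t : T) :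
    Runs O (.tl x y) s t (1 + (s y).size) (PMF.pure (Function.update s x (s y).tail, t)) :=
  Runs.mono (runs_assign fun _ => rfl) (Nat.add_le_add_left (Data.size_tail_le _) _)

theorem runs_eq (x y z : ℕ) (s : Store) (t : T) :
    Runs O (.eq x y z) s t (1 + (s y).size + (s z).size)
      (PMF.pure (Function.update s x (encode (decide (s y = s z))), t)) :=
  runs_assign fun _ => rfl

theorem runs_toss (x : ℕ) (s : Store) (t : T) :
    Runs O (.toss x) s t 4
      ((PMF.uniformOfFintype Bool).map fun b => (Function.update s x (encode b), t)) := by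
  refine ⟨(PMF.uniformOfFintype Bool).map fun b => ((Function.update s x (encode b), t),
    1 + (encode b).size), by rw [PMF.map_comp]; rfl, ?_, fun f hf => ?_⟩
  · intro y hy
    simp only [PMF.support_map, Set.mem_image] at hy
    obtain ⟨b, -, rfl⟩ := hy
    have := size_encode_bool_le b
    show 1 + _ ≤ 4; omega
  · simp only [exec, PMF.map_comp]
    congr 1; funext b
    have := size_encode_bool_le b
    simp only [assign, Function.comp]
    rw [if_pos (by omega)]

theorem runs_query {x y : ℕ} {s : Store} {t : T} {c : ℕ}
    (h : ∀ r ∈ (O t (s y)).support, r.1.size ≤ c) :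
    Runs O (.query x y) s t (1 + c)
      ((O t (s y)).map fun r => (Function.update s x r.1, r.2)) := by
  refine ⟨(O t (s y)).map fun r => ((Function.update s x r.1, r.2), 1 + r.1.size),
    by rw [PMF.map_comp]; rfl, ?_, fun f hf => ?_⟩
  · intro z hz
    simp only [PMF.support_map, Set.mem_image] at hz
    obtain ⟨r, hr, rfl⟩ := hz
    exact Nat.add_le_add_left (h r hr) 1
  · simp only [exec, PMF.map_comp]
    refine map_congr_support fun r hr => ?_
    have := h r hr
    simp only [assign, Function.comp]
    rw [if_pos (by omega)]

theorem runs_ite_nil {x : ℕ} {p q : Prog} {s : Store} {t : T} {c : ℕ} {μ : PMF (Store × T)}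
    (hx : s x = .nil) (h : Runs O q s t c μ) : Runs O (.ite x p q) s t (c + 1) μ := by
  obtain ⟨ν, h1, h2, h3⟩ := h
  refine ⟨ν.map fun y => (y.1, y.2 + 1), by rw [PMF.map_comp]; exact h1, ?_, ?_⟩
  · intro z hz
    simp only [PMF.support_map, Set.mem_image] at hz
    obtain ⟨r, hr, rfl⟩ := hz
    exact Nat.add_le_add_right (h2 r hr) 1
  · intro f hf
    obtain ⟨f, rfl⟩ : ∃ f', f = f' + 1 := ⟨f - 1, by omega⟩
    simp only [exec, hx, if_true]
    rw [h3 f (by omega), PMF.map_comp]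
    congr 1; funext y; simp

theorem runs_ite_cons {x : ℕ} {p q : Prog} {s : Store} {t : T} {c : ℕ} {μ : PMF (Store × T)}
    (hx : s x ≠ .nil) (h : Runs O p s t c μ) : Runs O (.ite x p q) s t (c + 1) μ := by
  obtain ⟨ν, h1, h2, h3⟩ := h
  refine ⟨ν.map fun y => (y.1, y.2 + 1), by rw [PMF.map_comp]; exact h1, ?_, ?_⟩
  · intro z hz
    simp only [PMF.support_map, Set.mem_image] at hz
    obtain ⟨r, hr, rfl⟩ := hz
    exact Nat.add_le_add_right (h2 r hr) 1
  · intro f hf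
    obtain ⟨f, rfl⟩ : ∃ f', f = f' + 1 := ⟨f - 1, by omega⟩
    simp only [exec, hx, if_false]
    rw [h3 f (by omega), PMF.map_comp]
    congr 1; funext y; simp

theorem runs_loop_nil {x : ℕ} {p : Prog} {s : Store} {t : T} (hx : s x = .nil) :
    Runs O (.loop x p) s t 1 (PMF.pure (s, t)) := by
  refine ⟨PMF.pure ((s, t), 1), by simp [PMF.pure_map], by simp, fun f hf => ?_⟩
  obtain ⟨f, rfl⟩ : ∃ f', f = f' + 1 := ⟨f - 1, by omega⟩
  simp [exec_loop_succ, hx, PMF.pure_map]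

theorem runs_loop_cons {x : ℕ} {p : Prog} {s : Store} {t : T} {c : ℕ} {μ : PMF (Store × T)}
    (hx : s x ≠ .nil) (h : Runs O (.seq p (.loop x p)) s t c μ) :
    Runs O (.loop x p) s t (c + 1) μ := by
  obtain ⟨ν, h1, h2, h3⟩ := h
  refine ⟨ν.map fun y => (y.1, y.2 + 1), by rw [PMF.map_comp]; exact h1, ?_, ?_⟩
  · intro z hz
    simp only [PMF.support_map, Set.mem_image] at hz
    obtain ⟨r, hr, rfl⟩ := hz
    exact Nat.add_le_add_right (h2 r hr) 1
  · intro f hf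
    obtain ⟨f, rfl⟩ : ∃ f', f = f' + 1 := ⟨f - 1, by omega⟩
    rw [exec_loop_succ, if_neg hx, ← exec_seq, h3 f (by omega), PMF.map_comp]
    congr 1; funext y; simp

/-- One execution that surely stops within `c` determines all those with more time, by
`exec_add_fuel`. The cost of an outcome is read off from the time that it leaves. -/
theorem runs_of_exec {p : Prog} {s : Store} {t : T} {c : ℕ}
    (h : none ∉ (exec O p (s, t, c)).support) {μ : PMF (Store × T)}
    (hμ : (exec O p (s, t, c)).map (Option.map fun y => (y.1, y.2.1)) = μ.map some) :
    Runs O p s t c μ := by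
  have hd : ∀ r ∈ (exec O p (s, t, c)).support, r ≠ none := fun r hr hn => h (hn ▸ hr)
  refine ⟨(exec O p (s, t, c)).map fun r => match r with
    | none => ((s, t), 0)
    | some y => ((y.1, y.2.1), c - y.2.2), ?_, ?_, fun f hf => ?_⟩
  · rw [PMF.map_comp]
    have h2 := congrArg (PMF.map fun r : Option (Store × T) => r.getD (s, t)) hμ
    rw [PMF.map_comp, PMF.map_comp] at h2
    rw [show ((fun r : Option (Store × T) => r.getD (s, t)) ∘ some) = id from rfl, PMF.map_id] at h2
    rw [← h2]
    congr 1; funext r; cases r <;> rfl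
  · intro x hx
    simp only [PMF.support_map, Set.mem_image] at hx
    obtain ⟨r, hr, rfl⟩ := hx
    cases r <;> simp
  · obtain ⟨k, rfl⟩ := Nat.exists_eq_add_of_le hf
    rw [exec_add_fuel k h, PMF.map_comp]
    refine map_congr_support fun r hr => ?_
    cases r with
    | none => exact absurd hr h
    | some y =>
      have := exec_fuel_le hr
      simp only [Option.map, addFuel, Function.comp, Option.some.injEq, Prod.mk.injEq, true_and]
      omega

/-- The values of the variables after a terminating execution are not much larger than before. -/
theorem Runs.size_le {p : Prog} {s : Store} {t : T} {c M : ℕ} {μ : PMF (Store × T)}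
    (h : Runs O p s t c μ) (hs : ∀ x, (s x).size ≤ M) {y : Store × T} (hy : y ∈ μ.support)
    (x : ℕ) : (y.1 x).size ≤ M + c := by
  obtain ⟨ν, rfl, h2, h3⟩ := h
  rw [PMF.support_map] at hy
  obtain ⟨z, hz, rfl⟩ := hy
  have hm : some (z.1.1, z.1.2, c - z.2) ∈ (exec O p (s, t, c)).support := by
    rw [h3 c le_rfl, PMF.support_map]; exact ⟨z, hz, rfl⟩
  have := exec_size_le (M := M + c) (fun x => Nat.add_le_add_right (hs x) c) hm x
  simp only at this; omega

end exec

/-! ## Subroutines -/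

/-- Rename the variables by `φ`, and answer all queries by `nil`. -/
def Prog.sub (φ : ℕ → ℕ) : Prog → Prog
  | .setNil x => .setNil (φ x)
  | .copy x y => .copy (φ x) (φ y)
  | .cons x y z => .cons (φ x) (φ y) (φ z)
  | .hd x y => .hd (φ x) (φ y)
  | .tl x y => .tl (φ x) (φ y)
  | .eq x y z => .eq (φ x) (φ y) (φ z)
  | .toss x => .toss (φ x)
  | .query x _ => .setNil (φ x)
  | .seq p q => .seq (p.sub φ) (q.sub φ)
  | .ite x p q => .ite (φ x) (p.sub φ) (q.sub φ)
  | .loop x p => .loop (φ x) (p.sub φ)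

section sub

variable {T : Type} {O : Oracle T} {φ : ℕ → ℕ}

theorem extend_comp_self (s : Store) : Function.extend φ (s ∘ φ) s = s := by
  classical
  funext i
  by_cases h : ∃ j, φ j = i
  · rw [Function.extend_def, dif_pos h]; exact congrArg s h.choose_spec
  · rw [Function.extend_apply' _ _ _ h]

theorem extend_update (hφ : φ.Injective) (s s' : Store) (x : ℕ) (v : Data) :
    Function.extend φ (Function.update s' x v) s =
      Function.update (Function.extend φ s' s) (φ x) v := by
  funext i
  by_cases h : ∃ j, φ j = i
  · obtain ⟨j, rfl⟩ := h
    rw [hφ.extend_apply]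
    by_cases hj : j = x
    · subst hj; simp
    · rw [Function.update_of_ne hj, Function.update_of_ne (hφ.ne hj), hφ.extend_apply]
  · have : i ≠ φ x := fun hi => h ⟨x, hi.symm⟩
    rw [Function.extend_apply' _ _ _ h, Function.update_of_ne this, Function.extend_apply' _ _ _ h]

theorem extend_comp (hφ : φ.Injective) (s s' : Store) : Function.extend φ s' s ∘ φ = s' := by
  funext j; simp [hφ.extend_apply]

theorem extend_extend (s s' s'' : Store) :
    Function.extend φ s'' (Function.extend φ s' s) = Function.extend φ s'' s := by
  classical
  funext i
  by_cases h : ∃ j, φ j = i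
  · simp only [Function.extend_def, dif_pos h]
  · simp only [Function.extend_apply' _ _ _ h]

/-- The configuration of the caller after a subroutine. -/
def returnTo (φ : ℕ → ℕ) (s : Store) (t : T) (c : Config Unit) : Config T :=
  (Function.extend φ c.1 s, t, c.2.2)

theorem assign_sub (hφ : φ.Injective) (x : ℕ) (v : Data) (c : ℕ) (s : Store) (t : T) (f : ℕ) :
    assign (φ x) v c s t f =
      (assign x v c (s ∘ φ) () f).map (returnTo φ s t) := by
  unfold assign
  split_ifs
  · simp [returnTo, extend_update hφ, extend_comp_self]
  · rfl

/-- Injectivity of `φ` keeps the renamed variables apart, and everything outside the range of `φ`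
belongs to the caller and survives. A replaced query costs the same as before: `noOracle` answers
`nil`, and storing it takes two units, just as `setNil`. -/
theorem exec_sub (hφ : φ.Injective) (p : Prog) (s : Store) (t : T) (f : ℕ) :
    exec O (p.sub φ) (s, t, f) =
      (exec noOracle p (s ∘ φ, (), f)).map (Option.map (returnTo φ s t)) := by
  have hcont : ∀ (q : Prog), (∀ s f, exec O (q.sub φ) (s, t, f) =
      (exec noOracle q (s ∘ φ, (), f)).map (Option.map (returnTo φ s t))) →
      ∀ (r : Option (Config Unit)) (s : Store),
      andThen O (q.sub φ) (r.map (returnTo φ s t)) =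
        (andThen noOracle q r).map (Option.map (returnTo φ s t)) := by
    intro q hq r s
    cases r with
    | none => simp [andThen, PMF.pure_map]
    | some c =>
      show exec O (q.sub φ) (returnTo φ s t c) = _
      rw [returnTo, hq, extend_comp hφ]
      obtain ⟨s', ⟨⟩, f'⟩ := c
      simp only [andThen]
      congr 1; funext r; cases r with
      | none => rfl
      | some c => simp [returnTo, extend_extend]
  induction p generalizing s f with
  | setNil x | copy x _ | cons x _ _ | hd x _ | tl x _ | eq x _ _ =>
    simp only [exec, Prog.sub, PMF.pure_map]
    exact congrArg PMF.pure (assign_sub hφ _ _ _ _ _ _)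
  | toss x =>
    simp only [exec, Prog.sub, PMF.map_comp]
    congr 1; funext b; rw [assign_sub hφ]; rfl
  | query x z =>
    simp only [exec, Prog.sub, noOracle, PMF.pure_map]
    rw [assign_sub hφ]; rfl
  | seq p q ihp ihq =>
    rw [Prog.sub, exec_seq, exec_seq, ihp, PMF.bind_map, PMF.map_bind]
    congr 1; funext r
    exact hcont q ihq r s
  | ite x p q ihp ihq =>
    cases f with
    | zero => simp [Prog.sub, exec, PMF.pure_map]
    | succ f =>
      simp only [Prog.sub, exec, Function.comp]
      split_ifs
      · exact ihq s f
      · exact ihp s f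
  | loop x p ih =>
    induction f using Nat.strong_induction_on generalizing s with
    | _ f ihf =>
      cases f with
      | zero => simp [Prog.sub, exec_loop_zero, PMF.pure_map]
      | succ f =>
        simp only [Prog.sub, exec_loop_succ, Function.comp_apply]
        split_ifs
        · simp [PMF.pure_map, returnTo, extend_comp_self]
        · rw [ih, PMF.bind_map, PMF.map_bind]
          refine bind_congr_support fun r hr => ?_
          cases r with
          | none => simp [andThen, PMF.pure_map]
          | some c =>
            have hc := exec_fuel_le hr
            obtain ⟨s', ⟨⟩, f'⟩ := c
            have := ihf f' (by simp only at hc; omega) (Function.extend φ s' s)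
            simp only [Function.comp, Option.map, andThen, returnTo]
            rw [Prog.sub] at this
            rw [this, extend_comp hφ]
            congr 1; funext r; cases r with
            | none => rfl
            | some c => simp [returnTo, extend_extend]

theorem Runs.sub (hφ : φ.Injective) {p : Prog} {s s₀ : Store} {t : T} {c : ℕ}
    {μ : PMF (Store × Unit)} (h : Runs noOracle p s₀ () c μ) (hs : s ∘ φ = s₀) :
    Runs O (p.sub φ) s t c (μ.map fun y => (Function.extend φ y.1 s, t)) := by
  obtain ⟨ν, rfl, h2, h3⟩ := h
  refine ⟨ν.map fun y => ((Function.extend φ y.1.1 s, t), y.2), ?_, ?_, fun f hf => ?_⟩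
  · rw [PMF.map_comp, PMF.map_comp]; rfl
  · intro x hx
    simp only [PMF.support_map, Set.mem_image] at hx
    obtain ⟨y, hy, rfl⟩ := hx
    exact h2 y hy
  · rw [exec_sub hφ, hs, h3 f hf, PMF.map_comp, PMF.map_comp]
    rfl

end sub

end TrollThrottle

end
open Filter
open scoped ENNReal

noncomputable section

namespace TrollThrottle

open Coding

/-! ## Polynomial bounds -/

/-- Monotone functions that are bounded by a polynomial. -/
@[fun_prop]
def PolyB (c : ℕ → ℕ) : Prop := Monotone c ∧ ∃ q : Polynomial ℕ, ∀ n, c n ≤ q.eval n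

theorem monotone_eval (q : Polynomial ℕ) : Monotone fun n => q.eval n := by
  intro m n h
  simp only [Polynomial.eval_eq_sum_range]
  gcongr

theorem PolyB.eval (q : Polynomial ℕ) : PolyB fun n => q.eval n :=
  ⟨monotone_eval q, q, fun _ => le_rfl⟩

@[fun_prop]
theorem PolyB.id : PolyB fun n => n :=
  ⟨monotone_id, Polynomial.X, fun n => by simp⟩

@[fun_prop]
theorem PolyB.const (k : ℕ) : PolyB fun _ => k :=
  ⟨monotone_const, Polynomial.C k, fun n => by simp⟩

@[fun_prop]
theorem PolyB.add {c d : ℕ → ℕ} (hc : PolyB c) (hd : PolyB d) : PolyB fun n => c n + d n := by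
  obtain ⟨h1, q, hq⟩ := hc
  obtain ⟨h2, r, hr⟩ := hd
  exact ⟨h1.add h2, q + r, fun n => by simpa using Nat.add_le_add (hq n) (hr n)⟩

@[fun_prop]
theorem PolyB.mul {c d : ℕ → ℕ} (hc : PolyB c) (hd : PolyB d) : PolyB fun n => c n * d n := by
  obtain ⟨h1, q, hq⟩ := hc
  obtain ⟨h2, r, hr⟩ := hd
  exact ⟨fun m n h => Nat.mul_le_mul (h1 h) (h2 h), q * r, fun n => by
    simpa using Nat.mul_le_mul (hq n) (hr n)⟩

@[fun_prop]
theorem PolyB.comp {c d : ℕ → ℕ} (hc : PolyB c) (hd : PolyB d) : PolyB fun n => c (d n) := by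
  obtain ⟨h1, q, hq⟩ := hc
  obtain ⟨h2, r, hr⟩ := hd
  exact ⟨fun m n h => h1 (h2 h), q.comp r, fun n => by
    rw [Polynomial.eval_comp]; exact (hq _).trans (monotone_eval q (hr n))⟩

/-! ## Stores -/

/-- The store with all variables `nil`. -/
def emptyStore : Store := fun _ => .nil

/-- Insert a value as the variable `x₀` and move the others. -/
def push (d : Data) (s : Store) : Store
  | 0 => d
  | i + 1 => s i

/-- The store with input `d`. -/
def st (d : Data) : Store := push d emptyStore

@[simp] theorem push_zero (d : Data) (s : Store) : push d s 0 = d := rfl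
@[simp] theorem push_succ (d : Data) (s : Store) (i : ℕ) : push d s (i + 1) = s i := rfl
@[simp] theorem push_one (d : Data) (s : Store) : push d s 1 = s 0 := rfl
@[simp] theorem push_two (d : Data) (s : Store) : push d s 2 = s 1 := rfl
@[simp] theorem push_three (d : Data) (s : Store) : push d s 3 = s 2 := rfl

theorem push_nil_emptyStore : push .nil emptyStore = emptyStore := by
  funext i; cases i <;> rfl

@[simp] theorem update_push_zero (d v : Data) (s : Store) :
    Function.update (push d s) 0 v = push v s := by
  funext i; cases i <;> simp

@[simp] theorem update_push_succ (d v : Data) (s : Store) (k : ℕ) :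
    Function.update (push d s) (k + 1) v = push d (Function.update s k v) := by
  funext i; cases i with
  | zero => simp
  | succ i => by_cases h : i = k <;> simp [h]

@[simp] theorem update_push_one (d v : Data) (s : Store) :
    Function.update (push d s) 1 v = push d (Function.update s 0 v) := update_push_succ d v s 0
@[simp] theorem update_push_two (d v : Data) (s : Store) :
    Function.update (push d s) 2 v = push d (Function.update s 1 v) := update_push_succ d v s 1

@[simp] theorem update_empty_zero (v : Data) :
    Function.update emptyStore 0 v = push v emptyStore := by
  rw [← push_nil_emptyStore, update_push_zero, push_nil_emptyStore]

@[simp] theorem emptyStore_apply (i : ℕ) : emptyStore i = .nil := rfl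

theorem update_nil_eq_st (d : Data) : Function.update (fun _ => Data.nil) 0 d = st d :=
  update_empty_zero d

/-- The list acts as a stack of saved variables: a subroutine whose variables are shifted by its
length works on the store below and leaves the stack intact. -/
theorem extend_add (s' : Store) (l : List Data) (s : Store) :
    Function.extend (· + l.length) s' (l.foldr push s) = l.foldr push s' := by
  induction l with
  | nil => funext i; exact (Function.injective_id).extend_apply s' s i
  | cons a l ih =>
    funext i
    cases i with
    | zero =>
      rw [Function.extend_apply']
      · rfl
      · rintro ⟨j, hj⟩; simp at hj
    | succ i =>
      have h := congrFun ih i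
      simp only [List.foldr_cons, push_succ]
      rw [← h]
      by_cases hj : ∃ j, j + l.length = i
      · obtain ⟨j, rfl⟩ := hj
        rw [(add_left_injective l.length).extend_apply,
          show j + l.length + 1 = j + (a :: l).length by simp [add_assoc],
          (add_left_injective (a :: l).length).extend_apply]
      · rw [Function.extend_apply' _ _ _ hj, Function.extend_apply']
        · simp
        · rintro ⟨j, hj'⟩; exact hj ⟨j, by simp at hj'; omega⟩

section Runs

variable {T : Type} {O : Oracle T}

/-- Call of a procedure on the variables after those in `l`. -/
theorem Runs.call {p : Prog} {x : Data} {c : ℕ} {F : PMF Data} (l : List Data) (t : T)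
    (h : Runs noOracle p (st x) () c (F.map fun d => (st d, ()))) :
    Runs O (p.sub (· + l.length)) (l.foldr push (st x)) t c
      (F.map fun d => (l.foldr push (st d), t)) := by
  have hs : (l.foldr push (st x)) ∘ (· + l.length) = st x := by
    rw [← extend_add (st x) l (st x), extend_comp (add_left_injective l.length)]
  refine (Runs.sub (add_left_injective l.length) h hs).congr ?_
  rw [PMF.map_comp]
  congr 1; funext d; simp [Function.comp, extend_add]

theorem Runs.call_pure {p : Prog} {x y : Data} {c : ℕ} (l : List Data) (t : T)
    (h : Runs noOracle p (st x) () c ((PMF.pure y).map fun d => (st d, ()))) :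
    Runs O (p.sub (· + l.length)) (l.foldr push (st x)) t c
      (PMF.pure (l.foldr push (st y), t)) := by
  simpa [PMF.pure_map] using Runs.call (O := O) l t h

/-- With time for both bounds, the two descriptions speak of the same execution. -/
theorem Runs.unique {p : Prog} {s : Store} {t : T} {c c' : ℕ} {μ μ' : PMF (Store × T)}
    (h : Runs O p s t c μ) (h' : Runs O p s t c' μ') : μ = μ' := by
  obtain ⟨ν, rfl, -, h3⟩ := h
  obtain ⟨ν', rfl, -, h3'⟩ := h'
  have e := (h3 (max c c') (le_max_left _ _)).symm.trans (h3' _ (le_max_right _ _))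
  have e' := congrArg (PMF.map fun r : Option (Config T) => r.elim (s, t) fun y => (y.1, y.2.1)) e
  rw [PMF.map_comp, PMF.map_comp] at e'
  exact e'

/-- Different outcomes `a` may lead to the same store, so `κ` need not be a function of the store.
Its values at outcomes with a common store describe the same run of `q` and agree by `Runs.unique`;
therefore an arbitrary preimage may be chosen. -/
theorem Runs.seq_map {α : Type*} {p q : Prog} {s : Store} {t : T} {c c' : ℕ} {F : PMF α}
    {g : α → Store × T} {κ : α → PMF (Store × T)} (hp : Runs O p s t c (F.map g))
    (hq : ∀ a ∈ F.support, Runs O q (g a).1 (g a).2 c' (κ a)) :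
    Runs O (.seq p q) s t (c + c') (F.bind κ) := by
  classical
  obtain ⟨ν', h1', h2', h3'⟩ : Runs O (.seq p q) s t (c + c')
      ((F.map fun a => g a).bind fun y => if h : ∃ a ∈ F.support, g a = y
        then κ h.choose else PMF.pure y) := by
    refine Runs.seq hp fun y hy => ?_
    rw [PMF.support_map] at hy
    obtain ⟨a, ha, rfl⟩ := hy
    have hex : ∃ a' ∈ F.support, g a' = g a := ⟨a, ha, rfl⟩
    rw [dif_pos hex]
    have := hq _ hex.choose_spec.1
    rwa [hex.choose_spec.2] at this
  refine ⟨ν', ?_, h2', h3'⟩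
  rw [h1', PMF.bind_map]
  refine bind_congr_support fun a ha => ?_
  have hex : ∃ a' ∈ F.support, g a' = g a := ⟨a, ha, rfl⟩
  simp only [Function.comp]
  rw [dif_pos hex]
  have e1 := hq _ hex.choose_spec.1
  rw [hex.choose_spec.2] at e1
  exact e1.unique (hq a ha)

end Runs

/-! ## Efficient computations -/

/-- Some program computes a sample of `F i` from `x i`, for all `i`, in time polynomial in the size
of `x i`; all other variables are `nil` at the end. -/
def Eff {ι : Type*} (x : ι → Data) (F : ι → PMF Data) : Prop :=
  ∃ (p : Prog) (c : ℕ → ℕ), PolyB c ∧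
    ∀ i, Runs noOracle p (st (x i)) () (c (x i).size) ((F i).map fun d => (st d, ()))

/-- `y` is computable from `x` in polynomial time. -/
def Det {ι : Type*} (x y : ι → Data) : Prop := Eff x fun i => PMF.pure (y i)

section Eff

variable {ι : Type*} {x y z : ι → Data} {F : ι → PMF Data}

theorem st_size_le (d : Data) (i : ℕ) : (st d i).size ≤ d.size := by
  cases i with
  | zero => exact le_rfl
  | succ i => exact d.size_pos

theorem Runs.output_size_le {p : Prog} {d : Data} {c : ℕ} {μ : PMF Data}
    (h : Runs noOracle p (st d) () c (μ.map fun d' => (st d', ()))) {d' : Data}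
    (hd : d' ∈ μ.support) : d'.size ≤ d.size + c := by
  have := Runs.size_le h (st_size_le d) (y := (st d', ()))
    (by rw [PMF.support_map]; exact ⟨d', hd, rfl⟩) 0
  simpa [st] using this

/-- The running time bounds the size of what is written. -/
theorem Eff.size_le (h : Eff x F) :
    ∃ B : ℕ → ℕ, PolyB B ∧ ∀ i, ∀ d ∈ (F i).support, d.size ≤ B (x i).size := by
  obtain ⟨p, c, hc, hp⟩ := h
  exact ⟨fun m => m + c m, by fun_prop, fun i d hd => (hp i).output_size_le hd⟩

theorem Det.size_le (h : Det x y) : ∃ B : ℕ → ℕ, PolyB B ∧ ∀ i, (y i).size ≤ B (x i).size := by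
  obtain ⟨B, hB, h⟩ := Eff.size_le h
  exact ⟨B, hB, fun i => h i _ (by simp)⟩

theorem Eff.congr {F' : ι → PMF Data} (h : Eff x F) (hF : ∀ i, F i = F' i) : Eff x F' := by
  rwa [show F' = F from funext fun i => (hF i).symm]

theorem Det.congr {y' : ι → Data} (h : Det x y) (hy : ∀ i, y i = y' i) : Det x y' := by
  rwa [show y' = y from funext fun i => (hy i).symm]

theorem Eff.reindex {κ : Type*} (h : Eff x F) (e : κ → ι) :
    Eff (fun k => x (e k)) fun k => F (e k) := by
  obtain ⟨p, c, hc, hp⟩ := h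
  exact ⟨p, c, hc, fun k => hp (e k)⟩

theorem Det.reindex {κ : Type*} (h : Det x y) (e : κ → ι) :
    Det (fun k => x (e k)) fun k => y (e k) := Eff.reindex h e

theorem Det.id : Det x x := by
  refine ⟨.setNil 1, fun _ => 2, by fun_prop, fun i => ?_⟩
  have := runs_setNil (O := noOracle) 1 (st (x i)) ()
  simpa [PMF.pure_map, st, push_nil_emptyStore] using this

theorem Det.eff (h : Det x y) (hF : Eff y F) : Eff x F := by
  obtain ⟨p, c, hc, hp⟩ := h
  obtain ⟨q, d, hd, hq⟩ := hF
  refine ⟨.seq p q, fun m => c m + d (m + c m), by fun_prop, fun i => ?_⟩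
  refine Runs.mono (Runs.seq_pure (by simpa [PMF.pure_map] using hp i) (hq i)) ?_
  -- Here the monotonicity in `PolyB` is needed: the size of the intermediate value is not known,
  -- only bounded by `m + c m`.
  exact Nat.add_le_add_left (hd.1 ((hp i).output_size_le (by simp))) _

theorem Det.trans (h : Det x y) (hz : Det y z) : Det x z := Det.eff h hz

theorem Det.of_prog {w : ι → Data} (p : Prog) (c : ℕ → ℕ) (hc : PolyB c)
    (h : ∀ i, Runs noOracle p (st (x i)) () (c (x i).size) (PMF.pure (st (w i), ()))) : Det x w :=
  ⟨p, c, hc, fun i => by simpa [PMF.pure_map] using h i⟩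

theorem Det.head (h : Det x y) : Det x fun i => (y i).head :=
  h.trans (.of_prog (.hd 0 0) (fun m => 1 + m) (by fun_prop) fun i => by
    simpa [st] using runs_hd (O := noOracle) 0 0 (st (y i)) ())

theorem Det.tail (h : Det x y) : Det x fun i => (y i).tail :=
  h.trans (.of_prog (.tl 0 0) (fun m => 1 + m) (by fun_prop) fun i => by
    simpa [st] using runs_tl (O := noOracle) 0 0 (st (y i)) ())

theorem Det.fst (h : Det x fun i => .cons (y i) (z i)) : Det x y := h.head

theorem Det.snd (h : Det x fun i => .cons (y i) (z i)) : Det x z := h.tail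

theorem Eff.left (h : Eff y F) : Eff (fun i => .cons (y i) (z i)) F :=
  Det.eff (Det.fst (y := y) (z := z) Det.id) h

theorem Eff.right (h : Eff z F) : Eff (fun i => .cons (y i) (z i)) F :=
  Det.eff (Det.snd (y := y) (z := z) Det.id) h

theorem Det.left {w : ι → Data} (h : Det y w) : Det (fun i => .cons (y i) (z i)) w := Eff.left h

theorem Det.right {w : ι → Data} (h : Det z w) : Det (fun i => .cons (y i) (z i)) w := Eff.right h

theorem Det.nil : Det x fun _ => .nil :=
  .of_prog (.setNil 0) (fun _ => 2) (by fun_prop) fun i => by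
    simpa [st] using runs_setNil (O := noOracle) 0 (st (x i)) ()

theorem Det.cons (hy : Det x y) (hz : Det x z) : Det x fun i => .cons (y i) (z i) := by
  obtain ⟨p, c, hc, hp⟩ := hy
  obtain ⟨q, d, hd, hq⟩ := hz
  -- The input stays in `x₀`; `y` is computed from a copy in `x₁` and `z` from a copy in `x₂`, with
  -- the variables beyond as work space. The last two assignments clear `x₁` and `x₂`, as `Eff`
  -- demands.
  refine .of_prog (.seq (.copy 1 0) (.seq (p.sub (· + 1)) (.seq (.copy 2 0) (.seq (q.sub (· + 2))
    (.seq (.cons 0 1 2) (.seq (.setNil 1) (.setNil 2)))))))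
    (fun m => 8 + 4 * m + 2 * c m + 2 * d m) (by fun_prop) fun i => ?_
  have h1 := (hp i).output_size_le (d' := y i) (by simp)
  have h2 := (hq i).output_size_le (d' := z i) (by simp)
  refine Runs.mono (Runs.seq_pure (runs_copy _ _ _ _) ?_) (c := 1 + (x i).size + (c (x i).size +
    (1 + (x i).size + (d (x i).size + ((2 + (y i).size + (z i).size) + (2 + 2)))))) (by omega)
  simp only [st, update_push_one, update_empty_zero, push_zero]
  refine Runs.seq_pure ((hp i).call_pure [x i] ()) ?_
  refine Runs.seq_pure (runs_copy _ _ _ _) ?_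
  simp only [List.foldr, st, update_push_two, update_push_one, update_empty_zero, push_zero]
  refine Runs.seq_pure ((hq i).call_pure [x i, y i] ()) ?_
  refine Runs.seq_pure (runs_cons _ _ _ _ _) ?_
  refine Runs.seq_pure (runs_setNil _ _ _) ?_
  simpa [st, push_nil_emptyStore] using
    runs_setNil (O := noOracle) 2 (push (.cons (y i) (z i)) (push .nil (push (z i) emptyStore))) ()

theorem Det.const (d : Data) : Det x fun _ => d := by
  induction d with
  | nil => exact .nil
  | cons a b iha ihb => exact iha.cons ihb

theorem Det.eq (hy : Det x y) (hz : Det x z) : Det x fun i => encode (decide (y i = z i)) := by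
  refine (hy.cons hz).trans (.of_prog (.seq (.hd 1 0) (.seq (.tl 2 0) (.seq (.eq 0 1 2)
    (.seq (.setNil 1) (.setNil 2))))) (fun m => 7 + 4 * m) (by fun_prop) fun i => ?_)
  refine Runs.mono (Runs.seq_pure (runs_hd _ _ _ _) ?_) (c := 1 + (Data.cons (y i) (z i)).size +
    (1 + (Data.cons (y i) (z i)).size + ((1 + (y i).size + (z i).size) + (2 + 2))))
    (by simp [Data.size]; omega)
  refine Runs.seq_pure (runs_tl _ _ _ _) ?_
  refine Runs.seq_pure (runs_eq _ _ _ _ _) ?_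
  refine Runs.seq_pure (runs_setNil _ _ _) ?_
  simpa [st, push_nil_emptyStore, Data.head, Data.tail] using
    runs_setNil (O := noOracle) 2 (push (encode (decide (y i = z i))) (push .nil
      (push (z i) emptyStore))) ()

theorem Eff.toss : Eff x fun _ => (PMF.uniformOfFintype Bool).map encode := by
  refine ⟨.toss 0, fun _ => 4, by fun_prop, fun i => ?_⟩
  have := runs_toss (O := noOracle) 0 (st (x i)) ()
  rw [PMF.map_comp]
  simpa [st, Function.comp_def] using this

/-- The second computation receives the outcome of the first in front of the original input. It has
to be correct and fast only for outcomes that occur, which is why it is indexed by a subtype. -/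
theorem Eff.bind {G : ι → Data → PMF Data} (hF : Eff x F)
    (hG : Eff (fun j : {j : ι × Data // j.2 ∈ (F j.1).support} => .cons j.1.2 (x j.1.1))
      fun j => G j.1.1 j.1.2) :
    Eff x fun i => (F i).bind (G i) := by
  obtain ⟨p, c, hc, hp⟩ := hF
  obtain ⟨q, d, hd, hq⟩ := hG
  refine ⟨.seq (.copy 1 0) (.seq (p.sub (· + 1)) (.seq (.cons 0 1 0) (.seq (.setNil 1) q))),
    fun m => 5 + 3 * m + 2 * c m + d (1 + 2 * m + c m), by fun_prop, fun i => ?_⟩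
  refine Runs.mono (Runs.seq_pure (runs_copy _ _ _ _) ?_) (c := 1 + (x i).size + (c (x i).size +
    ((2 + ((x i).size + c (x i).size) + (x i).size) +
      (2 + d (1 + 2 * (x i).size + c (x i).size))))) (by dsimp only; omega)
  simp only [st, update_push_one, update_empty_zero, push_zero]
  rw [PMF.map_bind]
  refine Runs.seq_map ((hp i).call [x i] ()) fun a ha => ?_
  have hs := (hp i).output_size_le ha
  refine Runs.mono (Runs.seq_pure (runs_cons _ _ _ _ _) ?_) (c := (2 + a.size + (x i).size) +
      (2 + d (1 + 2 * (x i).size + c (x i).size))) (by omega)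
  simp only [List.foldr, st, push_zero, push_one, update_push_zero]
  refine Runs.seq_pure (runs_setNil _ _ _) ?_
  simp only [update_push_one, update_push_zero, push_nil_emptyStore]
  exact (hq ⟨(i, a), ha⟩).mono (hd.1 (by simp [Data.size]; omega))

theorem Eff.map {g : ι → Data → Data} (hF : Eff x F)
    (hG : Det (fun j : {j : ι × Data // j.2 ∈ (F j.1).support} => .cons j.1.2 (x j.1.1))
      fun j => g j.1.1 j.1.2) :
    Eff x fun i => (F i).map (g i) :=
  (hF.bind (G := fun i d => PMF.pure (g i d)) hG).congr fun _ => PMF.bind_pure_comp _ _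

/-- Each branch is indexed by the cases that reach it, so that its proof of efficiency may use the
condition. -/
theorem Eff.ite_data {b : ι → Data} (hb : Det x b)
    (h1 : Eff (fun j : {i // b i ≠ .nil} => x j) fun j => F j)
    (h0 : Eff (fun j : {i // b i = .nil} => x j) fun j => F j) : Eff x F := by
  obtain ⟨p, c, hc, hp⟩ := hb
  obtain ⟨q, d, hd, hq⟩ := h1
  obtain ⟨r, e, he, hr⟩ := h0
  refine ⟨.seq (.copy 1 0) (.seq (p.sub (· + 1)) (.ite 1 (.seq (.setNil 1) q) r)),
    fun m => 4 + m + c m + d m + e m, by fun_prop, fun i => ?_⟩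
  refine Runs.mono (Runs.seq_pure (runs_copy _ _ _ _) ?_) (c := 1 + (x i).size + (c (x i).size +
    (2 + d (x i).size + e (x i).size + 1))) (by dsimp only; omega)
  simp only [st, update_push_one, update_empty_zero, push_zero]
  refine Runs.seq_pure ((hp i).call_pure [x i] ()) ?_
  by_cases h : b i = .nil
  · refine runs_ite_nil (by simpa [st] using h) ?_
    simp only [List.foldr, st, h, push_nil_emptyStore]
    exact (hr ⟨i, h⟩).mono (by dsimp only; omega)
  · refine runs_ite_cons (by simpa [st] using h) ?_
    refine Runs.mono (Runs.seq_pure (runs_setNil _ _ _) ?_) (c := 2 + d (x i).size) (by omega)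
    simp only [List.foldr, st, update_push_one, update_push_zero, push_nil_emptyStore]
    exact hq ⟨i, h⟩

/-- Case distinction by a property that can be decided from `x`. -/
theorem Eff.ite {P : ι → Prop} [DecidablePred P] (hb : Det x fun i => encode (decide (P i)))
    (h1 : Eff (fun j : {i // P i} => x j) fun j => F j)
    (h0 : Eff (fun j : {i // ¬ P i} => x j) fun j => F j) : Eff x F := by
  have key : ∀ i, encode (decide (P i)) = .nil ↔ ¬ P i := fun i => by
    by_cases h : P i <;> simp [h, encode]
  exact Eff.ite_data hb (h1.reindex fun j : {i // encode (decide (P i)) ≠ .nil} =>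
      (⟨j.1, not_not.1 fun h => j.2 ((key _).2 h)⟩ : {i // P i}))
    (h0.reindex fun j : {i // encode (decide (P i)) = .nil} =>
      (⟨j.1, (key _).1 j.2⟩ : {i // ¬ P i}))

/-! ### Loops over lists -/

/-- A list of trees as a tree. -/
def chain : List Data → Data
  | [] => .nil
  | e :: l => .cons e (chain l)

theorem chain_map_encode {α : Type} [Coding α] (l : List α) : chain (l.map encode) = encode l := by
  induction l with
  | nil => rfl
  | cons a l ih =>
    show Data.cons (encode a) _ = Data.cons (encode a) (encode l)
    rw [← ih]

/-- Iterate `G` over a list. -/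
def foldM (G : Data → Data → PMF Data) : List Data → Data → PMF Data
  | [], s => PMF.pure s
  | e :: l, s => (G e s).bind (foldM G l)

theorem foldM_pure (g : Data → Data → Data) (l : List Data) (s : Data) :
    foldM (fun e s => PMF.pure (g e s)) l s = PMF.pure (l.foldl (fun s e => g e s) s) := by
  induction l generalizing s with
  | nil => rfl
  | cons e l ih => simp [foldM, ih]

theorem length_le_size_chain (l : List Data) : l.length ≤ (chain l).size := by
  induction l with
  | nil => simp
  | cons e l ih => simp only [chain, Data.size, List.length_cons]; omega

theorem size_le_size_chain {l : List Data} {e : Data} (he : e ∈ l) : e.size ≤ (chain l).size := by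
  induction l with
  | nil => simp at he
  | cons a l ih =>
    simp only [chain, Data.size]
    rcases List.mem_cons.1 he with rfl | h
    · omega
    · have := ih h; omega

/-- That a single round is efficient does not suffice: an accumulator that doubles in each round
grows exponentially. The invariant `P` provides a bound on all accumulators that occur, in terms of
the input and not of the previous accumulator. -/
theorem Eff.foldM {l : ι → List Data} {G : ι → Data → Data → PMF Data}
    (hl : Det x fun i => chain (l i)) (hz : Det x z) (P : ι → List Data → Data → Prop) (B : ℕ → ℕ)
    (hB : PolyB B) (hP : ∀ i l' s, l' <:+ l i → P i l' s → s.size ≤ B (x i).size)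
    (hPz : ∀ i, P i (l i) (z i))
    (hPG : ∀ i e l' s, e :: l' <:+ l i → P i (e :: l') s → ∀ s' ∈ (G i e s).support, P i l' s')
    (hG : Eff (fun j : {j : ι × Data × Data //
        ∃ l', j.2.1 :: l' <:+ l j.1 ∧ P j.1 (j.2.1 :: l') j.2.2} =>
      .cons (x j.1.1) (.cons j.1.2.1 j.1.2.2)) fun j => G j.1.1 j.1.2.1 j.1.2.2) :
    Eff x fun i => TrollThrottle.foldM (G i) (l i) (z i) := by
  obtain ⟨p, c, hc, hp⟩ := hl
  obtain ⟨q, d, hd, hq⟩ := hz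
  obtain ⟨r, e, he, hr⟩ := hG
  -- Between rounds `x₀` holds the input, `x₁` the rest of the list and `x₂` the accumulator. The
  -- body assembles the argument of `r` in `x₂` with the help of `x₃` and calls `r` there.
  let body : Prog := .seq (.hd 3 1) (.seq (.tl 1 1) (.seq (.cons 3 3 2) (.seq (.cons 2 0 3)
    (.seq (.setNil 3) (r.sub (· + 2))))))
  -- cost of one round
  let k : ℕ → ℕ := fun m => 14 + 10 * (m + c m) + 10 * B m + e (2 + 2 * m + c m + B m)
  have hloop : ∀ i (l' : List Data) (s : Data), l' <:+ l i → P i l' s →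
      (chain l').size ≤ (x i).size + c (x i).size →
      Runs noOracle (.loop 1 body) (push (x i) (push (chain l') (st s))) ()
        (1 + l'.length * k (x i).size)
        ((TrollThrottle.foldM (G i) l' s).map fun s' =>
          (push (x i) (push .nil (st s')), ())) := by
    intro i l'
    induction l' with
    | nil =>
      intro s _ _ _
      simpa [TrollThrottle.foldM, PMF.pure_map, chain] using
        runs_loop_nil (O := noOracle) (p := body) (t := ())
          (show push (x i) (push .nil (st s)) 1 = .nil from rfl)
    | cons a l' ih =>
      intro s hl' hs hsz
      have hsB := hP i _ s hl' hs
      simp only [chain, Data.size] at hsz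
      have h1 := hr ⟨(i, a, s), l', hl', hs⟩
      refine Runs.mono (runs_loop_cons (c := (13 + 10 * ((x i).size + c (x i).size) +
        10 * B (x i).size + e (2 + 2 * (x i).size + c (x i).size + B (x i).size)) +
        (1 + l'.length * k (x i).size)) (by simp [chain]) ?_) (by
          simp only [List.length_cons, add_mul, k]; omega)
      rw [TrollThrottle.foldM, PMF.map_bind]
      refine Runs.seq_map (g := fun s' => (push (x i) (push (chain l') (st s')), ())) ?_ ?_
      · refine Runs.mono (Runs.seq_pure (runs_hd _ _ _ _) ?_) (c := (1 + (Data.cons a (chain l')).size)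
          + ((1 + (Data.cons a (chain l')).size) + ((2 + a.size + s.size) +
          ((2 + (x i).size + (Data.cons a s).size) + (2 +
            e (2 + 2 * (x i).size + c (x i).size + B (x i).size))))))
            (by simp only [Data.size]; omega)
        refine Runs.seq_pure (runs_tl _ _ _ _) ?_
        refine Runs.seq_pure (runs_cons _ _ _ _ _) ?_
        refine Runs.seq_pure (runs_cons _ _ _ _ _) ?_
        refine Runs.seq_pure (runs_setNil _ _ _) ?_
        simp [chain, Data.head, Data.tail, st, push_nil_emptyStore]
        exact (h1.call [x i, chain l'] ()).mono (he.1 (by simp [Data.size]; omega))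
      · intro s' hs'
        exact ih s' ((List.suffix_cons a l').trans hl') (hPG i a l' s hl' hs s' hs') (by omega)
  refine ⟨.seq (.copy 1 0) (.seq (p.sub (· + 1)) (.seq (.copy 2 0) (.seq (q.sub (· + 2))
    (.seq (.loop 1 body) (.seq (.copy 0 2) (.setNil 2)))))),
    fun m => 10 + 5 * m + c m + d m + (1 + (m + c m) * k m) + B m, by fun_prop, fun i => ?_⟩
  have h1 := (hp i).output_size_le (d' := chain (l i)) (by simp)
  have h2 := length_le_size_chain (l i)
  refine Runs.mono (Runs.seq_pure (runs_copy _ _ _ _) ?_) (c := 1 + (x i).size + (c (x i).size +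
    (1 + (x i).size + (d (x i).size + ((1 + (l i).length * k (x i).size) +
    ((1 + B (x i).size) + 2)))))) (by
      have : (l i).length * k (x i).size ≤ ((x i).size + c (x i).size) * k (x i).size :=
        Nat.mul_le_mul_right _ (h2.trans h1)
      dsimp only; omega)
  simp only [st, update_push_one, update_empty_zero, push_zero]
  refine Runs.seq_pure ((hp i).call_pure [x i] ()) ?_
  refine Runs.seq_pure (runs_copy _ _ _ _) ?_
  simp only [List.foldr, st, update_push_two, update_push_one, update_empty_zero, push_zero]
  refine Runs.seq_pure ((hq i).call_pure [x i, chain (l i)] ()) ?_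
  have hfin : ∀ (l' : List Data) (s : Data), l' <:+ l i → P i l' s →
      ∀ s' ∈ (TrollThrottle.foldM (G i) l' s).support, P i [] s' := by
    intro l'
    induction l' with
    | nil => intro s _ hs s' hs'; simp [TrollThrottle.foldM] at hs'; rwa [hs']
    | cons a l' ih =>
      intro s hl' hs s' hs'
      simp only [TrollThrottle.foldM, PMF.mem_support_bind_iff] at hs'
      obtain ⟨u, hu, hs'⟩ := hs'
      exact ih u ((List.suffix_cons a l').trans hl') (hPG i a l' s hl' hs u hu) s' hs'
  rw [← PMF.bind_pure_comp]
  refine Runs.seq_map (hloop i (l i) (z i) List.suffix_rfl (hPz i) h1) fun s' hs' => ?_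
  have := hP i [] s' (List.nil_suffix) (hfin (l i) (z i) List.suffix_rfl (hPz i) s' hs')
  refine Runs.mono (Runs.seq_pure (runs_copy _ _ _ _) ?_) (c := (1 + s'.size) + 2) (by omega)
  simpa [st, push_nil_emptyStore] using
    runs_setNil (O := noOracle) 2 (push s' (push .nil (push s' emptyStore))) ()

theorem Det.foldl {l : ι → List Data} {g : ι → Data → Data → Data}
    (hl : Det x fun i => chain (l i)) (hz : Det x z) (P : ι → List Data → Data → Prop) (B : ℕ → ℕ)
    (hB : PolyB B) (hP : ∀ i l' s, l' <:+ l i → P i l' s → s.size ≤ B (x i).size)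
    (hPz : ∀ i, P i (l i) (z i))
    (hPG : ∀ i e l' s, e :: l' <:+ l i → P i (e :: l') s → P i l' (g i e s))
    (hG : Det (fun j : {j : ι × Data × Data //
        ∃ l', j.2.1 :: l' <:+ l j.1 ∧ P j.1 (j.2.1 :: l') j.2.2} =>
      .cons (x j.1.1) (.cons j.1.2.1 j.1.2.2)) fun j => g j.1.1 j.1.2.1 j.1.2.2) :
    Det x fun i => (l i).foldl (fun s e => g i e s) (z i) :=
  (Eff.foldM (G := fun i e s => PMF.pure (g i e s)) hl hz P B hB hP hPz
    (fun i e l' s he hs s' hs' => by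
      rw [(PMF.mem_support_pure_iff _ _).1 hs']; exact hPG i e l' s he hs) hG).congr fun i =>
        foldM_pure _ _ _

end Eff

theorem encode_injective {α : Type} [Coding α] : Function.Injective (encode : α → Data) := by
  intro a b h
  have := congrArg (decode (α := α)) h
  simpa [decode_encode] using this

/-! ### From programs with arbitrary use of variables to efficient computations -/

/-- Set the variables `x₁, …, x_k` to `nil`. -/
def Prog.clear : ℕ → Prog
  | 0 => .setNil 1
  | k + 1 => .seq (.setNil (k + 1)) (clear k)

theorem runs_clear {T : Type} {O : Oracle T} (k : ℕ) (s : Store) (t : T)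
    (h : ∀ i, k < i → s i = .nil) :
    Runs O (.clear k) s t (2 * k + 2) (PMF.pure (st (s 0), t)) := by
  induction k generalizing s with
  | zero =>
    refine (runs_setNil 1 s t).congr ?_
    congr 2
    funext i
    rcases i with _ | i
    · simp [st]
    · by_cases hi : i = 0 <;> simp [st, hi, h]
  | succ k ih =>
    refine Runs.mono (Runs.seq_pure (runs_setNil _ _ _) (ih _ fun i hi => ?_)) (c := 2 + (2 * k + 2))
      (by omega) |>.congr (by simp)
    by_cases hik : i = k + 1
    · simp [hik]
    · rw [Function.update_of_ne hik]; exact h i (by omega)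

/-- A program from `IsPPT` may leave arbitrary values in its variables; clearing those within its
width gives the clean stores of `Eff`. Since `1ⁿ` is unary, the argument of the time bound is at
most the size of the whole input. -/
theorem IsPPT.eff {α β : Type} [Coding α] [Coding β] {f : ℕ → α → PMF β} (hf : IsPPT f) :
    Eff (fun j : ℕ × α => encode j) fun j => (f j.1 j.2).map encode := by
  obtain ⟨p, q, hp⟩ := hf
  refine ⟨.seq p (.clear p.width), fun m => q.eval m + (2 * p.width + 2),
    (PolyB.eval q).add (by fun_prop), fun j => ?_⟩
  have hrun := hp j.1 j.2
  simp only [run, PMF.map_comp, update_nil_eq_st] at hrun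
  set c := q.eval (j.1 + (encode j.2).size) with hc
  set e := exec noOracle p (st (encode (j.1, j.2)), (), c) with he
  have hnone : none ∉ e.support := fun hn => by
    have : (none : Option Data) ∈ ((f j.1 j.2).map fun b => some (encode b)).support := by
      rw [← hrun, PMF.support_map]; exact ⟨none, hn, rfl⟩
    simp [PMF.support_map] at this
  have hc' : c ≤ q.eval (encode j).size := by
    refine monotone_eval q ?_
    have : ∀ n : ℕ, n ≤ (encode n).size := fun n => by
      induction n with
      | zero => simp
      | succ n ih =>
        show n + 1 ≤ 1 + 1 + (encode n).size; omega
    have := this j.1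
    show _ ≤ 1 + (encode j.1).size + (encode j.2).size
    omega
  let μ : PMF (Store × Unit) := e.map fun r => r.elim (emptyStore, ()) fun y => (y.1, y.2.1)
  have hR : Runs noOracle p (st (encode j)) () c μ := by
    refine runs_of_exec hnone ?_
    simp only [μ, PMF.map_comp]
    refine map_congr_support fun r hr => ?_
    cases r with
    | none => exact absurd hr hnone
    | some y => rfl
  refine Runs.mono (Runs.congr (Runs.seq hR (κ := fun y => PMF.pure (st (y.1 0), ()))
    (c' := 2 * p.width + 2) fun y hy => ?_) ?_) (Nat.add_le_add_right hc' _)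
  · refine runs_clear _ _ _ fun i hi => ?_
    simp only [μ, PMF.support_map] at hy
    obtain ⟨r, hr, rfl⟩ := hy
    cases r with
    | none => exact absurd hr hnone
    | some y =>
      have := exec_frame hr i hi.le
      simp only [Option.elim]
      rw [this]
      obtain ⟨i, rfl⟩ : ∃ i', i = i' + 1 := ⟨i - 1, by omega⟩
      rfl
  · have h2 := congrArg (PMF.map fun r : Option Data => (st (r.getD .nil), ())) hrun
    rw [PMF.map_comp, PMF.map_comp] at h2
    rw [show PMF.bind μ (fun y => PMF.pure (st (y.1 0), ())) = μ.map (fun y => (st (y.1 0), ()))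
      from PMF.bind_pure_comp _ _, PMF.map_comp, PMF.map_comp]
    refine Eq.trans ?_ h2
    refine map_congr_support fun r hr => ?_
    cases r with
    | none => exact absurd hr hnone
    | some y => rfl

section

variable {ι : Type*} {x y z : ι → Data} {F : ι → PMF Data}
variable {α β γ : Type} [Coding α] [Coding β] [Coding γ]

theorem Det.pair {a : ι → α} {b : ι → β} (ha : Det x fun i => encode (a i))
    (hb : Det x fun i => encode (b i)) : Det x fun i => encode (a i, b i) := ha.cons hb

theorem IsPPT.call {f : ℕ → α → PMF β} (hf : IsPPT f) {n : ι → ℕ} {a : ι → α}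
    (hn : Det x fun i => encode (n i)) (ha : Det x fun i => encode (a i)) :
    Eff x fun i => (f (n i) (a i)).map encode :=
  Det.eff (y := fun i => encode (n i, a i)) (hn.cons ha)
    (hf.eff.reindex fun i : ι => (n i, a i))

theorem IsPolyTime.call {f : ℕ → α → β} (hf : IsPolyTime f) {n : ι → ℕ} {a : ι → α}
    (hn : Det x fun i => encode (n i)) (ha : Det x fun i => encode (a i)) :
    Det x fun i => encode (f (n i) (a i)) :=
  (IsPPT.call hf hn ha).congr fun i => by simp [PMF.pure_map]

theorem IsPPT.size_le {f : ℕ → α → PMF β} (hf : IsPPT f) :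
    ∃ B : ℕ → ℕ, PolyB B ∧
      ∀ n a, ∀ b ∈ (f n a).support, (encode b).size ≤ B (encode (n, a)).size := by
  obtain ⟨B, hB, h⟩ := hf.eff.size_le
  exact ⟨B, hB, fun n a b hb => h (n, a) _ (by rw [PMF.support_map]; exact ⟨b, hb, rfl⟩)⟩

theorem Det.ite {P : ι → Prop} [DecidablePred P] (hb : Det x fun i => encode (decide (P i)))
    (h1 : Det (fun j : {i // P i} => x j) fun j => y j)
    (h0 : Det (fun j : {i // ¬ P i} => x j) fun j => y j) : Det x y :=
  Eff.ite hb h1 h0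

theorem Eff.cond {b : ι → Bool} (hb : Det x fun i => encode (b i))
    (h1 : Eff (fun j : {i // b i = true} => x j) fun j => F j)
    (h0 : Eff (fun j : {i // ¬ b i = true} => x j) fun j => F j) : Eff x F :=
  Eff.ite (P := fun i => b i = true) (hb.congr fun i => by simp) h1 h0

theorem Det.not {b : ι → Bool} (hb : Det x fun i => encode (b i)) :
    Det x fun i => encode (!(b i)) :=
  Eff.cond hb ((Det.const (encode false)).congr fun j => by simp [j.2])
    ((Det.const (encode true)).congr fun j => by simp [Bool.eq_false_iff.2 j.2])

theorem Det.and {b c : ι → Bool} (hb : Det x fun i => encode (b i))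
    (hc : Det x fun i => encode (c i)) : Det x fun i => encode (b i && c i) :=
  Eff.cond hb ((hc.reindex _).congr fun j => by simp [j.2])
    ((Det.const (encode false)).congr fun j => by simp [Bool.eq_false_iff.2 j.2])

theorem Det.or {b c : ι → Bool} (hb : Det x fun i => encode (b i))
    (hc : Det x fun i => encode (c i)) : Det x fun i => encode (b i || c i) :=
  Eff.cond hb ((Det.const (encode true)).congr fun j => by simp [j.2])
    ((hc.reindex _).congr fun j => by simp [Bool.eq_false_iff.2 j.2])

theorem Det.isNil (h : Det x y) : Det x fun i => encode (decide (y i = .nil)) := h.eq .nil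

theorem Det.eqCode {a b : ι → α} [DecidableEq α] (ha : Det x fun i => encode (a i))
    (hb : Det x fun i => encode (b i)) : Det x fun i => encode (decide (a i = b i)) :=
  (ha.eq hb).congr fun i => by simp [encode_injective.eq_iff]

theorem Det.isSome {o : ι → Option α} (h : Det x fun i => encode (o i)) :
    Det x fun i => encode (o i).isSome :=
  (h.isNil.not).congr fun i => by
    cases o i <;> simp [encode]

theorem Det.encSome {a : ι → α} (h : Det x fun i => encode (a i)) :
    Det x fun i => encode (some (a i)) := Det.nil.cons h

theorem Det.consList {a : ι → α} {l : ι → List α} (h : Det x fun i => encode (a i))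
    (hl : Det x fun i => encode (l i)) : Det x fun i => encode (a i :: l i) := h.cons hl

theorem Det.encFst {a : ι → α} {b : ι → β} (h : Det x fun i => encode (a i, b i)) :
    Det x fun i => encode (a i) := Det.fst h

theorem Det.encSnd {a : ι → α} {b : ι → β} (h : Det x fun i => encode (a i, b i)) :
    Det x fun i => encode (b i) := Det.snd h

theorem Det.ofSome {o : ι → Option α} {a : ι → α} (h : Det x fun i => encode (o i))
    (ha : ∀ i, o i = Option.some (a i)) : Det x fun i => encode (a i) :=
  h.tail.congr fun i => by rw [ha]; rfl

/-- The decoder occurs in the mathematical description only: the program passes on the encoding of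
an outcome. Hence nothing is assumed about the efficiency of `decode`. -/
theorem Eff.bindCode {f : ι → PMF α} {G : ι → α → PMF Data}
    (hF : Eff x fun i => (f i).map encode)
    (hG : Eff (fun j : {j : ι × α // j.2 ∈ (f j.1).support} => .cons (encode j.1.2) (x j.1.1))
      fun j => G j.1.1 j.1.2) : Eff x fun i => (f i).bind (G i) := by
  classical
  have h : Eff x fun i => ((f i).map encode).bind fun d =>
      (decode d : Option α).elim (PMF.pure .nil) (G i) := by
    refine Eff.bind hF ?_
    have hex : ∀ j : {j : ι × Data // j.2 ∈ ((f j.1).map encode).support},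
        ∃ a ∈ (f j.1.1).support, encode a = j.1.2 := fun j => by
      have := j.2; rwa [PMF.support_map] at this
    choose g hg hg' using hex
    have := hG.reindex fun j : {j : ι × Data // j.2 ∈ ((f j.1).map encode).support} =>
      (⟨(j.1.1, g j), hg j⟩ : {j : ι × α // j.2 ∈ (f j.1).support})
    simp only [hg'] at this
    exact this.congr fun j => by rw [← hg' j, decode_encode]; rfl
  exact h.congr fun i => by
    rw [PMF.bind_map]
    congr 1; funext a; simp [decode_encode]

theorem Eff.mapCode {f : ι → PMF α} {g : ι → α → Data}
    (hF : Eff x fun i => (f i).map encode)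
    (hG : Det (fun j : {j : ι × α // j.2 ∈ (f j.1).support} => .cons (encode j.1.2) (x j.1.1))
      fun j => g j.1.1 j.1.2) : Eff x fun i => (f i).map (g i) :=
  (hF.bindCode (G := fun i a => PMF.pure (g i a)) hG).congr fun _ => PMF.bind_pure_comp _ _

/-! ### Searching -/

theorem encode_size_mem {l : List α} {a : α} (h : a ∈ l) : (encode a).size ≤ (encode l).size := by
  rw [← chain_map_encode]
  exact size_le_size_chain (List.mem_map_of_mem h)

/-- A loop keeps the first hit. Its accumulator is always the code of `none` or of `some` element of
the list, which bounds its size. -/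
theorem Det.find {l : ι → List α} {p : ι → α → Bool} (hl : Det x fun i => encode (l i))
    (hp : Det (fun j : {j : ι × α // j.2 ∈ l j.1} => .cons (x j.1.1) (encode j.1.2))
      fun j => encode (p j.1.1 j.1.2)) : Det x fun i => encode ((l i).find? (p i)) := by
  classical
  obtain ⟨B, hB, hlB⟩ := hl.size_le
  let g : ι → Data → Data → Data := fun i e s => if s = .nil then
    (decode e : Option α).elim s fun a => if p i a = true then .cons .nil e else s else s
  have key : ∀ i (l' : List α) (s : Option α),
      (l'.map encode).foldl (fun s e => g i e s) (encode s) = encode (s.or (l'.find? (p i))) := by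
    intro i l'
    induction l' with
    | nil => intro s; simp
    | cons a l' ih =>
      intro s
      have : g i (encode a) (encode s) = encode (s.or (if p i a = true then some a else none)) := by
        cases s with
        | none => by_cases h : p i a = true <;> simp [g, encode, decode_encode, h]
        | some b => simp [g, encode]
      rw [List.map_cons, List.foldl_cons, this, ih]
      cases s with
      | none => by_cases h : p i a = true <;> simp [h]
      | some b => simp
  have hmain : Det x fun i => ((l i).map encode).foldl (fun s e => g i e s) .nil := by
    refine Det.foldl (hl.congr fun i => (chain_map_encode _).symm) Det.nil
      (fun i _ s => ∃ o : Option α, s = encode o ∧ ∀ a ∈ o, a ∈ l i) (fun m => 2 + B m)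
      (by fun_prop) ?_ ?_ ?_ ?_
    · rintro i l' s - ⟨o, rfl, ho⟩
      cases o with
      | none => show 1 ≤ _; omega
      | some a =>
        have := (encode_size_mem (ho a rfl)).trans (hlB i)
        show 1 + 1 + (encode a).size ≤ _; omega
    · exact fun i => ⟨none, rfl, by simp⟩
    · rintro i e l' s he ⟨o, rfl, ho⟩
      obtain ⟨a, ha, rfl⟩ : ∃ a ∈ l i, encode a = e := by
        simpa using he.subset (List.mem_cons_self)
      refine ⟨o.or (if p i a = true then some a else none), ?_, ?_⟩
      · have := key i [a] o; by_cases h : p i a = true <;> simpa [h] using this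
      · cases o with
        | none => by_cases h : p i a = true <;> simp [h, ha]
        | some b => simpa using ho
    · have hex : ∀ j : {j : ι × Data × Data // ∃ l', j.2.1 :: l' <:+ (l j.1).map encode ∧
          ∃ o : Option α, j.2.2 = encode o ∧ ∀ a ∈ o, a ∈ l j.1}, ∃ a ∈ l j.1.1, encode a = j.1.2.1 := by
        rintro ⟨j, l', hj, -⟩
        simpa using hj.subset (List.mem_cons_self)
      choose a ha ha' using hex
      have hp' := hp.reindex fun j => (⟨(j.1.1, a j), ha j⟩ : {j : ι × α // j.2 ∈ l j.1})
      refine Det.ite (P := fun j => j.1.2.2 = .nil) Det.id.tail.tail.isNil ?_ ?_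
      · refine Eff.cond (b := fun j => p j.1.1.1 (a j.1)) ?_ ?_ ?_
        · refine Det.trans ?_ (hp'.reindex _)
          refine Det.cons Det.id.head (Det.id.tail.head.congr fun j => ?_)
          simp [ha', Data.head, Data.tail]
        · refine (Det.nil.cons Det.id.tail.head).congr fun j => ?_
          have h1 := j.1.2; have h2 := j.2
          simp only [g, h1, if_true, ← ha', decode_encode, Option.elim, h2]
          rfl
        · refine Det.nil.congr fun j => ?_
          have h1 := j.1.2; have h2 := j.2
          simp only [g, h1, if_true, ← ha', decode_encode, Option.elim, h2]
          rfl
      · refine Det.id.tail.tail.congr fun j => ?_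
        have h1 := j.2
        simp only [g, h1, if_false]
        rfl
  exact hmain.congr fun i => (key i (l i) none).trans (by simp)

theorem Det.mem [DecidableEq α] {l : ι → List α} {a : ι → α} (hl : Det x fun i => encode (l i))
    (ha : Det x fun i => encode (a i)) : Det x fun i => encode (decide (a i ∈ l i)) := by
  refine (Det.find (p := fun i b => decide (b = a i)) hl ?_).isSome.congr fun i => ?_
  · exact Det.eqCode Det.id.tail (Det.id.head.trans (ha.reindex _))
  · congr 1; rw [Bool.eq_iff_iff]; simp

end

/-! ### Iteration and arithmetic -/

/-- Iterate a randomized step. -/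
def iter {α : Type} (G : α → PMF α) : ℕ → α → PMF α
  | 0, a => PMF.pure a
  | k + 1, a => (iter G k a).bind G

theorem iter_pure {α : Type} (g : α → α) (k : ℕ) (a : α) :
    iter (fun a => PMF.pure (g a)) k a = PMF.pure (g^[k] a) := by
  induction k with
  | zero => rfl
  | succ k ih => rw [iter, ih, PMF.pure_bind, Function.iterate_succ_apply']

theorem foldM_append (G : Data → Data → PMF Data) (l l' : List Data) (s : Data) :
    foldM G (l ++ l') s = (foldM G l s).bind (foldM G l') := by
  induction l generalizing s with
  | nil => simp [foldM]
  | cons a l ih =>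
    simp only [List.cons_append, foldM, PMF.bind_bind]
    congr 1; funext u; exact ih u

theorem chain_replicate (n : ℕ) : chain (List.replicate n .nil) = encode n := by
  induction n with
  | zero => rfl
  | succ n ih =>
    show Data.cons .nil _ = Data.cons .nil (encode n)
    rw [← ih]

theorem size_encode_nat (n : ℕ) : (encode n).size = 2 * n + 1 := by
  induction n with
  | zero => rfl
  | succ n ih =>
    show 1 + 1 + (encode n).size = _
    omega

section

variable {ι : Type*} {x y z : ι → Data} {α β : Type} [Coding α] [Coding β]

/-- A unary numeral is a list of `nil`s, so iteration is a loop over the numeral. The number `m` of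
completed rounds, which the invariant may use, is recovered from the length of the remaining list.
-/
theorem Eff.iter {k : ι → ℕ} {a₀ : ι → α} {G : ι → α → PMF α} (hk : Det x fun i => encode (k i))
    (h0 : Det x fun i => encode (a₀ i)) (P : ι → ℕ → α → Prop) (B : ℕ → ℕ) (hB : PolyB B)
    (hP : ∀ i m a, m ≤ k i → P i m a → (encode a).size ≤ B (x i).size) (hP0 : ∀ i, P i 0 (a₀ i))
    (hPG : ∀ i m a, m < k i → P i m a → ∀ a' ∈ (G i a).support, P i (m + 1) a')
    (hG : Eff (fun j : {j : ι × α // ∃ m < k j.1, P j.1 m j.2} =>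
      .cons (x j.1.1) (encode j.1.2)) fun j => (G j.1.1 j.1.2).map encode) :
    Eff x fun i => (TrollThrottle.iter (G i) (k i) (a₀ i)).map encode := by
  let G' : ι → Data → Data → PMF Data := fun i _ s =>
    (decode s : Option α).elim (PMF.pure .nil) fun a => (G i a).map encode
  have hG' : ∀ i e a, G' i e (encode a) = (G i a).map encode := fun i e a => by
    simp [G', decode_encode]
  have key : ∀ i m a, TrollThrottle.foldM (G' i) (List.replicate m .nil) (encode a) =
      (TrollThrottle.iter (G i) m a).map encode := by
    intro i m
    induction m with
    | zero => intro a; simp [TrollThrottle.foldM, TrollThrottle.iter, PMF.pure_map]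
    | succ m ih =>
      intro a
      rw [List.replicate_succ', foldM_append, ih, PMF.bind_map, TrollThrottle.iter, PMF.map_bind]
      congr 1; funext a'
      simp [TrollThrottle.foldM, hG']
  refine Eff.congr (Eff.foldM (G := G') (hk.congr fun i => (chain_replicate _).symm) h0
    (fun i l' s => l'.length ≤ k i ∧ ∃ a, s = encode a ∧ P i (k i - l'.length) a) B hB ?_ ?_ ?_ ?_)
    fun i => key i _ _
  · rintro i l' s - ⟨h, a, rfl, ha⟩
    exact hP i _ a (by omega) ha
  · exact fun i => ⟨by simp, a₀ i, rfl, by simpa using hP0 i⟩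
  · rintro i e l' s - ⟨h, a, rfl, ha⟩ s' hs'
    rw [hG' i e, PMF.support_map] at hs'
    obtain ⟨a', ha', rfl⟩ := hs'
    simp only [List.length_cons] at h ha
    refine ⟨by omega, a', rfl, ?_⟩
    have := hPG i _ a (by omega) ha a' ha'
    rwa [show k i - (l'.length + 1) + 1 = k i - l'.length by omega] at this
  · have hex : ∀ j : {j : ι × Data × Data // ∃ l', j.2.1 :: l' <:+ List.replicate (k j.1) .nil ∧
        (j.2.1 :: l').length ≤ k j.1 ∧
        ∃ a, j.2.2 = encode a ∧ P j.1 (k j.1 - (j.2.1 :: l').length) a},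
        ∃ a, encode a = j.1.2.2 ∧ ∃ m < k j.1.1, P j.1.1 m a := by
      rintro ⟨⟨i, e, s⟩, l', -, h, a, h', ha⟩
      exact ⟨a, h'.symm, _, by simp only [List.length_cons] at h ⊢; omega, ha⟩
    choose a ha ha' using hex
    have h := hG.reindex fun j => (⟨(j.1.1, a j), ha' j⟩ : {j : ι × α // ∃ m < k j.1, P j.1 m j.2})
    simp only [ha] at h
    refine Eff.congr (Det.eff ((Det.left Det.id).cons (Det.right (Det.right Det.id))) h)
      fun j => ?_
    rw [← ha j, hG' _ j.1.2.1]

theorem Det.iterate {k : ι → ℕ} {a₀ : ι → α} {g : ι → α → α} (hk : Det x fun i => encode (k i))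
    (h0 : Det x fun i => encode (a₀ i)) (B : ℕ → ℕ) (hB : PolyB B)
    (hP : ∀ i m, m ≤ k i → (encode ((g i)^[m] (a₀ i))).size ≤ B (x i).size)
    (hg : Det (fun j : {j : ι × α // ∃ m < k j.1, j.2 = (g j.1)^[m] (a₀ j.1)} =>
      .cons (x j.1.1) (encode j.1.2)) fun j => encode (g j.1.1 j.1.2)) :
    Det x fun i => encode ((g i)^[k i] (a₀ i)) := by
  refine Eff.congr (Eff.iter (G := fun i a => PMF.pure (g i a)) hk h0
    (fun i m a => a = (g i)^[m] (a₀ i)) B hB ?_ (fun i => rfl) ?_ ?_) fun i => ?_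
  · rintro i m a hm rfl; exact hP i m hm
  · rintro i m a hm rfl a' ha'
    rw [(PMF.mem_support_pure_iff _ _).1 ha', Function.iterate_succ_apply']
  · exact Eff.congr hg fun j => by simp [PMF.pure_map]
  · rw [iter_pure, PMF.pure_map]

theorem Det.nat_size_le {n : ι → ℕ} (h : Det x fun i => encode (n i)) :
    ∃ B : ℕ → ℕ, PolyB B ∧ ∀ i, n i ≤ B (x i).size := by
  obtain ⟨B, hB, h⟩ := h.size_le
  exact ⟨B, hB, fun i => by have := h i; rw [size_encode_nat] at this; omega⟩

theorem Det.succ {n : ι → ℕ} (h : Det x fun i => encode (n i)) :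
    Det x fun i => encode (n i + 1) := Det.nil.cons h

theorem Det.pred {n : ι → ℕ} (h : Det x fun i => encode (n i)) :
    Det x fun i => encode (n i - 1) := h.tail.congr fun i => by cases n i <;> rfl

/-- Numbers are unary, so addition is repeated succession; subtraction and multiplication follow the
same pattern. -/
theorem Det.add {m n : ι → ℕ} (hm : Det x fun i => encode (m i)) (hn : Det x fun i => encode (n i)) :
    Det x fun i => encode (m i + n i) := by
  obtain ⟨B, hB, hmB⟩ := hm.nat_size_le
  obtain ⟨C, hC, hnC⟩ := hn.nat_size_le
  have key : ∀ a k : ℕ, (fun a => a + 1)^[k] a = a + k := fun a k => by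
    induction k with
    | zero => rfl
    | succ k ih => rw [Function.iterate_succ_apply', ih]; omega
  refine (Det.iterate (g := fun _ a => a + 1) hn hm (fun s => 2 * (B s + C s) + 1) (by fun_prop)
    (fun i k hk => ?_) (Det.succ (Det.right Det.id))).congr fun i => by rw [key]
  have := hmB i; have := hnC i
  rw [key, size_encode_nat]
  omega

theorem Det.sub {m n : ι → ℕ} (hm : Det x fun i => encode (m i)) (hn : Det x fun i => encode (n i)) :
    Det x fun i => encode (m i - n i) := by
  obtain ⟨B, hB, hmB⟩ := hm.nat_size_le
  have key : ∀ a k : ℕ, (fun a => a - 1)^[k] a = a - k := fun a k => by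
    induction k with
    | zero => rfl
    | succ k ih => rw [Function.iterate_succ_apply', ih]; omega
  refine (Det.iterate (g := fun _ a => a - 1) hn hm (fun s => 2 * B s + 1) (by fun_prop)
    (fun i k hk => ?_) (Det.pred (Det.right Det.id))).congr fun i => by rw [key]
  have := hmB i
  rw [key, size_encode_nat]
  omega

theorem Det.mul {m n : ι → ℕ} (hm : Det x fun i => encode (m i)) (hn : Det x fun i => encode (n i)) :
    Det x fun i => encode (m i * n i) := by
  obtain ⟨B, hB, hmB⟩ := hm.nat_size_le
  obtain ⟨C, hC, hnC⟩ := hn.nat_size_le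
  have key : ∀ b k : ℕ, (fun a => a + b)^[k] 0 = k * b := fun b k => by
    induction k with
    | zero => simp
    | succ k ih => rw [Function.iterate_succ_apply', ih, add_mul, one_mul]
  refine (Det.iterate (g := fun i a => a + n i) hm (Det.const (encode 0))
    (fun s => 2 * (B s * C s) + 1) (by fun_prop)
    (fun i k hk => ?_) ?_).congr fun i => by rw [key]
  · rw [key, size_encode_nat]
    have := Nat.mul_le_mul (hk.trans (hmB i)) (hnC i)
    omega
  · exact Det.add (Det.right Det.id) (Det.left (hn.reindex _))

theorem Det.poly {n : ι → ℕ} (hn : Det x fun i => encode (n i)) (q : Polynomial ℕ) :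
    Det x fun i => encode (q.eval (n i)) := by
  induction q using Polynomial.induction_on' with
  | add p q hp hq => simpa using hp.add hq
  | monomial k c =>
    have : Det x fun i => encode (n i ^ k) := by
      induction k with
      | zero => exact Det.const (encode 1)
      | succ k ih => simpa [pow_succ] using ih.mul hn
    simpa using (Det.const (encode c)).mul this

/-! ### Random bits and random numbers -/

theorem randomBits_zero : randomBits 0 = PMF.pure [] := by
  have : ∀ f : Fin 0 → Bool, List.ofFn f = [] := fun f => by simp
  rw [randomBits, show (List.ofFn : (Fin 0 → Bool) → Bits) = Function.const _ [] from funext this,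
    PMF.map_const]

/-- Programs have single fair coins only; this recursion is the loop that samples a random string.
-/
theorem randomBits_succ (k : ℕ) : randomBits (k + 1) =
    (randomBits k).bind fun l => (PMF.uniformOfFintype Bool).map fun b => b :: l := by
  have h : PMF.uniformOfFintype (Fin (k + 1) → Bool) =
      (PMF.uniformOfFintype (Fin k → Bool)).bind fun g =>
        (PMF.uniformOfFintype Bool).map fun b => (Fin.cons b g : Fin (k + 1) → Bool) := by
    ext f
    simp only [PMF.bind_apply, PMF.map_apply, PMF.uniformOfFintype_apply, tsum_fintype]
    rw [Finset.sum_eq_single (Fin.tail f), Finset.sum_eq_single (f 0)]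
    · simp only [Fin.cons_self_tail, if_true, Fintype.card_fun, Fintype.card_bool, Fintype.card_fin]
      rw [← ENNReal.mul_inv (by simp) (by simp)]
      push_cast
      rw [pow_succ]
    · intro b _ hb
      rw [if_neg]
      rintro h; apply hb; rw [h]; rfl
    · simp
    · intro g _ hg
      rw [Finset.sum_eq_zero, mul_zero]
      intro b _
      rw [if_neg]
      rintro h; apply hg; rw [h]; rfl
    · simp
  rw [randomBits, h, randomBits, PMF.map_bind, PMF.bind_map]
  congr 1; funext g
  simp only [PMF.map_comp, Function.comp]
  congr 1; funext b
  simp [List.ofFn_succ]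

theorem randomBits_length {k : ℕ} {l : Bits} (h : l ∈ (randomBits k).support) : l.length = k := by
  rw [randomBits, PMF.support_map] at h
  obtain ⟨f, -, rfl⟩ := h
  simp

theorem size_encode_bits_le (l : Bits) : (encode l).size ≤ 4 * l.length + 1 := by
  induction l with
  | nil => simp [encode, encodeList, Data.size]
  | cons b l ih =>
    have := size_encode_bool_le b
    show 1 + (encode b).size + (encode l).size ≤ _
    simp only [List.length_cons]; omega

theorem length_le_size_encode_bits (l : Bits) : l.length ≤ (encode l).size := by
  rw [← chain_map_encode]
  simpa using length_le_size_chain (l.map encode)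

theorem Eff.randomBits {k : ι → ℕ} (hk : Det x fun i => encode (k i)) :
    Eff x fun i => (TrollThrottle.randomBits (k i)).map encode := by
  obtain ⟨B, hB, hkB⟩ := hk.nat_size_le
  refine Eff.congr (Eff.iter (α := Bits) (a₀ := fun _ => []) (G := fun _ l =>
    (PMF.uniformOfFintype Bool).map fun b => b :: l) hk (Det.const (encode ([] : Bits)))
    (fun i m l => l.length = m) (fun s => 4 * B s + 1) (by fun_prop) ?_ ?_ ?_ ?_) fun i => ?_
  · rintro i m l hm rfl
    have := hkB i
    exact (size_encode_bits_le l).trans (by omega)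
  · simp
  · rintro i m l hm rfl l' hl'
    rw [PMF.support_map] at hl'
    obtain ⟨b, -, rfl⟩ := hl'
    simp
  · refine Eff.congr (Eff.map (g := fun j d => .cons d (encode j.1.2)) Eff.toss
      ((Det.left Det.id).cons (Det.right (Det.right Det.id)))) fun j => ?_
    rw [PMF.map_comp, PMF.map_comp]; rfl
  · congr 1
    generalize k i = m
    induction m with
    | zero => rw [randomBits_zero]; rfl
    | succ m ih => rw [TrollThrottle.iter, ih, randomBits_succ]

/-- One step of the choice of a random number: double the range, unless it has reached `N`. -/
def guessStep (N : ℕ) (a : ℕ × ℕ) : PMF (ℕ × ℕ) :=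
  if a.1 < N then (PMF.uniformOfFintype Bool).map fun b =>
    (a.1 + a.1, if b = true then a.1 + a.2 else a.2)
  else PMF.pure a

/-- A random number, almost uniform below `N`. -/
def guess (N : ℕ) : PMF ℕ := (iter (guessStep N) N (1, 0)).map Prod.snd

/-- With fair coins and a strict time bound, an exactly uniform choice below `N` is impossible in
general. Doubling the range until it reaches `N` ends with a range `w ≤ 2 * N` in which every number
has probability at least `1 / w`, so only a factor two is lost. -/
theorem le_guess {N j : ℕ} (hj : j < N) : ((2 * N : ℕ) : ℝ≥0∞)⁻¹ ≤ guess N j := by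
  -- The clause `min N (k + 1) ≤ w` records that the range grows in every step as long as it is
  -- below `N`; so `N` steps suffice.
  have key : ∀ k, ∃ w, 1 ≤ w ∧ w ≤ 2 * N ∧ min N (k + 1) ≤ w ∧
      ∀ j < w, ((w : ℕ) : ℝ≥0∞)⁻¹ ≤ iter (guessStep N) k (1, 0) (w, j) := by
    intro k
    induction k with
    | zero =>
      refine ⟨1, le_rfl, by omega, by omega, fun j hj => ?_⟩
      obtain rfl : j = 0 := by omega
      simp [iter]
    | succ k ih =>
      obtain ⟨w, h1, h2, h3, h4⟩ := ih
      by_cases hw : w < N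
      · refine ⟨w + w, by omega, by omega, by omega, fun j hj => ?_⟩
        rw [iter, PMF.bind_apply]
        have hstep : ∀ i b, (if b = true then w + i else i) = j →
            (2 : ℝ≥0∞)⁻¹ ≤ guessStep N (w, i) (w + w, j) := by
          intro i b hb
          rw [guessStep, if_pos hw, PMF.map_apply]
          refine le_trans ?_ (ENNReal.le_tsum b)
          simp [hb]
        obtain ⟨i, b, hi, hb⟩ : ∃ i b, i < w ∧ (if b = true then w + i else i) = j := by
          by_cases h : j < w
          · exact ⟨j, false, h, by simp⟩
          · exact ⟨j - w, true, by omega, by simp; omega⟩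
        refine le_trans ?_ (ENNReal.le_tsum (w, i))
        refine le_trans ?_ (mul_le_mul' (h4 i hi) (hstep i b hb))
        rw [← ENNReal.mul_inv (by simp) (by simp)]
        push_cast
        rw [mul_two]
      · refine ⟨w, h1, h2, by omega, fun j hj => ?_⟩
        rw [iter, PMF.bind_apply]
        refine le_trans ?_ (ENNReal.le_tsum (w, j))
        rw [guessStep, if_neg hw, PMF.pure_apply, if_pos rfl, mul_one]
        exact h4 j hj
  obtain ⟨w, h1, h2, h3, h4⟩ := key N
  rw [guess, PMF.map_apply]
  refine le_trans ?_ (ENNReal.le_tsum (w, j))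
  rw [if_pos rfl]
  refine le_trans ?_ (h4 j (by omega))
  rw [ENNReal.inv_le_inv]
  exact_mod_cast h2

/-- The bound is `2 * N + 1` and not `2 * N` because of `N = 0`, where the initial range `1` is kept
and `0` is returned. -/
theorem guess_lt {N j : ℕ} (h : j ∈ (guess N).support) : j < 2 * N + 1 := by
  have key : ∀ k, ∀ a ∈ (iter (guessStep N) k (1, 0)).support,
      a.1 ≤ 2 * N + 1 ∧ a.2 < a.1 := by
    intro k
    induction k with
    | zero => intro a ha; simp [iter] at ha; subst ha; simp
    | succ k ih =>
      intro a ha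
      simp only [iter, PMF.mem_support_bind_iff] at ha
      obtain ⟨b, hb, ha⟩ := ha
      have := ih b hb
      rw [guessStep] at ha
      split_ifs at ha with hN
      · rw [PMF.support_map] at ha
        obtain ⟨c, -, rfl⟩ := ha
        dsimp only
        split_ifs <;> omega
      · rw [(PMF.mem_support_pure_iff _ _).1 ha]; exact this
  rw [guess, PMF.support_map] at h
  obtain ⟨a, ha, rfl⟩ := h
  have := key N a ha
  omega

theorem Eff.guess {N : ι → ℕ} (hN : Det x fun i => encode (N i)) :
    Eff x fun i => (TrollThrottle.guess (N i)).map encode := by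
  obtain ⟨B, hB, hNB⟩ := hN.nat_size_le
  have h : Eff x fun i => (TrollThrottle.iter (guessStep (N i)) (N i) (1, 0)).map encode := by
    refine Eff.iter (α := ℕ × ℕ) (a₀ := fun _ => (1, 0)) (G := fun i => guessStep (N i)) hN
      (Det.const (encode (1, 0))) (fun i m a => a.1 ≤ 2 * N i + 1 ∧ a.2 < a.1)
      (fun s => 8 * B s + 8) (by fun_prop) ?_ ?_ ?_ ?_
    · rintro i m ⟨a, b⟩ hm ⟨h1, h2⟩
      have := hNB i
      show 1 + (encode a).size + (encode b).size ≤ _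
      rw [size_encode_nat, size_encode_nat]
      dsimp only at h1 h2 ⊢
      omega
    · exact fun i => ⟨by simp, by simp⟩
    · rintro i m b hm hb a ha
      rw [guessStep] at ha
      split_ifs at ha with hN
      · rw [PMF.support_map] at ha
        obtain ⟨c, -, rfl⟩ := ha
        dsimp only
        split_ifs <;> omega
      · rw [(PMF.mem_support_pure_iff _ _).1 ha]; exact hb
    · have hN' := hN.reindex fun j : {j : ι × ℕ × ℕ // ∃ m < N j.1,
        j.2.1 ≤ 2 * N j.1 + 1 ∧ j.2.2 < j.2.1} => j.1.1
      have hw : Det (fun j : {j : ι × ℕ × ℕ // ∃ m < N j.1,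
          j.2.1 ≤ 2 * N j.1 + 1 ∧ j.2.2 < j.2.1} => Data.cons (x j.1.1) (encode j.1.2))
          fun j => encode j.1.2.1 := Det.encFst (b := fun j => j.1.2.2) (Det.right Det.id)
      have hi : Det (fun j : {j : ι × ℕ × ℕ // ∃ m < N j.1,
          j.2.1 ≤ 2 * N j.1 + 1 ∧ j.2.2 < j.2.1} => Data.cons (x j.1.1) (encode j.1.2))
          fun j => encode j.1.2.2 := Det.encSnd (a := fun j => j.1.2.1) (Det.right Det.id)
      refine Eff.ite (P := fun j => j.1.2.1 < N j.1.1)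
        ((((Det.left hN').sub hw).isNil.not).congr fun j => ?_) ?_ ?_
      · have : ∀ k : ℕ, encode k = Data.nil ↔ k = 0 := fun k => by
          cases k <;> simp [encode, encodeNat]
        rw [← decide_not]
        congr 1
        rw [decide_eq_decide, this]
        omega
      · refine Eff.congr (Eff.bind (Eff.toss) (G := fun j d => PMF.pure (encode
          (j.1.1.2.1 + j.1.1.2.1, if d = .nil then j.1.1.2.2 else j.1.1.2.1 + j.1.1.2.2))) ?_)
          fun j => ?_
        · have hw' := Det.right (y := fun j => j.1.2) (hw.reindex
            fun j : {j : {j : {j : ι × ℕ × ℕ // ∃ m < N j.1, j.2.1 ≤ 2 * N j.1 + 1 ∧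
              j.2.2 < j.2.1} // j.1.2.1 < N j.1.1} × Data //
              j.2 ∈ ((PMF.uniformOfFintype Bool).map encode).support} => j.1.1.1)
          have hi' := Det.right (y := fun j => j.1.2) (hi.reindex
            fun j : {j : {j : {j : ι × ℕ × ℕ // ∃ m < N j.1, j.2.1 ≤ 2 * N j.1 + 1 ∧
              j.2.2 < j.2.1} // j.1.2.1 < N j.1.1} × Data //
              j.2 ∈ ((PMF.uniformOfFintype Bool).map encode).support} => j.1.1.1)
          refine Det.pair (hw'.add hw') (Det.ite (P := fun j => j.1.2 = .nil)
            (Det.left Det.id).isNil ?_ ?_)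
          · exact (hi'.reindex _).congr fun j => by rw [if_pos j.2]
          · exact ((hw'.add hi').reindex _).congr fun j => by rw [if_neg j.2]
        · rw [guessStep, if_pos j.2, PMF.map_comp, PMF.bind_map, ← PMF.bind_pure_comp]
          congr 1; funext b
          cases b <;> simp [encode]
      · exact Eff.congr (F := fun j => PMF.pure (encode j.1.1.2)) (Det.right Det.id) fun j => by
          rw [guessStep, if_neg j.2, PMF.pure_map]
  exact (h.mapCode (g := fun _ a => encode a.2) (Det.encSnd (a := fun j => j.1.2.1)
    (Det.left Det.id))).congr fun i => by rw [TrollThrottle.guess, PMF.map_comp]; rfl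

/-! ### Canonical decoding -/

variable (α) in
/-- The decoder of `α` is efficient. -/
def Canon : Prop := Det (fun d : Data => d) fun d => encode (decode d : Option α)

theorem Canon.det (h : Canon α) (hy : Det x y) :
    Det x fun i => encode (decode (y i) : Option α) := hy.trans (h.reindex y)

/-- The list of the components of a tree. -/
def unchain : Data → List Data
  | .nil => []
  | .cons a d => a :: unchain d

theorem chain_unchain (d : Data) : chain (unchain d) = d := by
  induction d with
  | nil => rfl
  | cons a d _ ih => simp [unchain, chain, ih]

theorem decode_bits (d : Data) :
    (decode d : Option Bits) = some ((unchain d).map fun e => decide (e ≠ .nil)) := by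
  induction d with
  | nil => rfl
  | cons a d _ ih =>
    have ha : (decode a : Option Bool) = some (decide (a ≠ .nil)) := by
      cases a <;> simp [decode]
    have ih' : (decodeList d : Option Bits) = _ := ih
    show (decode a : Option Bool).bind (fun x => (decodeList d).map fun l => x :: l) = _
    rw [ha, ih']
    simp [unchain]

theorem Det.reverse {l : ι → List Data} (h : Det x fun i => chain (l i)) :
    Det x fun i => chain (l i).reverse := by
  obtain ⟨B, hB, hlB⟩ := h.size_le
  refine (Det.foldl (g := fun _ e s => .cons e s) h Det.nil
    (fun i l' s => s.size + (chain l').size ≤ 1 + (chain (l i)).size) (fun m => 1 + B m)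
    (by fun_prop) (fun i l' s _ hs => ?_) (fun i => ?_) (fun i e l' s _ hs => ?_)
    (Det.right Det.id)).congr fun i => ?_
  · have := hlB i
    omega
  · simp [Data.size]
  · simp only [chain, Data.size] at hs ⊢
    omega
  · have : ∀ (l : List Data) (s : List Data), l.foldl (fun s e => Data.cons e s) (chain s) =
        chain (l.reverse ++ s) := by
      intro l
      induction l with
      | nil => intro s; rfl
      | cons a l ih => intro s; simpa [chain] using ih (a :: s)
    exact (this (l i) []).trans (by simp)

/-- Every tree is a chain of subtrees, and a subtree counts as the bit `true` when it is not `nil`.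
So decoding never fails and amounts to normalizing the components. The loop delivers them in reverse
order, hence the additional reversal. -/
theorem canon_bits : Canon Bits := by
  have h1 : Det (fun d : Data => d) fun d =>
      chain ((unchain d).map fun e => encode (decide (e ≠ .nil))).reverse := by
    refine (Det.foldl (l := unchain) (g := fun _ e s => .cons (encode (decide (e ≠ .nil))) s)
      (Det.id.congr fun d => (chain_unchain d).symm) Det.nil
      (fun d l' s => s.size + 4 * l'.length ≤ 4 * (unchain d).length + 1) (fun m => 4 * m + 1)
      (by fun_prop) (fun d l' s _ hs => ?_) (fun i => ?_) (fun i e l' s _ hs => ?_)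
      (Det.cons ((Det.right (Det.left Det.id)).isNil.not.congr fun j => by
        rw [decide_not]) (Det.right (Det.right Det.id)))).congr fun d => ?_
    · have := length_le_size_chain (unchain d)
      rw [chain_unchain] at this
      omega
    · simp [Data.size]; omega
    · have := size_encode_bool_le (decide (e ≠ .nil))
      simp only [Data.size, List.length_cons] at hs ⊢
      omega
    · have : ∀ (l : List Data) (s : List Data),
          l.foldl (fun s e => Data.cons (encode (decide (e ≠ .nil))) s) (chain s) =
          chain ((l.map fun e => encode (decide (e ≠ .nil))).reverse ++ s) := by
        intro l
        induction l with
        | nil => intro s; rfl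
        | cons a l ih =>
          intro s
          have := ih (encode (decide (a ≠ .nil)) :: s)
          simpa [chain] using this
      exact (this (unchain d) []).trans (by simp)
  refine (Det.nil.cons h1.reverse).congr fun d => ?_
  rw [decode_bits, List.reverse_reverse]
  show _ = Data.cons .nil (encode _)
  rw [← chain_map_encode, List.map_map]
  rfl

theorem encode_option_eq_nil {o : Option α} : encode o = Data.nil ↔ o = none := by
  cases o <;> simp [encode]

/-- A failure in a component shows up as `nil` and can be tested before the results are put
together. -/
theorem Canon.prod (ha : Canon α) (hb : Canon β) : Canon (α × β) := by
  have ha' := ha.det (Det.id (x := fun d : Data => d)).head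
  have hb' := hb.det (Det.id (x := fun d : Data => d)).tail
  refine Det.ite (P := fun d => d = .nil ∨ encode (decode d.head : Option α) = .nil ∨
    encode (decode d.tail : Option β) = .nil)
    ((Det.id.isNil.or (ha'.isNil.or hb'.isNil)).congr fun d => by simp) ?_ ?_
  · refine Det.nil.congr ?_
    rintro ⟨d, hd⟩
    cases d with
    | nil => rfl
    | cons a b =>
      simp only [encode_option_eq_nil, Data.head, Data.tail, reduceCtorEq, false_or] at hd
      rcases hd with h | h
      · simp [decode, h, encode]
      · cases h' : (decode a : Option α) <;> simp [decode, h, h', encode]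
  · refine (Det.nil.cons ((ha'.reindex _).tail.cons (hb'.reindex _).tail)).congr ?_
    rintro ⟨d, hd⟩
    cases d with
    | nil => simp at hd
    | cons a b =>
      simp only [encode_option_eq_nil, Data.head, Data.tail, reduceCtorEq, false_or, not_or] at hd
      obtain ⟨u, hu⟩ := Option.ne_none_iff_exists'.1 hd.1
      obtain ⟨v, hv⟩ := Option.ne_none_iff_exists'.1 hd.2
      simp [decode, hu, hv, encode, Data.head, Data.tail]

theorem Canon.sum (ha : Canon α) (hb : Canon β) : Canon (α ⊕ β) := by
  have ha' := ha.det (Det.id (x := fun d : Data => d)).tail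
  have hb' := hb.det (Det.id (x := fun d : Data => d)).tail
  refine Det.ite (P := fun d => d = .nil) Det.id.isNil ?_ ?_
  · refine Det.nil.congr ?_
    rintro ⟨d, rfl⟩
    rfl
  · refine Det.ite (P := fun d => d.1.head = .nil) Det.id.head.isNil ?_ ?_
    · refine Det.ite (P := fun d => encode (decode d.1.1.tail : Option α) = .nil)
        ((ha'.reindex _).isNil) ?_ ?_
      · refine Det.nil.congr ?_
        rintro ⟨⟨⟨d, h1⟩, h2⟩, h3⟩
        cases d with
        | nil => simp at h1
        | cons a b =>
          have h3' : decode b = none := encode_option_eq_nil.1 h3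
          simp only [Data.head] at h2
          subst h2
          simp [decode, h3', encode]
      · refine (Det.nil.cons (Det.nil.cons (ha'.reindex _).tail)).congr ?_
        rintro ⟨⟨⟨d, h1⟩, h2⟩, h3⟩
        cases d with
        | nil => simp at h1
        | cons a b =>
          have h3' : decode b ≠ none := fun h => h3 (encode_option_eq_nil.2 h)
          simp only [Data.head] at h2
          subst h2
          obtain ⟨u, hu⟩ := Option.ne_none_iff_exists'.1 h3'
          simp [decode, hu, encode, Data.tail]
    · refine Det.ite (P := fun d => encode (decode d.1.1.tail : Option β) = .nil)
        ((hb'.reindex _).isNil) ?_ ?_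
      · refine Det.nil.congr ?_
        rintro ⟨⟨⟨d, h1⟩, h2⟩, h3⟩
        cases d with
        | nil => simp at h1
        | cons a b =>
          have h3' : decode b = none := encode_option_eq_nil.1 h3
          simp only [Data.head] at h2
          cases a with
          | nil => simp at h2
          | cons => simp [decode, h3', encode]
      · refine (Det.nil.cons ((Det.const (.cons .nil .nil)).cons (hb'.reindex _).tail)).congr ?_
        rintro ⟨⟨⟨d, h1⟩, h2⟩, h3⟩
        cases d with
        | nil => simp at h1
        | cons a b =>
          have h3' : decode b ≠ none := fun h => h3 (encode_option_eq_nil.2 h)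
          simp only [Data.head] at h2
          obtain ⟨u, hu⟩ := Option.ne_none_iff_exists'.1 h3'
          cases a with
          | nil => simp at h2
          | cons => simp [decode, hu, encode, Data.tail]

theorem Canon.frameQuery (h : Canon α) : Canon (FrameQuery α) := by
  have hs := canon_bits.sum (((canon_bits.prod canon_bits).sum (canon_bits.prod canon_bits)).sum
    ((canon_bits.prod (canon_bits.prod h)).sum (canon_bits.prod (canon_bits.prod canon_bits))))
  refine Det.congr hs fun d => ?_
  have hof : ∀ u, (FrameQuery.ofSum u : FrameQuery α).toSum = u := by
    rintro (u | ((u | u) | (u | u))) <;> rfl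
  show encode (decode d) = encode ((decode d).map FrameQuery.ofSum)
  generalize (decode d : Option (Bits ⊕ (((Bits × Bits) ⊕ (Bits × Bits)) ⊕
    ((Bits × Bits × α) ⊕ (Bits × Bits × Bits))))) = o
  cases o with
  | none => rfl
  | some u =>
    show Data.cons .nil (encode u) = Data.cons .nil (encode (FrameQuery.ofSum u).toSum)
    rw [hof]

end

/-! ## Oracles that may stop the execution -/

/-- Values of final stores, oracle states, and remaining time. -/
abbrev Val (U : Type) := Store → U → ℕ → ℝ≥0∞

section wp

variable {U : Type} (κ : U → Data → PMF (Option Data × U)) (w : U → ℝ≥0∞)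

/-- The value after an assignment. -/
def wpAssign (x : ℕ) (v : Data) (c : ℕ) (V : Val U) : Val U := fun s u f =>
  if c ≤ f then V (Function.update s x v) u (f - c) else 0

/-- The value before a loop of at most `k` rounds. -/
def wpLoop (x : ℕ) (body : Val U → Val U) (V : Val U) : ℕ → Val U
  | 0 => fun _ _ _ => 0
  | k + 1 => fun s u f => match f with
    | 0 => 0
    | f + 1 => if s x = .nil then V s u f else body (wpLoop x body V k) s u f

/-- The expected value of an execution with an oracle `κ` that may stop it: the value is `w` if
the oracle stops the execution, `V` at the regular end, and `0` if the time is used up. -/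
def wp : Prog → Val U → Val U
  | .setNil x, V => fun s u f => wpAssign x .nil 2 V s u f
  | .copy x y, V => fun s u f => wpAssign x (s y) (1 + (s y).size) V s u f
  | .cons x y z, V => fun s u f =>
    wpAssign x (.cons (s y) (s z)) (1 + (Data.cons (s y) (s z)).size) V s u f
  | .hd x y, V => fun s u f => wpAssign x (s y).head (1 + (s y).head.size) V s u f
  | .tl x y, V => fun s u f => wpAssign x (s y).tail (1 + (s y).tail.size) V s u f
  | .eq x y z, V => fun s u f =>
    wpAssign x (encode (decide (s y = s z))) (1 + (s y).size + (s z).size) V s u f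
  | .toss x, V => fun s u f => ev (PMF.uniformOfFintype Bool) fun b =>
    wpAssign x (encode b) (1 + (encode b).size) V s u f
  | .query x y, V => fun s u f => match f with
    | 0 => 0
    | f + 1 => ev (κ u (s y)) fun r => match r.1 with
      | none => w r.2
      | some a => wpAssign x a (1 + a.size) V s r.2 (f + 1)
  | .seq p q, V => wp p (wp q V)
  | .ite x p q, V => fun s u f => match f with
    | 0 => 0
    | f + 1 => if s x = .nil then wp q V s u f else wp p V s u f
  | .loop x p, V => fun s u f => wpLoop x (wp p) V f s u f

variable {κ w}

/-- Values are linear in the pair of stopping value and final value. This splits one simulation into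
two bounds: stopped runs and forgeries at the end count for traceability, collisions are counted
with stopping value `0`. -/
theorem wp_add (w' : U → ℝ≥0∞) (p : Prog) (V V' : Val U) :
    wp κ (w + w') p (V + V') = wp κ w p V + wp κ w' p V' := by
  have hassign : ∀ x v c (V V' : Val U) s u f, wpAssign x v c (V + V') s u f =
      wpAssign x v c V s u f + wpAssign x v c V' s u f := by
    intro x v c V V' s u f
    unfold wpAssign
    split_ifs <;> simp
  induction p generalizing V V' with
  | setNil x | copy x _ | cons x _ _ | hd x _ | tl x _ | eq x _ _ =>
    funext s u f; simp only [wp, hassign, Pi.add_apply]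
  | toss x => funext s u f; simp only [wp, hassign, ev_add, Pi.add_apply]
  | query x z =>
    funext s u f
    cases f with
    | zero => simp [wp]
    | succ f =>
      simp only [wp, Pi.add_apply, ← ev_add]
      congr 1; funext r
      cases r.1 with
      | none => rfl
      | some a => exact hassign _ _ _ _ _ _ _ _
  | seq p q ihp ihq => simp only [wp, ihq, ihp]
  | ite x p q ihp ihq =>
    funext s u f
    cases f with
    | zero => simp [wp]
    | succ f =>
      simp only [wp, Pi.add_apply]
      split_ifs
      · simp [ihq]
      · simp [ihp]
  | loop x p ih =>
    have key : ∀ k, wpLoop x (wp κ (w + w') p) (V + V') k =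
        wpLoop x (wp κ w p) V k + wpLoop x (wp κ w' p) V' k := by
      intro k
      induction k with
      | zero => funext s u f; simp [wpLoop]
      | succ k ihk =>
        funext s u f
        cases f with
        | zero => simp [wpLoop]
        | succ f =>
          simp only [wpLoop, Pi.add_apply, ihk, ih]
          split_ifs <;> rfl
    funext s u f
    simp only [wp, key, Pi.add_apply]

/-- Values of configurations, and `0` if the time is used up. -/
def orZero {α : Type*} (g : α → ℝ≥0∞) : Option α → ℝ≥0∞
  | none => 0
  | some a => g a

theorem ev_andThen_none {T : Type} {O : Oracle T} {q : Prog} {V : Config T → ℝ≥0∞} :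
    ev (andThen O q none) (orZero V) = 0 := by
  rw [andThen, ev_pure, orZero]

theorem ev_le_add {α : Type*} {μ : PMF α} {g g' : α → ℝ≥0∞} {c : ℝ≥0∞}
    (h : ∀ a ∈ μ.support, g a ≤ g' a + c) : ev μ g ≤ ev μ g' + c := by
  refine (ev_mono h).trans ?_
  rw [ev_add, ev_const]

/-- A simulation relation between an oracle and an oracle that may stop the execution bounds the
expected values; `ε` is an error that depends on the state. -/
theorem ev_exec_le_wp {T : Type} {O : Oracle T} {Dead : T → Prop} {Rel : T → U → ℕ → Prop}
    {ε : U → ℝ≥0∞} {M : ℕ}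
    (hDead : ∀ t d, Dead t → ∀ r ∈ (O t d).support, Dead r.2)
    (hRel : ∀ t u f f', Rel t u f → f' ≤ f → Rel t u f')
    (hQ : ∀ t u f d (g₁ : Data × T → ℝ≥0∞) (g₂ : Data → U → ℝ≥0∞), Rel t u (f + 1) →
      d.size + f + 1 ≤ M → (∀ r, g₁ r ≤ 1) → (∀ a t', Dead t' → g₁ (a, t') = 0) →
      (∀ a t' u', Rel t' u' f → g₁ (a, t') ≤ g₂ a u' + ε u') →
      ev (O t d) g₁ ≤ ev (κ u d) (fun r => match r.1 with
        | none => w r.2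
        | some a => g₂ a r.2) + ε u)
    (p : Prog) (V₁ : Config T → ℝ≥0∞) (V : Val U) (h1 : ∀ c, V₁ c ≤ 1)
    (h0 : ∀ s t f, Dead t → V₁ (s, t, f) = 0)
    (hV : ∀ s t u f, Rel t u f → (∀ x, (s x).size + f ≤ M) → V₁ (s, t, f) ≤ V s u f + ε u)
    (s : Store) (t : T) (u : U) (f : ℕ) (hr : Rel t u f) (hs : ∀ x, (s x).size + f ≤ M) :
    ev (exec O p (s, t, f)) (orZero V₁) ≤ wp κ w p V s u f + ε u := by
  have hone : ∀ (V₁ : Config T → ℝ≥0∞), (∀ c, V₁ c ≤ 1) → ∀ r, orZero V₁ r ≤ 1 := by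
    intro V₁ h r; cases r <;> simp [orZero, h]
  -- A dead oracle state stays dead, so the remaining execution is worth `0` and nothing has to be
  -- shown about the simulation.
  have hdead : ∀ (p : Prog) (V₁ : Config T → ℝ≥0∞), (∀ s t f, Dead t → V₁ (s, t, f) = 0) →
      ∀ s t f, Dead t → ev (exec O p (s, t, f)) (orZero V₁) = 0 := by
    intro p V₁ h0 s t f ht
    refine le_antisymm (le_trans (ev_mono (g' := fun _ => 0) fun r hr => ?_)
      (ev_const _ _).le) bot_le
    cases r with
    | none => exact le_rfl
    | some c =>
      have : Dead c.2.1 := exec_invariant (I := fun _ t _ => Dead t) (m := p.width)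
        (fun _ _ _ _ _ _ _ h _ _ => h) (fun _ _ _ _ _ _ _ h hr _ => hDead _ _ h _ hr)
        (fun _ _ _ h => h) p le_rfl s t f ht c hr
      exact (h0 _ _ _ this).le
  have hassign : ∀ (V₁ : Config T → ℝ≥0∞) (V : Val U), (∀ s t u f, Rel t u f →
      (∀ x, (s x).size + f ≤ M) → V₁ (s, t, f) ≤ V s u f + ε u) → ∀ x v c s t u f f',
      v.size ≤ c → Rel t u f' → f - c ≤ f' → (∀ x, (s x).size + f ≤ M) →
      orZero V₁ (assign x v c s t f) ≤ wpAssign x v c V s u f + ε u := by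
    intro V₁ V hV x v c s t u f f' hv hr hf hs
    unfold assign wpAssign
    split_ifs with hc
    · refine hV _ _ _ _ (hRel _ _ _ _ hr hf) fun z => ?_
      by_cases hz : z = x
      · subst hz; have := hs z; simp; omega
      · have := hs z; simp [hz]; omega
    · exact bot_le
  induction p generalizing V₁ V s t u f with
  | setNil x | copy x _ | cons x _ _ | hd x _ | tl x _ | eq x _ _ =>
    simp only [exec, ev_pure, wp]
    refine hassign V₁ V hV _ _ _ _ _ _ _ f ?_ hr (Nat.sub_le _ _) hs
    first
    | omega
    | simp [Data.size]
    | exact (size_encode_bool_le _).trans (by grind [Data.size_pos])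
  | toss x =>
    simp only [exec, ev_map, wp]
    refine ev_le_add fun b _ => ?_
    exact hassign V₁ V hV _ _ _ _ _ _ _ f (by omega) hr (Nat.sub_le _ _) hs
  | query x z =>
    simp only [exec, ev_map]
    cases f with
    | zero =>
      refine (ev_mono (g' := fun _ => 0) fun r _ => ?_).trans ((ev_const _ _).le.trans bot_le)
      simp [Function.comp, assign, orZero]
    | succ f =>
      refine (hQ t u f (s z) _ (fun a u' => wpAssign x a (1 + a.size) V s u' (f + 1)) hr
        (hs z) (fun r => hone V₁ h1 _) (fun a t' ht' => ?_) fun a t' u' hr' => ?_)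
      · simp only [Function.comp, assign]
        split_ifs
        · exact h0 _ _ _ ht'
        · rfl
      · exact hassign V₁ V hV _ _ _ _ _ _ _ f (by omega) hr' (by omega) hs
  | seq p q ihp ihq =>
    rw [exec_seq, ev_bind, wp]
    have : (fun r => ev (andThen O q r) (orZero V₁)) =
        orZero fun c => ev (exec O q c) (orZero V₁) := by
      funext r
      cases r with
      | none => exact ev_andThen_none
      | some c => rfl
    rw [this]
    exact ihp _ _ (fun c => ev_le_one (hone V₁ h1)) (hdead q V₁ h0)
      (fun s t u f hr hs => ihq V₁ V h1 h0 hV s t u f hr hs) s t u f hr hs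
  | ite x p q ihp ihq =>
    cases f with
    | zero => simp [exec, ev_pure, orZero]
    | succ f =>
      have hr' := hRel _ _ _ f hr (Nat.le_succ f)
      have hs' : ∀ x, (s x).size + f ≤ M := fun x => by have := hs x; omega
      simp only [exec, wp]
      split_ifs
      · exact ihq V₁ V h1 h0 hV s t u f hr' hs'
      · exact ihp V₁ V h1 h0 hV s t u f hr' hs'
  | loop x p ih =>
    simp only [wp]
    have hdloop : ∀ (k : ℕ) (s : Store) (t : T) (f : ℕ), Dead t →
        ev (execLoop x (exec O p) k (s, t, f)) (orZero V₁) = 0 := by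
      intro k
      induction k with
      | zero => intro s t f _; simp [execLoop, ev_pure, orZero]
      | succ k ihk =>
        intro s t f ht
        cases f with
        | zero => simp [execLoop, ev_pure, orZero]
        | succ f =>
          simp only [execLoop]
          split_ifs
          · rw [ev_pure]; exact h0 _ _ _ ht
          · rw [ev_bind]
            refine le_antisymm (le_trans (ev_mono (g' := orZero fun c =>
              ev (execLoop x (exec O p) k c) (orZero V₁)) fun r _ => ?_)
              (hdead p _ (fun s t f ht => ihk s t f ht) s t f ht).le) bot_le
            cases r with
            | none => simp [ev_pure, orZero]
            | some c => exact le_rfl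
    have key : ∀ (k : ℕ) (s : Store) (t : T) (u : U) (f : ℕ), Rel t u f →
        (∀ x, (s x).size + f ≤ M) → ev (execLoop x (exec O p) k (s, t, f)) (orZero V₁) ≤
        wpLoop x (wp κ w p) V k s u f + ε u := by
      intro k
      induction k with
      | zero => intro s t u f _ _; simp [execLoop, ev_pure, orZero]
      | succ k ihk =>
        intro s t u f hr hs
        cases f with
        | zero => simp [execLoop, ev_pure, orZero]
        | succ f =>
          have hr' := hRel _ _ _ f hr (Nat.le_succ f)
          have hs' : ∀ x, (s x).size + f ≤ M := fun x => by have := hs x; omega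
          simp only [execLoop, wpLoop]
          split_ifs
          · rw [ev_pure]; exact hV s t u f hr' hs'
          · rw [ev_bind]
            refine le_trans (ev_mono (g' := orZero fun c =>
              ev (execLoop x (exec O p) k c) (orZero V₁)) fun r _ => ?_)
              (ih _ _ (fun c => ev_le_one (hone V₁ h1)) (hdloop k)
              (fun s t u f hr hs => ihk s t u f hr hs) s t u f hr' hs')
            cases r with
            | none => simp [ev_pure, orZero]
            | some c => exact le_rfl
    exact key f s t u f hr hs

end wp

/-! ## Compilation of an adversary and a handler of its queries

The variable `x_i` of the adversary is stored in `x_{2i+1}`. The variable `x₂` is a flag that is set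
when the handler stops the execution, `x₄` is the test of the current loop, `x₆` is the state of the
handler, `x₈` is `nil`, and the handler works on `x₁₀, x₁₂, …`. -/

/-- Execute `p` unless the execution has been stopped. -/
def Prog.guarded (p : Prog) : Prog := .ite 2 (.setNil 8) p

/-- The test of a loop on `x`. -/
def Prog.test (x : ℕ) : Prog := .ite 2 (.setNil 4) (.ite x (.cons 4 8 8) (.setNil 4))

/-- Call the handler `H` for the query in `y` and store the answer in `x`. -/
def Prog.call (H : Prog) (x y : ℕ) : Prog :=
  .seq (.cons 10 6 y) (.seq H (.seq (.tl 6 10) (.seq (.hd 10 10)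
    (.ite 10 (.seq (.tl x 10) (.setNil 10)) (.cons 2 8 8)))))

/-- Replace the queries of a program by calls of `H`. -/
def Prog.compile : Prog → Prog → Prog
  | .setNil x, _ => guarded (.setNil (2 * x + 1))
  | .copy x y, _ => guarded (.copy (2 * x + 1) (2 * y + 1))
  | .cons x y z, _ => guarded (.cons (2 * x + 1) (2 * y + 1) (2 * z + 1))
  | .hd x y, _ => guarded (.hd (2 * x + 1) (2 * y + 1))
  | .tl x y, _ => guarded (.tl (2 * x + 1) (2 * y + 1))
  | .eq x y z, _ => guarded (.eq (2 * x + 1) (2 * y + 1) (2 * z + 1))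
  | .toss x, _ => guarded (.toss (2 * x + 1))
  | .query x y, H => guarded (call H (2 * x + 1) (2 * y + 1))
  | .seq p q, H => .seq (p.compile H) (q.compile H)
  | .ite x p q, H => .ite (2 * x + 1) (p.compile H) (q.compile H)
  | .loop x p, H => .seq (test (2 * x + 1)) (.loop 4 (.seq (p.compile H) (test (2 * x + 1))))

/-- The time for the overhead of the compilation. -/
def Prog.overhead : Prog → ℕ
  | .seq p q => p.overhead + q.overhead
  | .ite _ p q => p.overhead + q.overhead + 1
  | .loop _ p => p.overhead + 20
  | _ => 3

/-- The store of a running execution with the store `s` of the adversary and handler state `b`. -/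
def Live (s : Store) (b : Data) (s' : Store) : Prop :=
  (∀ i, s' (2 * i + 1) = s i) ∧ s' 2 = .nil ∧ s' 6 = b ∧ s' 8 = .nil ∧ ∀ j, s' (10 + 2 * j) = .nil

/-- The store of a stopped execution with handler state `b`. -/
def Stopped (b : Data) (s' : Store) : Prop :=
  s' 2 ≠ .nil ∧ s' 6 = b ∧ s' 8 = .nil ∧ ∀ j, s' (10 + 2 * j) = .nil

theorem Live.update {s s' : Store} {b : Data} (h : Live s b s') (x : ℕ) (v : Data) :
    Live (Function.update s x v) b (Function.update s' (2 * x + 1) v) := by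
  obtain ⟨h1, h2, h3, h4, h5⟩ := h
  refine ⟨fun i => ?_, ?_, ?_, ?_, fun j => ?_⟩
  · by_cases hi : i = x
    · subst hi; simp
    · rw [Function.update_of_ne hi, Function.update_of_ne (by omega), h1]
  all_goals rw [Function.update_of_ne (by omega)]
  exacts [h2, h3, h4, h5 j]

theorem Live.update_four {s s' : Store} {b : Data} (h : Live s b s') (v : Data) :
    Live s b (Function.update s' 4 v) := by
  obtain ⟨h1, h2, h3, h4, h5⟩ := h
  refine ⟨fun i => ?_, ?_, ?_, ?_, fun j => ?_⟩
  all_goals rw [Function.update_of_ne (by omega)]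
  exacts [h1 i, h2, h3, h4, h5 j]

theorem Stopped.update_four {s' : Store} {b : Data} (h : Stopped b s') (v : Data) :
    Stopped b (Function.update s' 4 v) := by
  obtain ⟨h1, h2, h3, h4⟩ := h
  refine ⟨?_, ?_, ?_, fun j => ?_⟩
  all_goals rw [Function.update_of_ne (by omega)]
  exacts [h1, h2, h3, h4 j]

section

variable {T : Type} {O : Oracle T} {H : Prog}

theorem runs_guarded_stopped {s' : Store} {b : Data} (h : Stopped b s') (p : Prog) (t : T) :
    Runs O p.guarded s' t 3 (PMF.pure (s', t)) := by
  refine runs_ite_cons h.1 ((runs_setNil 8 s' t).congr ?_)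
  rw [show Function.update s' 8 .nil = s' from by
    rw [← h.2.2.1, Function.update_eq_self]]

theorem runs_test_stopped {s' : Store} {b : Data} (h : Stopped b s') (x : ℕ) (t : T) :
    Runs O (.test x) s' t 3 (PMF.pure (Function.update s' 4 .nil, t)) :=
  runs_ite_cons h.1 (runs_setNil 4 s' t)

theorem runs_test_live {s s' : Store} {b : Data} (h : Live s b s') (x : ℕ) (t : T) :
    ∃ v, (v = .nil ↔ s x = .nil) ∧
      Runs O (.test (2 * x + 1)) s' t 6 (PMF.pure (Function.update s' 4 v, t)) := by
  by_cases hx : s x = .nil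
  · refine ⟨.nil, by simp [hx], runs_ite_nil h.2.1 (Runs.mono (runs_ite_nil ?_
      (runs_setNil 4 s' t)) (by omega))⟩
    rw [h.1, hx]
  · refine ⟨.cons .nil .nil, by simp [hx], runs_ite_nil h.2.1 (runs_ite_cons ?_
      ((runs_cons 4 8 8 s' t).congr ?_ |>.mono ?_))⟩
    · rwa [h.1]
    · rw [h.2.2.2.1]
    · rw [h.2.2.2.1]; simp [Data.size]

/-- Once the flag `x₂` is set, every guarded statement does nothing and every loop test yields
`nil`, so the rest of the program is crossed in a time that depends on its text only. -/
theorem runs_compile_stopped (p : Prog) {s' : Store} {b : Data} (h : Stopped b s') (t : T) :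
    ∃ s'', Stopped b s'' ∧ Runs O (p.compile H) s' t p.overhead (PMF.pure (s'', t)) := by
  induction p generalizing s' with
  | seq p q ihp ihq =>
    obtain ⟨s₁, h1, hr1⟩ := ihp h
    obtain ⟨s₂, h2, hr2⟩ := ihq h1
    exact ⟨s₂, h2, hr1.seq_pure hr2⟩
  | ite x p q ihp ihq =>
    by_cases hx : s' (2 * x + 1) = .nil
    · obtain ⟨s₂, h2, hr2⟩ := ihq h
      exact ⟨s₂, h2, (runs_ite_nil hx hr2).mono (by simp only [Prog.overhead]; omega)⟩
    · obtain ⟨s₂, h2, hr2⟩ := ihp h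
      exact ⟨s₂, h2, (runs_ite_cons hx hr2).mono (by simp only [Prog.overhead]; omega)⟩
  | loop x p ih =>
    refine ⟨_, h.update_four .nil, Runs.mono ((runs_test_stopped h _ t).seq_pure
      (runs_loop_nil (by simp))) (by simp only [Prog.overhead]; omega)⟩
  | _ => exact ⟨s', h, runs_guarded_stopped h _ t⟩

/-- The remaining time depends on the outcome; it is enough to bound the value for every remaining
time that the cost bound `c` allows. The time accounts of the reductions all rest on this. -/
theorem Runs.le_ev {p : Prog} {s : Store} {t : T} {c F : ℕ} {μ : PMF (Store × T)}
    (h : Runs O p s t c μ) (hc : c ≤ F) {g : Store × T → ℝ≥0∞}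
    {W : Option (Config T) → ℝ≥0∞}
    (hg : ∀ y ∈ μ.support, ∀ F', F ≤ F' + c → g y ≤ W (some (y.1, y.2, F'))) :
    ev μ g ≤ ev (exec O p (s, t, F)) W := by
  obtain ⟨ν, rfl, h2, h3⟩ := h
  rw [h3 F hc, ev_map, ev_map]
  refine ev_mono fun x hx => hg x.1 ?_ _ ?_
  · rw [PMF.support_map]; exact ⟨x, hx, rfl⟩
  · have := h2 x hx; omega

theorem Runs.le_ev_pure {p : Prog} {s s' : Store} {t t' : T} {c F : ℕ}
    (h : Runs O p s t c (PMF.pure (s', t'))) (hc : c ≤ F) {v : ℝ≥0∞}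
    {W : Option (Config T) → ℝ≥0∞} (hg : ∀ F', F ≤ F' + c → v ≤ W (some (s', t', F'))) :
    v ≤ ev (exec O p (s, t, F)) W := by
  have := h.le_ev hc (g := fun _ => v) (W := W) fun y hy F' hF => by
    rw [(PMF.mem_support_pure_iff _ _).1 hy]; exact hg F' hF
  rwa [ev_pure] at this

theorem Runs.le_ev_map {β : Type} {p : Prog} {s : Store} {t : T} {c F : ℕ} {μ : PMF β}
    {k : β → Store × T} (h : Runs O p s t c (μ.map k)) (hc : c ≤ F) {g : β → ℝ≥0∞}
    {W : Option (Config T) → ℝ≥0∞}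
    (hg : ∀ r ∈ μ.support, ∀ F', F ≤ F' + c → g r ≤ W (some ((k r).1, (k r).2, F'))) :
    ev μ g ≤ ev (exec O p (s, t, F)) W := by
  -- As `k` need not be injective, `g` is not a function of the store. The infimum of the values
  -- over the admissible remaining times is one, and it dominates `g`.
  refine le_trans ?_ (h.le_ev hc (g := fun y => ⨅ F' : ℕ, ⨅ _ : F ≤ F' + c,
    W (some (y.1, y.2, F'))) fun y _ F' hF => iInf₂_le F' hF)
  rw [ev_map]
  exact ev_mono fun r hr => le_iInf₂ fun F' hF => hg r hr F' hF

variable {U : Type} {κ : U → Data → PMF (Option Data × U)} {w : U → ℝ≥0∞} {enc : U → Data}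
  {st' : U → T} {Inv : U → ℕ → Prop} {M R₀ R : ℕ}

/-- The result of the handler: the answer, or `nil` if the execution stops, and the new state. -/
def encResult (enc : U → Data) (r : Option Data × U) : Data :=
  .cons (r.1.elim .nil (.cons .nil)) (enc r.2)

variable (O H κ enc st' Inv M R₀) in
/-- The program `H` implements the oracle `κ`, from all states that satisfy the invariant. -/
structure Implements : Prop where
  mono : ∀ u f f', Inv u f → f' ≤ f → Inv u f'
  inv : ∀ u f d, Inv u (f + 1) → d.size + f + 1 ≤ M → ∀ a u', (some a, u') ∈ (κ u d).support →
    Inv u' f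
  size_le : ∀ u f, Inv u f → (enc u).size ≤ R₀
  size_result_le : ∀ u f d, Inv u (f + 1) → d.size + f + 1 ≤ M → ∀ r ∈ (κ u d).support,
    (encResult enc r).size ≤ R₀
  runs : ∀ u f d s, Inv u (f + 1) → d.size + f + 1 ≤ M → s 10 = .cons (enc u) d →
    (∀ j, s (10 + 2 * (j + 1)) = .nil) → Runs O H s (st' u) R₀
      ((κ u d).map fun r => (Function.update s 10 (encResult enc r), st' r.2))

/-- The handler finds its state and the query in `x₁₀` and leaves a tagged result there: an answer
is moved to the adversary's variable, whereas `nil` raises the flag `x₂`. In both cases the block of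
the handler is clean again for the next call. -/
theorem runs_call (hI : Implements O H κ enc st' Inv M R₀) {s s' : Store} {u : U} {f : ℕ}
    (hL : Live s (enc u) s') (x y : ℕ) (hi : Inv u (f + 1)) (hs : (s y).size + f + 1 ≤ M) :
    ∃ fin : Option Data × U → Store,
      (∀ a u', Live (Function.update s x a) (enc u') (fin (some a, u'))) ∧
      (∀ u', Stopped (enc u') (fin (none, u'))) ∧
      Runs O (Prog.call H (2 * x + 1) (2 * y + 1)) s' (st' u) (20 + 6 * R₀ + M)
        ((κ u (s y)).map fun r => (fin r, st' r.2)) := by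
  obtain ⟨h1, h2, h3, h4, h5⟩ := hL
  let s₁ := Function.update s' 10 (.cons (enc u) (s y))
  let fin : Option Data × U → Store := fun r =>
    let s₂ := Function.update (Function.update s₁ 6 (enc r.2)) 10 (r.1.elim .nil (.cons .nil))
    r.1.elim (Function.update s₂ 2 (.cons .nil .nil)) fun a =>
      Function.update (Function.update s₂ (2 * x + 1) a) 10 .nil
  refine ⟨fin, fun a u' => ?_, fun u' => ?_, ?_⟩
  · simp only [fin, s₁, Option.elim]
    refine ⟨fun i => ?_, ?_, ?_, ?_, fun j => ?_⟩
    · rw [Function.update_of_ne (by omega)]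
      by_cases hi : i = x
      · subst hi; simp
      · rw [Function.update_of_ne (by omega), Function.update_of_ne (by omega),
          Function.update_of_ne (by omega), Function.update_of_ne (by omega),
          Function.update_of_ne hi, h1]
    · rw [Function.update_of_ne (by omega), Function.update_of_ne (by omega),
        Function.update_of_ne (by omega), Function.update_of_ne (by omega),
        Function.update_of_ne (by omega), h2]
    · rw [Function.update_of_ne (by omega), Function.update_of_ne (by omega),
        Function.update_of_ne (by omega), Function.update_self]
    · rw [Function.update_of_ne (by omega), Function.update_of_ne (by omega),
        Function.update_of_ne (by omega), Function.update_of_ne (by omega),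
        Function.update_of_ne (by omega), h4]
    · by_cases hj : j = 0
      · subst hj; simp
      · rw [Function.update_of_ne (by omega), Function.update_of_ne (by omega),
          Function.update_of_ne (by omega), Function.update_of_ne (by omega),
          Function.update_of_ne (by omega), h5]
  · simp only [fin, s₁, Option.elim]
    refine ⟨by simp, ?_, ?_, fun j => ?_⟩
    · rw [Function.update_of_ne (by omega), Function.update_of_ne (by omega),
        Function.update_self]
    · rw [Function.update_of_ne (by omega), Function.update_of_ne (by omega),
        Function.update_of_ne (by omega), Function.update_of_ne (by omega), h4]
    · rw [Function.update_of_ne (by omega)]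
      by_cases hj : j = 0
      · subst hj; simp
      · rw [Function.update_of_ne (by omega), Function.update_of_ne (by omega),
          Function.update_of_ne (by omega), h5]
  · have hb := hI.size_le u _ hi
    have hH := hI.runs u f (s y) s₁ hi hs (by simp [s₁]) fun j => by
      simp only [s₁]
      rw [Function.update_of_ne (by omega), h5]
    refine Runs.mono (Runs.seq_pure (runs_cons 10 6 (2 * y + 1) s' (st' u)) ?_)
      (c := 2 + (s' 6).size + (s' (2 * y + 1)).size + (R₀ + (1 + R₀ + (1 + R₀ + (8 + R₀))))) (by
        rw [h3, h1]; omega)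
    rw [h3, h1]
    show Runs O _ s₁ _ _ _
    refine Runs.congr (Runs.seq_map hH (κ := fun r => PMF.pure (fin r, st' r.2)) fun r hr => ?_)
      (PMF.bind_pure_comp _ _)
    have hsz := hI.size_result_le u f (s y) hi hs r hr
    refine Runs.mono (Runs.seq_pure (runs_tl 6 10 _ _) ?_) (c := 1 + (encResult enc r).size +
      (1 + (encResult enc r).size + (8 + R₀))) (by omega) |> fun h => by simpa using h
    have e1 : Function.update (Function.update s₁ 10 (encResult enc r)) 6
        (Function.update s₁ 10 (encResult enc r) 10).tail =
        Function.update (Function.update s₁ 6 (enc r.2)) 10 (encResult enc r) := by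
      rw [Function.update_self, Function.update_comm (by omega)]; rfl
    rw [e1]
    refine Runs.seq_pure (runs_hd 10 10 _ _ |>.mono (c' := 1 + (encResult enc r).size)
      (by simp)) ?_
    have e2 : Function.update (Function.update (Function.update s₁ 6 (enc r.2)) 10
        (encResult enc r)) 10 (Function.update (Function.update s₁ 6 (enc r.2)) 10
        (encResult enc r) 10).head = Function.update (Function.update s₁ 6 (enc r.2)) 10
        (r.1.elim .nil (.cons .nil)) := by
      simp [encResult, Data.head]
    rw [e2]
    obtain ⟨o, u'⟩ := r
    cases o with
    | none =>
      have h10 : Function.update (Function.update s₁ 6 (enc u')) 10 Data.nil 10 = .nil := by simp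
      refine Runs.mono (c := 7 + R₀ + 1) ?_ (by omega)
      refine runs_ite_nil h10 (Runs.mono ((runs_cons 2 8 8 _ _).congr ?_) ?_) (c := 7 + R₀)
      · simp only [fin, Option.elim, s₁]
        rw [Function.update_of_ne (by omega), Function.update_of_ne (by omega),
          Function.update_of_ne (by omega), h4]
      · simp only [s₁, Option.elim]
        rw [Function.update_of_ne (by omega), Function.update_of_ne (by omega),
          Function.update_of_ne (by omega), h4]
        simp [Data.size]; omega
    | some a =>
      have h10 : Function.update (Function.update s₁ 6 (enc u')) 10 (Data.cons .nil a) 10 ≠ .nil := by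
        simp
      refine Runs.mono (c := 7 + R₀ + 1) ?_ (by omega)
      refine runs_ite_cons h10 (Runs.mono (Runs.seq_pure (runs_tl (2 * x + 1) 10 _ _)
        (runs_setNil 10 _ _)) ?_ |>.congr ?_) (c := 7 + R₀)
      · simp only [encResult, Option.elim, Data.size] at hsz
        simp [Data.size]; omega
      · simp [fin, Data.tail]

/-- A compiled adversary succeeds at least as likely as the adversary with the oracle `κ`. -/
theorem wp_le_ev_compile (hI : Implements O H κ enc st' Inv M R₀) (hR : 30 + 6 * R₀ + M ≤ R)
    (p : Prog) (hp : p.overhead ≤ R) (e : ℕ) (V : Val U) (W : Option (Config T) → ℝ≥0∞)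
    (hlive : ∀ s u f F s', Inv u f → (∀ x, (s x).size + f ≤ M) → Live s (enc u) s' →
      f * R + e ≤ F → V s u f ≤ W (some (s', st' u, F)))
    (hhalt : ∀ u F s', (enc u).size ≤ R₀ → Stopped (enc u) s' → e ≤ F → w u ≤ W (some (s', st' u, F)))
    (s : Store) (u : U) (f F : ℕ) (s' : Store) (hi : Inv u f) (hs : ∀ x, (s x).size + f ≤ M)
    (hL : Live s (enc u) s') (hF : f * R + p.overhead + e ≤ F) :
    wp κ w p V s u f ≤ ev (exec O (p.compile H) (s', st' u, F)) W := by
  -- Every time unit of the adversary is worth `R` units of the compiled program, and `e` units are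
  -- reserved for what follows. In the hypothesis on `F` one unit has already been spent on the
  -- guard.
  have hassign : ∀ (e : ℕ) (V : Val U) (W : Option (Config T) → ℝ≥0∞)
      (_ : ∀ s u f F s', Inv u f → (∀ x, (s x).size + f ≤ M) → Live s (enc u) s' →
        f * R + e ≤ F → V s u f ≤ W (some (s', st' u, F))) (x : ℕ) (v : Data) (c : ℕ) (s : Store)
      (u : U) (f F : ℕ) (s' : Store), Inv u f → (∀ x, (s x).size + f ≤ M) → Live s (enc u) s' →
      f * R + 3 + e ≤ F + 1 → 1 ≤ c → v.size ≤ c →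
      wpAssign x v c V s u f ≤ W (assign (2 * x + 1) v c s' (st' u) F) := by
    intro e V W hlive x v c s u f F s' hi hs hL hF hc hv
    unfold wpAssign
    split_ifs with hcf
    · obtain ⟨g, rfl⟩ := Nat.exists_eq_add_of_le hcf
      have hcR : c ≤ c * R := Nat.le_mul_of_pos_right c (by omega)
      have hmul : (c + g) * R = c * R + g * R := add_mul _ _ _
      rw [assign, if_pos (by omega), show c + g - c = g by omega]
      refine hlive _ _ _ _ _ (hI.mono _ _ _ hi (by omega)) (fun z => ?_) (hL.update x v) (by omega)
      by_cases hz : z = x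
      · subst hz; have := hs z; simp; omega
      · have := hs z; simp [hz]; omega
    · exact bot_le
  have hguard : ∀ (p : Prog) (s' : Store) (t : T) (F : ℕ), s' 2 = .nil →
      exec O p.guarded (s', t, F + 1) = exec O p (s', t, F) := by
    intro p s' t F h
    simp [Prog.guarded, exec, h]
  induction p generalizing e V W s u f F s' with
  | setNil x | copy x _ | cons x _ _ | hd x _ | tl x _ | eq x _ _ =>
    simp only [Prog.overhead] at hF
    obtain ⟨F, rfl⟩ : ∃ F', F = F' + 1 := ⟨F - 1, by omega⟩
    rw [Prog.compile, hguard _ _ _ _ hL.2.1]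
    simp only [exec, ev_pure, wp, hL.1]
    refine hassign e V W hlive _ _ _ _ _ _ _ _ hi hs hL hF ?_ ?_
    all_goals first
      | omega
      | simp [Data.size]; try done
      | exact (size_encode_bool_le _).trans (by grind [Data.size_pos])
  | toss x =>
    simp only [Prog.overhead] at hF
    obtain ⟨F, rfl⟩ : ∃ F', F = F' + 1 := ⟨F - 1, by omega⟩
    rw [Prog.compile, hguard _ _ _ _ hL.2.1]
    simp only [exec, ev_map, wp]
    refine ev_mono fun b _ => hassign e V W hlive _ _ _ _ _ _ _ _ hi hs hL hF ?_ ?_ <;> omega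
  | query x y =>
    cases f with
    | zero => simp [wp]
    | succ f =>
      simp only [Prog.overhead] at hF
      have hmul : (f + 1) * R = f * R + R := by ring
      obtain ⟨fin, h1, h2, hrun⟩ := runs_call hI hL x y hi (hs y)
      rw [Prog.compile]
      have hrun' := runs_ite_nil (p := .setNil 8) hL.2.1 hrun
      simp only [wp]
      -- The call of the handler is covered by the `R` units of the single time unit that the query
      -- costs the adversary.
      refine hrun'.le_ev_map (by omega) fun r hr F' hF' => ?_
      obtain ⟨_ | a, u'⟩ := r
      · have hsz := hI.size_result_le u f _ hi (hs y) _ hr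
        exact hhalt _ _ _ (by
          show (enc u').size ≤ R₀
          simp only [encResult, Data.size] at hsz; omega) (h2 u') (by omega)
      · show wpAssign x a (1 + a.size) V s u' (f + 1) ≤ _
        unfold wpAssign
        split_ifs with hcf
        · have hle : (f + 1 - (1 + a.size)) * R ≤ f * R := Nat.mul_le_mul_right _ (by omega)
          refine hlive _ _ _ _ _ (hI.mono _ _ _ (hI.inv u f _ hi (hs y) a u' hr) (by omega))
            (fun z => ?_) (h1 a u') (by omega)
          by_cases hz : z = x
          · subst hz; have := hs z; simp; omega
          · have := hs z; simp [hz]; omega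
        · exact bot_le
  | seq p q ihp ihq =>
    simp only [Prog.overhead] at hF hp
    rw [wp, Prog.compile, exec_seq, ev_bind]
    -- The first part must leave `q.overhead` in reserve, because `q` has to be crossed even if the
    -- execution is stopped.
    refine ihp (by omega) (q.overhead + e) _ _ ?_ ?_ s u f F s' hi hs hL (by omega)
    · intro s u f F s' hi hs hL hF
      exact ihq (by omega) e V W hlive hhalt s u f F s' hi hs hL (by omega)
    · intro u F s' hu hS hF
      obtain ⟨s'', hS', hr⟩ := runs_compile_stopped (O := O) (H := H) q hS (st' u)
      exact hr.le_ev_pure (by omega) fun F' hF' => hhalt _ _ _ hu hS' (by omega)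
  | ite x p q ihp ihq =>
    simp only [Prog.overhead] at hF hp
    obtain ⟨F, rfl⟩ : ∃ F', F = F' + 1 := ⟨F - 1, by omega⟩
    cases f with
    | zero => simp [wp]
    | succ f =>
      have hmul : (f + 1) * R = f * R + R := by ring
      have hi' := hI.mono _ _ f hi (by omega)
      have hs' : ∀ x, (s x).size + f ≤ M := fun x => by have := hs x; omega
      simp only [wp, Prog.compile, exec, hL.1]
      split_ifs
      · exact ihq (by omega) e V W hlive hhalt s u f F s' hi' hs' hL (by omega)
      · exact ihp (by omega) e V W hlive hhalt s u f F s' hi' hs' hL (by omega)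
  | loop x p ih =>
    simp only [Prog.overhead] at hF hp
    have key : ∀ (k : ℕ) (s : Store) (u : U) (f F : ℕ) (s' : Store), Inv u f →
        (∀ x, (s x).size + f ≤ M) → Live s (enc u) s' → (s' 4 = .nil ↔ s x = .nil) →
        f * R + e ≤ F → wpLoop x (wp κ w p) V k s u f ≤
          ev (exec O (.loop 4 (.seq (p.compile H) (.test (2 * x + 1)))) (s', st' u, F)) W := by
      intro k
      induction k with
      | zero => intro s u f F s' _ _ _ _ _; exact bot_le
      | succ k ihk =>
        intro s u f F s' hi hs hL h4 hF
        cases f with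
        | zero => exact bot_le
        | succ f =>
          have hmul : (f + 1) * R = f * R + R := by ring
          have hi' := hI.mono _ _ f hi (by omega)
          have hs' : ∀ x, (s x).size + f ≤ M := fun x => by have := hs x; omega
          obtain ⟨F, rfl⟩ : ∃ F', F = F' + 1 := ⟨F - 1, by omega⟩
          rw [exec_loop_succ]
          simp only [wpLoop, h4]
          split_ifs with hx
          · rw [ev_pure]; exact hlive _ _ _ _ _ hi' hs' hL (by omega)
          · rw [ev_bind, exec_seq, ev_bind]
            -- The reserve of `10` pays for the test after the body and, if the body was stopped,
            -- for leaving the loop.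
            refine ih (by omega) (10 + e) _ _ ?_ ?_ s u f F s' hi' hs' hL (by omega)
            · intro s u f F s' hi hs hL hF
              obtain ⟨v, hv, hr⟩ := runs_test_live (O := O) hL x (st' u)
              exact hr.le_ev_pure (by omega) fun F' hF' =>
                ihk s u f F' _ hi hs (hL.update_four v) (by simpa using hv) (by omega)
            · intro u F s' hu hS hF
              refine (runs_test_stopped (O := O) hS (2 * x + 1) (st' u)).le_ev_pure (by omega)
                fun F' hF' => ?_
              exact (runs_loop_nil (O := O) (by simp)).le_ev_pure (by omega) fun F'' hF'' =>
                hhalt _ _ _ hu (hS.update_four .nil) (by omega)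
    rw [Prog.compile, exec_seq, ev_bind]
    obtain ⟨v, hv, hr⟩ := runs_test_live (O := O) hL x (st' u)
    exact hr.le_ev_pure (by omega) fun F' hF' =>
      key f s u f F' _ hi hs (hL.update_four v) (by simpa using hv) (by omega)

end

instance : Coding Data where
  encode d := d
  decode d := some d
  decode_encode _ := rfl

section

variable {T : Type} {O : Oracle T}

/-- Call of a procedure on the variables `φ 0, φ 1, …`. -/
theorem Runs.call_at {φ : ℕ → ℕ} (hφ : φ.Injective) {p : Prog} {x : Data} {c : ℕ} {F : PMF Data}
    {s : Store} (t : T) (h : Runs noOracle p (st x) () c (F.map fun d => (st d, ())))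
    (h0 : s (φ 0) = x) (hs : ∀ j, s (φ (j + 1)) = .nil) :
    Runs O (p.sub φ) s t c (F.map fun d => (Function.update s (φ 0) d, t)) := by
  have hst : s ∘ φ = st x := by
    funext j
    cases j with
    | zero => exact h0
    | succ j => exact hs j
  refine (Runs.sub hφ h hst).congr ?_
  rw [PMF.map_comp]
  congr 1; funext d
  have hd : st d = Function.update (s ∘ φ) 0 d := by rw [hst]; simp [st]
  simp only [Function.comp, hd, extend_update hφ]
  rw [extend_comp_self]

end

/-! ## Handlers of oracle queries -/

/-- The variables of the handler. -/
def blockVar (j : ℕ) : ℕ := 10 + 2 * j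

theorem blockVar_injective : blockVar.Injective := fun i j h => by
  simp only [blockVar] at h; omega

section

variable {B Q K R T : Type}

/-- The simulation of an answer: `s₁` answers itself or asks an oracle `ans`; in the latter case
`s₂` computes the answer from that of the oracle. -/
def simulate (s₁ : B → Data → PMF ((Option Data × B) ⊕ (Q × K))) (s₂ : K → R → Data × B)
    (ans : T → Q → PMF (R × T)) (b : B) (t : T) (d : Data) : PMF (Option Data × B × T) :=
  (s₁ b d).bind fun
    | .inl r => PMF.pure (r.1, r.2, t)
    | .inr q => (ans t q.1).map fun r => (some (s₂ q.2 r.1).1, (s₂ q.2 r.1).2, r.2)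

variable [Coding B] [Coding Q] [Coding K] [Coding R]

/-- The program and its time bound are fixed before the oracle, so one handler serves all security
parameters and all keys of the challenger. Besides the state and the query, only the bound `m` on
the oracle's answers enters the time. -/
theorem exists_handler {s₁ : B → Data → PMF ((Option Data × B) ⊕ (Q × K))}
    {s₂ : K → R → Data × B}
    (h₁ : Eff (fun j : B × Data => encode j) fun j => (s₁ j.1 j.2).map encode)
    (h₂ : Det (fun j : K × R => encode j) fun j => encode (s₂ j.1 j.2)) :
    ∃ (H : Prog) (c : ℕ → ℕ), PolyB c ∧
      ∀ (T : Type) (O : Oracle T) (ans : T → Q → PMF (R × T)) (b : B) (t : T) (d : Data) (m : ℕ),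
      (∀ q k, .inr (q, k) ∈ (s₁ b d).support →
        O t (encode q) = (ans t q).map (fun r => (encode r.1, r.2)) ∧
        ∀ r ∈ (ans t q).support, (encode r.1).size ≤ m) →
      (∀ r ∈ (simulate s₁ s₂ ans b t d).support,
        (encode (r.1, r.2.1)).size ≤ c ((encode (b, d)).size + m)) ∧
      ∀ s : Store, s 10 = encode (b, d) → (∀ j, s (10 + 2 * (j + 1)) = .nil) →
        Runs O H s t (c ((encode (b, d)).size + m))
          ((simulate s₁ s₂ ans b t d).map fun r =>
            (Function.update s 10 (encode (r.1, r.2.1)), r.2.2)) := by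
  have h₂' : Det (fun j : K × R => encode j) fun j =>
      encode (some (s₂ j.1 j.2).1, (s₂ j.1 j.2).2) := (h₂.encFst.encSome).pair h₂.encSnd
  obtain ⟨B₁, hB₁, hs₁⟩ := h₁.size_le
  obtain ⟨B₂, hB₂, hs₂⟩ := h₂'.size_le
  obtain ⟨p₁, c₁, hc₁, hp₁⟩ := h₁
  obtain ⟨p₂, c₂, hc₂, hp₂⟩ := h₂'
  let c : ℕ → ℕ := fun x => c₁ x + c₂ (2 * B₁ x + x + 1) + 10 * B₁ x + 5 * x + 20 +
    B₂ (2 * B₁ x + x + 1)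
  -- After the first part, `x₁₂` receives the tag and `x₁₀` the content of the result. If the oracle
  -- is needed, `x₁₂` becomes the query and then the answer, and `x₁₀` the continuation, which is
  -- paired with the answer for the second part.
  refine ⟨.seq (p₁.sub blockVar) (.seq (.hd 12 10) (.seq (.tl 10 10) (.ite 12
    (.seq (.hd 12 10) (.seq (.query 12 12) (.seq (.tl 10 10) (.seq (.cons 10 10 12)
      (.seq (.setNil 12) (p₂.sub blockVar))))))
    (.setNil 12)))), c, by fun_prop, ?_⟩
  intro T O ans b t d m hq
  set x := (encode (b, d)).size + m with hx
  have hsize : ∀ e ∈ (s₁ b d).support, (encode e).size ≤ B₁ x := fun e he =>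
    (hs₁ (b, d) _ (by rw [PMF.support_map]; exact ⟨e, he, rfl⟩)).trans (hB₁.1 (by omega))
  have hinr : ∀ q k, .inr (q, k) ∈ (s₁ b d).support →
      (encode q).size + (encode k).size + 3 ≤ B₁ x := fun q k he => by
    have h : 1 + (1 + 1 + 1) + (1 + (encode q).size + (encode k).size) ≤ B₁ x := hsize _ he
    omega
  refine ⟨fun r hr => ?_, fun s hs h0 => ?_⟩
  · simp only [simulate, PMF.mem_support_bind_iff] at hr
    obtain ⟨e, he, hr⟩ := hr
    obtain r' | ⟨q, k⟩ := e
    · rw [(PMF.mem_support_pure_iff _ _).1 hr]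
      have h : 1 + 1 + (encode r').size ≤ B₁ x := hsize _ he
      show (encode r').size ≤ _
      dsimp only [c]; omega
    · rw [PMF.support_map] at hr
      obtain ⟨a, ha, rfl⟩ := hr
      have h1 := hinr q k he
      have h2 := (hq q k he).2 a ha
      have h3 : (encode (some (s₂ k a.1).1, (s₂ k a.1).2)).size ≤
        B₂ (1 + (encode k).size + (encode a.1).size) := hs₂ (k, a.1)
      have h4 := hB₂.1 (show 1 + (encode k).size + (encode a.1).size ≤ 2 * B₁ x + x + 1 by omega)
      exact (h3.trans h4).trans (by dsimp only [c]; omega)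
  · have hrun := Runs.call_at (O := O) blockVar_injective (s := s) t (hp₁ (b, d)) hs h0
    rw [PMF.map_comp] at hrun
    rw [simulate, PMF.map_bind]
    have hc1 := hc₁.1 (show (encode (b, d)).size ≤ x by omega)
    refine Runs.mono (Runs.seq_map (c' := c₂ (2 * B₁ x + x + 1) + 10 * B₁ x + 5 * x + 20) hrun
      fun e he => ?_) (by dsimp only [c]; omega)
    simp only [Function.comp]
    rw [show blockVar 0 = 10 from rfl]
    have h12 : s 12 = .nil := h0 0
    obtain r' | ⟨q, k⟩ := e
    · have h : 1 + 1 + (encode r').size ≤ B₁ x := hsize _ he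
      dsimp only
      rw [PMF.pure_map]
      have he' : encode (Sum.inl r' : (Option Data × B) ⊕ (Q × K)) =
        .cons .nil (encode r') := rfl
      rw [he']
      refine Runs.mono (Runs.seq_pure (runs_hd 12 10 _ t) (Runs.seq_pure (runs_tl 10 10 _ t)
        (runs_ite_nil ?_ ((runs_setNil 12 _ t).congr ?_)))) ?_
      · simp [Data.head]
      · congr 2
        funext i
        by_cases h1 : i = 12
        · subst h1; simp [h12]
        · by_cases h2 : i = 10
          · subst h2; simp [Data.tail]
          · simp [h1, h2]
      · simp [Data.size]; omega
    · have hsz := hinr q k he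
      obtain ⟨hO, hm⟩ := hq q k he
      have he' : encode (Sum.inr (q, k) : (Option Data × B) ⊕ (Q × K)) =
        .cons (.cons .nil .nil) (.cons (encode q) (encode k)) := rfl
      rw [he']
      dsimp only
      rw [PMF.map_comp]
      set s' : Store := Function.update (Function.update s 12 (encode q)) 10
        (.cons (encode q) (encode k)) with hs'
      have hquery : Runs O (.query 12 12) s' t (1 + m) ((ans t q).map fun r =>
          (Function.update s' 12 (encode r.1), r.2)) := by
        have h' : s' 12 = encode q := by simp [hs']
        refine (runs_query (c := m) ?_).congr ?_
        · rw [h', hO, PMF.support_map]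
          rintro _ ⟨r, hr, rfl⟩
          exact hm r hr
        · rw [h', hO, PMF.map_comp]; rfl
      have hrest : ∀ r ∈ (ans t q).support, Runs O (.seq (.tl 10 10) (.seq (.cons 10 10 12)
          (.seq (.setNil 12) (p₂.sub blockVar)))) (Function.update s' 12 (encode r.1)) r.2
          (c₂ (2 * B₁ x + x + 1) + 2 * B₁ x + m + 10) (PMF.pure (Function.update s 10
            (encode (some (s₂ k r.1).1, (s₂ k r.1).2)), r.2)) := by
        intro r hr
        have hmr := hm r hr
        have hp := Runs.call_at (O := O) blockVar_injective (s := Function.update s 10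
          (.cons (encode k) (encode r.1))) r.2 (hp₂ (k, r.1)) (by simp [blockVar]; rfl)
          (fun j => by
            rw [Function.update_of_ne (by simp only [blockVar]; omega)]; exact h0 j)
        refine Runs.mono (Runs.seq_pure (runs_tl 10 10 _ _) (Runs.seq_pure (runs_cons 10 10 12 _ _)
          (Runs.seq_pure ((runs_setNil 12 _ _).congr ?_) (hp.congr ?_)))) ?_
        · congr 2
          funext i
          by_cases h1 : i = 12
          · subst h1; simp [h12]
          · by_cases h2 : i = 10
            · subst h2; simp [hs', Data.tail]
            · simp [h1, h2, hs']
        · rw [PMF.pure_map, show blockVar 0 = 10 from rfl, Function.update_idem]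
        · have hc2 := hc₂.1 (show (encode (k, r.1)).size ≤ 2 * B₁ x + x + 1 by
            show 1 + (encode k).size + (encode r.1).size ≤ _
            omega)
          simp [hs', Data.size, Data.tail]
          omega
      have hall := Runs.seq_map hquery hrest
      replace hall := hall.congr (PMF.bind_pure_comp _ _)
      refine Runs.mono (Runs.seq_pure (runs_hd 12 10 _ t) (Runs.seq_pure (runs_tl 10 10 _ t)
        (runs_ite_cons ?_ (Runs.seq_pure ((runs_hd 12 10 _ t).congr ?_) hall)))) ?_
      · simp [Data.head]
      · congr 2
        funext i
        by_cases h1 : i = 12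
        · subst h1; simp [Data.head, Data.tail, hs']
        · by_cases h2 : i = 10
          · subst h2; simp [Data.tail, hs']
          · simp [h1, h2, hs']
      · simp [Data.size, Data.tail]; omega

/-- A handler that needs no oracle. -/
theorem exists_local_handler {U : Type} {κ : U → Data → PMF (Option Data × U)} {enc : U → Data}
    (h : Eff (fun j : U × Data => .cons (enc j.1) j.2) fun j =>
      (κ j.1 j.2).map (encResult enc)) :
    ∃ (H : Prog) (c : ℕ → ℕ), PolyB c ∧ ∀ (u : U) (d : Data),
      (∀ r ∈ (κ u d).support, (encResult enc r).size ≤ c (Data.cons (enc u) d).size) ∧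
      ∀ s : Store, s 10 = .cons (enc u) d → (∀ j, s (10 + 2 * (j + 1)) = .nil) →
        Runs noOracle H s () (c (Data.cons (enc u) d).size)
          ((κ u d).map fun r => (Function.update s 10 (encResult enc r), ())) := by
  obtain ⟨B₁, hB₁, hs₁⟩ := h.size_le
  obtain ⟨p₁, c₁, hc₁, hp₁⟩ := h
  refine ⟨p₁.sub blockVar, fun x => c₁ x + B₁ x, by fun_prop, fun u d => ⟨fun r hr => ?_,
    fun s hs h0 => ?_⟩⟩
  · exact (hs₁ (u, d) _ (by rw [PMF.support_map]; exact ⟨r, hr, rfl⟩)).trans (by simp)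
  · have hrun := Runs.call_at (O := noOracle) blockVar_injective (s := s) () (hp₁ (u, d)) hs h0
    rw [PMF.map_comp] at hrun
    exact hrun.mono (by simp)

end

/-! ## Reductions -/

/-- The variables of the initial computation of a reduction. -/
def evenVar (j : ℕ) : ℕ := 2 * j

theorem evenVar_injective : evenVar.Injective := fun i j h => by
  simp only [evenVar] at h; omega

/-- The variables of the final computation of a reduction. -/
def finalVar : ℕ → ℕ
  | 0 => 0
  | j + 1 => 10 + 2 * j

theorem finalVar_injective : finalVar.Injective := fun i j h => by
  cases i <;> cases j <;> simp only [finalVar] at h <;> omega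

/-- The preparation of the final computation: `x₀` gets the flag, the state and the output. -/
def finalPrep : Prog :=
  .seq (.ite 2 (.seq (.setNil 1) (.cons 2 8 8)) (.setNil 8)) (.seq (.cons 6 6 1) (.cons 0 2 6))

theorem runs_finalPrep {T : Type} {O : Oracle T} {s : Store} {t : T} {flag : Bool} {b out : Data}
    (h2 : s 2 = .nil ↔ flag = false) (h6 : s 6 = b) (h8 : s 8 = .nil)
    (h10 : ∀ j, s (10 + 2 * j) = .nil) (hout : out = if flag then .nil else s 1) :
    ∃ s', s' 0 = .cons (encode flag) (.cons b out) ∧ (∀ j, s' (finalVar (j + 1)) = .nil) ∧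
      Runs O finalPrep s t (30 + 2 * b.size + 2 * out.size) (PMF.pure (s', t)) := by
  set s₁ := Function.update (Function.update s 1 out) 2 (encode flag) with hs₁
  refine ⟨Function.update (Function.update s₁ 6 (.cons b out)) 0
    (.cons (encode flag) (.cons b out)), by simp, fun j => ?_, ?_⟩
  · simp only [finalVar, hs₁]
    rw [Function.update_of_ne (by omega), Function.update_of_ne (by omega),
      Function.update_of_ne (by omega), Function.update_of_ne (by omega), h10]
  · have hfirst : Runs O (.ite 2 (.seq (.setNil 1) (.cons 2 8 8)) (.setNil 8)) s t 9
        (PMF.pure (s₁, t)) := by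
      cases flag with
      | false =>
        have hs2 := h2.2 rfl
        refine Runs.mono (runs_ite_nil hs2 ((runs_setNil 8 s t).congr ?_)) (by omega)
        simp only [Bool.false_eq_true, if_false] at hout
        rw [hs₁, hout, Function.update_eq_self, show (encode false : Data) = s 2 from hs2.symm,
          Function.update_eq_self, ← h8, Function.update_eq_self]
      | true =>
        have hs2 : s 2 ≠ .nil := fun h => by simpa using h2.1 h
        simp only [if_true] at hout
        refine Runs.mono (runs_ite_cons hs2 (Runs.seq_pure (runs_setNil 1 s t)
          ((runs_cons 2 8 8 _ t).congr ?_))) ?_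
        · rw [Function.update_of_ne (by omega), h8, hs₁, hout]; rfl
        · rw [Function.update_of_ne (by omega), h8]; simp [Data.size]
    have e6 : s₁ 6 = b := by rw [hs₁, Function.update_of_ne (by omega),
      Function.update_of_ne (by omega), h6]
    have e1 : s₁ 1 = out := by rw [hs₁, Function.update_of_ne (by omega), Function.update_self]
    have e2 : s₁ 2 = encode flag := by rw [hs₁, Function.update_self]
    have hsz := size_encode_bool_le flag
    refine Runs.mono (Runs.seq_pure hfirst (Runs.seq_pure (runs_cons 6 6 1 s₁ t)
      ((runs_cons 0 2 6 _ t).congr ?_))) ?_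
    · rw [e6, e1, Function.update_self, Function.update_of_ne (by omega), e2]
    · rw [e6, e1, Function.update_self, Function.update_of_ne (by omega), e2]
      simp only [Data.size]; omega

/-- The expected value of the output of an adversary, `0` if there is none. -/
theorem ev_play {T α β : Type} [Coding α] [Coding β] (A : Adversary) (O : Oracle T) (n : ℕ)
    (a : α) (t : T) (g : β × T → ℝ≥0∞) : ev (A.play O n a t) (orZero g) =
      ev (exec O A.prog (st (encode (n, a)), t, A.clock.eval n))
        (orZero fun z : Config T => orZero (fun b => g (b, z.2.1)) (decode (z.1 0))) := by
  simp only [Adversary.play, run, ev_map, update_nil_eq_st]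
  congr 1
  funext z
  cases z with
  | none => rfl
  | some z =>
    simp only [Function.comp, Option.map_some, Option.bind_some, orZero]
    cases (decode (z.1 0) : Option β) <;> rfl

section

variable {ι α β U T : Type} [Coding α] [Coding β] {A : Adversary} {N : ι → ℕ} {a : ι → α}
  {O : ι → Oracle T} {κ : U → Data → PMF (Option Data × U)} {enc : U → Data} {st' : U → T}
  {Inv : ι → U → ℕ → Prop} {init : ι → PMF (Data × U)} {final : Bool → U → Data → β} {H : Prog}
  {M R₀ : ℕ → ℕ} {t₀ : ι → T}

/-- The passage from values of a simulation to actual adversaries. The constructed program computes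
an initial handler state, runs the compiled adversary, and derives the output from the final state
and from whether the run was stopped. The index `i` ranges over all parameters and keys, and one
program has to serve them all. -/
theorem exists_reduction (hM : PolyB M) (hR₀ : PolyB R₀)
    (hI : ∀ i, Implements (O i) H κ enc st' (Inv i) (M (N i)) (R₀ (N i)))
    (hinit : Eff (fun i => encode (N i, a i)) fun i =>
      (init i).map fun r => .cons r.1 (enc r.2))
    (ha : ∀ i, (encode (a i)).size ≤ M (N i))
    (hinv : ∀ i, ∀ r ∈ (init i).support, Inv i r.2 (A.clock.eval (N i)) ∧ st' r.2 = t₀ i ∧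
      r.1.size + A.clock.eval (N i) ≤ M (N i))
    (hfinal : Det (fun j : Bool × U × Data =>
      .cons (encode j.1) (.cons (enc j.2.1) j.2.2)) fun j => encode (final j.1 j.2.1 j.2.2)) :
    ∃ B : Adversary, ∀ (i : ι) (V : Val U) (w : U → ℝ≥0∞) (W : β → T → ℝ≥0∞),
      (∀ s u f, Inv i u f → V s u f ≤ W (final false u (s 0)) (st' u)) →
      (∀ u, w u ≤ W (final true u .nil) (st' u)) →
      ev (init i) (fun r => wp κ w A.prog V (st r.1) r.2 (A.clock.eval (N i))) ≤
        ev (B.play (O i) (N i) (a i) (t₀ i)) (orZero fun r : β × T => W r.1 r.2) := by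
  obtain ⟨p₁, c₁, hc₁, hp₁⟩ := hinit
  obtain ⟨p₂, c₂, hc₂, hp₂⟩ := hfinal
  have hclock := PolyB.eval A.clock
  -- `R` is the price of one time unit of the simulated adversary, `e` the reserve for the final
  -- computation, and `c` the total of all phases; a polynomial above `c` becomes the clock.
  let R : ℕ → ℕ := fun n => 30 + 6 * R₀ n + M n + A.prog.overhead
  let e : ℕ → ℕ := fun n => (30 + 2 * R₀ n + 2 * M n) + c₂ (5 + R₀ n + M n)
  let x₁ : ℕ → ℕ := fun n => 2 * n + 2 + M n
  let c : ℕ → ℕ := fun n => c₁ (x₁ n) + (10 + 3 * M n + 3 * R₀ n) +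
    (A.clock.eval n * R n + A.prog.overhead + e n)
  have hc : PolyB c := by fun_prop
  obtain ⟨q, hq⟩ := hc.2
  refine ⟨⟨.seq (p₁.sub evenVar) (.seq (.seq (.hd 1 0) (.seq (.tl 6 0) (.setNil 0)))
    (.seq (A.prog.compile H) (.seq finalPrep (p₂.sub finalVar)))), q⟩, fun i V w W hV hw => ?_⟩
  have hIi := hI i
  have hai := ha i
  have hinvi := hinv i
  have hpi := hp₁ i
  dsimp only at hpi hp₂
  generalize N i = n at hIi hai hinvi hpi ⊢
  set N₀ := A.clock.eval n with hN₀
  -- the value of the final configuration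
  let W' : Option (Config T) → ℝ≥0∞ := orZero fun z : Config T =>
    orZero (fun b => W b z.2.1) (decode (z.1 0))
  rw [ev_play]
  show _ ≤ ev _ W'
  have hqn := hq n
  have hn' : (encode (n, a i)).size ≤ x₁ n := by
    have h2 := size_encode_nat n
    show 1 + (encode n).size + (encode (a i)).size ≤ 2 * n + 2 + M n
    omega
  have hcn := hc₁.1 hn'
  have hrun := Runs.call_at (O := O i) evenVar_injective (s := st (encode (n, a i))) (t₀ i)
    hpi rfl fun j => rfl
  rw [PMF.map_comp] at hrun
  dsimp only
  rw [exec_seq, ev_bind]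
  refine hrun.le_ev_map (by dsimp only [c] at hqn; rw [← hN₀] at hqn; omega) fun r hr F₁ hF₁ => ?_
  obtain ⟨hi₁, hi₂, hi₃⟩ := hinvi r hr
  have hsz := hIi.size_le r.2 _ hi₁
  -- the start of the simulated execution
  set s₁ := Function.update (st (encode (n, a i))) (evenVar 0) (.cons r.1 (enc r.2)) with hs₁
  set s₂ := Function.update (Function.update (Function.update s₁ 1 r.1) 6 (enc r.2)) 0 .nil with hs₂
  have e0 : s₁ 0 = .cons r.1 (enc r.2) := by simp [hs₁, evenVar]
  have hprep : Runs (O i) (.seq (.hd 1 0) (.seq (.tl 6 0) (.setNil 0))) s₁ (t₀ i)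
      (10 + 2 * M n + 2 * R₀ n) (PMF.pure (s₂, t₀ i)) := by
    refine Runs.mono (Runs.seq_pure (runs_hd 1 0 s₁ _) (Runs.seq_pure (runs_tl 6 0 _ _)
      ((runs_setNil 0 _ _).congr ?_))) ?_
    · rw [Function.update_of_ne (by omega), e0]; rfl
    · rw [Function.update_of_ne (by omega), e0]; simp only [Data.size]; omega
  have hL : Live (st r.1) (enc r.2) s₂ := by
    have h0 : ∀ k, s₁ (k + 1) = .nil := fun k => by
      rw [hs₁, show evenVar 0 = 0 from rfl, Function.update_of_ne (by omega)]; rfl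
    refine ⟨fun k => ?_, ?_, ?_, ?_, fun j => ?_⟩
    · rw [hs₂, Function.update_of_ne (by omega), Function.update_of_ne (by omega)]
      cases k with
      | zero => simp [st]
      | succ k => rw [Function.update_of_ne (by omega)]; exact h0 _
    all_goals simp only [hs₂]
    · rw [Function.update_of_ne (by omega), Function.update_of_ne (by omega),
        Function.update_of_ne (by omega)]; exact h0 1
    · rw [Function.update_of_ne (by omega), Function.update_self]
    · rw [Function.update_of_ne (by omega), Function.update_of_ne (by omega),
        Function.update_of_ne (by omega)]; exact h0 7
    · rw [Function.update_of_ne (by omega), Function.update_of_ne (by omega),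
        Function.update_of_ne (by omega), show 10 + 2 * j = (9 + 2 * j) + 1 by omega]
      exact h0 _
  show _ ≤ ev (exec (O i) _ (s₁, t₀ i, F₁)) W'
  rw [exec_seq, ev_bind]
  refine hprep.le_ev_pure (by dsimp only [c] at hqn; rw [← hN₀] at hqn; omega) fun F₂ hF₂ => ?_
  show _ ≤ ev (exec (O i) _ (s₂, t₀ i, F₂)) W'
  rw [exec_seq, ev_bind, ← hi₂]
  -- the final computation
  have hfin : ∀ (s' : Store) (u : U) (F : ℕ) (flag : Bool) (out : Data), (enc u).size ≤ R₀ n →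
      out.size ≤ M n → (s' 2 = .nil ↔ flag = false) → s' 6 = enc u → s' 8 = .nil →
      (∀ j, s' (10 + 2 * j) = .nil) → (out = if flag then .nil else s' 1) → e n ≤ F →
      W (final flag u out) (st' u) ≤
        ev (exec (O i) (.seq finalPrep (p₂.sub finalVar)) (s', st' u, F)) W' := by
    intro s' u F flag out hu ho h2 h6 h8 h10 hout hF
    obtain ⟨s₃, h30, h31, hr₃⟩ := runs_finalPrep (O := O i) (t := st' u) h2 h6 h8 h10 hout
    have hr₄ := Runs.call_at (O := O i) finalVar_injective (s := s₃) (st' u) (hp₂ (flag, u, out))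
      h30 h31
    rw [PMF.pure_map] at hr₄
    dsimp only at hr₄
    have hbool := size_encode_bool_le flag
    have hcost := hc₂.1 (show (Data.cons (encode flag) (.cons (enc u) out)).size ≤
      5 + R₀ n + M n by simp only [Data.size]; omega)
    refine (hr₃.seq_pure hr₄).le_ev_pure (by dsimp only [e] at hF; omega) fun F' _ => ?_
    simp only [W', orZero, show finalVar 0 = 0 from rfl, Function.update_self, decode_encode]
    exact le_rfl
  have hM1 : ∀ x, (st r.1 x).size + N₀ ≤ M n := fun x => by
    have := st_size_le r.1 x; omega
  refine wp_le_ev_compile hIi (R := R n) (by dsimp only [R]; omega) A.prog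
    (by dsimp only [R]; omega) (e n) V _ ?_ ?_ (st r.1) r.2 N₀ F₂ s₂ hi₁ hM1 hL ?_
  · intro s u f F s' hu hs hLs hF
    refine (hV s u f hu).trans (hfin s' u F false (s 0) (hIi.size_le u f hu) ?_ ?_ hLs.2.2.1
      hLs.2.2.2.1 hLs.2.2.2.2 ?_ (by omega))
    · have := hs 0; omega
    · simp [hLs.2.1]
    · simpa using (hLs.1 0).symm
  · intro u F s' hu hS hF
    refine (hw u).trans (hfin s' u F true .nil hu ?_ ?_ hS.2.1 hS.2.2.1 hS.2.2.2 ?_ hF)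
    · have := hM1 1; simp only [Data.size]; have := (st r.1 1).size_pos; omega
    · simp [hS.1]
    · simp
  · dsimp only [c] at hqn; rw [← hN₀] at hqn; omega

end

/-! ## The reduction to traceability -/

namespace DAA

variable (D : DAA)

/-- The answers of the challenger before their encoding. -/
def traceAnswer (n : ℕ) (pk skI : Bits) (t : TraceState) :
    TraceQuery → PMF (Option Bits × TraceState)
  | .sign S dom m =>
    match t.signers.find? fun e => e.1 == S with
    | none => PMF.pure (none, t)
    | some e => (D.sign n e.2.1 e.2.2 dom m).map fun σ =>
      (some σ, { t with signed := (S, dom, m, σ) :: t.signed })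
  | .hjoin S =>
    match t.signers.find? fun e => e.1 == S with
    | some _ => PMF.pure (none, t)
    | none => (D.freshKey n).bind fun sk => (randomBits (D.coins.eval n)).bind fun r =>
      (D.issue n skI (D.join n pk sk r)).map fun cred =>
        (some cred, { t with signers := (S, sk, cred) :: t.signers })
  | .join S sk r =>
    match t.signers.find? fun e => e.1 == S with
    | some _ => PMF.pure (none, t)
    | none => if D.isKey n sk = true ∧ r.length = D.coins.eval n then
        (D.issue n skI (D.join n pk sk r)).map fun cred => (some cred,
          { t with signers := (S, sk, cred) :: t.signers, RL := sk :: t.RL })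
      else PMF.pure (none, t)
  | .corrupt S =>
    match t.signers.find? fun e => e.1 == S with
    | none => PMF.pure (none, t)
    | some e => PMF.pure (some e.2.1, { t with RL := e.2.1 :: t.RL })

theorem traceHandler_eq (n : ℕ) (pk skI : Bits) (t : TraceState) (q : TraceQuery) :
    D.traceHandler n pk skI t q =
      (D.traceAnswer n pk skI t q).map fun r => (encode r.1, r.2) := by
  cases q with
  | sign S dom m =>
    simp only [traceHandler, traceAnswer]
    cases t.signers.find? fun e => e.1 == S with
    | none => simp only [PMF.pure_map]; rfl
    | some e => simp only [PMF.map_comp]; exact PMF.bind_pure_comp _ _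
  | hjoin S =>
    simp only [traceHandler, traceAnswer]
    cases t.signers.find? fun e => e.1 == S with
    | some e => simp only [PMF.pure_map]; rfl
    | none =>
      simp only [PMF.map_bind, PMF.map_comp]
      refine congrArg _ (funext fun sk => congrArg _ (funext fun r => PMF.bind_pure_comp _ _))
  | join S sk r =>
    simp only [traceHandler, traceAnswer]
    cases t.signers.find? fun e => e.1 == S with
    | some e => simp only [PMF.pure_map]; rfl
    | none =>
      split_ifs
      · simp only [PMF.map_comp]; exact PMF.bind_pure_comp _ _
      · simp only [PMF.pure_map]; rfl
  | corrupt S =>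
    simp only [traceHandler, traceAnswer]
    cases t.signers.find? fun e => e.1 == S with
    | none => simp only [PMF.pure_map]; rfl
    | some e => simp only [PMF.pure_map]; rfl

/-- The oracle of the traceability game on an encoded query. -/
theorem handle_traceHandler (n : ℕ) (pk skI : Bits) (t : TraceState) (q : TraceQuery) :
    handle (D.traceHandler n pk skI) t (encode q) =
      (D.traceAnswer n pk skI t q).map fun r => (encode r.1, r.2) := by
  rw [handle, decode_encode, ← traceHandler_eq]

end DAA

/-- The data that the reduction keeps fixed: the security parameter, the public key, the reference
string with its trapdoor, and the basename of forgeries. -/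
structure Fixed where
  n : ℕ
  pk : Bits
  ρ : Bits
  τ : Bits
  dom₀ : Bits

/-- The variable state of the reduction: a countdown to the creation of the target user, the
corrupted users, the database, the users `(U, sk, cred)` (without key for the target user), the
revocation list, the last name of a joined signer, the credential of the target, the messages
signed for the target, and a forgery. -/
structure Sim where
  cd : ℕ
  CU : List Bits
  ver : List (Bits × Bits)
  USK : List (Bits × Option Bits × Bits)
  RL : List Bits
  idc : Bits
  tgt : Option Bits
  log : List Bits
  forged : Bits

instance : Coding Fixed where
  encode c := encode (c.n, c.pk, c.ρ, c.τ, c.dom₀)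
  decode d := (decode d : Option (ℕ × Bits × Bits × Bits × Bits)).map
    fun x => ⟨x.1, x.2.1, x.2.2.1, x.2.2.2.1, x.2.2.2.2⟩
  decode_encode c := by simp [decode_encode]

instance : Coding Sim where
  encode c := encode (c.cd, c.CU, c.ver, c.USK, c.RL, c.idc, c.tgt, c.log, c.forged)
  decode d := (decode d : Option (ℕ × List Bits × List (Bits × Bits) ×
      List (Bits × Option Bits × Bits) × List Bits × Bits × Option Bits × List Bits × Bits)).map
    fun x => ⟨x.1, x.2.1, x.2.2.1, x.2.2.2.1, x.2.2.2.2.1, x.2.2.2.2.2.1, x.2.2.2.2.2.2.1,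
      x.2.2.2.2.2.2.2.1, x.2.2.2.2.2.2.2.2⟩
  decode_encode c := by simp [decode_encode]

instance : Coding DAA.TraceState where
  encode t := encode (t.signers, t.RL, t.signed)
  decode d := (decode d : Option (List (Bits × Bits × Bits) × List Bits ×
      List (Bits × Option Bits × Bits × Bits))).map fun x => ⟨x.1, x.2.1, x.2.2⟩
  decode_encode c := by simp [decode_encode]

/-- What remains to be done after the answer of the challenger: the creation of a user, the answer
to `JoinSystem`, or a comment of the target. -/
abbrev Cont := Option (Bits × Option Bits) ⊕ (Bits × Bits)

/-- An answer (`none` to stop the execution) and a new state, or a query to the challenger. -/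
abbrev Step := (Option Data × Fixed × Sim) ⊕ (DAA.TraceQuery × Fixed × Sim × Cont)

section

variable (D : LinkableDAA) (h : ℕ → Bits → Bits)
  (Pf : ProofSystem (Bits × Bits) (Bits × Bits)) (E₂ : ℕ → Bits → Bits → Bits × Bits → Bits →
    PMF (Bits × Bits))

/-- The state after a query for a credential for the key `sk`. -/
def Sim.addKey (m : Sim) (sk : Bits) : Sim :=
  { m with idc := true :: m.idc, RL := sk :: m.RL }

/-- The state of the challenger after the signer `S` has joined with the key `sk`. -/
def DAA.TraceState.addKey (t : DAA.TraceState) (S sk cred : Bits) : DAA.TraceState :=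
  { t with signers := (S, sk, cred) :: t.signers, RL := sk :: t.RL }

/-- The query for a credential for a known key. -/
def askJoin (c : Fixed) (m : Sim) (sk r : Bits) (o : Option (Bits × Option Bits)) : Step :=
  .inr (.join (true :: m.idc) sk r, c, m.addKey sk, .inl o)

/-- The attempt of a forgery with a key, or the query for a credential. -/
def tryForge (c : Fixed) (m : Sim) (sk r : Bits) (o : Option (Bits × Option Bits)) (σ : Bits) :
    Step :=
  if D.verify c.n c.pk [] (some c.dom₀) σ m.RL = true then .inl (none, c, { m with forged := σ })
  else askJoin c m sk r o

/-- A credential for a known key. If the target exists, first test whether the key is that of the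
target. -/
def keyIssue (c : Fixed) (m : Sim) (sk r : Bits) (o : Option (Bits × Option Bits)) : PMF Step :=
  match m.tgt with
  | none => PMF.pure (askJoin c m sk r o)
  | some cred => (D.sign c.n sk cred (some c.dom₀) []).map (tryForge D c m sk r o)

/-- Whether `U` is honest or corrupted. -/
def Sim.Known (m : Sim) (U : Bits) : Prop := (m.USK.find? fun e => e.1 == U).isSome ∨ U ∈ m.CU

instance (m : Sim) (U : Bits) : Decidable (m.Known U) := by unfold Sim.Known; infer_instance

/-- The creation of a user other than the target. -/
def createUser (c : Fixed) (m : Sim) (U : Bits) : PMF Step :=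
  (D.freshKey c.n).bind fun sk => (randomBits (D.coins.eval c.n)).bind fun r =>
    (Pf.createProof c.n c.ρ (D.join c.n c.pk sk r, c.pk) (sk, r)).bind fun π =>
      if Pf.verifyProof c.n c.ρ (D.join c.n c.pk sk r, c.pk) π = true then
        keyIssue D c m sk r (some (U, some sk))
      else PMF.pure (.inl (some (encode (none : Option Bits)), c, m))

/-- A comment of the user with entry `e`. -/
def commentStep (c : Fixed) (m : Sim) (dom x : Bits) (e : Bits × Option Bits × Bits) : PMF Step :=
  match e.2.1 with
  | none => PMF.pure (.inr (.sign [] (some dom) (h c.n x), c, { m with log := x :: m.log },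
      .inr (dom, h c.n x)))
  | some sk => (D.sign c.n sk e.2.2 (some dom) (h c.n x)).map fun σ =>
      .inl (some (encode (some (D.nymGen c.n sk dom, (σ, D.nymGen c.n sk dom, dom, h c.n x)))),
        c, m)

/-- The first part of an answer to a query of the adversary. -/
def queryStep (c : Fixed) (m : Sim) : Option (FrameQuery (Bits × Bits)) → PMF Step
  | none => PMF.pure (.inl (some .nil, c, m))
  | some (.corruptUser U) => PMF.pure (.inl (some (encode
      ((m.USK.find? fun e => e.1 == U).map fun e => (e.2.1.getD [], e.2.2))), c,
      { m with CU := U :: m.CU }))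
  | some (.corruptVer U V) =>
    PMF.pure (.inl (some (encode ()), c, { m with ver := (V, U) :: m.ver }))
  | some (.createHonestUser U V) =>
    if m.Known U then PMF.pure (.inl (some (encode (none : Option Bits)), c, m))
    else if m.cd = 1 then PMF.pure (.inr (.hjoin [], c,
      { m with ver := (V, U) :: m.ver, cd := m.cd - 1 }, .inl (some (U, none))))
    else createUser D Pf c { m with ver := (V, U) :: m.ver, cd := m.cd - 1 } U
  | some (.joinSystem U V j) =>
    if (¬ m.Known U ∧ (V, U) ∈ m.ver) ∧ Pf.verifyProof c.n c.ρ (j.1, c.pk) j.2 = true then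
      (E₂ c.n c.ρ c.τ (j.1, c.pk) j.2).bind fun w => keyIssue D c m w.1 w.2 none
    else PMF.pure (.inl (some (encode (none : Option Bits)), c, m))
  | some (.createComment U dom x) =>
    match m.USK.find? fun e => e.1 == U && decide (U ∉ m.CU) with
    | none => PMF.pure (.inl (some (encode (none : Option (Bits × Bits × Bits × Bits × Bits))), c, m))
    | some e => commentStep D h c m dom x e

/-- The second part, with the answer of the challenger. -/
def answerStep (k : Fixed × Sim × Cont) (a : Option Bits) : Data × Fixed × Sim :=
  match k.2.2 with
  | .inl none => (encode a, k.1, k.2.1)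
  | .inl (some (U, o)) => (encode a, k.1, { k.2.1 with
      USK := (U, o, a.getD []) :: k.2.1.USK, tgt := if o = none then a else k.2.1.tgt })
  | .inr (dom, hm) => (encode (a.map fun σ =>
      (D.nymExtract k.1.n σ, (σ, D.nymExtract k.1.n σ, dom, hm))), k.1, k.2.1)

/-- The state of the simulated game: the secret key of the issuer, the state of the reduction, and
the state of the challenger. -/
abbrev GameState := Bits × (Fixed × Sim) × DAA.TraceState

/-- The oracles of the adversary in the simulated game. -/
def simOracle (u : GameState) (d : Data) : PMF (Option Data × GameState) :=
  (simulate (fun b d => queryStep D h Pf E₂ b.1 b.2 (decode d)) (answerStep D)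
    (D.traceAnswer u.2.1.1.n u.2.1.1.pk u.1) u.2.1 u.2.2 d).map fun r => (r.1, u.1, r.2.1, r.2.2)

end

/-! ## The simulation -/

open Classical in
/-- The indicator of a proposition. -/
def ind (p : Prop) : ℝ≥0∞ := if p then 1 else 0

theorem ind_le_one (p : Prop) : ind p ≤ 1 := by unfold ind; split_ifs <;> simp

theorem ind_true {p : Prop} (hp : p) : ind p = 1 := if_pos hp

theorem ind_false {p : Prop} (hp : ¬ p) : ind p = 0 := if_neg hp

/-- The output `(S, σ, m, dom)` is a forgery. -/
def DAA.Forgery (D : DAA) (n : ℕ) (pk : Bits) (r : Bits × Bits × Bits × Option Bits)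
    (t : DAA.TraceState) : Prop :=
  D.verify n pk r.2.2.1 r.2.2.2 r.2.1 t.RL = true ∧ ¬ ∃ S', (S', r.2.2.2, r.2.2.1, r.2.1) ∈ t.signed

section

variable (D : LinkableDAA) (h : ℕ → Bits → Bits)
  (Pf : ProofSystem (Bits × Bits) (Bits × Bits)) (E₂ : ℕ → Bits → Bits → Bits × Bits → Bits →
    PMF (Bits × Bits))

/-- The completion of a step of the reduction. -/
def finishStep (u : GameState) : Step → PMF (Option Data × GameState)
  | .inl r => PMF.pure (r.1, u.1, r.2, u.2.2)
  | .inr q => (D.traceAnswer u.2.1.1.n u.2.1.1.pk u.1 u.2.2 q.1).map fun r =>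
    (some (answerStep D q.2 r.1).1, u.1, (answerStep D q.2 r.1).2, r.2)

theorem simOracle_eq (u : GameState) (d : Data) : simOracle D h Pf E₂ u d =
    (queryStep D h Pf E₂ u.2.1.1 u.2.1.2 (decode d)).bind (finishStep D u) := by
  rw [simOracle, simulate, PMF.map_bind]
  congr 1
  funext s
  cases s with
  | inl r => simp [finishStep, PMF.pure_map]
  | inr q => simp only [finishStep, PMF.map_comp]; rfl

/-- The probability that a signature for the basename of forgeries is rejected. -/
def rejectProb (c : Fixed) (sk cred : Bits) : ℝ≥0∞ :=
  ev (D.sign c.n sk cred (some c.dom₀) []) fun σ =>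
    ind (D.verify c.n c.pk [] (some c.dom₀) σ [] ≠ true)

/-- The error of the simulation before the creation of the target. -/
def initialError (c : Fixed) (skI : Bits) (N : ℕ) : ℝ≥0∞ :=
  (ev (D.freshKey c.n) fun sk => ev (randomBits (D.coins.eval c.n)) fun r =>
    ev (D.issue c.n skI (D.join c.n c.pk sk r)) fun cred => rejectProb D c sk cred) +
  N * ⨆ k, D.freshKey c.n k

/-- The error of the simulation. -/
def simError (N : ℕ) (u : GameState) : ℝ≥0∞ :=
  match u.2.2.signers.find? fun e => e.1 == [] with
  | none => initialError D u.2.1.1 u.1 N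
  | some e => rejectProb D u.2.1.1 e.2.1 e.2.2

/-- The value of a stopped simulation. -/
def forgeryValue (c : Fixed) (u : GameState) : ℝ≥0∞ :=
  ind (D.Forgery c.n c.pk ([], u.2.1.2.forged, [], some u.2.1.1.dom₀) u.2.2)

/-- The value of an answer of the simulation. -/
def stepValue (c : Fixed) (g₂ : Data → GameState → ℝ≥0∞) (r : Option Data × GameState) : ℝ≥0∞ :=
  match r.1 with
  | none => forgeryValue D c r.2
  | some a => g₂ a r.2

theorem ev_finishStep_inl (u : GameState) (r : Option Data × Fixed × Sim)
    (K : Option Data × GameState → ℝ≥0∞) :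
    ev (finishStep D u (.inl r)) K = K (r.1, u.1, r.2, u.2.2) := ev_pure _ _

variable {D} in
/-- No key has the same pseudonym as another one. -/
def NymInjective (D : LinkableDAA) (n : ℕ) : Prop :=
  ∀ sk sk' dom, D.isKey n sk = true → D.isKey n sk' = true →
    D.nymGen n sk dom = D.nymGen n sk' dom → sk = sk'

variable {D}

/-- Being linked means having equal pseudonyms, and all signatures with `sk'` for `dom` have the
pseudonym of `sk'`; so a link would identify the two keys. -/
theorem not_createdWith (hlink : D.InstantlyLinkable) {n : ℕ} (hinj : NymInjective D n)
    {sk sk' dom σ : Bits} (hsk : D.isKey n sk = true) (hsk' : D.isKey n sk' = true)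
    (hne : sk' ≠ sk) (hσ : D.nymExtract n σ = D.nymGen n sk dom) :
    ¬ D.CreatedWith n sk' dom σ := by
  rintro ⟨cred, m, σ', hσ', hl⟩
  rw [hlink.link_iff, ← hlink.nymGen_eq n sk' cred dom m hsk' σ' hσ', hσ] at hl
  exact hne (hinj _ _ _ hsk hsk' hl).symm

/-- A signature under a key that is not revoked is accepted under the revocation list if it is
accepted without. -/
theorem verify_revoked (hcorrect : D.toDAA.Correct) (hlink : D.InstantlyLinkable) {n : ℕ}
    (hinj : NymInjective D n) {pk m dom sk σ : Bits} {RL : List Bits} (hsk : D.isKey n sk = true)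
    (hRL : ∀ k ∈ RL, D.isKey n k = true) (hmem : sk ∉ RL)
    (hσ : D.nymExtract n σ = D.nymGen n sk dom) :
    D.verify n pk m (some dom) σ RL = true ↔ D.verify n pk m (some dom) σ [] = true := by
  rw [hcorrect.revocation n pk m dom σ RL hRL]
  refine ⟨And.left, fun hv => ⟨hv, fun k hk => ?_⟩⟩
  exact not_createdWith hlink hinj hsk (hRL k hk) (fun e => hmem (e ▸ hk)) hσ

/-- Names are made longer with every join, so the next one exceeds all names in use. The empty name
is left for the target. -/
theorem find_fresh {l : List (Bits × Bits × Bits)} {idc : Bits}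
    (hl : ∀ s ∈ l, s.1.length ≤ idc.length) : (l.find? fun e => e.1 == true :: idc) = none := by
  rw [List.find?_eq_none]
  intro s hs he
  have h1 := hl s hs
  have h2 : s.1 = true :: idc := by simpa using he
  rw [h2] at h1
  simp at h1

theorem ev_askJoin {u : GameState} {c : Fixed} {m : Sim} {sk r : Bits}
    {o : Option (Bits × Option Bits)} (hc : u.2.1.1 = c)
    (hnames : ∀ s ∈ u.2.2.signers, s.1.length ≤ m.idc.length) (hsk : D.isKey c.n sk = true)
    (hr : r.length = D.coins.eval c.n) (K : Option Data × GameState → ℝ≥0∞) :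
    ev (finishStep D u (askJoin c m sk r o)) K =
      ev (D.issue c.n u.1 (D.join c.n c.pk sk r)) fun cred =>
        K (some (answerStep D (c, m.addKey sk, .inl o) (some cred)).1, u.1,
          (answerStep D (c, m.addKey sk, .inl o) (some cred)).2,
          u.2.2.addKey (true :: m.idc) sk cred) := by
  subst hc
  simp only [finishStep, askJoin, DAA.traceAnswer, find_fresh hnames]
  rw [if_pos ⟨hsk, hr⟩, ev_map, ev_map]
  rfl

/-- The conditions for the issuing of a credential for a known key in the state `m`; the key and
the credential of the target are `E`. -/
structure Issuable (D : LinkableDAA) (c : Fixed) (u : GameState) (m : Sim)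
    (E : Option (Bits × Bits)) : Prop where
  fixed : u.2.1.1 = c
  RL : u.2.2.RL = m.RL
  RL_key : ∀ k ∈ m.RL, D.isKey c.n k = true
  names : ∀ s ∈ u.2.2.signers, s.1.length ≤ m.idc.length
  signer : (u.2.2.signers.find? fun e => e.1 == []) = E.map fun e => ([], e.1, e.2)
  tgt : m.tgt = E.map Prod.snd
  live : ∀ e, E = some e → D.isKey c.n e.1 = true ∧ e.1 ∉ m.RL
  signed : ∀ S hm σ, (S, some c.dom₀, hm, σ) ∉ u.2.2.signed

/-- The issuing of a credential for a known key. -/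
theorem keyIssue_le (hcorrect : D.toDAA.Correct) (hlink : D.InstantlyLinkable) {u : GameState}
    {c : Fixed} {m : Sim} {E : Option (Bits × Bits)} (hI : Issuable D c u m E)
    (hinj : NymInjective D c.n) {sk r : Bits} {o : Option (Bits × Option Bits)}
    (hsk : D.isKey c.n sk = true) (hr : r.length = D.coins.eval c.n) {N : ℕ} {X : Bits → ℝ≥0∞}
    {g₂ : Data → GameState → ℝ≥0∞} (hX1 : ∀ cred, X cred ≤ 1)
    (hX : (∀ e, E = some e → sk ≠ e.1) → ∀ cred,
      X cred ≤ g₂ (answerStep D (c, m.addKey sk, .inl o) (some cred)).1 (u.1,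
          (answerStep D (c, m.addKey sk, .inl o) (some cred)).2,
          u.2.2.addKey (true :: m.idc) sk cred) + simError D N u) :
    ev (D.issue c.n u.1 (D.join c.n c.pk sk r)) X ≤
      ev ((keyIssue D c m sk r o).bind (finishStep D u)) (stepValue D c g₂) + simError D N u := by
  have hask : (∀ e, E = some e → sk ≠ e.1) → ev (D.issue c.n u.1 (D.join c.n c.pk sk r)) X ≤
      ev (finishStep D u (askJoin c m sk r o)) (stepValue D c g₂) + simError D N u := fun hne => by
    rw [ev_askJoin hI.fixed hI.names hsk hr]
    exact ev_le_add fun cred _ => hX hne cred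
  have hX1' : ev (D.issue c.n u.1 (D.join c.n c.pk sk r)) X ≤ 1 := ev_le_one hX1
  cases E with
  | none =>
    have htgt : m.tgt = none := by simpa using hI.tgt
    simp only [keyIssue, htgt, PMF.pure_bind]
    exact hask (by simp)
  | some e =>
    have htgt : m.tgt = some e.2 := by simpa using hI.tgt
    obtain ⟨he1, he2⟩ := hI.live e rfl
    -- A successful test is a forgery whatever the key is, because nothing has been signed for the
    -- basename `c.dom₀`.
    have hhalt : ∀ σ, D.verify c.n c.pk [] (some c.dom₀) σ m.RL = true →
        ev (finishStep D u (tryForge D c m sk r o σ)) (stepValue D c g₂) = 1 := fun σ hσ => by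
      rw [tryForge, if_pos hσ, ev_finishStep_inl]
      refine ind_true ⟨?_, ?_⟩
      · rw [← hI.RL] at hσ; exact hσ
      · rintro ⟨S', hS'⟩; exact hI.signed _ _ _ hS'
    simp only [keyIssue, htgt, PMF.bind_map, ev_bind]
    -- If the key is the target's, listing it would ruin the simulation. But the whole future is
    -- worth at most `1`, which is the chance that the test signature is accepted plus the chance
    -- that it is rejected. The former is the value of stopping, the latter is exactly the permitted
    -- error. Acceptance under the empty list carries over to `m.RL` since the key is not yet
    -- listed.
    by_cases hne : sk = e.1
    · have herr : simError D N u = rejectProb D c sk e.2 := by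
        simp only [simError, hI.signer, Option.map_some, hI.fixed, hne]
      rw [herr, rejectProb, ← ev_add]
      refine hX1'.trans ((ev_const (D.sign c.n sk e.2 (some c.dom₀) []) 1).ge.trans
        (ev_mono fun σ hσ => ?_))
      by_cases hv : D.verify c.n c.pk [] (some c.dom₀) σ [] = true
      · have hv' := (verify_revoked hcorrect hlink hinj hsk hI.RL_key (hne ▸ he2)
          (hlink.nymGen_eq _ _ _ _ _ hsk σ hσ).symm).2 hv
        simp only [Function.comp, hhalt σ hv']
        exact le_self_add
      · rw [ind_true hv]
        exact le_add_self
    -- For another key the test does no harm: if it succeeds, the value is already the maximal `1`,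
    -- and if it fails, the run continues as in the experiment.
    · refine (ev_const (D.sign c.n sk e.2 (some c.dom₀) []) _).ge.trans
        (ev_le_add fun σ _ => ?_)
      by_cases hv : D.verify c.n c.pk [] (some c.dom₀) σ m.RL = true
      · simp only [Function.comp, hhalt σ hv]
        exact hX1'.trans le_self_add
      · simp only [Function.comp, tryForge, if_neg hv]
        exact hask (by simpa using hne)

end

/-! ### The experiment with a list of the created users -/

/-- Entries of the user database. -/
abbrev Entry := Bits × Bits × Bits × Bits

/-- The state of the experiment for the protocol. -/
abbrev FState := FrameState (Bits × Bits × Bits × Bits)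

open Classical in
/-- The list of the user that is created by a query; `none` if the issuer aborts. -/
def createdBy (t t' : FState) : Option (FrameQuery (Bits × Bits)) → List (Option Entry)
  | some (.createHonestUser U _) => if U ∈ t.HU ∨ U ∈ t.CU then []
    else [if t'.USK.length = t.USK.length then none else t'.USK.head?]
  | _ => []

section

variable (D : LinkableDAA) (h : ℕ → Bits → Bits) (Pf : ProofSystem (Bits × Bits) (Bits × Bits))

/-- The oracles of the experiment. -/
def frameOracle (c : Fixed) (skI : Bits) : Oracle FState :=
  handle ((protocol D h Pf).frameHandler (c.n, c.ρ) c.pk (c.pk, skI))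

/-- The oracles, with a list of the created users. -/
def ghostOracle (c : Fixed) (skI : Bits) : Oracle (FState × List (Option Entry)) := fun g d =>
  (frameOracle D h Pf c skI g.1 d).map fun r =>
    (r.1, r.2, g.2 ++ createdBy g.1 r.2 (decode d))

variable {D h Pf} {c : Fixed} {skI : Bits}

theorem frameOracle_eq (t : FState) (d : Data) : frameOracle D h Pf c skI t d =
    match (decode d : Option (FrameQuery (Bits × Bits))) with
    | none => PMF.pure (.nil, t)
    | some q => (protocol D h Pf).frameHandler (c.n, c.ρ) c.pk (c.pk, skI) t q := by
  rw [frameOracle, handle]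
  cases (decode d : Option (FrameQuery (Bits × Bits))) <;> rfl

theorem pmf_bind_eq {α β : Type} (μ : PMF α) (f : α → PMF β) : (μ >>= f) = μ.bind f := rfl

theorem pmf_pure_eq {α : Type} (a : α) : (Pure.pure a : PMF α) = PMF.pure a := rfl

/-- A new user in the state of the experiment. -/
def FrameState.addUser (t : FState) (U V sk cred : Bits) : FState :=
  { t with ver := (V, U) :: t.ver, USK := (U, sk, cred, V) :: t.USK, HU := U :: t.HU }

/-- The sampling is written out in the order in which the simulation performs it, so that the two
can be compared draw by draw. -/
theorem frameHandler_create {t : FState} {U V : Bits} (hU : ¬ (U ∈ t.HU ∨ U ∈ t.CU)) :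
    (protocol D h Pf).frameHandler (c.n, c.ρ) c.pk (c.pk, skI) t (.createHonestUser U V) =
      (D.freshKey c.n).bind fun sk => (randomBits (D.coins.eval c.n)).bind fun r =>
        (Pf.createProof c.n c.ρ (D.join c.n c.pk sk r, c.pk) (sk, r)).bind fun π =>
          if Pf.verifyProof c.n c.ρ (D.join c.n c.pk sk r, c.pk) π = true then
            (D.issue c.n skI (D.join c.n c.pk sk r)).map fun cred =>
              (encode (some cred), t.addUser U V sk cred)
          else PMF.pure (encode (none : Option Bits), { t with ver := (V, U) :: t.ver }) := by
  simp only [CommentingScheme.frameHandler, if_neg hU, CommentingScheme.joinIssue, protocol]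
  simp only [pmf_bind_eq, pmf_pure_eq, PMF.bind_bind, PMF.pure_bind]
  refine congrArg _ (funext fun sk => congrArg _ (funext fun r => congrArg _ (funext fun π => ?_)))
  split_ifs
  · simp only [PMF.bind_bind, PMF.pure_bind, Option.map_some, ← PMF.bind_pure_comp]
    rfl
  · simp only [PMF.pure_bind, Option.map_none]

theorem frameHandler_joinSystem {t : FState} {U V : Bits} {j : Bits × Bits} :
    (protocol D h Pf).frameHandler (c.n, c.ρ) c.pk (c.pk, skI) t (.joinSystem U V j) =
      if (¬ (U ∈ t.HU ∨ U ∈ t.CU) ∧ (V, U) ∈ t.ver) ∧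
          Pf.verifyProof c.n c.ρ (j.1, c.pk) j.2 = true then
        (D.issue c.n skI j.1).map fun cred => (encode (some cred), t)
      else PMF.pure (encode (none : Option Bits), t) := by
  simp only [CommentingScheme.frameHandler, protocol]
  simp only [pmf_bind_eq, pmf_pure_eq]
  by_cases h1 : U ∉ t.HU ∧ U ∉ t.CU ∧ (V, U) ∈ t.ver
  · rw [if_pos h1]
    by_cases h2 : Pf.verifyProof c.n c.ρ (j.1, c.pk) j.2 = true
    · rw [if_pos h2, if_pos (by tauto)]
      simp only [PMF.bind_bind, PMF.pure_bind, ← PMF.bind_pure_comp]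
      rfl
    · rw [if_neg h2, if_neg (by tauto), PMF.pure_bind]
  · rw [if_neg h1, if_neg (by tauto)]

/-- A comment in the state of the experiment. -/
def FrameState.addComment (t : FState) (U nym dom x : Bits) (γ : Bits × Bits × Bits × Bits) :
    FState := { t with COMM := (U, nym, dom, x, γ) :: t.COMM }

theorem frameHandler_comment {t : FState} {U dom x : Bits} :
    (protocol D h Pf).frameHandler (c.n, c.ρ) c.pk (c.pk, skI) t (.createComment U dom x) =
      match t.USK.find? fun e => e.1 == U && decide (U ∈ t.HU) with
      | none => PMF.pure (encode (none : Option (Bits × Bits × Bits × Bits × Bits)), t)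
      | some e => (D.sign c.n e.2.1 e.2.2.1 (some dom) (h c.n x)).map fun σ =>
          (encode (some (D.nymGen c.n e.2.1 dom, (σ, D.nymGen c.n e.2.1 dom, dom, h c.n x))),
            t.addComment U (D.nymGen c.n e.2.1 dom) dom x
              (σ, D.nymGen c.n e.2.1 dom, dom, h c.n x)) := by
  simp only [CommentingScheme.frameHandler, protocol]
  simp only [pmf_bind_eq, pmf_pure_eq]
  cases t.USK.find? fun e => e.1 == U && decide (U ∈ t.HU) with
  | none => rfl
  | some e =>
    simp only [PMF.bind_bind, PMF.pure_bind, ← PMF.bind_pure_comp]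
    rfl

end

/-! ## The relation between the experiment and the simulation -/

open Classical in
/-- The entry of the reduction for a user, if `E` is the entry of the target. -/
def view (E : Option Entry) (e : Entry) : Bits × Option Bits × Bits :=
  (e.1, if E = some e then none else some e.2.1, e.2.2.1)

section

/-- The states of the experiment and of the simulation correspond; the target is the user number
`j`, with the entry `E`, if it exists. At most `f` queries remain. -/
structure Sync (D : LinkableDAA) (h : ℕ → Bits → Bits) (c : Fixed) (j N : ℕ) (t : FState)
    (l : List (Option Entry)) (m : Sim) (τ : DAA.TraceState) (f : ℕ) (E : Option Entry) :
    Prop where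
  log_le : l.length + f ≤ N
  target : l[j]? = E.map some
  cd : m.cd = j + 1 - l.length
  CU : m.CU = t.CU
  ver : m.ver = t.ver
  HU : ∀ U, U ∈ t.HU ↔ (∃ e ∈ t.USK, e.1 = U) ∧ U ∉ t.CU
  USK : m.USK = t.USK.map (view E)
  RL : τ.RL = m.RL
  RL_key : ∀ k ∈ m.RL, D.isKey c.n k = true
  RL_len : m.RL.length + f ≤ N
  names : ∀ s ∈ τ.signers, s.1.length ≤ m.idc.length
  signer : (τ.signers.find? fun e => e.1 == []) = E.map fun e => ([], e.2.1, e.2.2.1)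
  tgt : m.tgt = E.map fun e => e.2.2.1
  live : ∀ e, E = some e → e ∈ t.USK ∧ e.1 ∉ t.CU ∧ D.isKey c.n e.2.1 = true ∧ e.2.1 ∉ m.RL
  signed : ∀ S dom hm σ, (S, dom, hm, σ) ∈ τ.signed → ∃ e dom' x, E = some e ∧ dom = some dom' ∧
    hm = h c.n x ∧ x ∈ m.log ∧ dom'.length < c.dom₀.length ∧
    (e.1, D.nymGen c.n e.2.1 dom', dom', x, (σ, D.nymGen c.n e.2.1 dom', dom', hm)) ∈ t.COMM

/-- The target cannot be framed any more. -/
def Dead (j : ℕ) (g : FState × List (Option Entry)) : Prop :=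
  g.2[j]? = some none ∨ ∃ e, g.2[j]? = some (some e) ∧ e.1 ∈ g.1.CU ∧ e.1 ∉ g.1.HU

variable {D : LinkableDAA} {h : ℕ → Bits → Bits} {Pf : ProofSystem (Bits × Bits) (Bits × Bits)}
  {E₂ : ℕ → Bits → Bits → Bits × Bits → Bits → PMF (Bits × Bits)}
  {c : Fixed} {skI : Bits} {j N f : ℕ} {t : FState} {l : List (Option Entry)} {m : Sim}
  {τ : DAA.TraceState} {E : Option Entry}

theorem Sync.mono (hS : Sync D h c j N t l m τ f E) {f' : ℕ} (hf : f' ≤ f) :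
    Sync D h c j N t l m τ f' E :=
  { hS with log_le := by have := hS.log_le; omega, RL_len := by have := hS.RL_len; omega }

/-- Entries of corrupted users stay in the database, and a user is honest when there is an entry and
no corruption. Hence the reduction can do without a list of honest users. -/
theorem Sync.known (hS : Sync D h c j N t l m τ f E) (U : Bits) :
    m.Known U ↔ U ∈ t.HU ∨ U ∈ t.CU := by
  have h1 : (m.USK.find? fun e => e.1 == U).isSome ↔ ∃ e ∈ t.USK, e.1 = U := by
    rw [hS.USK, List.find?_isSome]
    simp [view]
  rw [Sim.Known, h1, hS.CU, hS.HU]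
  by_cases hU : U ∈ t.CU <;> simp [hU]

theorem Sync.find (hS : Sync D h c j N t l m τ f E) {p : Bits × Option Bits × Bits → Bool}
    {p' : Entry → Bool} (hp : ∀ e ∈ t.USK, p (view E e) = p' e) :
    m.USK.find? p = (t.USK.find? p').map (view E) := by
  rw [hS.USK, List.find?_map]
  congr 1
  exact List.find?_congr fun e he => hp e he

theorem Sync.issuable (hS : Sync D h c j N t l m τ f E) {m' : Sim} (h1 : m'.RL = m.RL)
    (h2 : m'.idc = m.idc) (h3 : m'.tgt = m.tgt) (m₀ : Sim) :
    Issuable D c (skI, (c, m₀), τ) m' (E.map fun e => (e.2.1, e.2.2.1)) where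
  fixed := rfl
  RL := by rw [h1]; exact hS.RL
  RL_key := by rw [h1]; exact hS.RL_key
  names := by rw [h2]; exact hS.names
  signer := by rw [hS.signer]; cases E <;> rfl
  tgt := by rw [h3, hS.tgt]; cases E <;> rfl
  live := by
    intro e he
    obtain ⟨e', rfl, rfl⟩ := Option.map_eq_some_iff.1 he
    rw [h1]
    exact (hS.live e' rfl).2.2
  signed := by
    intro S hm σ hs
    obtain ⟨e, dom', x, -, h4, -, -, h5, -⟩ := hS.signed _ _ _ _ hs
    -- Every signed basename is strictly shorter than `c.dom₀`, hence different from it.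
    obtain rfl := Option.some.inj h4
    exact lt_irrefl _ h5

/-- The inequality with the target's key keeps that key off the list. A query lists at most one key,
so the loss of one remaining query pays for the growth of `m.RL`. -/
theorem Sync.addKey (hS : Sync D h c j N t l m τ f E) {sk : Bits} (cred : Bits)
    (hlen : m.RL.length + (f + 1) ≤ N) (hsk : D.isKey c.n sk = true) (hne : ∀ e, E = some e → sk ≠ e.2.1) :
    Sync D h c j N t l (m.addKey sk) (τ.addKey (true :: m.idc) sk cred) f E where
  log_le := hS.log_le
  target := hS.target
  cd := hS.cd
  CU := hS.CU
  ver := hS.ver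
  HU := hS.HU
  USK := hS.USK
  RL := congrArg (sk :: ·) hS.RL
  RL_key := by
    intro k hk
    rcases List.mem_cons.1 hk with rfl | hk
    exacts [hsk, hS.RL_key k hk]
  RL_len := by simp only [Sim.addKey, List.length_cons]; omega
  names := by
    intro s hs
    rcases List.mem_cons.1 hs with rfl | hs
    · exact le_rfl
    · exact (hS.names s hs).trans (Nat.le_succ _)
  signer := by rw [← hS.signer]; rfl
  tgt := hS.tgt
  live := by
    intro e he
    obtain ⟨h1, h2, h3, h4⟩ := hS.live e he
    refine ⟨h1, h2, h3, ?_⟩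
    simp only [Sim.addKey, List.mem_cons, not_or]
    exact ⟨fun h => hne e he h.symm, h4⟩
  signed := hS.signed

theorem getElem?_append_single {α : Type*} {l : List α} {j : ℕ} (x : α) (hj : l.length ≠ j) :
    (l ++ [x])[j]? = l[j]? := by
  rcases lt_or_gt_of_ne hj with h | h
  · rw [List.getElem?_eq_none (by simp; omega), List.getElem?_eq_none (by omega)]
  · rw [List.getElem?_append_left h]

/-- An attempt of creating a user. -/
theorem Sync.attempt (hS : Sync D h c j N t l m τ (f + 1) E) (hj : l.length ≠ j) (U V : Bits)
    (x : Option Entry) : Sync D h c j N { t with ver := (V, U) :: t.ver } (l ++ [x])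
      { m with ver := (V, U) :: m.ver, cd := m.cd - 1 } τ f E :=
  { hS with
    log_le := by have := hS.log_le; simp; omega
    target := by rw [getElem?_append_single _ hj]; exact hS.target
    cd := by have := hS.cd; simp; omega
    ver := by simp [hS.ver]
    RL_len := by have := hS.RL_len; simp; omega }

theorem Sync.addUser (hS : Sync D h c j N t l m τ f E) {U V sk cred : Bits}
    (hU : ¬ (U ∈ t.HU ∨ U ∈ t.CU)) :
    Sync D h c j N { t with USK := (U, sk, cred, V) :: t.USK, HU := U :: t.HU } l
      { m with USK := (U, some sk, cred) :: m.USK } τ f E :=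
  { hS with
    HU := by
      intro U'
      have := hS.HU U'
      have h2 : U ∉ t.CU := fun h => hU (.inr h)
      by_cases e : U' = U
      · subst e; simp [h2]
      · simp [e, this, Ne.symm e]
    USK := by
      -- The target is honest already whereas `U` is not, so the new entry is not that of the
      -- target.
      have hne : E ≠ some (U, sk, cred, V) := fun hE => by
        obtain ⟨h1, h2, -⟩ := hS.live _ hE
        exact hU (.inl ((hS.HU U).2 ⟨⟨_, h1, rfl⟩, h2⟩))
      simp [view, hne, hS.USK]
    live := fun e he => by
      obtain ⟨h1, h2⟩ := hS.live e he
      exact ⟨List.mem_cons_of_mem _ h1, h2⟩ }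

theorem createdBy_addUser {U V sk cred : Bits} (hU : ¬ (U ∈ t.HU ∨ U ∈ t.CU)) :
    createdBy t (t.addUser U V sk cred) (some (.createHonestUser U V)) =
      [some (U, sk, cred, V)] := by
  simp [createdBy, hU, FrameState.addUser]

theorem createdBy_ver {U V : Bits} {ver : List (Bits × Bits)} (hU : ¬ (U ∈ t.HU ∨ U ∈ t.CU)) :
    createdBy t { t with ver := ver } (some (.createHonestUser U V)) = [none] := by
  simp [createdBy, hU]

/-- Union bound over the list. -/
theorem ev_ind_mem_le {α : Type*} (μ : PMF α) (l : List α) :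
    ev μ (fun a => ind (a ∈ l)) ≤ l.length * ⨆ k, μ k := by
  classical
  induction l with
  | nil => simp [ind, ev_const μ 0]
  | cons b l ih =>
    have h1 : ev μ (fun a => ind (a = b)) ≤ ⨆ k, μ k := by
      refine le_trans (le_of_eq ?_) (le_iSup (fun k => μ k) b)
      rw [ev, tsum_eq_single b]
      · simp [ind]
      · intro a ha; simp [ind, ha]
    calc ev μ (fun a => ind (a ∈ b :: l))
        ≤ ev μ (fun a => ind (a = b) + ind (a ∈ l)) := ev_mono fun a _ => by
          by_cases h1 : a = b
          · rw [ind_true h1]; exact (ind_le_one _).trans le_self_add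
          · by_cases h2 : a ∈ l
            · rw [ind_true h2]; exact (ind_le_one _).trans le_add_self
            · simp [ind, h1, h2]
      _ ≤ (⨆ k, μ k) + l.length * ⨆ k, μ k := by rw [ev_add]; exact add_le_add h1 ih
      _ = _ := by push_cast [List.length_cons]; ring

end

/-! ### The simulation of single queries -/

section

variable {D : LinkableDAA} {h : ℕ → Bits → Bits} {Pf : ProofSystem (Bits × Bits) (Bits × Bits)}
  {E₂ : ℕ → Bits → Bits → Bits × Bits → Bits → PMF (Bits × Bits)}
  {c : Fixed} {skI : Bits} {j N f : ℕ} {t : FState} {l : List (Option Entry)} {m : Sim}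
  {τ : DAA.TraceState} {E : Option Entry} {g₁ : Data × FState × List (Option Entry) → ℝ≥0∞}
  {g₂ : Data → GameState → ℝ≥0∞}

/-- The values of the answers in the experiment are bounded by those in the simulation. -/
structure Bound (D : LinkableDAA) (h : ℕ → Bits → Bits) (c : Fixed) (skI : Bits) (j N f : ℕ)
    (g₁ : Data × FState × List (Option Entry) → ℝ≥0∞) (g₂ : Data → GameState → ℝ≥0∞) : Prop where
  le_one : ∀ r, g₁ r ≤ 1
  dead : ∀ a g, Dead j g → g₁ (a, g) = 0
  sync : ∀ a t l m τ E, Sync D h c j N t l m τ f E →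
    g₁ (a, t, l) ≤ g₂ a (skI, (c, m), τ) + simError D N (skI, (c, m), τ)

theorem le_answer {X : ℝ≥0∞} {ε : ℝ≥0∞} {u : GameState} {a : Data} {b : Fixed × Sim}
    (hX : X ≤ g₂ a (u.1, b, u.2.2) + ε) :
    X ≤ ev ((PMF.pure (Sum.inl (some a, b)) : PMF Step).bind (finishStep D u)) (stepValue D c g₂) + ε := by
  rw [PMF.pure_bind, ev_finishStep_inl]; exact hX

/-- Once the target is corrupted it cannot be framed, so the experiment is worth `0` and the wrong
key in the simulated answer is irrelevant. Of all other users the reduction knows the key. -/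
theorem corruptUser_le (hS : Sync D h c j N t l m τ (f + 1) E)
    (hB : Bound D h c skI j N f g₁ g₂) (U : Bits) :
    ev ((protocol D h Pf).frameHandler (c.n, c.ρ) c.pk (c.pk, skI) t (.corruptUser U))
      (fun r => g₁ (r.1, r.2, l ++ createdBy t r.2 (some (.corruptUser U)))) ≤
    ev ((queryStep D h Pf E₂ c m (some (.corruptUser U))).bind (finishStep D (skI, (c, m), τ)))
      (stepValue D c g₂) + simError D N (skI, (c, m), τ) := by
  refine (ev_pure _ _).trans_le ?_
  simp only [createdBy, List.append_nil]
  by_cases hE : ∃ e, E = some e ∧ e.1 = U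
  · obtain ⟨e, rfl, rfl⟩ := hE
    rw [hB.dead _ _ (.inr ⟨e, by simpa using hS.target, by simp, by simp⟩)]
    exact bot_le
  · refine le_answer ?_
    have hfind := hS.find (p := fun e => e.1 == U) (p' := fun e => e.1 == U) fun e _ => rfl
    have hans : ((m.USK.find? fun e => e.1 == U).map fun e => (e.2.1.getD [], e.2.2)) =
        (t.USK.find? fun e => e.1 == U).map fun e => (e.2.1, e.2.2.1) := by
      rw [hfind]
      cases he : t.USK.find? fun e => e.1 == U with
      | none => rfl
      | some e =>
        have h1 : e.1 = U := by simpa using List.find?_some he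
        have h2 : E ≠ some e := fun h => hE ⟨e, h, h1⟩
        simp [view, h2]
    rw [hans]
    refine hB.sync _ _ _ _ _ E { hS.mono (Nat.le_succ f) with
      CU := congrArg (U :: ·) hS.CU
      HU := fun U' => ?_
      live := fun e he => ?_ }
    · have := hS.HU U'
      simp [this]
      tauto
    · obtain ⟨h1, h2, h3⟩ := hS.live e he
      refine ⟨h1, ?_, h3⟩
      simp only [List.mem_cons, not_or]
      exact ⟨fun h => hE ⟨e, he, h⟩, h2⟩

theorem corruptVer_le (hS : Sync D h c j N t l m τ (f + 1) E)
    (hB : Bound D h c skI j N f g₁ g₂) (U V : Bits) :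
    ev ((protocol D h Pf).frameHandler (c.n, c.ρ) c.pk (c.pk, skI) t (.corruptVer U V))
      (fun r => g₁ (r.1, r.2, l ++ createdBy t r.2 (some (.corruptVer U V)))) ≤
    ev ((queryStep D h Pf E₂ c m (some (.corruptVer U V))).bind (finishStep D (skI, (c, m), τ)))
      (stepValue D c g₂) + simError D N (skI, (c, m), τ) := by
  refine (ev_pure _ _).trans_le ?_
  simp only [createdBy, List.append_nil]
  exact le_answer (hB.sync _ _ _ _ _ E { hS.mono (Nat.le_succ f) with
    ver := congrArg ((V, U) :: ·) hS.ver })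

/-- The extracted key and coins reproduce the adversary's commitment, so the challenger issues
exactly the credential that the experiment would issue. The randomness of the extractor has no
counterpart in the experiment, whose value is constant in it. -/
theorem joinSystem_le (hcorrect : D.toDAA.Correct) (hlink : D.InstantlyLinkable)
    (hinj : NymInjective D c.n) (hE₂ : ∀ x π, Pf.verifyProof c.n c.ρ x π = true →
      ∀ w ∈ (E₂ c.n c.ρ c.τ x π).support, D.joinRel c.n x w)
    (hS : Sync D h c j N t l m τ (f + 1) E)
    (hB : Bound D h c skI j N f g₁ g₂) (U V : Bits) (i : Bits × Bits) :
    ev ((protocol D h Pf).frameHandler (c.n, c.ρ) c.pk (c.pk, skI) t (.joinSystem U V i))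
      (fun r => g₁ (r.1, r.2, l ++ createdBy t r.2 (some (.joinSystem U V i)))) ≤
    ev ((queryStep D h Pf E₂ c m (some (.joinSystem U V i))).bind (finishStep D (skI, (c, m), τ)))
      (stepValue D c g₂) + simError D N (skI, (c, m), τ) := by
  rw [frameHandler_joinSystem]
  simp only [createdBy, List.append_nil, queryStep, hS.known, hS.ver]
  split_ifs with hif
  · rw [ev_map, PMF.bind_bind, ev_bind]
    refine (ev_const (E₂ c.n c.ρ c.τ (i.1, c.pk) i.2) _).ge.trans (ev_le_add fun w hw => ?_)
    obtain ⟨hk, hr, hcom⟩ := hE₂ _ _ hif.2 w hw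
    dsimp only at hcom
    rw [hcom]
    refine keyIssue_le (u := (skI, (c, m), τ)) hcorrect hlink (hS.issuable rfl rfl rfl m) hinj hk hr (fun _ => hB.le_one _)
      fun hne cred => ?_
    have hS' := (hS.mono (Nat.le_succ f)).addKey cred hS.RL_len hk fun e he => by
      simpa using hne (e.2.1, e.2.2.1) (by simp [he])
    refine (hB.sync _ _ _ _ _ E hS').trans (le_of_eq ?_)
    congr 1
  · refine (ev_pure _ _).trans_le (le_answer ?_)
    exact hB.sync _ _ _ _ _ E (hS.mono (Nat.le_succ f))

/-- The target's key is unknown to the reduction, but the pseudonym of a comment can be read off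
from the signature. Each signature recorded by the challenger is matched with the comment in `COMM`
it belongs to; this will turn a repeated signature into a collision. -/
theorem createComment_le (hlink : D.InstantlyLinkable)
    (hS : Sync D h c j N t l m τ (f + 1) E) (hB : Bound D h c skI j N f g₁ g₂)
    (U dom x : Bits) (hdom : dom.length < c.dom₀.length) :
    ev ((protocol D h Pf).frameHandler (c.n, c.ρ) c.pk (c.pk, skI) t (.createComment U dom x))
      (fun r => g₁ (r.1, r.2, l ++ createdBy t r.2 (some (.createComment U dom x)))) ≤
    ev ((queryStep D h Pf E₂ c m (some (.createComment U dom x))).bind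
      (finishStep D (skI, (c, m), τ))) (stepValue D c g₂) + simError D N (skI, (c, m), τ) := by
  rw [frameHandler_comment]
  have hfind := hS.find (p := fun e => e.1 == U && decide (U ∉ m.CU))
    (p' := fun e => e.1 == U && decide (U ∈ t.HU)) fun e he => by
      rw [hS.CU]
      by_cases h1 : e.1 = U
      · have := hS.HU U
        have h2 : ∃ e ∈ t.USK, e.1 = U := ⟨e, he, h1⟩
        simp [view, h1, this, h2]
      · have h2 : (e.1 == U) = false := beq_eq_false_iff_ne.2 h1
        simp [view, h2]
  simp only [createdBy, List.append_nil, queryStep, hfind]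
  cases he : t.USK.find? fun e => e.1 == U && decide (U ∈ t.HU) with
  | none =>
    refine (ev_pure _ _).trans_le (le_answer ?_)
    exact hB.sync _ _ _ _ _ E (hS.mono (Nat.le_succ f))
  | some e =>
    simp only [Option.map_some, commentStep, view]
    have hU : e.1 = U := by
      have := List.find?_some he
      simp at this; exact this.1
    by_cases hE : E = some e
    · obtain ⟨h1, h2, h3, h4⟩ := hS.live e hE
      have hsig : (τ.signers.find? fun e => e.1 == []) = some ([], e.2.1, e.2.2.1) := by
        rw [hS.signer, hE]; rfl
      simp only [hE, if_true, PMF.pure_bind, finishStep, DAA.traceAnswer, hsig, ev_map]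
      refine ev_le_add fun σ hσ => ?_
      have hnym := hlink.nymGen_eq _ _ _ _ _ h3 σ hσ
      simp only [Function.comp, stepValue, answerStep, Option.map_some, ← hnym]
      refine (hB.sync _ (t.addComment U (D.nymGen c.n e.2.1 dom) dom x
        (σ, D.nymGen c.n e.2.1 dom, dom, h c.n x)) _ { m with log := x :: m.log }
        { τ with signed := ([], some dom, h c.n x, σ) :: τ.signed } E
        { hS.mono (Nat.le_succ f) with signed := fun S d hm σ' hs => ?_ }).trans (le_of_eq ?_)
      · rcases List.mem_cons.1 hs with hs | hs
        · simp only [Prod.mk.injEq] at hs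
          obtain ⟨rfl, rfl, rfl, rfl⟩ := hs
          refine ⟨e, dom, x, hE, rfl, rfl, by simp, hdom, ?_⟩
          rw [hU]
          exact List.mem_cons_self
        · obtain ⟨e', dom', x', h5, h6, h7, h8, h9, h10⟩ := hS.signed _ _ _ _ hs
          exact ⟨e', dom', x', h5, h6, h7, List.mem_cons_of_mem _ h8, h9,
            List.mem_cons_of_mem _ h10⟩
      · congr 1
    · simp only [hE, if_false, PMF.bind_map, ev_map, ev_bind]
      refine ev_le_add fun σ hσ => ?_
      simp only [Function.comp, ev_finishStep_inl]
      refine hB.sync _ _ _ _ _ E { hS.mono (Nat.le_succ f) with signed := fun S d hm σ' hs => ?_ }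
      obtain ⟨e', dom', x', h5, h6, h7, h8, h9, h10⟩ := hS.signed _ _ _ _ hs
      exact ⟨e', dom', x', h5, h6, h7, h8, h9, List.mem_cons_of_mem _ h10⟩

/-- The creation of the target. -/
theorem createTarget_le (hS : Sync D h c j N t l m τ (f + 1) E) (hB : Bound D h c skI j N f g₁ g₂)
    {U V : Bits} (hU : ¬ (U ∈ t.HU ∨ U ∈ t.CU)) (hcd : m.cd = 1) :
    ev ((protocol D h Pf).frameHandler (c.n, c.ρ) c.pk (c.pk, skI) t (.createHonestUser U V))
      (fun r => g₁ (r.1, r.2, l ++ createdBy t r.2 (some (.createHonestUser U V)))) ≤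
    ev ((queryStep D h Pf E₂ c m (some (.createHonestUser U V))).bind
      (finishStep D (skI, (c, m), τ))) (stepValue D c g₂) + simError D N (skI, (c, m), τ) := by
  -- The countdown starts at `j + 1` and drops with each attempted creation, so it is `1` exactly
  -- after `j` attempts.
  have hlen : l.length = j := by have := hS.cd; omega
  obtain rfl : E = none := by
    have := hS.target
    rw [List.getElem?_eq_none (by omega)] at this
    cases E <;> simp_all
  have hsig : (τ.signers.find? fun e => e.1 == []) = none := by rw [hS.signer]; rfl
  rw [frameHandler_create hU]
  simp only [queryStep, hS.known, hU, if_false, hcd, if_true, PMF.pure_bind, finishStep,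
    DAA.traceAnswer, hsig, simError, initialError, ev_map, ev_bind]
  have hend : ev (D.freshKey c.n) (fun sk => ind (sk ∈ m.RL)) ≤ N * ⨆ k, D.freshKey c.n k := by
    refine (ev_ind_mem_le _ _).trans ?_
    gcongr
    have := hS.RL_len
    omega
  -- The event that the fresh key is already listed is charged to the second summand of
  -- `initialError`. The first summand is the average of `rejectProb` over the key and the
  -- credential that are sampled at this moment.
  refine le_trans ?_ (add_le_add_right (add_le_add_right hend _) _)
  simp only [← ev_add]
  refine ev_mono fun sk hsk => ?_
  rw [← ev_const (randomBits (D.coins.eval c.n)) (ind (sk ∈ m.RL)), ← ev_add, ← ev_add]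
  refine ev_mono fun r hr => ?_
  rw [← ev_const (D.issue c.n skI (D.join c.n c.pk sk r)) (ind (sk ∈ m.RL)), ← ev_add, ← ev_add]
  -- In the experiment the target also proves knowledge of its key, in the challenger's `HJoin` it
  -- does not. If the proof is rejected, the target never comes into being and the value is `0`; so
  -- the proof can be averaged away.
  refine (ev_mono (g' := fun _ => _) fun π _ => ?_).trans (ev_const _ _).le
  split_ifs
  · rw [ev_map]
    refine ev_mono fun cred _ => ?_
    simp only [Function.comp, createdBy_addUser hU]
    by_cases hmem : sk ∈ m.RL
    · rw [ind_true hmem]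
      exact (hB.le_one _).trans (le_add_self.trans le_add_self)
    · set e : Entry := (U, sk, cred, V) with he
      have hview : ∀ e' ∈ t.USK, view none e' = view (some e) e' := fun e' he' => by
        have : e ≠ e' := fun h => by
          have hc : U ∉ t.CU := fun h => hU (.inr h)
          exact hU (.inl ((hS.HU U).2 ⟨⟨e', he', by rw [← h]⟩, hc⟩))
        simp [view, this]
      refine (hB.sync _ (t.addUser U V sk cred) (l ++ [some e]) { m with
        ver := (V, U) :: m.ver, cd := 0, USK := (U, none, cred) :: m.USK, tgt := some cred }
        { τ with signers := ([], sk, cred) :: τ.signers } (some e) ?_).trans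
          (le_trans (le_of_eq ?_) (add_le_add_right le_self_add _))
      · refine { hS.mono (Nat.le_succ f) with
          log_le := by have := hS.log_le; simp; omega
          target := by simp [← hlen]
          cd := by simp; omega
          ver := congrArg ((V, U) :: ·) hS.ver
          HU := fun U' => ?_
          USK := ?_
          names := fun s hs => ?_
          signer := by simp [he]
          tgt := rfl
          live := fun e' he' => ?_
          signed := fun S d hm σ hs => ?_ }
        · have := hS.HU U'
          have h2 : U ∉ t.CU := fun h => hU (.inr h)
          by_cases e : U' = U
          · subst e; simp [FrameState.addUser, h2]
          · simp [FrameState.addUser, e, this, Ne.symm e]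
        · simp only [FrameState.addUser, List.map_cons, hS.USK, List.map_congr_left hview]
          simp [view, he]
        · rcases List.mem_cons.1 hs with rfl | hs
          · simp
          · exact hS.names s hs
        · obtain rfl := Option.some.inj he'
          exact ⟨List.mem_cons_self, fun h => hU (.inr h), D.isKey_of_freshKey c.n sk hsk, hmem⟩
        · obtain ⟨e, -, -, h, -⟩ := hS.signed _ _ _ _ hs
          cases h
      · simp [stepValue, answerStep, simError]
  · rw [ev_pure, createdBy_ver hU, hB.dead _ _ (.inl (by simp [hlen]))]
    exact bot_le

/-- The creation of another user. -/
theorem createOther_le (hcorrect : D.toDAA.Correct) (hlink : D.InstantlyLinkable)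
    (hinj : NymInjective D c.n) (hS : Sync D h c j N t l m τ (f + 1) E)
    (hB : Bound D h c skI j N f g₁ g₂)
    {U V : Bits} (hU : ¬ (U ∈ t.HU ∨ U ∈ t.CU)) (hcd : m.cd ≠ 1) :
    ev ((protocol D h Pf).frameHandler (c.n, c.ρ) c.pk (c.pk, skI) t (.createHonestUser U V))
      (fun r => g₁ (r.1, r.2, l ++ createdBy t r.2 (some (.createHonestUser U V)))) ≤
    ev ((queryStep D h Pf E₂ c m (some (.createHonestUser U V))).bind
      (finishStep D (skI, (c, m), τ))) (stepValue D c g₂) + simError D N (skI, (c, m), τ) := by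
  have hlen : l.length ≠ j := by have := hS.cd; omega
  rw [frameHandler_create hU]
  simp only [queryStep, hS.known, hU, if_false, hcd, createUser, PMF.bind_bind, ev_bind]
  refine ev_le_add fun sk hsk => ev_le_add fun r hr => ev_le_add fun π _ => ?_
  have hk := D.isKey_of_freshKey c.n sk hsk
  rw [← ev_bind]
  split_ifs with hv
  · rw [ev_map]
    simp only [Function.comp_def, createdBy_addUser hU]
    refine keyIssue_le (u := (skI, (c, m), τ)) hcorrect hlink
      (hS.issuable (m' := { m with ver := (V, U) :: m.ver, cd := m.cd - 1 }) rfl rfl rfl m) hinj hk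
      (randomBits_length hr) (fun _ => hB.le_one _) fun hne cred => ?_
    have hS' := ((hS.attempt hlen U V (some (U, sk, cred, V))).addKey cred hS.RL_len hk
      fun e he => by simpa using hne (e.2.1, e.2.2.1) (by simp [he])).addUser (V := V)
        (cred := cred) (sk := sk) hU
    refine (hB.sync _ _ _ _ _ E hS').trans (le_of_eq ?_)
    simp [answerStep, Sim.addKey, simError, DAA.TraceState.addKey]
  · refine (ev_pure _ _).trans_le (le_answer ?_)
    rw [createdBy_ver hU]
    exact hB.sync _ _ _ _ _ E (hS.attempt hlen U V none)

theorem createKnown_le (hS : Sync D h c j N t l m τ (f + 1) E) (hB : Bound D h c skI j N f g₁ g₂)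
    {U V : Bits} (hU : U ∈ t.HU ∨ U ∈ t.CU) :
    ev ((protocol D h Pf).frameHandler (c.n, c.ρ) c.pk (c.pk, skI) t (.createHonestUser U V))
      (fun r => g₁ (r.1, r.2, l ++ createdBy t r.2 (some (.createHonestUser U V)))) ≤
    ev ((queryStep D h Pf E₂ c m (some (.createHonestUser U V))).bind
      (finishStep D (skI, (c, m), τ))) (stepValue D c g₂) + simError D N (skI, (c, m), τ) := by
  simp only [CommentingScheme.frameHandler, queryStep, hS.known, hU, if_true, createdBy,
    List.append_nil]
  refine (ev_pure _ _).trans_le (le_answer ?_)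
  exact hB.sync _ _ _ _ _ E (hS.mono (Nat.le_succ f))

/-- A query in the experiment and in the simulation. -/
theorem query_le (hcorrect : D.toDAA.Correct) (hlink : D.InstantlyLinkable)
    (hinj : NymInjective D c.n) (hE₂ : ∀ x π, Pf.verifyProof c.n c.ρ x π = true →
      ∀ w ∈ (E₂ c.n c.ρ c.τ x π).support, D.joinRel c.n x w)
    (hS : Sync D h c j N t l m τ (f + 1) E) (hB : Bound D h c skI j N f g₁ g₂) (d : Data)
    (hdom : ∀ U dom x, (decode d : Option (FrameQuery (Bits × Bits))) =
      some (.createComment U dom x) → dom.length < c.dom₀.length) :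
    ev (ghostOracle D h Pf c skI (t, l) d) g₁ ≤
      ev (simOracle D h Pf E₂ (skI, (c, m), τ) d) (stepValue D c g₂) +
        simError D N (skI, (c, m), τ) := by
  rw [simOracle_eq, ghostOracle, ev_map, frameOracle_eq]
  generalize (decode d : Option (FrameQuery (Bits × Bits))) = q at hdom ⊢
  cases q with
  | none =>
    refine (ev_pure _ _).trans_le (le_answer ?_)
    simp only [Function.comp, createdBy, List.append_nil]
    exact hB.sync _ _ _ _ _ E (hS.mono (Nat.le_succ f))
  | some q =>
    cases q with
    | corruptUser U => exact corruptUser_le hS hB U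
    | corruptVer U V => exact corruptVer_le hS hB U V
    | createHonestUser U V =>
      by_cases hU : U ∈ t.HU ∨ U ∈ t.CU
      · exact createKnown_le hS hB hU
      · by_cases hcd : m.cd = 1
        · exact createTarget_le hS hB hU hcd
        · exact createOther_le hcorrect hlink hinj hS hB hU hcd
    | joinSystem U V i => exact joinSystem_le hcorrect hlink hinj hE₂ hS hB U V i
    | createComment U dom x => exact createComment_le hlink hS hB U dom x (hdom U dom x rfl)

end

/-- Outputs of adversaries in the experiment. -/
abbrev FrameOut := Bits × Bits × Bits × Bits × Bits × Bits × Bits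

/-! ### From the framing of some user to the framing of user number `j` -/

section

variable (D : LinkableDAA) (h : ℕ → Bits → Bits)

/-- The output `(nym, dom, m, γ)` is a new comment that is accepted. -/
def NewComment (c : Fixed) (t : FState) (o : FrameOut) : Prop :=
  (o.2.2.2.2.1 = o.1 ∧ o.2.2.2.2.2.1 = o.2.1 ∧
    D.verify c.n c.pk o.2.2.2.2.2.2 (some o.2.1) o.2.2.2.1 [] = true ∧
    h c.n o.2.2.1 = o.2.2.2.2.2.2 ∧ D.nymExtract c.n o.2.2.2.1 = o.1 ∧
    D.verifyBsn c.n o.2.2.2.1 o.2.1 = true) ∧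
  ¬ ∃ U, (U, o.1, o.2.1, o.2.2.1, o.2.2.2) ∈ t.COMM

/-- The output frames some honest user. -/
def Framed (c : Fixed) (t : FState) (o : FrameOut) : Prop :=
  NewComment D h c t o ∧ ∃ e ∈ t.USK, e.1 ∈ t.HU ∧ o.1 = D.nymGen c.n e.2.1 o.2.1

/-- The output frames the user number `j`. -/
def FramedAt (c : Fixed) (j : ℕ) (g : FState × List (Option Entry)) (o : FrameOut) : Prop :=
  NewComment D h c g.1 o ∧ ∃ e, g.2[j]? = some (some e) ∧ e.1 ∈ g.1.HU ∧
    o.1 = D.nymGen c.n e.2.1 o.2.1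

/-- The value of a final configuration for a property of the output. -/
def outValue {T : Type} (P : T → FrameOut → Prop) (z : Config T) : ℝ≥0∞ :=
  orZero (fun o => ind (P z.2.1 o)) (decode (z.1 0))

theorem outValue_le_one {T : Type} (P : T → FrameOut → Prop) (z : Config T) :
    outValue P z ≤ 1 := by
  unfold outValue
  cases (decode (z.1 0) : Option FrameOut) with
  | none => simp [orZero]
  | some o => exact ind_le_one _

variable {D h} {Pf : ProofSystem (Bits × Bits) (Bits × Bits)} {c : Fixed} {skI : Bits}

/-- Only a creation adds an entry to the user database, and no oracle makes a corrupted user honest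
again. The log of created users and the notion `Dead` depend on these facts. -/
theorem frameHandler_support {t : FState} {q : FrameQuery (Bits × Bits)} {r : Data × FState}
    (hr : r ∈ ((protocol D h Pf).frameHandler (c.n, c.ρ) c.pk (c.pk, skI) t q).support) :
    (r.2.USK = t.USK ∨ ∃ U V e, q = .createHonestUser U V ∧ ¬ (U ∈ t.HU ∨ U ∈ t.CU) ∧
      r.2.USK = e :: t.USK) ∧ ∀ U ∈ t.CU, U ∉ t.HU → U ∈ r.2.CU ∧ U ∉ r.2.HU := by
  cases q with
  | corruptUser U =>
    obtain rfl := (PMF.mem_support_pure_iff _ _).1 hr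
    exact ⟨.inl rfl, fun U' h1 h2 => ⟨List.mem_cons_of_mem _ h1, by simp [h2]⟩⟩
  | corruptVer U V =>
    obtain rfl := (PMF.mem_support_pure_iff _ _).1 hr
    exact ⟨.inl rfl, fun U' h1 h2 => ⟨h1, h2⟩⟩
  | createHonestUser U V =>
    by_cases hU : U ∈ t.HU ∨ U ∈ t.CU
    · simp only [CommentingScheme.frameHandler, hU, if_true] at hr
      obtain rfl := (PMF.mem_support_pure_iff _ _).1 hr
      exact ⟨.inl rfl, fun U' h1 h2 => ⟨h1, h2⟩⟩
    · rw [frameHandler_create hU] at hr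
      simp only [PMF.mem_support_bind_iff] at hr
      obtain ⟨sk, -, r', -, π, -, hr⟩ := hr
      split_ifs at hr
      · rw [PMF.support_map] at hr
        obtain ⟨cred, -, rfl⟩ := hr
        refine ⟨.inr ⟨U, V, _, rfl, hU, rfl⟩, fun U' h1 h2 => ⟨h1, ?_⟩⟩
        simp only [FrameState.addUser, List.mem_cons, not_or]
        exact ⟨fun e => hU (.inr (e ▸ h1)), h2⟩
      · obtain rfl := (PMF.mem_support_pure_iff _ _).1 hr
        exact ⟨.inl rfl, fun U' h1 h2 => ⟨h1, h2⟩⟩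
  | joinSystem U V i =>
    rw [frameHandler_joinSystem] at hr
    split_ifs at hr
    · rw [PMF.support_map] at hr
      obtain ⟨cred, -, rfl⟩ := hr
      exact ⟨.inl rfl, fun U' h1 h2 => ⟨h1, h2⟩⟩
    · obtain rfl := (PMF.mem_support_pure_iff _ _).1 hr
      exact ⟨.inl rfl, fun U' h1 h2 => ⟨h1, h2⟩⟩
  | createComment U dom x =>
    rw [frameHandler_comment] at hr
    cases he : t.USK.find? fun e => e.1 == U && decide (U ∈ t.HU) with
    | none =>
      rw [he] at hr
      obtain rfl := (PMF.mem_support_pure_iff _ _).1 hr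
      exact ⟨.inl rfl, fun U' h1 h2 => ⟨h1, h2⟩⟩
    | some e =>
      rw [he] at hr
      simp only [PMF.support_map] at hr
      obtain ⟨σ, -, rfl⟩ := hr
      exact ⟨.inl rfl, fun U' h1 h2 => ⟨h1, h2⟩⟩

theorem ghostOracle_support {g : FState × List (Option Entry)} {d : Data}
    {r : Data × FState × List (Option Entry)} (hr : r ∈ (ghostOracle D h Pf c skI g d).support) :
    (∃ x, r.2.2 = g.2 ++ x ∧ x.length ≤ 1 ∧ ∀ e ∈ r.2.1.USK, e ∈ g.1.USK ∨ some e ∈ x) ∧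
      ∀ U ∈ g.1.CU, U ∉ g.1.HU → U ∈ r.2.1.CU ∧ U ∉ r.2.1.HU := by
  rw [ghostOracle, PMF.support_map] at hr
  obtain ⟨r', hr', rfl⟩ := hr
  rw [frameOracle_eq] at hr'
  dsimp only
  cases hq : (decode d : Option (FrameQuery (Bits × Bits))) with
  | none =>
    rw [hq] at hr'
    obtain rfl := (PMF.mem_support_pure_iff _ _).1 hr'
    exact ⟨⟨[], rfl, by simp, fun e he => .inl he⟩, fun U h1 h2 => ⟨h1, h2⟩⟩
  | some q =>
    rw [hq] at hr'
    obtain ⟨h1, h2⟩ := frameHandler_support hr'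
    refine ⟨⟨_, rfl, ?_, fun e he => ?_⟩, h2⟩
    · unfold createdBy
      split
      · split_ifs <;> simp
      · simp
    · rcases h1 with h1 | ⟨U, V, e', rfl, hU, h1⟩
      · exact .inl (h1 ▸ he)
      · rw [h1] at he
        rcases List.mem_cons.1 he with rfl | he
        · right; simp [createdBy, hU, h1]
        · exact .inl he

/-- The log grows at its end only, so entry number `j` is permanent, and so is corruption. -/
theorem Dead.ghostOracle {j : ℕ} {g : FState × List (Option Entry)} (hd : Dead j g) (d : Data)
    {r : Data × FState × List (Option Entry)} (hr : r ∈ (ghostOracle D h Pf c skI g d).support) :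
    Dead j r.2 := by
  obtain ⟨⟨x, hx, -, -⟩, h2⟩ := ghostOracle_support hr
  have hmono : ∀ a, g.2[j]? = some a → r.2.2[j]? = some a := fun a ha => by
    rw [hx, List.getElem?_append_left (List.getElem?_eq_some_iff.1 ha).1, ha]
  rcases hd with hd | ⟨e, he, h3, h4⟩
  · exact .inl (hmono _ hd)
  · exact .inr ⟨e, hmono _ he, h2 _ h3 h4⟩

/-- The list of the created users does not influence an execution. -/
theorem exec_ghostOracle (p : Prog) (s : Store) (g : FState × List (Option Entry)) (f : ℕ) :
    (exec (ghostOracle D h Pf c skI) p (s, g, f)).map (Option.map fun z => (z.1, z.2.1.1, z.2.2)) =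
      exec (frameOracle D h Pf c skI) p (s, g.1, f) := by
  set π : Option (Config (FState × List (Option Entry))) → Option (Config FState) :=
    Option.map fun z => (z.1, z.2.1.1, z.2.2) with hπ
  have hassign : ∀ x v k s (g : FState × List (Option Entry)) f,
      π (assign x v k s g f) = assign x v k s g.1 f := by
    intro x v k s g f
    unfold assign
    split_ifs <;> rfl
  have hseq : ∀ (q : Prog) (hq : ∀ s g f, (exec (ghostOracle D h Pf c skI) q (s, g, f)).map π =
      exec (frameOracle D h Pf c skI) q (s, g.1, f)) (r : Option (Config _)),
      (andThen (ghostOracle D h Pf c skI) q r).map π = andThen (frameOracle D h Pf c skI) q (π r) := by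
    intro q hq r
    cases r with
    | none => exact PMF.pure_map _ _
    | some z => exact hq z.1 z.2.1 z.2.2
  induction p generalizing s g f with
  | setNil x | copy x _ | cons x _ _ | hd x _ | tl x _ | eq x _ _ =>
    simp only [exec, PMF.pure_map, hassign]
  | toss x => simp only [exec, PMF.map_comp, Function.comp_def, hassign]
  | query x y => simp only [exec, ghostOracle, PMF.map_comp, Function.comp_def, hassign]
  | seq p q ihp ihq =>
    rw [exec_seq, exec_seq, ← ihp, PMF.map_bind, PMF.bind_map]
    congr 1
    funext r
    exact hseq q ihq r
  | ite x p q ihp ihq =>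
    cases f with
    | zero => simp only [exec, PMF.pure_map]; rfl
    | succ f =>
      simp only [exec]
      split_ifs
      · exact ihq _ _ _
      · exact ihp _ _ _
  | loop x p ih =>
    have key : ∀ F s g f, f ≤ F → (exec (ghostOracle D h Pf c skI) (.loop x p) (s, g, f)).map π =
        exec (frameOracle D h Pf c skI) (.loop x p) (s, g.1, f) := by
      intro F
      induction F with
      | zero =>
        intro s g f hf
        obtain rfl : f = 0 := by omega
        rw [exec_loop_zero, exec_loop_zero, PMF.pure_map]; rfl
      | succ F ihF =>
        intro s g f hf
        cases f with
        | zero => rw [exec_loop_zero, exec_loop_zero, PMF.pure_map]; rfl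
        | succ f =>
          rw [exec_loop_succ, exec_loop_succ]
          split_ifs
          · rw [PMF.pure_map]; rfl
          · rw [← ih, PMF.map_bind, PMF.bind_map]
            refine bind_congr_support fun r hr => ?_
            cases r with
            | none => exact PMF.pure_map _ _
            | some z =>
              have := exec_fuel_le hr
              exact ihF z.1 z.2.1 z.2.2 (by omega)
    exact key f s g f le_rfl

theorem ind_exists_le {ι : Type*} (s : Finset ι) (P : ι → Prop) :
    ind (∃ i ∈ s, P i) ≤ ∑ i ∈ s, ind (P i) := by
  by_cases h : ∃ i ∈ s, P i
  · obtain ⟨i, hi, hP⟩ := h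
    exact (by rw [ind_true hP]; exact ind_le_one _ : _ ≤ ind (P i)).trans
      (Finset.single_le_sum (f := fun i => ind (P i)) (fun _ _ => bot_le) hi)
  · rw [ind_false h]; exact bot_le

/-- To frame some user is to frame one of the created users. -/
theorem ev_framed_le (p : Prog) (s : Store) (N : ℕ) {t : FState} (ht : t.USK = []) :
    ev (exec (frameOracle D h Pf c skI) p (s, t, N)) (orZero (outValue (Framed D h c))) ≤
      ∑ j ∈ Finset.range N, ev (exec (ghostOracle D h Pf c skI) p (s, (t, []), N))
        (orZero (outValue (FramedAt D h c j))) := by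
  rw [← exec_ghostOracle p s (t, []) N, ev_map, ← ev_sum]
  refine ev_mono fun r hr => ?_
  cases r with
  | none => simp [orZero]
  | some z =>
    -- Each entry of the user database is logged, and each entry of the log has cost at least one
    -- time unit. Hence the framed user has a number below `N`.
    obtain ⟨h1, h2⟩ := exec_invariant (I := fun _ (g : FState × List (Option Entry)) f =>
      (∀ e ∈ g.1.USK, some e ∈ g.2) ∧ g.2.length + f ≤ N) (m := p.width)
      (fun s g f x v k _ h _ hk => ⟨h.1, by have := h.2; omega⟩)
      (fun s g f x y r _ h hr hk => by
        obtain ⟨⟨x, hx, hx1, hx2⟩, -⟩ := ghostOracle_support hr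
        refine ⟨fun e he => ?_, ?_⟩
        · rw [hx, List.mem_append]
          exact (hx2 e he).imp (h.1 e) id
        · have := h.2
          have := r.1.size_pos
          rw [hx, List.length_append]; omega)
      (fun s g f h => ⟨h.1, by have := h.2; omega⟩) p le_rfl s (t, []) N
      ⟨by simp [ht], by simp⟩ z hr
    simp only [Function.comp, Option.map_some, orZero, outValue]
    cases (decode (z.1 0) : Option FrameOut) with
    | none => exact bot_le
    | some o =>
      show ind (Framed D h c z.2.1.1 o) ≤ _
      refine le_trans ?_ (ind_exists_le (Finset.range N) fun j => FramedAt D h c j z.2.1 o)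
      by_cases hF : Framed D h c z.2.1.1 o
      · obtain ⟨h3, e, he, h4, h5⟩ := hF
        obtain ⟨j, hj, hje⟩ := List.mem_iff_getElem.1 (h1 e he)
        rw [ind_true (⟨j, by simp; omega, h3, e, by rw [List.getElem?_eq_getElem hj, hje], h4, h5⟩ :
          ∃ j ∈ Finset.range N, FramedAt D h c j z.2.1 o)]
        exact ind_le_one _
      · rw [ind_false hF]; exact bot_le

end

/-! ### The final outputs of the reductions -/

section

/-- The initial state of the reduction for the user number `j`. -/
def Sim.start (j : ℕ) : Sim := ⟨j + 1, [], [], [], [], [], none, [], []⟩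

/-- The initial state of the experiment. -/
def FState.start : FState := ⟨[], [], [], [], [], []⟩

variable (D : LinkableDAA) (h : ℕ → Bits → Bits)

/-- The output of the reduction to traceability. -/
def forgeryOutput (flag : Bool) (b : Fixed × Sim) (out : Data) : Bits × Bits × Bits × Option Bits :=
  if flag then ([], b.2.forged, [], some b.1.dom₀)
  else match (decode out : Option FrameOut) with
    | none => ([], [], [], none)
    | some o => ([], o.2.2.2.1, h b.1.n o.2.2.1, some o.2.1)

/-- The output of the reduction to collision resistance. -/
def collisionOutput (b : Fixed × Sim) (out : Data) : Bits × Bits :=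
  match (decode out : Option FrameOut) with
  | none => ([], [])
  | some o =>
    match b.2.log.find? fun y => decide (y ≠ o.2.2.1) && decide (h b.1.n y = h b.1.n o.2.2.1) with
    | none => ([], [])
    | some y => (y, o.2.2.1)

/-- A collision. -/
def Collision (n : ℕ) (r : Bits × Bits) : Prop := r.1 ≠ r.2 ∧ h n r.1 = h n r.2

/-- The value of the final output of the reduction to traceability. -/
def forgeryFinal : Val GameState := fun s u _ =>
  ind (D.Forgery u.2.1.1.n u.2.1.1.pk (forgeryOutput h false u.2.1 (s 0)) u.2.2)

/-- The value of the final output of the reduction to collision resistance. -/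
def collisionFinal : Val GameState := fun s u _ =>
  ind (Collision h u.2.1.1.n (collisionOutput h u.2.1 (s 0)))

variable {D h} {Pf : ProofSystem (Bits × Bits) (Bits × Bits)}
  {E₂ : ℕ → Bits → Bits → Bits × Bits → Bits → PMF (Bits × Bits)}
  {c : Fixed} {skI : Bits} {j N f : ℕ} {t : FState} {l : List (Option Entry)} {m : Sim}
  {τ : DAA.TraceState} {E : Option Entry}

/-- If the challenger returned `σ` for this basename and hash value, it did so for a comment on some
`x`; the framing comment being new, `x` is another message with the same hash value. Otherwise `σ`
is a forgery: the target's key is not listed, so acceptance under the empty list implies acceptance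
under the revocation list. -/
theorem framedAt_final (hcorrect : D.toDAA.Correct) (hlink : D.InstantlyLinkable)
    (hinj : NymInjective D c.n) (hS : Sync D h c j N t l m τ f E) (s : Store) :
    outValue (FramedAt D h c j) (s, (t, l), f) ≤
      (forgeryFinal D h + collisionFinal h) s (skI, (c, m), τ) f := by
  simp only [outValue, Pi.add_apply, forgeryFinal, collisionFinal, forgeryOutput, collisionOutput]
  cases (decode (s 0) : Option FrameOut) with
  | none => exact bot_le
  | some o =>
    simp only [orZero, Bool.false_eq_true, if_false]
    by_cases hF : FramedAt D h c j (t, l) o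
    · obtain ⟨⟨⟨h1, h2, h3, h4, h5, h6⟩, h7⟩, e, he, h8, h9⟩ := hF
      have hE : E = some e := by
        have := hS.target
        rw [he] at this
        cases E <;> simp_all
      obtain ⟨h10, h11, h12, h13⟩ := hS.live e hE
      by_cases hs : ∃ S', (S', some o.2.1, h c.n o.2.2.1, o.2.2.2.1) ∈ τ.signed
      · obtain ⟨S', hs⟩ := hs
        obtain ⟨e', dom', x, h14, h15, h16, h17, -, h18⟩ := hS.signed _ _ _ _ hs
        obtain rfl : e = e' := Option.some.inj (hE.symm.trans h14)
        obtain rfl := Option.some.inj h15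
        have hne : x ≠ o.2.2.1 := by
          rintro rfl
          refine h7 ⟨e.1, ?_⟩
          rw [← h9, h4] at h18
          convert h18 using 4
          exact Prod.ext rfl (Prod.ext rfl (Prod.ext h1 (Prod.ext h2 rfl)))
        -- The search may return a message other than `x`, but every hit is a collision.
        have hsome : (m.log.find? fun y => decide (y ≠ o.2.2.1) &&
            decide (h c.n y = h c.n o.2.2.1)).isSome := by
          rw [List.find?_isSome]
          exact ⟨x, h17, by simp [hne, h16]⟩
        obtain ⟨y, hy⟩ := Option.isSome_iff_exists.1 hsome
        have hy' := List.find?_some hy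
        simp only [Bool.and_eq_true, decide_eq_true_eq] at hy'
        rw [hy, ind_true (p := Collision h c.n (y, o.2.2.1)) hy']
        exact (ind_le_one _).trans le_add_self
      · refine le_trans ?_ le_self_add
        rw [ind_true (p := D.Forgery c.n c.pk ([], o.2.2.2.1, h c.n o.2.2.1, some o.2.1) τ)]
        · exact ind_le_one _
        · refine ⟨?_, hs⟩
          rw [hS.RL]
          refine (verify_revoked hcorrect hlink hinj h12 hS.RL_key h13 (h5.trans h9)).2 ?_
          rw [h4]; exact h3
    · rw [ind_false hF]; exact bot_le

/-- The probability that the user number `j` is framed. -/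
theorem ev_framedAt_le (hcorrect : D.toDAA.Correct) (hlink : D.InstantlyLinkable)
    (hinj : NymInjective D c.n) (hE₂ : ∀ x π, Pf.verifyProof c.n c.ρ x π = true →
      ∀ w ∈ (E₂ c.n c.ρ c.τ x π).support, D.joinRel c.n x w) {M : ℕ}
    (hdom : ∀ d : Data, d.size ≤ M → ∀ U dom x,
      (decode d : Option (FrameQuery (Bits × Bits))) = some (.createComment U dom x) →
        dom.length < c.dom₀.length) (p : Prog) (input : Data) (hM : input.size + N ≤ M) :
    ev (exec (ghostOracle D h Pf c skI) p (st input, (.start, []), N))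
      (orZero (outValue (FramedAt D h c j))) ≤
    wp (simOracle D h Pf E₂) (forgeryValue D c) p (forgeryFinal D h) (st input)
        (skI, (c, .start j), ⟨[], [], []⟩) N +
      wp (simOracle D h Pf E₂) 0 p (collisionFinal h) (st input)
        (skI, (c, .start j), ⟨[], [], []⟩) N + initialError D c skI N := by
  have hstart : Sync D h c j N .start [] (.start j) ⟨[], [], []⟩ N none := by
    constructor <;> simp [Sim.start, FState.start]
  have hadd := congrFun (congrFun (congrFun (wp_add (κ := simOracle D h Pf E₂) (w := forgeryValue D c)
    0 p (forgeryFinal D h) (collisionFinal h)) (st input)) (skI, (c, .start j), ⟨[], [], []⟩)) N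
  simp only [Pi.add_apply] at hadd
  rw [← hadd, add_zero]
  -- The error is a function of the simulated state, whereas the entry `E` is quantified
  -- existentially, as the target appears only in the course of the run.
  refine ev_exec_le_wp (Dead := Dead j) (M := M) (ε := simError D N)
    (Rel := fun g u f => u.1 = skI ∧ u.2.1.1 = c ∧ ∃ E, Sync D h c j N g.1 g.2 u.2.1.2 u.2.2 f E)
    (fun g d hg r hr => hg.ghostOracle d hr) ?_ ?_ p _ _ (outValue_le_one _) ?_ ?_ _ _ _ _
    ⟨rfl, rfl, none, hstart⟩ ?_
  · rintro g u f f' ⟨h1, h2, E, h3⟩ hf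
    exact ⟨h1, h2, E, h3.mono hf⟩
  · rintro ⟨t, l⟩ ⟨x, ⟨c', m⟩, τ⟩ f d g₁ g₂ ⟨h1, h2, E, hS⟩ hd h4 h5 h6
    dsimp only at h1 h2 hS
    subst h1 h2
    exact query_le hcorrect hlink hinj hE₂ hS
      ⟨h4, fun a g hg => h5 a g hg, fun a t l m τ E hS => h6 a (t, l) (_, (_, m), τ)
        ⟨rfl, rfl, E, hS⟩⟩ d (hdom d (by omega))
  · rintro s g f hg
    simp only [outValue]
    cases (decode (s 0) : Option FrameOut) with
    | none => rfl
    | some o =>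
      refine ind_false ?_
      rintro ⟨-, e, he, h1, -⟩
      rcases hg with hg | ⟨e', he', -, h2⟩
      · rw [he] at hg; simp at hg
      · rw [he] at he'
        obtain rfl : e = e' := by simpa using he'
        exact h2 h1
  · rintro s ⟨t, l⟩ ⟨x, ⟨c', m⟩, τ⟩ f ⟨h1, h2, E, hS⟩ -
    dsimp only at h1 h2 hS
    subst h1 h2
    exact (framedAt_final hcorrect hlink hinj hS s).trans le_self_add
  · intro x
    have := st_size_le input x
    omega

end

/-! ## Efficiency of the reductions -/

section

variable {ι : Type*} {α β : Type} [Coding α] [Coding β] {x y : ι → Data} {F : ι → PMF Data}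

/-- The values `a` extend the input `x`, reindexed by `e`, to `x'`. -/
structure Extends {κ : Type*} (x : ι → Data) (e : κ → ι) (a : κ → α) (x' : κ → Data) : Prop where
  lift : ∀ ⦃y : ι → Data⦄, Det x y → Det x' fun k => y (e k)
  added : Det x' fun k => encode (a k)

theorem Extends.cons {κ : Type*} (x : ι → Data) (e : κ → ι) (a : κ → α) :
    Extends x e a fun k => .cons (encode (a k)) (x (e k)) :=
  ⟨fun _ h => Det.right (h.reindex e), Det.left Det.id⟩

end

section

universe u

variable {ι : Type u} {α β : Type} [Coding α] [Coding β] {x y : ι → Data} {F : ι → PMF Data}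

/-- The branches are stated for arbitrary index types and for any input that extends `x` by the
content of the option. Thus nested case distinctions do not pile up explicit subtypes. -/
theorem Eff.cases_option {o : ι → Option α} (ho : Det x fun i => encode (o i))
    (h0 : ∀ {κ : Type u} (e : κ → ι), (∀ k, o (e k) = none) →
      Eff (fun k => x (e k)) fun k => F (e k))
    (h1 : ∀ {κ : Type u} (e : κ → ι) (a : κ → α) (x' : κ → Data), Extends x e a x' →
      (∀ k, o (e k) = some (a k)) → Eff x' fun k => F (e k)) : Eff x F := by
  classical
  refine Eff.ite (P := fun i => o i = none) (ho.isNil.congr fun i => ?_)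
    (h0 Subtype.val fun j => j.2) ?_
  · congr 1; exact decide_eq_decide.2 encode_option_eq_nil
  · choose a ha using fun j : {i // ¬ o i = none} => Option.ne_none_iff_exists'.1 j.2
    exact h1 Subtype.val a _ ⟨fun y h => h.reindex Subtype.val, (ho.reindex Subtype.val).ofSome ha⟩ ha

theorem Eff.cases_sum {o : ι → α ⊕ β} (ho : Det x fun i => encode (o i))
    (h0 : ∀ {κ : Type u} (e : κ → ι) (a : κ → α) (x' : κ → Data), Extends x e a x' →
      (∀ k, o (e k) = .inl (a k)) → Eff x' fun k => F (e k))
    (h1 : ∀ {κ : Type u} (e : κ → ι) (a : κ → β) (x' : κ → Data), Extends x e a x' →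
      (∀ k, o (e k) = .inr (a k)) → Eff x' fun k => F (e k)) : Eff x F := by
  refine Eff.ite (P := fun i => (o i).isLeft = true) (ho.head.isNil.congr fun i => ?_) ?_ ?_
  · congr 1; cases o i <;> simp [encode, Data.head]
  · choose a ha using fun j : {i // (o i).isLeft = true} => Sum.isLeft_iff.1 j.2
    refine h0 Subtype.val a _ ⟨fun y h => h.reindex Subtype.val,
      ((ho.reindex Subtype.val).tail.congr fun j => ?_)⟩ ha
    rw [ha]; rfl
  · choose a ha using fun j : {i // ¬ (o i).isLeft = true} =>
      Sum.isRight_iff.1 (by simpa using j.2)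
    refine h1 Subtype.val a _ ⟨fun y h => h.reindex Subtype.val,
      ((ho.reindex Subtype.val).tail.congr fun j => ?_)⟩ ha
    rw [ha]; rfl

theorem Eff.bindEncode {f : ι → PMF α} {G : ι → α → PMF β}
    (hF : Eff x fun i => (f i).map encode)
    (hG : ∀ {κ : Type u} (e : κ → ι) (a : κ → α) (x' : κ → Data), Extends x e a x' →
      Eff x' fun k => (G (e k) (a k)).map encode) : Eff x fun i => ((f i).bind (G i)).map encode :=
  (hF.bindCode (G := fun i a => (G i a).map encode) (hG _ _ _ (Extends.cons _ _ _))).congr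
    fun i => by rw [PMF.map_bind]

theorem Eff.mapEncode {f : ι → PMF α} {g : ι → α → β}
    (hF : Eff x fun i => (f i).map encode)
    (hG : ∀ {κ : Type u} (e : κ → ι) (a : κ → α) (x' : κ → Data), Extends x e a x' →
      Det x' fun k => encode (g (e k) (a k))) : Eff x fun i => ((f i).map (g i)).map encode :=
  (hF.mapCode (hG _ _ _ (Extends.cons _ _ _))).congr fun _ => (PMF.map_comp _ _ _).symm

theorem Eff.pureCode {a : ι → α} (h : Det x fun i => encode (a i)) :
    Eff x fun i => (PMF.pure (a i)).map encode := Eff.congr h fun i => by rw [PMF.pure_map]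

theorem Det.inl {a : ι → α} (h : Det x fun i => encode (a i)) :
    Det x fun i => encode (Sum.inl (a i) : α ⊕ β) := Det.nil.cons h

theorem Det.inr {b : ι → β} (h : Det x fun i => encode (b i)) :
    Det x fun i => encode (Sum.inr (b i) : α ⊕ β) := (Det.const (.cons .nil .nil)).cons h

theorem Eff.iteCode {P : ι → Prop} [DecidablePred P] {f g : ι → PMF α}
    (hb : Det x fun i => encode (decide (P i)))
    (h1 : Eff (fun j : {i // P i} => x j) fun j => (f j).map encode)
    (h0 : Eff (fun j : {i // ¬ P i} => x j) fun j => (g j).map encode) :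
    Eff x fun i => (if P i then f i else g i).map encode :=
  Eff.ite hb (h1.congr fun j => by rw [if_pos j.2]) (h0.congr fun j => by rw [if_neg j.2])

theorem Det.iteCode {P : ι → Prop} [DecidablePred P] {f g : ι → α}
    (hb : Det x fun i => encode (decide (P i)))
    (h1 : Det (fun j : {i // P i} => x j) fun j => encode (f j))
    (h0 : Det (fun j : {i // ¬ P i} => x j) fun j => encode (g j)) :
    Det x fun i => encode (if P i then f i else g i) :=
  Det.ite hb (h1.congr fun j => by rw [if_pos j.2]) (h0.congr fun j => by rw [if_neg j.2])

theorem Det.eqTrue {b : ι → Bool} (hb : Det x fun i => encode (b i)) :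
    Det x fun i => encode (decide (b i = true)) := hb.congr fun i => by simp

theorem Det.getD {o : ι → Option α} (h : Det x fun i => encode (o i)) {a : α} :
    Det x fun i => encode ((o i).getD a) := by
  refine Eff.cases_option h (fun e he => ?_) (fun e b x' hx he => ?_)
  · exact (Det.const (encode a)).congr fun j => by simp only [he]; rfl
  · exact hx.added.congr fun j => by simp only [he]; rfl

theorem Det.mapOption {o : ι → Option α} {g : ι → α → β} (h : Det x fun i => encode (o i))
    (hg : ∀ {κ : Type u} (e : κ → ι) (a : κ → α) (x' : κ → Data), Extends x e a x' →
      Det x' fun k => encode (g (e k) (a k))) : Det x fun i => encode ((o i).map (g i)) := by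
  refine Eff.cases_option h (fun e he => ?_) (fun e b x' hx he => ?_)
  · exact Det.nil.congr fun j => by simp only [he]; rfl
  · exact (hg e b x' hx).encSome.congr fun j => by simp only [he]; rfl

theorem Det.findCode {l : ι → List α} {p : ι → α → Bool} (hl : Det x fun i => encode (l i))
    (hp : ∀ {κ : Type u} (e : κ → ι) (a : κ → α) (x' : κ → Data), Extends x e a x' →
      Det x' fun k => encode (p (e k) (a k))) : Det x fun i => encode ((l i).find? (p i)) :=
  Det.find hl (hp (fun j : {j : ι × α // j.2 ∈ l j.1} => j.1.1) (fun j => j.1.2) _ ⟨fun _ h => Det.left (h.reindex _),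
    Det.right Det.id⟩)

theorem Det.beq [BEq α] [LawfulBEq α] {a b : ι → α} (ha : Det x fun i => encode (a i))
    (hb : Det x fun i => encode (b i)) : Det x fun i => encode (a i == b i) := by
  classical
  exact (Det.eqCode ha hb).congr fun i => by congr 1; rw [Bool.eq_iff_iff]; simp

theorem Det.memCode {l : ι → List α} {a : ι → α} [∀ i, Decidable (a i ∈ l i)]
    (hl : Det x fun i => encode (l i)) (ha : Det x fun i => encode (a i)) :
    Det x fun i => encode (decide (a i ∈ l i)) := by
  classical
  exact (Det.mem hl ha).congr fun i => by congr

theorem Det.length {l : ι → Bits} (h : Det x fun i => encode (l i)) :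
    Det x fun i => encode (l i).length := by
  obtain ⟨B, hB, hlB⟩ := h.size_le
  have key : ∀ (l : List Data) (s : ℕ), l.foldl (fun s _ => Data.cons .nil s) (encode s) =
      encode (s + l.length) := by
    intro l
    induction l with
    | nil => intro s; rfl
    | cons a l ih =>
      intro s
      rw [List.foldl_cons, List.length_cons, show s + (l.length + 1) = (s + 1) + l.length by omega,
        ← ih]
      rfl
  refine (Det.foldl (l := fun i => (l i).map encode) (g := fun _ _ s => .cons .nil s)
    (h.congr fun i => (chain_map_encode _).symm) (Det.const (encode 0))
    (fun i l' s => s.size + 2 * l'.length ≤ 2 * (l i).length + 1) (fun m => 2 * B m + 1)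
    (by fun_prop) (fun i l' s _ hs => ?_) (fun i => ?_) (fun i e l' s _ hs => ?_)
    (Det.nil.cons (Det.right (Det.right Det.id)))).congr fun i => ?_
  · have := hlB i
    have := length_le_size_encode_bits (l i)
    omega
  · simp [size_encode_nat, Nat.add_comm]
  · simp only [List.length_cons, Data.size] at hs ⊢; omega
  · rw [key]; simp

end

/-! ### Efficiency of the building blocks of the reduction -/

section

universe u

variable {ι : Type u} {x : ι → Data}

variable {c : ι → Fixed} {m : ι → Sim}

theorem Fixed.det_n (hc : Det x fun i => encode (c i)) : Det x fun i => encode (c i).n :=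
  Det.fst hc
theorem Fixed.det_pk (hc : Det x fun i => encode (c i)) : Det x fun i => encode (c i).pk :=
  Det.fst (Det.snd hc)
theorem Fixed.det_ρ (hc : Det x fun i => encode (c i)) : Det x fun i => encode (c i).ρ :=
  Det.fst (Det.snd (Det.snd hc))
theorem Fixed.det_τ (hc : Det x fun i => encode (c i)) : Det x fun i => encode (c i).τ :=
  Det.fst (Det.snd (Det.snd (Det.snd hc)))
theorem Fixed.det_dom₀ (hc : Det x fun i => encode (c i)) : Det x fun i => encode (c i).dom₀ :=
  Det.snd (Det.snd (Det.snd (Det.snd hc)))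

theorem Sim.det_cd (hm : Det x fun i => encode (m i)) : Det x fun i => encode (m i).cd :=
  Det.fst hm
theorem Sim.det_CU (hm : Det x fun i => encode (m i)) : Det x fun i => encode (m i).CU :=
  Det.fst (Det.snd hm)
theorem Sim.det_ver (hm : Det x fun i => encode (m i)) : Det x fun i => encode (m i).ver :=
  Det.fst (Det.snd (Det.snd hm))
theorem Sim.det_USK (hm : Det x fun i => encode (m i)) : Det x fun i => encode (m i).USK :=
  Det.fst (Det.snd (Det.snd (Det.snd hm)))
theorem Sim.det_RL (hm : Det x fun i => encode (m i)) : Det x fun i => encode (m i).RL :=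
  Det.fst (Det.snd (Det.snd (Det.snd (Det.snd hm))))
theorem Sim.det_idc (hm : Det x fun i => encode (m i)) : Det x fun i => encode (m i).idc :=
  Det.fst (Det.snd (Det.snd (Det.snd (Det.snd (Det.snd hm)))))
theorem Sim.det_tgt (hm : Det x fun i => encode (m i)) : Det x fun i => encode (m i).tgt :=
  Det.fst (Det.snd (Det.snd (Det.snd (Det.snd (Det.snd (Det.snd hm))))))
theorem Sim.det_log (hm : Det x fun i => encode (m i)) : Det x fun i => encode (m i).log :=
  Det.fst (Det.snd (Det.snd (Det.snd (Det.snd (Det.snd (Det.snd (Det.snd hm)))))))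
theorem Sim.det_forged (hm : Det x fun i => encode (m i)) : Det x fun i => encode (m i).forged :=
  Det.snd (Det.snd (Det.snd (Det.snd (Det.snd (Det.snd (Det.snd (Det.snd hm)))))))

theorem Sim.det_mk {cd : ι → ℕ} {CU : ι → List Bits} {ver : ι → List (Bits × Bits)}
    {USK : ι → List (Bits × Option Bits × Bits)} {RL : ι → List Bits} {idc : ι → Bits}
    {tgt : ι → Option Bits} {log : ι → List Bits} {forged : ι → Bits}
    (h1 : Det x fun i => encode (cd i)) (h2 : Det x fun i => encode (CU i))
    (h3 : Det x fun i => encode (ver i)) (h4 : Det x fun i => encode (USK i))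
    (h5 : Det x fun i => encode (RL i)) (h6 : Det x fun i => encode (idc i))
    (h7 : Det x fun i => encode (tgt i)) (h8 : Det x fun i => encode (log i))
    (h9 : Det x fun i => encode (forged i)) :
    Det x fun i => encode
      (⟨cd i, CU i, ver i, USK i, RL i, idc i, tgt i, log i, forged i⟩ : Sim) :=
  h1.cons (h2.cons (h3.cons (h4.cons (h5.cons (h6.cons (h7.cons (h8.cons h9)))))))

theorem Sim.det_addKey {sk : ι → Bits} (hm : Det x fun i => encode (m i))
    (hsk : Det x fun i => encode (sk i)) : Det x fun i => encode ((m i).addKey (sk i)) :=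
  Sim.det_mk (det_cd hm) (det_CU hm) (det_ver hm) (det_USK hm) (hsk.consList (det_RL hm))
    (Det.consList (Det.const (encode true)) (det_idc hm)) (det_tgt hm) (det_log hm) (det_forged hm)

theorem Sim.det_known {U : ι → Bits} (hm : Det x fun i => encode (m i))
    (hU : Det x fun i => encode (U i)) : Det x fun i => encode (decide ((m i).Known (U i))) := by
  refine (((Det.findCode (p := fun i e => e.1 == U i) (det_USK hm) fun e a x' hx =>
    Det.beq (Det.encFst hx.added) (hx.lift hU)).isSome).or
    (Det.memCode (det_CU hm) hU)).congr fun i => ?_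
  congr 1
  rw [Bool.eq_iff_iff, Bool.or_eq_true, decide_eq_true_iff, decide_eq_true_iff]
  exact Iff.rfl

variable (D : LinkableDAA) (h : ℕ → Bits → Bits)
  (Pf : ProofSystem (Bits × Bits) (Bits × Bits)) (E₂ : ℕ → Bits → Bits → Bits × Bits → Bits →
    PMF (Bits × Bits))

theorem det_askJoin {sk r : ι → Bits} {o : ι → Option (Bits × Option Bits)}
    (hc : Det x fun i => encode (c i)) (hm : Det x fun i => encode (m i))
    (hsk : Det x fun i => encode (sk i)) (hr : Det x fun i => encode (r i))
    (ho : Det x fun i => encode (o i)) :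
    Det x fun i => encode (askJoin (c i) (m i) (sk i) (r i) (o i)) := by
  have hname : Det x fun i => encode (true :: (m i).idc) :=
    Det.consList (Det.const (encode true)) (Sim.det_idc hm)
  have hq : Det x fun i => encode (DAA.TraceQuery.join (true :: (m i).idc) (sk i) (r i)) :=
    Det.inr (α := (Bits × Option Bits × Bits) ⊕ Bits) (Det.inl (β := Bits) (hname.pair (hsk.pair hr)))
  exact Det.inr (α := Option Data × Fixed × Sim) (hq.pair (hc.pair ((Sim.det_addKey hm hsk).pair
    (Det.inl (β := Bits × Bits) ho))))

theorem det_tryForge {sk r σ : ι → Bits} {o : ι → Option (Bits × Option Bits)}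
    (hc : Det x fun i => encode (c i)) (hm : Det x fun i => encode (m i))
    (hsk : Det x fun i => encode (sk i)) (hr : Det x fun i => encode (r i))
    (ho : Det x fun i => encode (o i)) (hσ : Det x fun i => encode (σ i)) :
    Det x fun i => encode (tryForge D (c i) (m i) (sk i) (r i) (o i) (σ i)) := by
  refine Det.iteCode (Det.eqTrue (D.verify_poly.call (Fixed.det_n hc) ((Fixed.det_pk hc).pair
    ((Det.const (encode ([] : Bits))).pair ((Fixed.det_dom₀ hc).encSome.pair
      (hσ.pair (Sim.det_RL hm))))))) ?_ ?_
  · have h1 : Det x fun i => encode (none : Option Data) := Det.nil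
    have h2 := Det.inl (β := DAA.TraceQuery × Fixed × Sim × Cont) (h1.pair (hc.pair
      (Sim.det_mk (Sim.det_cd hm) (Sim.det_CU hm)
      (Sim.det_ver hm) (Sim.det_USK hm) (Sim.det_RL hm) (Sim.det_idc hm) (Sim.det_tgt hm)
      (Sim.det_log hm) hσ)))
    exact h2.reindex _
  · exact (det_askJoin hc hm hsk hr ho).reindex _

theorem eff_keyIssue {sk r : ι → Bits} {o : ι → Option (Bits × Option Bits)}
    (hc : Det x fun i => encode (c i)) (hm : Det x fun i => encode (m i))
    (hsk : Det x fun i => encode (sk i)) (hr : Det x fun i => encode (r i))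
    (ho : Det x fun i => encode (o i)) :
    Eff x fun i => (keyIssue D (c i) (m i) (sk i) (r i) (o i)).map encode := by
  refine Eff.cases_option (Sim.det_tgt hm) (fun e he => ?_) fun e cred x' hx he => ?_
  · refine Eff.congr (Eff.pureCode ((det_askJoin hc hm hsk hr ho).reindex _)) fun j => ?_
    simp only [keyIssue, he]
  · refine Eff.congr (Eff.mapEncode (f := fun k =>
      D.sign (c (e k)).n (sk (e k)) (cred k) (some (c (e k)).dom₀) [])
      (g := fun k => tryForge D (c (e k)) (m (e k)) (sk (e k)) (r (e k)) (o (e k))) ?_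
        fun e' σ x'' hx' => ?_) fun j => ?_
    · exact D.sign_ppt.call (Fixed.det_n (hx.lift hc)) ((hx.lift hsk).pair (hx.added.pair
        ((Fixed.det_dom₀ (hx.lift hc)).encSome.pair (Det.const (encode ([] : Bits))))))
    · exact det_tryForge D (hx'.lift (hx.lift hc)) (hx'.lift (hx.lift hm))
        (hx'.lift (hx.lift hsk)) (hx'.lift (hx.lift hr)) (hx'.lift (hx.lift ho)) hx'.added
    · simp only [keyIssue, he]

theorem det_answer {a : ι → Data} (ha : Det x a)
    (hc : Det x fun i => encode (c i)) (hm : Det x fun i => encode (m i)) :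
    Det x fun i => encode (.inl (some (a i), c i, m i) : Step) :=
  Det.inl (β := DAA.TraceQuery × Fixed × Sim × Cont)
    ((Det.encSome (a := a) ha).pair (hc.pair hm))

theorem eff_createUser {U : ι → Bits} (hc : Det x fun i => encode (c i))
    (hm : Det x fun i => encode (m i)) (hU : Det x fun i => encode (U i)) :
    Eff x fun i => (createUser D Pf (c i) (m i) (U i)).map encode := by
  refine Eff.bindEncode (D.freshKey_ppt.call (a := fun _ => ()) (Fixed.det_n hc) Det.nil)
    fun e sk x' hx => ?_
  refine Eff.bindEncode (Eff.randomBits ((Fixed.det_n (hx.lift hc)).poly _)) fun e' r x'' hx' => ?_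
  have hc' := hx'.lift (hx.lift hc)
  have hsk := hx'.lift hx.added
  have hx1 : Det x'' fun k => encode (D.join (c (e (e' k))).n (c (e (e' k))).pk (sk (e' k)) (r k),
      (c (e (e' k))).pk) :=
    (D.join_poly.call (Fixed.det_n hc') ((Fixed.det_pk hc').pair (hsk.pair hx'.added))).pair
      (Fixed.det_pk hc')
  refine Eff.bindEncode (Pf.createProof_ppt.call (Fixed.det_n hc') ((Fixed.det_ρ hc').pair
    (hx1.pair (hsk.pair hx'.added)))) fun e'' π y hy => ?_
  refine Eff.iteCode (Det.eqTrue (Pf.verifyProof_poly.call (Fixed.det_n (hy.lift hc'))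
    ((Fixed.det_ρ (hy.lift hc')).pair ((hy.lift hx1).pair hy.added)))) ?_ ?_
  · exact (eff_keyIssue D (hy.lift hc') (hy.lift (hx'.lift (hx.lift hm))) (hy.lift hsk)
      (hy.lift hx'.added) (((hy.lift (hx'.lift (hx.lift hU))).pair
        (hy.lift hsk).encSome).encSome)).reindex _
  · exact (Eff.pureCode (det_answer Det.nil (hy.lift hc')
      (hy.lift (hx'.lift (hx.lift hm))))).reindex _

variable {h} in
theorem eff_commentStep (hh : IsPolyTime h) {dom z : ι → Bits} {en : ι → Bits × Option Bits × Bits}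
    (hc : Det x fun i => encode (c i)) (hm : Det x fun i => encode (m i))
    (hdom : Det x fun i => encode (dom i)) (hz : Det x fun i => encode (z i))
    (hen : Det x fun i => encode (en i)) :
    Eff x fun i => (commentStep D h (c i) (m i) (dom i) (z i) (en i)).map encode := by
  have hhm := hh.call (Fixed.det_n hc) hz
  refine Eff.cases_option hen.encSnd.encFst (fun e he => ?_) fun e sk x' hx he => ?_
  · have hq : Det x fun i => encode (DAA.TraceQuery.sign [] (some (dom i)) (h (c i).n (z i))) :=
      Det.inl (β := (Bits × Bits × Bits) ⊕ Bits) (Det.inl (β := Bits)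
        ((Det.const (encode ([] : Bits))).pair (hdom.encSome.pair hhm)))
    have := Det.inr (α := Option Data × Fixed × Sim) (hq.pair (hc.pair ((Sim.det_mk (Sim.det_cd hm)
      (Sim.det_CU hm) (Sim.det_ver hm) (Sim.det_USK hm) (Sim.det_RL hm) (Sim.det_idc hm)
      (Sim.det_tgt hm) (hz.consList (Sim.det_log hm)) (Sim.det_forged hm)).pair
      (Det.inr (α := Option (Bits × Option Bits)) (hdom.pair hhm)))))
    refine Eff.congr (Eff.pureCode (this.reindex e)) fun j => ?_
    simp only [commentStep, he]
  · have hc' := hx.lift hc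
    refine Eff.congr (Eff.mapEncode (f := fun k => D.sign (c (e k)).n (sk k) (en (e k)).2.2
      (some (dom (e k))) (h (c (e k)).n (z (e k)))) (g := fun k σ => (.inl (some (encode (some
        (D.nymGen (c (e k)).n (sk k) (dom (e k)), (σ, D.nymGen (c (e k)).n (sk k) (dom (e k)),
          dom (e k), h (c (e k)).n (z (e k)))))), c (e k), m (e k)) : Step)) ?_
        fun e' σ x'' hx' => ?_) fun j => ?_
    · exact D.sign_ppt.call (Fixed.det_n hc') (hx.added.pair ((hx.lift hen.encSnd.encSnd).pair
        ((hx.lift hdom).encSome.pair (hx.lift hhm))))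
    · have hnym := hx'.lift (D.nymGen_poly.call (Fixed.det_n hc') (hx.added.pair (hx.lift hdom)))
      exact det_answer (Det.encSome (hnym.pair (hx'.added.pair (hnym.pair
        ((hx'.lift (hx.lift hdom)).pair (hx'.lift (hx.lift hhm))))))) (hx'.lift hc')
        (hx'.lift (hx.lift hm))
    · simp only [commentStep, he]

end

/-! ### Efficiency of the answers to the adversary's queries -/

section

universe u

variable {ι : Type u} {x : ι → Data} {c : ι → Fixed} {m : ι → Sim}

variable (D : LinkableDAA) {h : ℕ → Bits → Bits}
  (Pf : ProofSystem (Bits × Bits) (Bits × Bits)) {E₂ : ℕ → Bits → Bits → Bits × Bits → Bits →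
    PMF (Bits × Bits)}

/-- The first part of the answer to the creation of a user. -/
def createStep (c : Fixed) (m : Sim) (U V : Bits) : PMF Step :=
  if m.Known U then PMF.pure (.inl (some (encode (none : Option Bits)), c, m))
  else if m.cd = 1 then PMF.pure (.inr (.hjoin [], c,
    { m with ver := (V, U) :: m.ver, cd := m.cd - 1 }, .inl (some (U, none))))
  else createUser D Pf c { m with ver := (V, U) :: m.ver, cd := m.cd - 1 } U

theorem eff_create {U V : ι → Bits} (hc : Det x fun i => encode (c i))
    (hm : Det x fun i => encode (m i)) (hU : Det x fun i => encode (U i))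
    (hV : Det x fun i => encode (V i)) :
    Eff x fun i => (createStep D Pf (c i) (m i) (U i) (V i)).map encode := by
  have hm₁ := Sim.det_mk (Sim.det_cd hm).pred (Sim.det_CU hm)
    ((hV.pair hU).consList (Sim.det_ver hm)) (Sim.det_USK hm)
    (Sim.det_RL hm) (Sim.det_idc hm) (Sim.det_tgt hm) (Sim.det_log hm) (Sim.det_forged hm)
  have hjoin : Det x fun _ => encode (DAA.TraceQuery.hjoin []) :=
    Det.const (encode (DAA.TraceQuery.hjoin []))
  have hnone : Det x fun _ => encode (none : Option Bits) := Det.nil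
  have hcont : Det x fun i => encode (.inl (some (U i, none)) : Cont) :=
    Det.inl (β := Bits × Bits) (hU.pair hnone).encSome
  have hstep := Det.inr (α := Option Data × Fixed × Sim) (hjoin.pair (hc.pair (hm₁.pair hcont)))
  refine Eff.iteCode (Sim.det_known hm hU) ?_ ?_
  · exact Eff.reindex (Eff.pureCode (det_answer (a := fun _ => encode (none : Option Bits)) Det.nil
      hc hm)) Subtype.val
  · refine Eff.iteCode (Det.reindex (y := fun i => encode (decide ((m i).cd = 1)))
      (((Sim.det_cd hm).eqCode (b := fun _ => 1) (Det.const (encode (1 : ℕ)))).congr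
        fun i => by congr) Subtype.val) ?_ ?_
    · exact ((Eff.pureCode hstep).reindex Subtype.val).reindex Subtype.val
    · exact ((eff_createUser D Pf hc hm₁ hU).reindex Subtype.val).reindex Subtype.val

variable (E₂) in
/-- The first part of the answer to a join. -/
def joinStep (c : Fixed) (m : Sim) (U V : Bits) (j : Bits × Bits) : PMF Step :=
  if (¬ m.Known U ∧ (V, U) ∈ m.ver) ∧ Pf.verifyProof c.n c.ρ (j.1, c.pk) j.2 = true then
    (E₂ c.n c.ρ c.τ (j.1, c.pk) j.2).bind fun w => keyIssue D c m w.1 w.2 none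
  else PMF.pure (.inl (some (encode (none : Option Bits)), c, m))

theorem eff_joinSystem {U V : ι → Bits} {j : ι → Bits × Bits}
    (hE₂ : IsPPT fun n (a : Bits × Bits × (Bits × Bits) × Bits) => E₂ n a.1 a.2.1 a.2.2.1 a.2.2.2)
    (hc : Det x fun i => encode (c i)) (hm : Det x fun i => encode (m i))
    (hU : Det x fun i => encode (U i)) (hV : Det x fun i => encode (V i))
    (hj : Det x fun i => encode ((j i).1, (j i).2)) :
    Eff x fun i => (joinStep D Pf E₂ (c i) (m i) (U i) (V i) (j i)).map encode := by
  have hst := hj.encFst.pair (Fixed.det_pk hc)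
  have hcond := (((Sim.det_known hm hU).not).and (Det.memCode (Sim.det_ver hm)
    (hV.pair hU))).and (Pf.verifyProof_poly.call (Fixed.det_n hc)
    ((Fixed.det_ρ hc).pair (hst.pair hj.encSnd)))
  refine Eff.iteCode (hcond.congr fun k => ?_) ?_ ?_
  · congr 1
    rw [Bool.eq_iff_iff]; simp
  · have hw : Eff x fun i => (E₂ (c i).n (c i).ρ (c i).τ ((j i).1, (c i).pk) (j i).2).map encode :=
      hE₂.call (Fixed.det_n hc) ((Fixed.det_ρ hc).pair ((Fixed.det_τ hc).pair (hst.pair hj.encSnd)))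
    have hb := Eff.bindEncode (G := fun i w => keyIssue D (c i) (m i) w.1 w.2 none) hw
      (fun e₃ w x₃ hx₃ => eff_keyIssue D (o := fun _ => none) (hx₃.lift hc) (hx₃.lift hm)
        hx₃.added.encFst hx₃.added.encSnd Det.nil)
    exact hb.reindex Subtype.val
  · exact Eff.reindex (Eff.pureCode (det_answer (a := fun _ => encode (none : Option Bits)) Det.nil
      hc hm)) Subtype.val

theorem eff_query {q : ι → FrameQuery (Bits × Bits)} (hh : IsPolyTime h)
    (hE₂ : IsPPT fun n (a : Bits × Bits × (Bits × Bits) × Bits) => E₂ n a.1 a.2.1 a.2.2.1 a.2.2.2)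
    (hc : Det x fun i => encode (c i)) (hm : Det x fun i => encode (m i))
    (hq : Det x fun i => encode (q i)) :
    Eff x fun i => (queryStep D h Pf E₂ (c i) (m i) (some (q i))).map encode := by
  have hq' : Det x fun i => encode (q i).toSum := hq
  have eq1 : ∀ i u, (q i).toSum = u → q i = FrameQuery.ofSum u := fun i u hu => by
    rw [← hu]; cases q i <;> rfl
  have hnone : ∀ {κ : Type u} {x' : κ → Data} {c' : κ → Fixed} {m' : κ → Sim},
      Det x' (fun k => encode (c' k)) → Det x' (fun k => encode (m' k)) →
      Eff x' fun k => (PMF.pure (.inl (some .nil, c' k, m' k) : Step)).map encode :=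
    fun hc' hm' => Eff.pureCode (det_answer Det.nil hc' hm')
  refine Eff.cases_sum hq' (fun e U x' hx he => ?_) fun e q₁ x' hx he => ?_
  -- corruption of users
  · have hm' := hx.lift hm
    have hans : Det x' fun k => encode (((m (e k)).USK.find? fun en => en.1 == U k).map
        fun en => (en.2.1.getD [], en.2.2)) :=
      Det.mapOption (g := fun _ (en : Bits × Option Bits × Bits) => (en.2.1.getD [], en.2.2))
        (Det.findCode (p := fun k en => en.1 == U k) (Sim.det_USK hm') fun e' a y hy =>
          Det.beq (Det.encFst hy.added) (hy.lift hx.added))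
        fun e' a y hy => (Det.getD hy.added.encSnd.encFst).pair hy.added.encSnd.encSnd
    refine Eff.congr (Eff.pureCode (det_answer hans (hx.lift hc) (Sim.det_mk (Sim.det_cd hm')
      (hx.added.consList (Sim.det_CU hm')) (Sim.det_ver hm') (Sim.det_USK hm') (Sim.det_RL hm')
      (Sim.det_idc hm') (Sim.det_tgt hm') (Sim.det_log hm') (Sim.det_forged hm')))) fun k => ?_
    rw [eq1 _ _ (he k)]; rfl
  refine Eff.cases_sum hx.added (fun e₁ q₂ x₁ hx₁ he₁ => ?_) fun e₁ q₂ x₁ hx₁ he₁ => ?_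
  · refine Eff.cases_sum hx₁.added (fun e₂ a x₂ hx₂ he₂ => ?_) fun e₂ a x₂ hx₂ he₂ => ?_
    all_goals
      have hc' := hx₂.lift (hx₁.lift (hx.lift hc))
      have hm' := hx₂.lift (hx₁.lift (hx.lift hm))
      have hqa : ∀ k, q (e (e₁ (e₂ k))) = FrameQuery.ofSum _ := fun k => eq1 _ _
        (by rw [he, he₁, he₂])
    -- corruption of the verification
    · refine Eff.congr (Eff.pureCode (det_answer (a := fun _ => encode ()) Det.nil hc'
        (Sim.det_mk (Sim.det_cd hm') (Sim.det_CU hm')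
        ((hx₂.added.encSnd.pair hx₂.added.encFst).consList (Sim.det_ver hm')) (Sim.det_USK hm')
        (Sim.det_RL hm') (Sim.det_idc hm') (Sim.det_tgt hm') (Sim.det_log hm')
        (Sim.det_forged hm')))) fun k => ?_
      rw [hqa]; rfl
    -- creation of users
    · refine Eff.congr (eff_create D Pf hc' hm' hx₂.added.encFst hx₂.added.encSnd) fun k => ?_
      rw [hqa]; rfl
  · refine Eff.cases_sum hx₁.added (fun e₂ a x₂ hx₂ he₂ => ?_) fun e₂ a x₂ hx₂ he₂ => ?_
    all_goals
      have hc' := hx₂.lift (hx₁.lift (hx.lift hc))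
      have hm' := hx₂.lift (hx₁.lift (hx.lift hm))
      have hqa : ∀ k, q (e (e₁ (e₂ k))) = FrameQuery.ofSum _ := fun k => eq1 _ _
        (by rw [he, he₁, he₂])
    -- joining
    · refine Eff.congr (eff_joinSystem D Pf hE₂ hc' hm' hx₂.added.encFst hx₂.added.encSnd.encFst
        (hx₂.added.encSnd.encSnd.encFst.pair hx₂.added.encSnd.encSnd.encSnd)) fun k => ?_
      rw [hqa]; rfl
    -- comments
    · have hU := hx₂.added.encFst
      have hfind : Det x₂ fun k => encode ((m (e (e₁ (e₂ k)))).USK.find? fun en =>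
          en.1 == (a k).1 && decide ((a k).1 ∉ (m (e (e₁ (e₂ k)))).CU)) :=
        Det.findCode (p := fun k en => en.1 == (a k).1 &&
          decide ((a k).1 ∉ (m (e (e₁ (e₂ k)))).CU)) (Sim.det_USK hm') fun e' b y hy =>
            (Det.beq (Det.encFst hy.added) (hy.lift hU)).and
              ((Det.memCode (hy.lift (Sim.det_CU hm')) (hy.lift hU)).not.congr fun k => by
                rw [decide_not])
      refine Eff.cases_option hfind (fun e₃ he₃ => ?_) fun e₃ b x₃ hx₃ he₃ => ?_
      · refine Eff.congr ((Eff.pureCode (det_answer (a := fun _ =>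
          encode (none : Option (Bits × Bits × Bits × Bits × Bits))) Det.nil hc'
          hm')).reindex _) fun k => ?_
        rw [hqa]
        simp only [queryStep, FrameQuery.ofSum, he₃]
      · refine Eff.congr (eff_commentStep D hh (hx₃.lift hc') (hx₃.lift hm')
          (hx₃.lift hx₂.added.encSnd.encFst) (hx₃.lift hx₂.added.encSnd.encSnd) hx₃.added)
          fun k => ?_
        rw [hqa]
        simp only [queryStep, FrameQuery.ofSum, he₃]

/-- A query arrives as an arbitrary tree; `Canon.frameQuery` brings it into canonical form or
recognizes that it encodes nothing. -/
theorem eff_queryStep (hh : IsPolyTime h)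
    (hE₂ : IsPPT fun n (a : Bits × Bits × (Bits × Bits) × Bits) => E₂ n a.1 a.2.1 a.2.2.1 a.2.2.2) :
    Eff (fun j : (Fixed × Sim) × Data => encode j) fun j =>
      (queryStep D h Pf E₂ j.1.1 j.1.2 (decode j.2)).map encode := by
  have hj : Det (fun j : (Fixed × Sim) × Data => encode j) fun j => encode (j.1, j.2) := Det.id
  have hc : Det (fun j : (Fixed × Sim) × Data => encode j) fun j => encode (j.1.1, j.1.2) :=
    hj.encFst
  refine Eff.cases_option ((Canon.frameQuery (canon_bits.prod canon_bits)).det hj.encSnd)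
    (fun e he => ?_) fun e q x' hx he => ?_
  · refine Eff.congr (Eff.pureCode (det_answer (a := fun _ => .nil) Det.nil (hc.encFst.reindex e)
      (hc.encSnd.reindex e))) fun k => ?_
    rw [show decode (e k).2 = none from he k]; rfl
  · exact Eff.congr (eff_query D Pf hh hE₂ (hx.lift hc.encFst) (hx.lift hc.encSnd) hx.added)
      fun k => by rw [show decode (e k).2 = some (q k) from he k]

theorem det_answerStep {k : ι → Fixed × Sim × Cont} {a : ι → Option Bits}
    (hk : Det x fun i => encode ((k i).1, (k i).2.1, (k i).2.2))
    (ha : Det x fun i => encode (a i)) : Det x fun i => encode (answerStep D (k i) (a i)) := by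
  have hc := hk.encFst
  have hm := hk.encSnd.encFst
  refine Eff.cases_sum hk.encSnd.encSnd (fun e o x' hx he => ?_) fun e o x' hx he => ?_
  · refine Eff.cases_option hx.added (fun e' he' => ?_) fun e' U x'' hx' he' => ?_
    · refine Det.congr ((((hx.lift ha).pair (α := Option Bits) ((hx.lift hc).pair
        (hx.lift hm)))).reindex e') fun j => ?_
      simp only [answerStep, he, he']; rfl
    · have hm' := hx'.lift (hx.lift hm)
      have ha' := hx'.lift (hx.lift ha)
      have htgt := Det.iteCode (P := fun j => (U j).2 = none) (f := fun j => a (e (e' j)))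
        (g := fun j => (k (e (e' j))).2.1.tgt) ((hx'.added.encSnd.eqCode
          (b := fun _ => (none : Option Bits)) Det.nil).congr fun i => by congr)
          (ha'.reindex _) ((Sim.det_tgt hm').reindex _)
      refine Det.congr (ha'.pair ((hx'.lift (hx.lift hc)).pair (Sim.det_mk (Sim.det_cd hm')
        (Sim.det_CU hm') (Sim.det_ver hm')
        ((hx'.added.encFst.pair (hx'.added.encSnd.pair (ha'.getD (a := [])))).consList (Sim.det_USK hm'))
        (Sim.det_RL hm') (Sim.det_idc hm')
        htgt
        (Sim.det_log hm') (Sim.det_forged hm')))) fun j => ?_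
      simp only [answerStep, he, he']; rfl
  · have hnx : Det x' fun j => encode ((a (e j)).map fun σ =>
        (D.nymExtract (k (e j)).1.n σ, (σ, D.nymExtract (k (e j)).1.n σ, (o j).1, (o j).2))) :=
      Det.mapOption (g := fun j σ => (D.nymExtract (k (e j)).1.n σ,
        (σ, D.nymExtract (k (e j)).1.n σ, (o j).1, (o j).2))) (hx.lift ha) fun e' σ y hy => by
        have hnym := D.nymExtract_poly.call (Fixed.det_n (hy.lift (hx.lift hc))) hy.added
        exact hnym.pair (hy.added.pair (hnym.pair (hy.lift (hx.added.encFst.pair hx.added.encSnd))))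
    refine Det.congr (hnx.pair ((hx.lift hc).pair (hx.lift hm))) fun j => ?_
    simp only [answerStep, he]; rfl

end

/-! ### Efficiency of the challenger -/

section

universe u

variable {ι : Type u} {x : ι → Data} {t : ι → DAA.TraceState}

theorem DAA.TraceState.det_signers (ht : Det x fun i => encode (t i)) :
    Det x fun i => encode (t i).signers := Det.fst ht

theorem DAA.TraceState.det_RL (ht : Det x fun i => encode (t i)) :
    Det x fun i => encode (t i).RL := Det.fst (Det.snd ht)

theorem DAA.TraceState.det_signed (ht : Det x fun i => encode (t i)) :
    Det x fun i => encode (t i).signed := Det.snd (Det.snd ht)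

theorem DAA.TraceState.det_mk {signers : ι → List (Bits × Bits × Bits)} {RL : ι → List Bits}
    {signed : ι → List (Bits × Option Bits × Bits × Bits)}
    (h1 : Det x fun i => encode (signers i)) (h2 : Det x fun i => encode (RL i))
    (h3 : Det x fun i => encode (signed i)) :
    Det x fun i => encode (⟨signers i, RL i, signed i⟩ : DAA.TraceState) := h1.cons (h2.cons h3)

theorem det_signer {S : ι → Bits} (ht : Det x fun i => encode (t i))
    (hS : Det x fun i => encode (S i)) :
    Det x fun i => encode ((t i).signers.find? fun e => e.1 == S i) :=
  Det.findCode (p := fun i e => e.1 == S i) (DAA.TraceState.det_signers ht) fun _ _ _ hy =>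
    Det.beq hy.added.encFst (hy.lift hS)

variable (D : DAA)

/-- In the reduction to collision resistance there is no challenger, and the adversary has to play
this part as well; only for that purpose must the challenger be efficient. -/
theorem eff_traceAnswer {n : ι → ℕ} {pk skI : ι → Bits} {q : ι → DAA.TraceQuery}
    (hn : Det x fun i => encode (n i)) (hpk : Det x fun i => encode (pk i))
    (hskI : Det x fun i => encode (skI i)) (ht : Det x fun i => encode (t i))
    (hq : Det x fun i => encode (q i)) :
    Eff x fun i => (D.traceAnswer (n i) (pk i) (skI i) (t i) (q i)).map encode := by
  have hq' : Det x fun i => encode (q i).toSum := hq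
  have eq1 : ∀ i u, (q i).toSum = u → q i = DAA.TraceQuery.ofSum u := fun i u hu => by
    rw [← hu]; cases q i <;> rfl
  have hnone : ∀ {κ : Type u} {x' : κ → Data} {t' : κ → DAA.TraceState},
      Det x' (fun k => encode (t' k)) →
      Eff x' fun k => (PMF.pure ((none : Option Bits), t' k)).map encode :=
    fun ht' => Eff.pureCode (Det.pair (a := fun _ => (none : Option Bits)) Det.nil ht')
  refine Eff.cases_sum hq' (fun e₁ q₁ x₁ hx₁ he₁ => ?_) fun e₁ q₁ x₁ hx₁ he₁ => ?_
  · refine Eff.cases_sum hx₁.added (fun e₂ a x₂ hx₂ he₂ => ?_) fun e₂ S x₂ hx₂ he₂ => ?_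
    all_goals
      have hn' := hx₂.lift (hx₁.lift hn)
      have hpk' := hx₂.lift (hx₁.lift hpk)
      have hskI' := hx₂.lift (hx₁.lift hskI)
      have ht' := hx₂.lift (hx₁.lift ht)
      have hqa : ∀ k, q (e₁ (e₂ k)) = DAA.TraceQuery.ofSum _ := fun k => eq1 _ _
        (by rw [he₁, he₂])
    · refine Eff.cases_option (det_signer ht' hx₂.added.encFst) (fun e₃ he₃ => ?_)
        fun e₃ b x₃ hx₃ he₃ => ?_
      · refine Eff.congr ((hnone ht').reindex e₃) fun k => ?_
        rw [hqa]; simp only [DAA.traceAnswer, DAA.TraceQuery.ofSum, he₃]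
      · have hdom := hx₃.lift hx₂.added.encSnd.encFst
        have hm := hx₃.lift hx₂.added.encSnd.encSnd
        have hs := D.sign_ppt.call (hx₃.lift hn') (hx₃.added.encSnd.encFst.pair
          (hx₃.added.encSnd.encSnd.pair (hdom.pair hm)))
        refine Eff.congr (Eff.mapEncode (g := fun k σ => (some σ,
          ({ t (e₁ (e₂ (e₃ k))) with signed := ((a (e₃ k)).1, (a (e₃ k)).2.1, (a (e₃ k)).2.2, σ) ::
            (t (e₁ (e₂ (e₃ k)))).signed } : DAA.TraceState))) hs fun e₄ σ x₄ hx₄ => ?_) fun k => ?_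
        · have ht'' := hx₄.lift (hx₃.lift ht')
          exact hx₄.added.encSome.pair (DAA.TraceState.det_mk (DAA.TraceState.det_signers ht'')
            (DAA.TraceState.det_RL ht'') (((hx₄.lift (hx₃.lift hx₂.added.encFst)).pair
              ((hx₄.lift hdom).pair ((hx₄.lift hm).pair hx₄.added))).consList
                (DAA.TraceState.det_signed ht'')))
        · rw [hqa]; simp only [DAA.traceAnswer, DAA.TraceQuery.ofSum, he₃]
    · refine Eff.cases_option (det_signer ht' hx₂.added) (fun e₃ he₃ => ?_)
        fun e₃ b x₃ hx₃ he₃ => ?_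
      · have hF : Eff (fun k => x₂ (e₃ k)) fun k => ((D.freshKey (n (e₁ (e₂ (e₃ k))))).bind fun sk =>
            (randomBits (D.coins.eval (n (e₁ (e₂ (e₃ k)))))).bind fun r =>
              (D.issue (n (e₁ (e₂ (e₃ k)))) (skI (e₁ (e₂ (e₃ k))))
                (D.join (n (e₁ (e₂ (e₃ k)))) (pk (e₁ (e₂ (e₃ k)))) sk r)).map fun cred =>
              (some cred, ({ t (e₁ (e₂ (e₃ k))) with signers :=
                (S (e₃ k), sk, cred) :: (t (e₁ (e₂ (e₃ k)))).signers } : DAA.TraceState))).map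
                  encode := by
          refine Eff.bindEncode (D.freshKey_ppt.call (a := fun _ => ()) (hn'.reindex e₃) Det.nil)
            fun e₄ sk x₄ hx₄ => ?_
          have hn₄ := hx₄.lift (hn'.reindex e₃)
          refine Eff.bindEncode (Eff.randomBits (hn₄.poly _)) fun e₅ r x₅ hx₅ => ?_
          have hj := D.join_poly.call (hx₅.lift hn₄) ((hx₅.lift (hx₄.lift (hpk'.reindex e₃))).pair
            ((hx₅.lift hx₄.added).pair hx₅.added))
          refine Eff.mapEncode (D.issue_ppt.call (hx₅.lift hn₄)
            ((hx₅.lift (hx₄.lift (hskI'.reindex e₃))).pair hj)) fun e₆ cred x₆ hx₆ => ?_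
          have ht'' := hx₆.lift (hx₅.lift (hx₄.lift (ht'.reindex e₃)))
          exact hx₆.added.encSome.pair (DAA.TraceState.det_mk
            (((hx₆.lift (hx₅.lift (hx₄.lift (hx₂.added.reindex e₃)))).pair
              ((hx₆.lift (hx₅.lift hx₄.added)).pair hx₆.added)).consList
                (DAA.TraceState.det_signers ht'')) (DAA.TraceState.det_RL ht'')
            (DAA.TraceState.det_signed ht''))
        refine Eff.congr hF fun k => ?_
        rw [hqa]; simp only [DAA.traceAnswer, DAA.TraceQuery.ofSum, he₃]
      · refine Eff.congr (hnone (hx₃.lift ht')) fun k => ?_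
        rw [hqa]; simp only [DAA.traceAnswer, DAA.TraceQuery.ofSum, he₃]
  · refine Eff.cases_sum hx₁.added (fun e₂ a x₂ hx₂ he₂ => ?_) fun e₂ S x₂ hx₂ he₂ => ?_
    all_goals
      have hn' := hx₂.lift (hx₁.lift hn)
      have hpk' := hx₂.lift (hx₁.lift hpk)
      have hskI' := hx₂.lift (hx₁.lift hskI)
      have ht' := hx₂.lift (hx₁.lift ht)
      have hqa : ∀ k, q (e₁ (e₂ k)) = DAA.TraceQuery.ofSum _ := fun k => eq1 _ _
        (by rw [he₁, he₂])
    · have hsk := hx₂.added.encSnd.encFst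
      have hr := hx₂.added.encSnd.encSnd
      refine Eff.cases_option (det_signer ht' hx₂.added.encFst) (fun e₃ he₃ => ?_)
        fun e₃ b x₃ hx₃ he₃ => ?_
      · have hj := D.join_poly.call hn' (hpk'.pair (hsk.pair hr))
        have hi := D.issue_ppt.call hn' (hskI'.pair hj)
        have hF : Eff x₂ fun k => (if D.isKey (n (e₁ (e₂ k))) (a k).2.1 = true ∧
            (a k).2.2.length = D.coins.eval (n (e₁ (e₂ k))) then
              (D.issue (n (e₁ (e₂ k))) (skI (e₁ (e₂ k))) (D.join (n (e₁ (e₂ k))) (pk (e₁ (e₂ k)))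
                (a k).2.1 (a k).2.2)).map fun cred => (some cred,
                (⟨((a k).1, (a k).2.1, cred) :: (t (e₁ (e₂ k))).signers,
                  (a k).2.1 :: (t (e₁ (e₂ k))).RL, (t (e₁ (e₂ k))).signed⟩ : DAA.TraceState))
            else PMF.pure (none, t (e₁ (e₂ k)))).map encode := by
          refine Eff.iteCode (((D.isKey_poly.call hn' hsk).and (hr.length.eqCode
            (hn'.poly D.coins))).congr fun k => ?_) ?_ ?_
          · congr 1
            rw [Bool.eq_iff_iff]; simp
          · refine Eff.mapEncode (hi.reindex Subtype.val) fun e₄ cred x₄ hx₄ => ?_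
            have ht'' := hx₄.lift (ht'.reindex Subtype.val)
            have ha := hx₄.lift (hx₂.added.reindex Subtype.val)
            exact hx₄.added.encSome.pair (DAA.TraceState.det_mk
              ((ha.encFst.pair (ha.encSnd.encFst.pair hx₄.added)).consList
                (DAA.TraceState.det_signers ht''))
              (ha.encSnd.encFst.consList (DAA.TraceState.det_RL ht''))
              (DAA.TraceState.det_signed ht''))
          · exact (hnone ht').reindex Subtype.val
        refine Eff.congr (hF.reindex e₃) fun k => ?_
        rw [hqa]; simp only [DAA.traceAnswer, DAA.TraceQuery.ofSum, he₃]
      · refine Eff.congr (hnone (hx₃.lift ht')) fun k => ?_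
        rw [hqa]; simp only [DAA.traceAnswer, DAA.TraceQuery.ofSum, he₃]
    · refine Eff.cases_option (det_signer ht' hx₂.added) (fun e₃ he₃ => ?_)
        fun e₃ b x₃ hx₃ he₃ => ?_
      · refine Eff.congr ((hnone ht').reindex e₃) fun k => ?_
        rw [hqa]; simp only [DAA.traceAnswer, DAA.TraceQuery.ofSum, he₃]
      · have ht'' := hx₃.lift ht'
        refine Eff.congr (Eff.pureCode (hx₃.added.encSnd.encFst.encSome.pair (DAA.TraceState.det_mk
          (DAA.TraceState.det_signers ht'') (hx₃.added.encSnd.encFst.consList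
            (DAA.TraceState.det_RL ht'')) (DAA.TraceState.det_signed ht'')))) fun k => ?_
        rw [hqa]; simp only [DAA.traceAnswer, DAA.TraceQuery.ofSum, he₃]

end

/-! ### Efficiency of the outputs and of the complete simulated game -/

section

universe u

variable {ι : Type u} {x : ι → Data} {b : ι → Fixed × Sim} {out : ι → Data}
  {h : ℕ → Bits → Bits}

theorem canon_frameOut : Canon FrameOut :=
  canon_bits.prod (canon_bits.prod (canon_bits.prod (canon_bits.prod (canon_bits.prod
    (canon_bits.prod canon_bits)))))

theorem det_forgeryOutput (hh : IsPolyTime h) {flag : ι → Bool}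
    (hflag : Det x fun i => encode (flag i)) (hb : Det x fun i => encode ((b i).1, (b i).2))
    (hout : Det x out) : Det x fun i => encode (forgeryOutput h (flag i) (b i) (out i)) := by
  have hnil : ∀ {κ : Type u} {y : κ → Data}, Det y fun _ => encode ([] : Bits) := Det.nil
  have h1 : Det x fun i => encode (([] : Bits), (b i).2.forged, ([] : Bits), some (b i).1.dom₀) :=
    hnil.pair ((Sim.det_forged hb.encSnd).pair (hnil.pair (Fixed.det_dom₀ hb.encFst).encSome))
  have h2 : Det x fun i => encode (match (decode (out i) : Option FrameOut) with
      | none => (([] : Bits), ([] : Bits), ([] : Bits), (none : Option Bits))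
      | some o => ([], o.2.2.2.1, h (b i).1.n o.2.2.1, some o.2.1)) := by
    refine Eff.cases_option (canon_frameOut.det hout) (fun e he => ?_) fun e o x' hx he => ?_
    · refine (Det.const (encode (([] : Bits), ([] : Bits), ([] : Bits),
        (none : Option Bits)))).congr fun k => ?_
      simp only [he]
    · refine Det.congr (hnil.pair (hx.added.encSnd.encSnd.encSnd.encFst.pair ((hh.call
        (Fixed.det_n (hx.lift hb.encFst)) hx.added.encSnd.encSnd.encFst).pair
          hx.added.encSnd.encFst.encSome))) fun k => ?_
      simp only [he]
  exact Det.iteCode hflag.eqTrue (h1.reindex Subtype.val) (h2.reindex Subtype.val)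

theorem det_collisionOutput (hh : IsPolyTime h) (hb : Det x fun i => encode ((b i).1, (b i).2))
    (hout : Det x out) : Det x fun i => encode (collisionOutput h (b i) (out i)) := by
  have hnil : ∀ {κ : Type u} {y : κ → Data}, Det y fun _ => encode (([], []) : Bits × Bits) :=
    Det.const _
  refine Eff.cases_option (canon_frameOut.det hout) (fun e he => ?_) fun e o x' hx he => ?_
  · refine hnil.congr fun k => ?_
    simp only [collisionOutput, he]
  · have hm := hx.added.encSnd.encSnd.encFst
    have hn := Fixed.det_n (hx.lift hb.encFst)
    have hfind : Det x' fun k => encode ((b (e k)).2.log.find? fun y => decide (y ≠ (o k).2.2.1) &&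
        decide (h (b (e k)).1.n y = h (b (e k)).1.n (o k).2.2.1)) := by
      refine Det.findCode (p := fun k y => decide (y ≠ (o k).2.2.1) &&
        decide (h (b (e k)).1.n y = h (b (e k)).1.n (o k).2.2.1))
        (Sim.det_log (hx.lift hb.encSnd)) fun e' y x'' hy => ?_
      refine (((hy.added.eqCode (hy.lift hm)).not).and ((hh.call (hy.lift hn) hy.added).eqCode
        (hh.call (hy.lift hn) (hy.lift hm)))).congr fun k => ?_
      simp
    refine Eff.cases_option hfind (fun e' he' => ?_) fun e' y x'' hy hye => ?_
    · refine hnil.congr fun k => ?_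
      simp only [collisionOutput, he]
      rw [he']
    · refine Det.congr (hy.added.pair (hy.lift hm)) fun k => ?_
      simp only [collisionOutput, he]
      rw [hye]

variable {h : ℕ → Bits → Bits} {E₂ : ℕ → Bits → Bits → Bits × Bits → Bits → PMF (Bits × Bits)}

theorem eff_finishStep (D : LinkableDAA) {v : ι → GameState} {s : ι → Step}
    (hs : Det x fun i => encode (s i))
    (hv : Det x fun i => encode ((v i).1, ((v i).2.1.1, (v i).2.1.2), (v i).2.2)) :
    Eff x fun i => (finishStep D (v i) (s i)).map encode := by
  refine Eff.cases_sum hs (fun e r x₁ hx₁ he₁ => ?_) fun e q x₁ hx₁ he₁ => ?_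
  · have hp : Det x₁ fun k => encode ((r k).1, (v (e k)).1, (r k).2, (v (e k)).2.2) :=
      Det.pair (a := fun k => (r k).1) hx₁.added.encFst (Det.pair (a := fun k => (v (e k)).1)
        (hx₁.lift hv.encFst) (Det.pair (a := fun k => (r k).2) hx₁.added.encSnd
          (hx₁.lift hv.encSnd.encSnd)))
    have hp' := Eff.pureCode hp
    refine Eff.congr hp' fun k => ?_
    simp only [he₁, finishStep]
  · have hu₁ := hx₁.lift hv
    have ha := eff_traceAnswer D.toDAA (Fixed.det_n hu₁.encSnd.encFst.encFst)
      (Fixed.det_pk hu₁.encSnd.encFst.encFst) hu₁.encFst hu₁.encSnd.encSnd hx₁.added.encFst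
    refine Eff.congr (Eff.mapEncode (g := fun k r => (some (answerStep D (q k).2 r.1).1,
      (v (e k)).1, (answerStep D (q k).2 r.1).2, r.2)) ha fun e₂ r x₂ hx₂ => ?_) fun k => ?_
    · have hans := det_answerStep D (k := fun k => (q (e₂ k)).2) (a := fun k => (r k).1)
        (hx₂.lift hx₁.added.encSnd) hx₂.added.encFst
      exact hans.encFst.encSome.pair ((hx₂.lift hu₁.encFst).pair (hans.encSnd.pair
        hx₂.added.encSnd))
    · simp only [he₁, finishStep]

theorem eff_simOracle (D : LinkableDAA) (Pf : ProofSystem (Bits × Bits) (Bits × Bits))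
    (hh : IsPolyTime h)
    (hE₂ : IsPPT fun n (a : Bits × Bits × (Bits × Bits) × Bits) => E₂ n a.1 a.2.1 a.2.2.1 a.2.2.2) :
    Eff (fun j : GameState × Data => .cons (encode j.1) j.2) fun j =>
      (simOracle D h Pf E₂ j.1 j.2).map (encResult encode) := by
  have hu : Det (fun j : GameState × Data => .cons (encode j.1) j.2) fun j =>
    encode (j.1.1, (j.1.2.1.1, j.1.2.1.2), j.1.2.2) := Det.left Det.id
  have hs : Eff (fun j : GameState × Data => .cons (encode j.1) j.2) fun j =>
      (queryStep D h Pf E₂ j.1.2.1.1 j.1.2.1.2 (decode j.2)).map encode :=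
    Det.eff (Det.cons hu.encSnd.encFst (Det.right Det.id))
      ((eff_queryStep D Pf hh hE₂).reindex fun j : GameState × Data => (j.1.2.1, j.2))
  have hall : Eff (fun j : GameState × Data => .cons (encode j.1) j.2) fun j =>
      ((queryStep D h Pf E₂ j.1.2.1.1 j.1.2.1.2 (decode j.2)).bind (finishStep D j.1)).map
        encode := by
    have hb := @Eff.bindEncode (GameState × Data) Step (Option Data × GameState) _ _ _
      (fun j => queryStep D h Pf E₂ j.1.2.1.1 j.1.2.1.2 (decode j.2))
      (fun j => finishStep D j.1) hs
    refine hb fun e s x hx => ?_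
    have hu' := hx.lift hu
    exact eff_finishStep D (v := fun k => (e k).1) hx.added hu'
  refine Eff.congr hall fun j => ?_
  rw [simOracle_eq]
  congr 1
  funext r
  obtain ⟨o, u⟩ := r
  cases o <;> rfl

end

/-! ## Sizes of the states of the reduction -/

section

variable {α β : Type} [Coding α] [Coding β]

theorem size_encode_pair (a : α) (b : β) :
    (encode (a, b)).size = 1 + (encode a).size + (encode b).size := rfl

theorem size_encode_cons (a : α) (l : List α) :
    (encode (a :: l)).size = 1 + (encode a).size + (encode l).size := rfl

theorem size_encode_some (a : α) : (encode (some a)).size = 2 + (encode a).size := rfl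

theorem size_encode_none : (encode (none : Option α)).size = 1 := rfl

theorem size_encode_inl (a : α) : (encode (.inl a : α ⊕ β)).size = 2 + (encode a).size := rfl

theorem size_encode_inr (b : β) : (encode (.inr b : α ⊕ β)).size = 4 + (encode b).size := rfl

theorem size_encode_getD (o : Option Bits) : (encode (o.getD [])).size ≤ (encode o).size := by
  cases o with
  | none => exact le_rfl
  | some a => rw [size_encode_some]; exact Nat.le_add_left _ _

end

theorem Fixed.size_encode (c : Fixed) : (encode c).size = 1 + (encode c.n).size +
    (1 + (encode c.pk).size + (1 + (encode c.ρ).size + (1 + (encode c.τ).size +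
      (encode c.dom₀).size))) := rfl

theorem Sim.size_encode (m : Sim) : (encode m).size = 1 + (encode m.cd).size +
    (1 + (encode m.CU).size + (1 + (encode m.ver).size + (1 + (encode m.USK).size +
      (1 + (encode m.RL).size + (1 + (encode m.idc).size + (1 + (encode m.tgt).size +
        (1 + (encode m.log).size + (encode m.forged).size))))))) := rfl

theorem DAA.TraceState.size_encode (t : DAA.TraceState) : (encode t).size =
    1 + (encode t.signers).size + (1 + (encode t.RL).size + (encode t.signed).size) := rfl

/-- A query to the challenger in the state `m`, with arguments of size at most `G`. -/
def SmallQuery (G : ℕ) (m : Sim) : DAA.TraceQuery → Prop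
  | .sign S dom hm => S = [] ∧ (encode dom).size + (encode hm).size ≤ G
  | .hjoin S => S = []
  | .join S sk r => S = true :: m.idc ∧ (encode sk).size + (encode r).size ≤ G
  | .corrupt _ => False

/-- A step from the state `m`, where the state grows by at most `G`. -/
def SmallStep (G : ℕ) (c : Fixed) (m : Sim) : Step → Prop
  | .inl r => r.1 ≠ none → r.2.1 = c ∧ (encode r.2.2).size ≤ (encode m).size + G ∧
      r.2.2.idc.length ≤ m.idc.length + 1
  | .inr q => q.2.1 = c ∧ (encode q.2.2.1).size ≤ (encode m).size + G ∧
      q.2.2.1.idc.length ≤ m.idc.length + 1 ∧ (encode q.2.2.2).size ≤ G ∧ SmallQuery G m q.1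

/-- The bound `K` on the constants, `G` and `Z₁` on the growth, and `S` on the total size. -/
structure Small (K Z₁ Z S N : ℕ) (u : GameState) (f : ℕ) : Prop where
  const : (encode u.1).size + (encode u.2.1.1).size + N ≤ K
  idc : u.2.1.2.idc.length + f ≤ N
  signers : ∀ e ∈ u.2.2.signers, (encode e.2).size ≤ Z₁
  total : (encode u.2.1.2).size + (encode u.2.2).size + Z * f ≤ S

section

variable (D : LinkableDAA) {h : ℕ → Bits → Bits} (Pf : ProofSystem (Bits × Bits) (Bits × Bits))
  {E₂ : ℕ → Bits → Bits → Bits × Bits → Bits → PMF (Bits × Bits)}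

theorem smallStep_keyIssue {G : ℕ} {c : Fixed} {m₀ m : Sim} {sk r : Bits}
    {o : Option (Bits × Option Bits)} (hidc : m.idc = m₀.idc)
    (hm : (encode m).size + 5 + (encode sk).size ≤ (encode m₀).size + G)
    (hs : (encode sk).size + (encode r).size ≤ G) (ho : (encode o).size + 2 ≤ G) {s : Step}
    (hsup : s ∈ (keyIssue D c m sk r o).support) : SmallStep G c m₀ s := by
  have hask : SmallStep G c m₀ (askJoin c m sk r o) := by
    refine ⟨rfl, ?_, ?_, ?_, ?_⟩
    · refine le_trans ?_ hm
      simp only [Sim.addKey, Sim.size_encode, size_encode_cons]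
      have : (encode true).size = 3 := rfl
      omega
    · simp [Sim.addKey, hidc]
    · rw [size_encode_inl]; omega
    · exact ⟨by rw [hidc], hs⟩
  unfold keyIssue at hsup
  split at hsup
  · rwa [(PMF.mem_support_pure_iff _ _).1 hsup]
  · rw [PMF.support_map] at hsup
    obtain ⟨σ, -, rfl⟩ := hsup
    unfold tryForge
    split_ifs
    · exact fun h => absurd rfl h
    · exact hask

/-- The growth has to be bounded independently of the current state, since a state that doubles with
each query would exceed every polynomial. New data stem from the query, from fresh keys and coins,
from the hash function, or from the extractor applied to the query and constants. Signatures made by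
the reduction go into answers only, except for a forgery, which ends the run. -/
theorem exists_smallStep (hh : IsPolyTime h)
    (hE₂ : IsPPT fun n (a : Bits × Bits × (Bits × Bits) × Bits) => E₂ n a.1 a.2.1 a.2.2.1 a.2.2.2) :
    ∃ G : ℕ → ℕ, PolyB G ∧ ∀ (K : ℕ) (c : Fixed) (m : Sim) (d : Data),
      (encode c).size ≤ K → d.size ≤ K →
      ∀ s ∈ (queryStep D h Pf E₂ c m (decode d)).support, SmallStep (G K) c m s := by
  obtain ⟨bQ, hbQ, hQ⟩ := (Canon.frameQuery (canon_bits.prod canon_bits)).size_le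
  obtain ⟨bF, hbF, hF⟩ := D.freshKey_ppt.size_le
  obtain ⟨bE, hbE, hE⟩ := hE₂.size_le
  obtain ⟨bH, hbH, hH⟩ := IsPPT.size_le hh
  have hco := PolyB.eval D.coins
  refine ⟨fun K => 3 * bQ K + 3 * bF K + 4 * D.coins.eval K + 3 * bE (6 * K + bQ K + 10) +
    bH (K + bQ K + 5) + 30, by fun_prop, ?_⟩
  intro K c m d hc hd s hs
  beta_reduce
  have hcs := Fixed.size_encode c
  have hnK : c.n ≤ K := by have := size_encode_nat c.n; omega
  have hQd := (hQ d).trans (hbQ.1 hd)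
  have hid : (encode m).size ≤ (encode m).size + 0 := le_rfl
  cases hdec : (decode d : Option (FrameQuery (Bits × Bits))) with
  | none =>
    rw [hdec] at hs
    rw [(PMF.mem_support_pure_iff _ _).1 hs]
    exact fun _ => ⟨rfl, Nat.le_add_right _ _, Nat.le_succ _⟩
  | some q =>
    rw [hdec] at hs hQd
    cases q with
    | corruptUser U =>
      have hU : 2 + (2 + (encode U).size) ≤ bQ K := hQd
      rw [(PMF.mem_support_pure_iff _ _).1 hs]
      refine fun _ => ⟨rfl, ?_, Nat.le_succ _⟩
      simp only [Sim.size_encode, size_encode_cons]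
      omega
    | corruptVer U V =>
      have hU : 2 + (4 + (2 + (2 + (1 + (encode U).size + (encode V).size)))) ≤ bQ K := hQd
      rw [(PMF.mem_support_pure_iff _ _).1 hs]
      refine fun _ => ⟨rfl, ?_, Nat.le_succ _⟩
      simp only [Sim.size_encode, size_encode_cons, size_encode_pair]
      omega
    | createHonestUser U V =>
      have hU : 2 + (4 + (2 + (4 + (1 + (encode U).size + (encode V).size)))) ≤ bQ K := hQd
      have hcd : (encode (m.cd - 1)).size ≤ (encode m.cd).size := by
        rw [size_encode_nat, size_encode_nat]; omega
      simp only [queryStep] at hs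
      split_ifs at hs with h1 h2
      · rw [(PMF.mem_support_pure_iff _ _).1 hs]
        exact fun _ => ⟨rfl, Nat.le_add_right _ _, Nat.le_succ _⟩
      · rw [(PMF.mem_support_pure_iff _ _).1 hs]
        refine ⟨rfl, ?_, Nat.le_succ _, ?_, rfl⟩
        · simp only [Sim.size_encode, size_encode_cons, size_encode_pair]
          omega
        · simp only [size_encode_inl, size_encode_some, size_encode_pair, size_encode_none]
          omega
      · simp only [createUser, PMF.mem_support_bind_iff] at hs
        obtain ⟨sk, hsk, r, hr, π, -, hs⟩ := hs
        have hsk' : (encode sk).size ≤ bF K := (hF c.n () sk hsk).trans (hbF.1 (by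
          show 1 + (encode c.n).size + 1 ≤ K
          omega))
        have hr' : (encode r).size ≤ 4 * D.coins.eval K + 1 := by
          have h1 := size_encode_bits_le r
          rw [randomBits_length hr] at h1
          have h2 := hco.1 hnK
          dsimp only at h2
          omega
        split_ifs at hs
        · refine smallStep_keyIssue D (m₀ := m) (by rfl) ?_ ?_ ?_ hs
          · simp only [Sim.size_encode, size_encode_cons, size_encode_pair]
            omega
          · omega
          · simp only [size_encode_some, size_encode_pair]
            omega
        · rw [(PMF.mem_support_pure_iff _ _).1 hs]
          refine fun _ => ⟨rfl, ?_, Nat.le_succ _⟩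
          simp only [Sim.size_encode, size_encode_cons, size_encode_pair]
          omega
    | joinSystem U V j =>
      have hU : 2 + (4 + (4 + (2 + (1 + (encode U).size + (1 + (encode V).size +
        (1 + (encode j.1).size + (encode j.2).size)))))) ≤ bQ K := hQd
      simp only [queryStep] at hs
      split_ifs at hs
      · simp only [PMF.mem_support_bind_iff] at hs
        obtain ⟨w, hw, hs⟩ := hs
        have hw' : 1 + (encode w.1).size + (encode w.2).size ≤ bE (6 * K + bQ K + 10) :=
          (hE c.n (c.ρ, c.τ, (j.1, c.pk), j.2) w hw).trans (hbE.1 (by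
            simp only [size_encode_pair]; omega))
        refine smallStep_keyIssue D (m₀ := m) (by rfl) ?_ ?_ ?_ hs
        · omega
        · omega
        · rw [size_encode_none]; omega
      · rw [(PMF.mem_support_pure_iff _ _).1 hs]
        exact fun _ => ⟨rfl, Nat.le_add_right _ _, Nat.le_succ _⟩
    | createComment U dom y =>
      have hU : 2 + (4 + (4 + (4 + (1 + (encode U).size + (1 + (encode dom).size +
        (encode y).size))))) ≤ bQ K := hQd
      simp only [queryStep] at hs
      split at hs
      · rw [(PMF.mem_support_pure_iff _ _).1 hs]
        exact fun _ => ⟨rfl, Nat.le_add_right _ _, Nat.le_succ _⟩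
      · have hy : (encode (h c.n y)).size ≤ bH (K + bQ K + 5) :=
          (hH c.n y _ ((PMF.mem_support_pure_iff _ _).2 rfl)).trans (hbH.1 (by
            simp only [size_encode_pair]; omega))
        unfold commentStep at hs
        split at hs
        · rw [(PMF.mem_support_pure_iff _ _).1 hs]
          refine ⟨rfl, ?_, Nat.le_succ _, ?_, rfl, ?_⟩
          · simp only [Sim.size_encode, size_encode_cons]
            omega
          · simp only [size_encode_inr, size_encode_pair]
            omega
          · simp only [size_encode_some]
            omega
        · rw [PMF.support_map] at hs
          obtain ⟨σ, -, rfl⟩ := hs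
          exact fun _ => ⟨rfl, Nat.le_add_right _ _, Nat.le_succ _⟩

/-- The size of a signature depends on the stored key and credential, so a separate bound `Z₁` for
the entries of signers is maintained. It does not deteriorate with the number of signers, because a
credential is issued for a key and coins and never depends on earlier credentials. -/
theorem exists_small_traceAnswer (D : DAA) {G : ℕ → ℕ} (hG : PolyB G) :
    ∃ Z₁ Z : ℕ → ℕ, PolyB Z₁ ∧ PolyB Z ∧
      ∀ (K n : ℕ) (pk skI : Bits) (t : DAA.TraceState) (m : Sim) (q : DAA.TraceQuery),
      (encode n).size + (encode pk).size + (encode skI).size + m.idc.length ≤ K →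
      (∀ e ∈ t.signers, (encode e.2).size ≤ Z₁ K) → SmallQuery (G K) m q →
      ∀ r ∈ (D.traceAnswer n pk skI t q).support, (encode r.1).size ≤ Z K ∧
        (encode r.2).size ≤ (encode t).size + Z K ∧ ∀ e ∈ r.2.signers, (encode e.2).size ≤ Z₁ K := by
  obtain ⟨bF, hbF, hF⟩ := D.freshKey_ppt.size_le
  obtain ⟨bJ, hbJ, hJ⟩ := IsPPT.size_le D.join_poly
  obtain ⟨bI, hbI, hI⟩ := D.issue_ppt.size_le
  obtain ⟨bS, hbS, hS⟩ := D.sign_ppt.size_le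
  have hco := PolyB.eval D.coins
  -- `R` bounds a key together with its coins, `C` a credential issued for them, and `B` a
  -- signature.
  let R : ℕ → ℕ := fun K => G K + bF K + 4 * D.coins.eval K + 1
  let C : ℕ → ℕ := fun K => bI (2 * K + 5 + bJ (2 * K + 5 + R K))
  let Z₁ : ℕ → ℕ := fun K => 1 + R K + C K
  have hR : PolyB R := by fun_prop
  have hC : PolyB C := hbI.comp ((by fun_prop : PolyB fun K => 2 * K + 5).add
    (hbJ.comp (by fun_prop)))
  have hZ₁ : PolyB Z₁ := by fun_prop
  let B : ℕ → ℕ := fun K => bS (K + Z₁ K + G K + 10)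
  have hB : PolyB B := hbS.comp (by fun_prop)
  refine ⟨Z₁, fun K => 2 * Z₁ K + 4 * K + 20 + B K + G K, hZ₁, by fun_prop, ?_⟩
  intro K n pk skI t m q hK hsig hq r hr
  beta_reduce
  have hnK : n ≤ K := by have := size_encode_nat n; omega
  have hcred : ∀ sk r' : Bits, (encode sk).size + (encode r').size ≤ R K →
      ∀ cred ∈ (D.issue n skI (D.join n pk sk r')).support, (encode cred).size ≤ C K := by
    intro sk r' hsr cred hcr
    have h1 : (encode (D.join n pk sk r')).size ≤ bJ (2 * K + 5 + R K) :=
      (hJ n (pk, sk, r') _ ((PMF.mem_support_pure_iff _ _).2 rfl)).trans (hbJ.1 (by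
        simp only [size_encode_pair]; omega))
    exact (hI n (skI, _) cred hcr).trans (hbI.1 (by
      show 1 + (encode n).size + (1 + (encode skI).size + (encode (D.join n pk sk r')).size) ≤ _
      omega))
  have hnil : (encode ([] : Bits)).size = 1 := rfl
  cases q with
  | sign S dom hm =>
    obtain ⟨rfl, hdom⟩ := hq
    unfold DAA.traceAnswer at hr
    dsimp only at hr
    split at hr
    · rw [(PMF.mem_support_pure_iff _ _).1 hr]
      exact ⟨by dsimp only; rw [size_encode_none]; omega, by dsimp only; omega, hsig⟩
    · rename_i e he
      rw [PMF.support_map] at hr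
      obtain ⟨σ, hσ, rfl⟩ := hr
      have he' : 1 + (encode e.2.1).size + (encode e.2.2).size ≤ Z₁ K :=
        hsig e (List.mem_of_find?_eq_some he)
      have hσ' : (encode σ).size ≤ B K := (hS n (e.2.1, e.2.2, dom, hm) σ hσ).trans (hbS.1 (by
        simp only [size_encode_pair]; omega))
      refine ⟨?_, ?_, hsig⟩
      · rw [size_encode_some]; omega
      · simp only [DAA.TraceState.size_encode, size_encode_cons, size_encode_pair]
        omega
  | hjoin S =>
    obtain rfl : S = [] := hq
    unfold DAA.traceAnswer at hr
    dsimp only at hr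
    split at hr
    · rw [(PMF.mem_support_pure_iff _ _).1 hr]
      exact ⟨by dsimp only; rw [size_encode_none]; omega, by dsimp only; omega, hsig⟩
    · simp only [PMF.mem_support_bind_iff, PMF.support_map] at hr
      obtain ⟨sk, hsk, r', hr', cred, hcr, rfl⟩ := hr
      have hsk' : (encode sk).size ≤ bF K := (hF n () sk hsk).trans (hbF.1 (by
        show 1 + (encode n).size + 1 ≤ K
        have := (encode pk).size_pos
        have := (encode skI).size_pos
        omega))
      have hr'' : (encode r').size ≤ 4 * D.coins.eval K + 1 := by
        have h1 := size_encode_bits_le r'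
        rw [randomBits_length hr'] at h1
        have h2 := hco.1 hnK
        dsimp only at h2
        omega
      have hsr : (encode sk).size + (encode r').size ≤ R K := by dsimp only [R]; omega
      have hc' := hcred sk r' hsr cred hcr
      have hz : 1 + (encode sk).size + (encode cred).size ≤ Z₁ K := by dsimp only [Z₁]; omega
      refine ⟨?_, ?_, ?_⟩
      · rw [size_encode_some]; omega
      · simp only [DAA.TraceState.size_encode, size_encode_cons, size_encode_pair]
        omega
      · intro e he
        rcases List.mem_cons.1 he with rfl | he
        exacts [hz, hsig e he]
  | join S sk r' =>
    obtain ⟨rfl, hsr₀⟩ := hq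
    unfold DAA.traceAnswer at hr
    dsimp only at hr
    split at hr
    · rw [(PMF.mem_support_pure_iff _ _).1 hr]
      exact ⟨by dsimp only; rw [size_encode_none]; omega, by dsimp only; omega, hsig⟩
    · split_ifs at hr
      · rw [PMF.support_map] at hr
        obtain ⟨cred, hcr, rfl⟩ := hr
        have hsr : (encode sk).size + (encode r').size ≤ R K := by dsimp only [R]; omega
        have hc' := hcred sk r' hsr cred hcr
        have hz : 1 + (encode sk).size + (encode cred).size ≤ Z₁ K := by dsimp only [Z₁]; omega
        have hname := size_encode_bits_le (true :: m.idc)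
        rw [List.length_cons] at hname
        refine ⟨?_, ?_, ?_⟩
        · rw [size_encode_some]; omega
        · simp only [DAA.TraceState.size_encode, size_encode_cons (α := Bits × Bits × Bits),
            size_encode_cons sk, size_encode_pair]
          omega
        · intro e he
          rcases List.mem_cons.1 he with rfl | he
          exacts [hz, hsig e he]
      · rw [(PMF.mem_support_pure_iff _ _).1 hr]
        exact ⟨by dsimp only; rw [size_encode_none]; omega, by dsimp only; omega, hsig⟩
  | corrupt S => exact hq.elim

theorem answerStep_fixed (k : Fixed × Sim × Cont) (a : Option Bits) :
    (answerStep D k a).2.1 = k.1 ∧ (answerStep D k a).2.2.idc = k.2.1.idc := by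
  unfold answerStep
  split <;> exact ⟨rfl, rfl⟩

theorem size_answerStep_le (k : Fixed × Sim × Cont) (a : Option Bits) :
    (encode (answerStep D k a).2.2).size ≤
      (encode k.2.1).size + (encode k.2.2).size + 2 * (encode a).size := by
  obtain ⟨c, m, o⟩ := k
  unfold answerStep
  rcases o with ((_ | ⟨U, o⟩) | ⟨dom, hm⟩)
  · dsimp only; omega
  · have hg := size_encode_getD a
    have ht : (encode (if o = none then a else m.tgt)).size ≤
        (encode m.tgt).size + (encode a).size := by split_ifs <;> omega
    simp only [Sim.size_encode, size_encode_cons, size_encode_pair, size_encode_inl,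
      size_encode_some]
    omega
  · dsimp only; omega

/-- The summand `Z * f` in `Small` is a potential: every query consumes one remaining time unit and
thereby releases `Z`, which pays for the growth of both parts of the state. A stopping step is
exempt since nothing follows it. -/
theorem exists_small (hh : IsPolyTime h)
    (hE₂ : IsPPT fun n (a : Bits × Bits × (Bits × Bits) × Bits) => E₂ n a.1 a.2.1 a.2.2.1 a.2.2.2) :
    ∃ Z₁ Z : ℕ → ℕ, PolyB Z₁ ∧ PolyB Z ∧ ∀ (K S N : ℕ) (u : GameState) (f : ℕ) (d : Data),
      Small K (Z₁ K) (Z K) S N u (f + 1) → d.size ≤ K →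
      (∀ q k, .inr (q, k) ∈ (queryStep D h Pf E₂ u.2.1.1 u.2.1.2 (decode d)).support →
        ∀ r ∈ (D.traceAnswer u.2.1.1.n u.2.1.1.pk u.1 u.2.2 q).support, (encode r.1).size ≤ Z K) ∧
      ∀ a u', (some a, u') ∈ (simOracle D h Pf E₂ u d).support →
        u'.1 = u.1 ∧ u'.2.1.1 = u.2.1.1 ∧ Small K (Z₁ K) (Z K) S N u' f := by
  obtain ⟨G, hG, hstep⟩ := exists_smallStep D Pf hh hE₂
  obtain ⟨Z₁, Z, hZ₁, hZ, htr⟩ := exists_small_traceAnswer D.toDAA hG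
  refine ⟨Z₁, fun K => 3 * Z K + 2 * G K, hZ₁, by fun_prop, ?_⟩
  intro K S N u f d hu hd
  beta_reduce at hu ⊢
  obtain ⟨h1, h2, h3, h4⟩ := hu
  rw [Nat.mul_succ] at h4
  have hcs := Fixed.size_encode u.2.1.1
  have hs := hstep K u.2.1.1 u.2.1.2 d (by omega) hd
  have ht := fun q hq => htr K u.2.1.1.n u.2.1.1.pk u.1 u.2.2 u.2.1.2 q (by omega) h3 hq
  refine ⟨fun q k hq r hr => (ht q (hs _ hq).2.2.2.2 r hr).1.trans (by omega),
    fun a u' hr => ?_⟩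
  rw [simOracle_eq, PMF.mem_support_bind_iff] at hr
  obtain ⟨s, hs', hr⟩ := hr
  have hss := hs s hs'
  cases s with
  | inl r =>
    have hr' := (PMF.mem_support_pure_iff _ _).1 hr
    obtain ⟨h5, rfl⟩ := Prod.ext_iff.1 hr'
    dsimp only at h5
    obtain ⟨h6, h7, h8⟩ := hss (by rw [← h5]; simp)
    dsimp only
    exact ⟨rfl, h6, ⟨by dsimp only; rw [h6]; exact h1, by dsimp only; omega, h3,
      by dsimp only; omega⟩⟩
  | inr q =>
    obtain ⟨h6, h7, h8, h9, h10⟩ := hss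
    simp only [finishStep, PMF.support_map] at hr
    obtain ⟨r, hr, hr'⟩ := hr
    obtain ⟨h11, h12, h13⟩ := ht q.1 h10 r hr
    obtain ⟨-, rfl⟩ := Prod.ext_iff.1 hr'
    obtain ⟨h14, h15⟩ := answerStep_fixed D q.2 r.1
    have h16 := size_answerStep_le D q.2 r.1
    dsimp only
    exact ⟨rfl, h14.trans h6, ⟨by dsimp only; rw [h14, h6]; exact h1,
      by dsimp only; rw [h15]; omega, h13, by dsimp only; omega⟩⟩

end

/-! ## The adversaries of the reduction -/

section

variable {D : LinkableDAA} {h : ℕ → Bits → Bits} {Pf : ProofSystem (Bits × Bits) (Bits × Bits)}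
  {E₂ : ℕ → Bits → Bits → Bits × Bits → Bits → PMF (Bits × Bits)}

theorem Small.mono {K Z₁ Z S N : ℕ} {u : GameState} {f f' : ℕ} (hu : Small K Z₁ Z S N u f)
    (hf : f' ≤ f) : Small K Z₁ Z S N u f' :=
  ⟨hu.const, by have := hu.idc; omega, hu.signers,
    le_trans (by gcongr) hu.total⟩

/-- Here the handler's state is the whole game, including the challenger and the issuer's secret
key, and no oracle is called. -/
theorem exists_implements_local (hh : IsPolyTime h)
    (hE₂ : IsPPT fun n (a : Bits × Bits × (Bits × Bits) × Bits) => E₂ n a.1 a.2.1 a.2.2.1 a.2.2.2) :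
    ∃ (H : Prog) (Z₁ Z : ℕ → ℕ) (R : ℕ → ℕ), PolyB Z ∧ PolyB R ∧ ∀ n K S N M, M ≤ K →
      Implements noOracle H (simOracle D h Pf E₂) encode (fun _ => ())
        (fun u f => u.2.1.1.n = n ∧ Small K (Z₁ K) (Z K) S N u f) M (R (K + S)) := by
  obtain ⟨Z₁, Z, -, hZ, hs⟩ := exists_small D Pf hh hE₂
  obtain ⟨H, c, hc, hH⟩ := exists_local_handler (eff_simOracle D Pf hh hE₂)
  refine ⟨H, Z₁, Z, fun x => c (2 * x + 4) + 2 * x + 3, hZ, by fun_prop,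
    fun n K S N M hM => ?_⟩
  have hsize : ∀ u f, Small K (Z₁ K) (Z K) S N u f → (encode u).size ≤ K + S + 3 := fun u f hu => by
    have h1 := hu.const
    have h2 := hu.total
    show 1 + (encode u.1).size + (1 + (1 + (encode u.2.1.1).size + (encode u.2.1.2).size) +
      (encode u.2.2).size) ≤ _
    omega
  have hbound : ∀ u f (d : Data), Small K (Z₁ K) (Z K) S N u f → d.size ≤ K →
      c (Data.cons (encode u) d).size ≤ c (2 * (K + S) + 4) + 2 * (K + S) + 3 :=
    fun u f d hu hd => by
      rw [add_assoc]
      refine le_trans (hc.1 ?_) (Nat.le_add_right _ _)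
      have := hsize u f hu
      simp only [Data.size]
      omega
  constructor
  · exact fun u f f' hu hf => ⟨hu.1, hu.2.mono hf⟩
  · intro u f d hu hd a u' hu'
    obtain ⟨-, h1, h2⟩ := (hs K S N u f d hu.2 (by omega)).2 a u' hu'
    exact ⟨h1 ▸ hu.1, h2⟩
  · exact fun u f hu => (hsize u f hu.2).trans (by beta_reduce; omega)
  · intro u f d hu hd r hr
    exact ((hH u d).1 r hr).trans (hbound u _ d hu.2 (by omega))
  · intro u f d s hu hd h1 h2
    exact ((hH u d).2 s h1 h2).mono (hbound u _ d hu.2 (by omega))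

/-- Here only the reduction's own part `u.2.1` is stored by the program; `u.2.2` is the state of the
actual challenger, and the issuer's secret key `u.1` occurs in the invariant alone. -/
theorem exists_implements_trace (hh : IsPolyTime h)
    (hE₂ : IsPPT fun n (a : Bits × Bits × (Bits × Bits) × Bits) => E₂ n a.1 a.2.1 a.2.2.1 a.2.2.2) :
    ∃ (H : Prog) (Z₁ Z : ℕ → ℕ) (R : ℕ → ℕ), PolyB Z ∧ PolyB R ∧ ∀ n pk skI K S N M, M ≤ K →
      Implements (handle (D.traceHandler n pk skI)) H (simOracle D h Pf E₂)
        (fun u => encode u.2.1) (fun u => u.2.2)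
        (fun u f => (u.1 = skI ∧ u.2.1.1.n = n ∧ u.2.1.1.pk = pk) ∧ Small K (Z₁ K) (Z K) S N u f)
        M (R (K + S)) := by
  obtain ⟨Z₁, Z, -, hZ, hs⟩ := exists_small D Pf hh hE₂
  obtain ⟨H, c, hc, hH⟩ := exists_handler (s₁ := fun (b : Fixed × Sim) d =>
    queryStep D h Pf E₂ b.1 b.2 (decode d)) (s₂ := answerStep D) (eff_queryStep D Pf hh hE₂)
    (det_answerStep D (k := fun j : (Fixed × Sim × Cont) × Option Bits => j.1)
      (a := fun j => j.2) Det.id.encFst Det.id.encSnd)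
  refine ⟨H, Z₁, Z, fun x => c (2 * x + 3 + Z x) + 2 * x + 3, hZ, by fun_prop,
    fun n pk skI K S N M hM => ?_⟩
  have hsize : ∀ u f, Small K (Z₁ K) (Z K) S N u f → (encode u.2.1).size ≤ K + S + 1 :=
    fun u f hu => by
      have h1 := hu.const
      have h2 := hu.total
      show 1 + (encode u.2.1.1).size + (encode u.2.1.2).size ≤ _
      omega
  have hbound : ∀ u f (d : Data), Small K (Z₁ K) (Z K) S N u f → d.size ≤ K →
      c ((encode (u.2.1, d)).size + Z K) ≤
        c (2 * (K + S) + 3 + Z (K + S)) + 2 * (K + S) + 3 := fun u f d hu hd => by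
    rw [add_assoc]
    refine le_trans (hc.1 ?_) (Nat.le_add_right _ _)
    have h1 := hsize u f hu
    have h2 := hZ.1 (Nat.le_add_right K S)
    show 1 + (encode u.2.1).size + d.size + Z K ≤ _
    omega
  have henc : ∀ (u : GameState) (r : Option Data × (Fixed × Sim) × DAA.TraceState),
      encResult (fun u : GameState => encode u.2.1) (r.1, u.1, r.2.1, r.2.2) =
        encode (r.1, r.2.1) := fun u r => by
    rcases r with ⟨_ | a, r⟩ <;> rfl
  have hq : ∀ (u : GameState) f (d : Data), u.1 = skI ∧ u.2.1.1.n = n ∧ u.2.1.1.pk = pk →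
      Small K (Z₁ K) (Z K) S N u (f + 1) → d.size ≤ K → _ := fun u f d hu hs' hd =>
    hH _ (handle (D.traceHandler n pk skI)) (D.traceAnswer u.2.1.1.n u.2.1.1.pk u.1) u.2.1 u.2.2
      d (Z K) fun q k hqk => ⟨by
        rw [hu.1, hu.2.1, hu.2.2]; exact D.handle_traceHandler n pk skI u.2.2 q,
        (hs K S N u f d hs' hd).1 q k hqk⟩
  constructor
  · exact fun u f f' hu hf => ⟨hu.1, hu.2.mono hf⟩
  · intro u f d hu hd a u' hu'
    obtain ⟨h0, h1, h2⟩ := (hs K S N u f d hu.2 (by omega)).2 a u' hu'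
    exact ⟨by rw [h0, h1]; exact hu.1, h2⟩
  · exact fun u f hu => (hsize u f hu.2).trans (by beta_reduce; omega)
  · intro u f d hu hd r hr
    rw [simOracle, PMF.support_map] at hr
    obtain ⟨r, hr, rfl⟩ := hr
    rw [henc]
    exact ((hq u f d hu.1 hu.2 (by omega)).1 r hr).trans (hbound u _ d hu.2 (by omega))
  · intro u f d s hu hd h1 h2
    refine (((hq u f d hu.1 hu.2 (by omega)).2 s h1 h2).mono
      (hbound u _ d hu.2 (by omega))).congr ?_
    rw [simOracle, PMF.map_comp]
    congr 1
    funext r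
    simp only [Function.comp, henc]

end

/-! ### The long basename and the initial states -/

section

/-- The basename of forgeries, of length `k`. -/
def longBsn (k : ℕ) : Bits := (fun l => true :: l)^[k] []

theorem length_longBsn (k : ℕ) : (longBsn k).length = k := by
  induction k with
  | zero => rfl
  | succ k ih => rw [longBsn, Function.iterate_succ_apply', List.length_cons, ← longBsn, ih]

theorem det_longBsn {ι : Type} {x : ι → Data} {k : ι → ℕ} (hk : Det x fun i => encode (k i)) :
    Det x fun i => encode (longBsn (k i)) := by
  obtain ⟨B, hB, hkB⟩ := hk.nat_size_le
  refine Det.iterate (g := fun _ l => true :: l) (a₀ := fun _ => ([] : Bits)) hk Det.nil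
    (fun x => 4 * B x + 1) (by fun_prop) (fun i m hm => ?_)
    (Det.consList (Det.const (encode true)) (Det.right Det.id))
  have h1 := size_encode_bits_le (longBsn m)
  rw [length_longBsn] at h1
  have h2 := hkB i
  refine h1.trans ?_
  omega

/-- The basename of forgeries is longer than those in the queries. -/
theorem exists_long {M : ℕ → ℕ} (hM : PolyB M) : ∃ q : Polynomial ℕ, ∀ (n : ℕ) (d : Data),
    d.size ≤ M n → ∀ U dom x, (decode d : Option (FrameQuery (Bits × Bits))) =
      some (.createComment U dom x) → dom.length < (longBsn (q.eval n)).length := by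
  obtain ⟨b, hb, hB⟩ := (Canon.frameQuery (canon_bits.prod canon_bits)).size_le
  obtain ⟨q, hq⟩ := (hb.comp hM).2
  refine ⟨q, fun n d hd U dom x hdec => ?_⟩
  have h1 := ((hB d).trans (hb.1 hd)).trans (hq n)
  rw [hdec] at h1
  have h2 : 2 + (4 + (4 + (4 + (1 + (encode U).size + (1 + (encode dom).size +
    (encode x).size))))) ≤ q.eval n := h1
  have h3 := length_le_size_encode_bits dom
  rw [length_longBsn]
  omega

/-- The initial state of the reduction. -/
def gameStart (n : ℕ) (pk skI dom₀ : Bits) (e : Bits × Bits) (j : ℕ) : GameState :=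
  (skI, (⟨n, pk, e.1, e.2, dom₀⟩, .start j), ⟨[], [], []⟩)

/-- The random initial state of the reduction and the input of the adversary. -/
def startDist (E₁ : ℕ → PMF (Bits × Bits)) (N n : ℕ) (pk skI dom₀ : Bits) :
    PMF (Data × GameState) :=
  (E₁ n).bind fun e => (guess N).map fun j =>
    (encode (n, ((n, e.1), pk)), gameStart n pk skI dom₀ e j)

theorem small_gameStart {n : ℕ} {pk skI dom₀ : Bits} {e : Bits × Bits} {j K Z₁ Z N : ℕ}
    (hK : (encode n).size + (encode pk).size + (encode skI).size + (encode e).size +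
      (encode dom₀).size + N + 4 ≤ K) (hj : j < 2 * N + 1) :
    Small K Z₁ Z (4 * N + 40 + Z * N) N (gameStart n pk skI dom₀ e j) N where
  const := by
    have h1 : (encode e).size = 1 + (encode e.1).size + (encode e.2).size := rfl
    have h2 := Fixed.size_encode (gameStart n pk skI dom₀ e j).2.1.1
    simp only [gameStart] at h2 ⊢
    omega
  idc := by simp [gameStart, Sim.start]
  signers := by simp [gameStart]
  total := by
    have h1 : (encode (Sim.start j)).size = 1 + (encode (j + 1)).size + 15 := rfl
    have h2 : (encode (⟨[], [], []⟩ : DAA.TraceState)).size = 5 := rfl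
    -- The countdown is unary and at most `2 * N + 1`; this explains the `4 * N` in the bound.
    rw [size_encode_nat] at h1
    simp only [gameStart]
    omega

variable {D : LinkableDAA} {h : ℕ → Bits → Bits} {Pf : ProofSystem (Bits × Bits) (Bits × Bits)}
  {E₁ : ℕ → PMF (Bits × Bits)} {E₂ : ℕ → Bits → Bits → Bits × Bits → Bits → PMF (Bits × Bits)}

theorem exists_start_size_le (D : LinkableDAA) (hE₁ : IsPPT fun n (_ : Unit) => E₁ n)
    (clock : Polynomial ℕ) : ∃ M : ℕ → ℕ, PolyB M ∧
      ∀ n, ∀ s ∈ (D.setup n).support, ∀ e ∈ (E₁ n).support,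
        (encode s.1).size ≤ M n ∧
        (encode (n, ((n, e.1), s.1))).size + clock.eval n ≤ M n ∧
        (encode n).size + (encode s.1).size + (encode s.2).size + (encode e).size +
          clock.eval n + 4 ≤ M n := by
  obtain ⟨bD, hbD, hD⟩ := D.setup_ppt.size_le
  obtain ⟨bE, hbE, hE⟩ := hE₁.size_le
  have hclock := PolyB.eval clock
  refine ⟨fun n => bD (2 * n + 3) + bE (2 * n + 3) + 4 * n + 20 + clock.eval n, by fun_prop,
    fun n s hs e he => ?_⟩
  have h0 : (encode (n, ())).size = 2 * n + 3 := by
    rw [size_encode_pair, size_encode_nat]; show 1 + (2 * n + 1) + 1 = _; omega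
  have h1 := hD n () s hs
  have h2 := hE n () e he
  rw [h0] at h1 h2
  have h3 : (encode s).size = 1 + (encode s.1).size + (encode s.2).size := rfl
  have h4 : (encode e).size = 1 + (encode e.1).size + (encode e.2).size := rfl
  simp only [size_encode_pair, size_encode_nat]
  omega

theorem eff_startDist {ι : Type} {x : ι → Data} {N n : ι → ℕ} {pk skI dom₀ : ι → Bits}
    (hE₁ : IsPPT fun n (_ : Unit) => E₁ n)
    (hN : Det x fun i => encode (N i)) (hn : Det x fun i => encode (n i))
    (hpk : Det x fun i => encode (pk i)) (hskI : Det x fun i => encode (skI i))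
    (hdom₀ : Det x fun i => encode (dom₀ i)) :
    Eff x fun i => (startDist E₁ (N i) (n i) (pk i) (skI i) (dom₀ i)).map encode := by
  refine Eff.bindEncode (hE₁.call (a := fun _ => ()) hn Det.nil) fun e y x' hx => ?_
  refine Eff.mapEncode (Eff.guess (hx.lift hN)) fun e' j x'' hx' => ?_
  have hn' := hx'.lift (hx.lift hn)
  have hpk' := hx'.lift (hx.lift hpk)
  have hy : Det x'' fun k => encode ((y (e' k)).1, (y (e' k)).2) := hx'.lift hx.added
  have hnil : Det x'' fun _ => Data.nil := Det.nil
  refine Det.cons (hn'.cons ((hn'.cons hy.encFst).cons hpk')) (Det.cons (hx'.lift (hx.lift hskI))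
    (Det.cons (Det.cons (hn'.cons (hpk'.cons (hy.encFst.cons (hy.encSnd.cons
      (hx'.lift (hx.lift hdom₀)))))) (Sim.det_mk hx'.added.succ hnil hnil hnil hnil hnil hnil hnil
        hnil)) (hnil.cons (hnil.cons hnil))))

end

/-! ### The adversaries against traceability and collision resistance -/

section

variable {D : LinkableDAA} {h : ℕ → Bits → Bits} (Pf : ProofSystem (Bits × Bits) (Bits × Bits))
  {E₁ : ℕ → PMF (Bits × Bits)} {E₂ : ℕ → Bits → Bits → Bits × Bits → Bits → PMF (Bits × Bits)}

theorem mem_support_startDist {N n : ℕ} {pk skI dom₀ : Bits} {r : Data × GameState}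
    (hr : r ∈ (startDist E₁ N n pk skI dom₀).support) : ∃ e ∈ (E₁ n).support, ∃ j < 2 * N + 1,
      r = (encode (n, ((n, e.1), pk)), gameStart n pk skI dom₀ e j) := by
  simp only [startDist, PMF.mem_support_bind_iff, PMF.support_map] at hr
  obtain ⟨e, he, j, hj, rfl⟩ := hr
  exact ⟨e, he, j, guess_lt hj, rfl⟩

/-- Stopping value and final value are both the indicator that the output is a forgery, so
`exists_reduction` applies with this indicator as `W`. Of the record given to `forgeryValue` only
the parameter and the public key are used; empty strings fill the other fields. -/
theorem exists_trace_adversary (hh : IsPolyTime h) (hE₁ : IsPPT fun n (_ : Unit) => E₁ n)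
    (hE₂ : IsPPT fun n (a : Bits × Bits × (Bits × Bits) × Bits) => E₂ n a.1 a.2.1 a.2.2.1 a.2.2.2)
    (A : Adversary) (q : Polynomial ℕ) : ∃ B : Adversary, ∀ n, ∀ s ∈ (D.setup n).support,
      ev (startDist E₁ (A.clock.eval n) n s.1 s.2 (longBsn (q.eval n))) (fun r =>
        wp (simOracle D h Pf E₂) (forgeryValue D ⟨n, s.1, [], [], []⟩) A.prog (forgeryFinal D h)
          (st r.1) r.2 (A.clock.eval n)) ≤
      ev (B.play (handle (D.traceHandler n s.1 s.2)) n s.1 (DAA.TraceState.mk [] [] []))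
        (orZero fun r => ind (D.Forgery n s.1 r.1 r.2)) := by
  obtain ⟨M, hM, hMb⟩ := exists_start_size_le (E₁ := E₁) D hE₁ A.clock
  obtain ⟨H, Z₁, Z, R, hZ, hR, hImp⟩ := exists_implements_trace (D := D) (Pf := Pf) hh hE₂
  have hclock := PolyB.eval A.clock
  have hq := PolyB.eval q
  let K : ℕ → ℕ := fun n => M n + 4 * q.eval n + 1
  let S : ℕ → ℕ := fun n => 4 * A.clock.eval n + 40 + Z (K n) * A.clock.eval n
  have hK : PolyB K := by fun_prop
  have hS : PolyB S := ((PolyB.const 4).mul hclock).add (PolyB.const 40) |>.add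
    ((hZ.comp hK).mul hclock)
  let ι := {i : ℕ × Bits × Bits // i.2 ∈ (D.setup i.1).support}
  refine Exists.elim (exists_reduction (A := A) (ι := ι) (N := fun i => i.1.1) (a := fun i => i.1.2.1)
    (O := fun i => handle (D.traceHandler i.1.1 i.1.2.1 i.1.2.2))
    (κ := simOracle D h Pf E₂) (enc := fun u => encode u.2.1) (st' := fun u => u.2.2)
    (Inv := fun i u f => (u.1 = i.1.2.2 ∧ u.2.1.1.n = i.1.1 ∧ u.2.1.1.pk = i.1.2.1) ∧
      Small (K i.1.1) (Z₁ (K i.1.1)) (Z (K i.1.1)) (S i.1.1) (A.clock.eval i.1.1) u f)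
    (init := fun i => startDist E₁ (A.clock.eval i.1.1) i.1.1 i.1.2.1 i.1.2.2
      (longBsn (q.eval i.1.1)))
    (final := fun flag u out => forgeryOutput h flag u.2.1 out) (H := H) (M := M)
    (R₀ := fun n => R (K n + S n)) (t₀ := fun _ => ⟨[], [], []⟩) hM (hR.comp (hK.add hS))
    (fun i => hImp i.1.1 i.1.2.1 i.1.2.2 (K i.1.1) (S i.1.1) (A.clock.eval i.1.1) (M i.1.1)
      (by dsimp only [K]; omega)) ?_ ?_ ?_ ?_) fun B hB => ?_
  · have hid : Det (fun i : ι => encode (i.1.1, i.1.2.1)) fun i => encode (i.1.1, i.1.2.1) := Det.id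
    -- The reduction does not have the issuer's secret key. The initial distribution is sampled with
    -- `[]` in its place, and the projection to the input and the reduction's own state removes it.
    refine Eff.congr (Eff.map (g := fun _ d => .cons d.head d.tail.tail.head)
      (eff_startDist (skI := fun _ => []) hE₁ (Det.poly hid.encFst A.clock) hid.encFst hid.encSnd
        Det.nil (det_longBsn (hid.encFst.poly q)))
      (Det.cons (Det.left Det.id).head (Det.left Det.id).tail.tail.head)) fun i => ?_
    simp only [startDist, PMF.map_bind, PMF.map_comp]
    rfl
  · rintro ⟨⟨n, s⟩, hs⟩
    obtain ⟨e, he⟩ := (E₁ n).support_nonempty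
    exact (hMb n s hs e he).1
  · rintro ⟨⟨n, s⟩, hs⟩ r hr
    obtain ⟨e, he, j, hj, rfl⟩ := mem_support_startDist hr
    obtain ⟨-, h1, h2⟩ := hMb n s hs e he
    have h3 := size_encode_bits_le (longBsn (q.eval n))
    rw [length_longBsn] at h3
    exact ⟨⟨⟨rfl, rfl, rfl⟩, small_gameStart (by dsimp only [K]; omega) hj⟩, rfl, h1⟩
  · have h1 : Det (fun j : Bool × GameState × Data =>
        .cons (encode j.1) (.cons (encode j.2.1.2.1) j.2.2)) fun j =>
          encode (j.2.1.2.1.1, j.2.1.2.1.2) := Det.right (Det.left Det.id)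
    exact det_forgeryOutput hh (Det.left Det.id) h1 (Det.right (Det.right Det.id))
  · refine ⟨B, fun n s hs => hB ⟨(n, s), hs⟩ _ _ (fun b t => ind (D.Forgery n s.1 b t)) ?_ ?_⟩
    · rintro s' u f ⟨⟨-, h1, h2⟩, -⟩
      dsimp only at h1 h2
      rw [forgeryFinal, h1, h2]
    · exact fun u => le_rfl

/-- The issuer's keys are sampled in the initial computation, and stopped runs count for nothing.
Averaging over these keys is therefore part of the bound, whereas the traceability bound holds for
each pair of keys. -/
theorem exists_collision_adversary (hh : IsPolyTime h) (hE₁ : IsPPT fun n (_ : Unit) => E₁ n)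
    (hE₂ : IsPPT fun n (a : Bits × Bits × (Bits × Bits) × Bits) => E₂ n a.1 a.2.1 a.2.2.1 a.2.2.2)
    (A : Adversary) (q : Polynomial ℕ) : ∃ B : Adversary, ∀ n,
      ev (D.setup n) (fun s =>
        ev (startDist E₁ (A.clock.eval n) n s.1 s.2 (longBsn (q.eval n))) fun r =>
          wp (simOracle D h Pf E₂) 0 A.prog (collisionFinal h) (st r.1) r.2 (A.clock.eval n)) ≤
      ev (B.play noOracle n () ()) (orZero fun r => ind (Collision h n r.1)) := by
  obtain ⟨M, hM, hMb⟩ := exists_start_size_le (E₁ := E₁) D hE₁ A.clock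
  obtain ⟨H, Z₁, Z, R, hZ, hR, hImp⟩ := exists_implements_local (D := D) (Pf := Pf) hh hE₂
  have hclock := PolyB.eval A.clock
  have hq := PolyB.eval q
  let K : ℕ → ℕ := fun n => M n + 4 * q.eval n + 1
  let S : ℕ → ℕ := fun n => 4 * A.clock.eval n + 40 + Z (K n) * A.clock.eval n
  have hK : PolyB K := by fun_prop
  have hS : PolyB S := ((PolyB.const 4).mul hclock).add (PolyB.const 40) |>.add
    ((hZ.comp hK).mul hclock)
  refine Exists.elim (exists_reduction (A := A) (ι := ℕ) (N := fun n => n) (a := fun _ => ())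
    (O := fun _ => noOracle)
    (κ := simOracle D h Pf E₂) (enc := encode) (st' := fun _ => ())
    (Inv := fun n u f => u.2.1.1.n = n ∧
      Small (K n) (Z₁ (K n)) (Z (K n)) (S n) (A.clock.eval n) u f)
    (init := fun n => (D.setup n).bind fun s => startDist E₁ (A.clock.eval n) n s.1 s.2
      (longBsn (q.eval n)))
    (final := fun _ u out => collisionOutput h u.2.1 out) (H := H) (M := M)
    (R₀ := fun n => R (K n + S n)) (t₀ := fun _ => ()) hM (hR.comp (hK.add hS))
    (fun n => hImp n (K n) (S n) (A.clock.eval n) (M n) (by dsimp only [K]; omega)) ?_ ?_ ?_ ?_) fun B hB => ?_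
  · have hn : Det (fun n : ℕ => encode (n, ())) fun n => encode n := Det.encFst Det.id
    refine Eff.congr (Eff.bindEncode (D.setup_ppt.call (a := fun _ => ()) hn Det.nil)
      fun e s x' hx => eff_startDist (pk := fun k => (s k).1) (skI := fun k => (s k).2) hE₁
        (Det.poly (hx.lift hn) A.clock) (hx.lift hn) (Det.encFst hx.added) (Det.encSnd hx.added)
        (det_longBsn ((hx.lift hn).poly q))) fun n => rfl
  · intro n
    obtain ⟨s, hs⟩ := (D.setup n).support_nonempty
    obtain ⟨e, he⟩ := (E₁ n).support_nonempty
    exact le_trans (Data.size_pos _) (hMb n s hs e he).1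
  · intro n r hr
    rw [PMF.mem_support_bind_iff] at hr
    obtain ⟨s, hs, hr⟩ := hr
    obtain ⟨e, he, j, hj, rfl⟩ := mem_support_startDist hr
    obtain ⟨-, h1, h2⟩ := hMb n s hs e he
    have h3 := size_encode_bits_le (longBsn (q.eval n))
    rw [length_longBsn] at h3
    exact ⟨⟨rfl, small_gameStart (by dsimp only [K]; omega) hj⟩, rfl, h1⟩
  · have h1 : Det (fun j : Bool × GameState × Data =>
        .cons (encode j.1) (.cons (encode j.2.1) j.2.2)) fun j =>
          encode (j.2.1.1, (j.2.1.2.1.1, j.2.1.2.1.2), j.2.1.2.2) := Det.right (Det.left Det.id)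
    exact det_collisionOutput hh h1.encSnd.encFst (Det.right (Det.right Det.id))
  · refine ⟨B, fun n => ?_⟩
    rw [← ev_bind]
    refine hB n _ _ (fun b _ => ind (Collision h n b)) ?_ fun u => bot_le
    rintro s' u f ⟨h1, -⟩
    rw [collisionFinal, h1]

end

/-! ## Guessing of keys -/

section

variable (D : DAA)

/-- A signature with a guessed key. -/
def guessOutput (n : ℕ) (cred : Bits) : PMF (Bits × Bits × Bits × Option Bits) :=
  (D.freshKey n).bind fun sk => (D.sign n sk cred (some []) []).map fun σ => ([], σ, [], some [])

theorem eff_guessOutput : Eff (fun j : (ℕ × Bits) × Option Bits => encode j) fun j =>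
    (guessOutput D j.1.1 (j.2.getD [])).map encode := by
  have hj : Det (fun j : (ℕ × Bits) × Option Bits => encode j) fun j =>
    encode ((j.1.1, j.1.2), j.2) := Det.id
  have hnil : ∀ {κ : Type} {y : κ → Data}, Det y fun _ => encode ([] : Bits) := Det.nil
  refine Eff.bindEncode (D.freshKey_ppt.call (a := fun _ => ()) hj.encFst.encFst Det.nil)
    fun e sk x' hx => ?_
  refine Eff.mapEncode (D.sign_ppt.call (hx.lift hj.encFst.encFst) (hx.added.pair
    ((hx.lift (Det.getD hj.encSnd)).pair (hnil.encSome.pair hnil)))) fun e' σ x'' hx' => ?_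
  exact hnil.pair (hx'.added.pair (hnil.pair hnil.encSome))

/-- The adversary has one honest signer join and signs with the received credential and a key of her
own choice. No `Sign` query was made and no key is revoked, so every accepted signature is a
forgery. -/
theorem exists_guess_adversary : ∃ B : Adversary, ∀ n, ∀ s ∈ (D.setup n).support,
    (ev (D.freshKey n) fun sk => ev (randomBits (D.coins.eval n)) fun r =>
      ev (D.issue n s.2 (D.join n s.1 sk r)) fun cred => ev (D.freshKey n) fun sk' =>
        ev (D.sign n sk' cred (some []) []) fun σ => ind (D.verify n s.1 [] (some []) σ [] = true)) ≤
    ev (B.play (handle (D.traceHandler n s.1 s.2)) n s.1 (DAA.TraceState.mk [] [] []))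
      (orZero fun r => ind (D.Forgery n s.1 r.1 r.2)) := by
  obtain ⟨Z₁, Z, -, hZ, htr⟩ := exists_small_traceAnswer D (PolyB.const 0)
  obtain ⟨bD, hbD, hD⟩ := D.setup_ppt.size_le
  obtain ⟨p, c, hc, hp⟩ := eff_guessOutput D
  let K : ℕ → ℕ := fun n => 2 * n + 1 + bD (2 * n + 3)
  have hK : PolyB K := by fun_prop
  let C : ℕ → ℕ := fun n => 100 + K n + 2 * Z (K n) + c (K n + Z (K n) + 2)
  have hC : PolyB C := ((PolyB.const 100).add hK |>.add ((PolyB.const 2).mul (hZ.comp hK))).add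
    (hc.comp ((hK.add (hZ.comp hK)).add (PolyB.const 2)))
  obtain ⟨q, hq⟩ := hC.2
  -- The first three assignments build the code of the query `hjoin []` in `x₁`: the tree for `inr
  -- []`, inside the tag of `inl`, with `x₂` serving as `nil`.
  refine ⟨⟨.seq (.cons 1 2 2) (.seq (.cons 1 1 2) (.seq (.cons 1 2 1) (.seq (.query 1 1)
    (.seq (.cons 0 0 1) (.seq (.setNil 1) (p.sub fun i => i)))))), q⟩, fun n s hs => ?_⟩
  have hqn := hq n
  set O := handle (D.traceHandler n s.1 s.2) with hO
  set t₀ := DAA.TraceState.mk [] [] [] with ht₀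
  set ans := D.traceAnswer n s.1 s.2 t₀ (.hjoin []) with hans
  have hsz : (encode n).size + (encode s.1).size + (encode s.2).size ≤ K n := by
    have h1 := hD n () s hs
    have h2 : (encode (n, ())).size = 2 * n + 3 := by
      rw [size_encode_pair, size_encode_nat]; show 1 + (2 * n + 1) + 1 = _; omega
    have h3 : (encode s).size = 1 + (encode s.1).size + (encode s.2).size := rfl
    rw [h2] at h1
    rw [size_encode_nat]
    dsimp only [K]
    omega
  have hcred : ∀ r ∈ ans.support, (encode r.1).size ≤ Z (K n) := fun r hr =>
    (htr (K n) n s.1 s.2 t₀ (.start 0) (.hjoin []) (by simpa [Sim.start] using hsz)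
      (by simp [ht₀]) rfl r hr).1
  set d := encode (n, s.1) with hd
  have hdK : d.size ≤ K n + 1 := by
    rw [hd, size_encode_pair]; have := (encode s.2).size_pos; omega
  let s₁ : Store := Function.update (st d) 1 (encode (DAA.TraceQuery.hjoin []))
  have hquery : Runs O (.query 1 1) s₁ t₀ (1 + Z (K n))
      (ans.map fun r => (Function.update s₁ 1 (encode r.1), r.2)) := by
    have hs1 : s₁ 1 = encode (DAA.TraceQuery.hjoin []) := Function.update_self _ _ _
    refine (runs_query (c := Z (K n)) ?_).congr ?_
    · rw [hs1, hO, D.handle_traceHandler, PMF.support_map]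
      rintro _ ⟨r, hr, rfl⟩
      exact hcred r hr
    · rw [hs1, hO, D.handle_traceHandler, PMF.map_comp]; rfl
  have hrest : ∀ r ∈ ans.support, Runs O (.seq (.cons 0 0 1) (.seq (.setNil 1) (p.sub fun i => i)))
      (Function.update s₁ 1 (encode r.1)) r.2 (10 + K n + Z (K n) + c (K n + Z (K n) + 2))
      (((guessOutput D n (r.1.getD [])).map fun b => (b, r.2)).map fun z =>
        (st (encode z.1), z.2)) := by
    intro r hr
    have h1 := hcred r hr
    have hcall := Runs.call_at (O := O) (φ := fun i => i) (fun _ _ h => h)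
      (s := st (.cons d (encode r.1))) r.2 (hp ((n, s.1), r.1)) rfl fun j => rfl
    refine Runs.mono (Runs.seq_pure (runs_cons 0 0 1 _ _) (Runs.seq_pure
      ((runs_setNil 1 _ _).congr ?_) (hcall.congr ?_))) ?_
    · congr 2
      funext i
      rcases i with _ | _ | i
      · simp [s₁, st]
      · simp [st, emptyStore]
      · simp [s₁, st, emptyStore]
    · rw [PMF.map_comp, PMF.map_comp]
      congr 1
      funext b
      simp [st]
    · have h2 := hc.1 (show (encode ((n, s.1), r.1)).size ≤ K n + Z (K n) + 2 by
        rw [size_encode_pair, ← hd]; omega)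
      simp [s₁, st]
      omega
  have hall := Runs.seq_map hquery hrest
  rw [← PMF.map_bind] at hall
  have hrun : Runs O _ (st d) t₀ _ _ := Runs.seq_pure (runs_cons 1 2 2 _ _)
    (Runs.seq_pure (runs_cons 1 1 2 _ _) (Runs.seq_pure
      ((runs_cons 1 2 1 _ _).congr (μ' := PMF.pure (s₁, t₀)) (by
        congr 2
        funext i
        rcases i with _ | _ | i
        · simp [s₁, st]
        · simp [s₁, st, emptyStore]; rfl
        · simp [s₁, st, emptyStore])) hall))
  rw [ev_play]
  have hbound := hrun.le_ev_map (F := q.eval n) (W := orZero fun z => orZero (fun b =>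
    ind (D.Forgery n s.1 b z.2.1)) (decode (z.1 0)))
    (g := fun z => ind (D.Forgery n s.1 z.1 z.2)) (by
      refine le_trans ?_ hqn
      simp [st, emptyStore, Data.size, C]
      omega) (fun r _ F' _ => by simp [orZero, st, decode_encode])
  refine le_trans ?_ hbound
  simp only [hans, DAA.traceAnswer, ht₀, List.find?_nil, ev_bind, ev_map, guessOutput]
  refine ev_mono fun sk _ => ev_mono fun r _ => ev_mono fun cred _ => ev_mono fun sk' _ =>
    ev_mono fun σ _ => ?_
  by_cases hv : D.verify n s.1 [] (some []) σ [] = true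
  · exact (ind_le_one _).trans (ind_true ⟨hv, by simp⟩).ge
  · rw [ind_false hv]; exact bot_le

end

/-! ## Probabilities of the experiments -/

theorem apply_true_eq_ev (μ : PMF Bool) : μ true = ev μ fun b => ind (b = true) := by
  rw [← ev_indicator_eq μ true]
  refine ev_congr fun b _ => ?_
  by_cases hb : b = true
  · rw [ind_true hb, if_pos hb]
  · rw [ind_false hb, if_neg hb]

theorem ofReal_Pr (μ : PMF Bool) : ENNReal.ofReal (Pr μ) = μ true :=
  ENNReal.ofReal_toReal (μ.apply_ne_top true)

theorem Pr_nonneg (μ : PMF Bool) : 0 ≤ Pr μ := ENNReal.toReal_nonneg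

theorem eq_true_of_Pr_eq_one {μ : PMF Bool} (h : Pr μ = 1) {b : Bool} (hb : b ∈ μ.support) :
    b = true := by
  have h1 : μ true = 1 := by rw [← ofReal_Pr, h, ENNReal.ofReal_one]
  rw [PMF.apply_eq_one_iff] at h1
  rw [h1] at hb
  exact hb

theorem ind_congr {p q : Prop} (h : p ↔ q) : ind p = ind q := by rw [propext h]

theorem collisionExp_apply (h : ℕ → Bits → Bits) (A : Adversary) (n : ℕ) :
    ev (A.play noOracle n () ()) (orZero fun r => ind (Collision h n r.1)) =
      collisionExp h A n true := by
  rw [apply_true_eq_ev]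
  simp only [collisionExp, pmf_bind_eq, pmf_pure_eq, ev_bind, ev_pure]
  refine ev_congr fun r _ => ?_
  rcases r with _ | ⟨⟨m, m'⟩, t⟩
  · simp [orZero, ind_false]
  · exact ind_congr (by simp [Collision])

/-- Only the first winning condition of the game is exploited; unlinked signatures play no role. -/
theorem DAA.le_traceExp_apply (D : DAA) (A : Adversary) (n : ℕ) :
    (ev (D.setup n) fun s => ev (A.play (handle (D.traceHandler n s.1 s.2)) n s.1
      (DAA.TraceState.mk [] [] [])) (orZero fun r => ind (D.Forgery n s.1 r.1 r.2))) ≤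
      D.traceExp A n true := by
  rw [apply_true_eq_ev]
  simp only [traceExp, pmf_bind_eq, pmf_pure_eq, ev_bind, ev_pure]
  refine ev_mono fun s _ => ev_mono fun r _ => ?_
  rcases r with _ | ⟨⟨S, σ, m, dom⟩, t⟩
  · exact bot_le
  · by_cases hF : D.Forgery n s.1 (S, σ, m, dom) t
    · refine (ind_le_one _).trans (ind_true ?_).ge
      simp only [decide_eq_true_eq]
      exact Or.inl hF
    · simp [orZero, ind_false hF]

section

variable (D : LinkableDAA) (h : ℕ → Bits → Bits) (Pf : ProofSystem (Bits × Bits) (Bits × Bits))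

/-- The pseudonym of a comment is determined by the key and the basename, so the signatures sampled
in the test have no influence. -/
theorem matchesNym_eq (ρ : ℕ × Bits) (pk nym dom m : Bits)
    (l : List (Bits × Bits × Bits × Bits)) :
    (protocol D h Pf).matchesNym ρ pk nym dom m l =
      PMF.pure (l.any fun e => decide (nym = D.nymGen ρ.1 e.2.1 dom)) := by
  induction l with
  | nil => rfl
  | cons e l ih =>
    rw [CommentingScheme.matchesNym, ih]
    simp only [protocol, pmf_bind_eq, pmf_pure_eq, PMF.bind_bind, PMF.pure_bind, List.any_cons]
    exact PMF.bind_const _ (PMF.pure (decide (nym = D.nymGen ρ.1 e.2.1 dom) ||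
      l.any fun e => decide (nym = D.nymGen ρ.1 e.2.1 dom)))

open Classical in
/-- The experiment after the setup of the proof system. -/
def frameRest (A : Adversary) (n : ℕ) (ρ : Bits) : PMF Bool :=
  (D.setup n).bind fun s =>
    (A.play (β := FrameOut) (frameOracle D h Pf ⟨n, s.1, ρ, [], []⟩ s.2) n ((n, ρ), s.1)
      FState.start).map fun r => match r with
      | none => false
      | some o => (protocol D h Pf).verify (n, ρ) s.1 o.1.1 o.1.2.1 o.1.2.2.1 o.1.2.2.2 &&
          decide (¬ ∃ U, (U, o.1.1, o.1.2.1, o.1.2.2.1, o.1.2.2.2) ∈ o.2.COMM) &&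
          (o.2.USK.filter fun e => decide (e.1 ∈ o.2.HU)).any
            fun e => decide (o.1.1 = D.nymGen n e.2.1 o.1.2.1)

theorem frameExp_eq (A : Adversary) (n : ℕ) :
    (protocol D h Pf).frameExp A n = (Pf.setup n).bind (frameRest D h Pf A n) := by
  simp only [CommentingScheme.frameExp, matchesNym_eq, pmf_bind_eq, pmf_pure_eq]
  have h1 : (protocol D h Pf).setup n = (Pf.setup n).bind fun ρ => PMF.pure (n, ρ) := rfl
  have h2 : ∀ ρ, (protocol D h Pf).keyGen ρ =
    (D.setup ρ.1).bind fun s => PMF.pure (s.1, (s.1, s.2)) := fun ρ => rfl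
  simp only [h1, h2, PMF.bind_bind, PMF.pure_bind]
  congr 1
  funext ρ
  rw [frameRest]
  congr 1
  funext s
  rw [← PMF.bind_pure_comp]
  congr 1
  funext r
  rcases r with _ | ⟨⟨nym, dom, m, γ⟩, t⟩
  · rfl
  · rfl

/-- The experiment does not look at the fields `τ` and `dom₀`; they are left free so that the
extractor's trapdoor and the long basename can be inserted. -/
theorem frameRest_apply (A : Adversary) (n : ℕ) (ρ τ dom₀ : Bits) :
    frameRest D h Pf A n ρ true = ev (D.setup n) fun s =>
      ev (exec (frameOracle D h Pf ⟨n, s.1, ρ, τ, dom₀⟩ s.2) A.prog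
        (st (encode (n, ((n, ρ), s.1))), .start, A.clock.eval n))
        (orZero (outValue (Framed D h ⟨n, s.1, ρ, τ, dom₀⟩))) := by
  rw [apply_true_eq_ev, frameRest, ev_bind]
  refine ev_congr fun s _ => ?_
  rw [ev_map]
  refine Eq.trans ?_ (ev_play A (frameOracle D h Pf ⟨n, s.1, ρ, [], []⟩ s.2) n ((n, ρ), s.1)
    FState.start fun r : FrameOut × FState => ind (Framed D h ⟨n, s.1, ρ, τ, dom₀⟩ r.2 r.1))
  refine ev_congr fun r _ => ?_
  rcases r with _ | ⟨⟨nym, dom, m, σ, nym', dom', hm⟩, t⟩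
  · simp [orZero, ind_false]
  · simp only [Function.comp, orZero]
    refine ind_congr ?_
    simp only [Framed, NewComment, protocol, Bool.and_eq_true, decide_eq_true_eq, List.any_eq_true,
      List.mem_filter]
    constructor
    · rintro ⟨⟨h1, h2⟩, e, ⟨h3, h4⟩, h5⟩
      exact ⟨⟨h1, h2⟩, e, h3, h4, h5⟩
    · rintro ⟨⟨h1, h2⟩, e, h3, h4, h5⟩
      exact ⟨⟨h1, h2⟩, e, ⟨h3, h4⟩, h5⟩

end

/-! ## Non-frameability -/

section

variable {D : LinkableDAA} {h : ℕ → Bits → Bits} {Pf : ProofSystem (Bits × Bits) (Bits × Bits)}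

/-- Whether a signature of an honest signer is accepted. -/
def DAA.acceptExp (D : DAA) (n : ℕ) (sk : Bits) (dom : Option Bits) (m : Bits) (RL : List Bits) :
    PMF Bool := do
  let (pk, cred) ← D.honestCred n sk
  let σ ← D.sign n sk cred dom m
  return D.verify n pk m dom σ RL

/-- If two keys had a common pseudonym for `dom`, each signature of the first would be linked to
signatures of the second and, by the revocation clause, would be rejected once the second key is
revoked. Acceptance with positive probability rules this out. -/
theorem nymInjective_of_accepted (hcorrect : D.toDAA.Correct) (hlink : D.InstantlyLinkable) {n : ℕ}
    {ν : ℝ} (hν : ν < 1) (hacc : ∀ (sk : Bits) (dom : Option Bits) (m : Bits) (RL : List Bits),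
      D.isKey n sk = true → (∀ sk' ∈ RL, D.isKey n sk' = true) → sk ∉ RL →
      1 - ν ≤ Pr (D.acceptExp n sk dom m RL)) : NymInjective D n := by
  intro sk sk' dom hsk hsk' hnym
  by_contra hne
  have h1 := hacc sk (some dom) [] [sk'] hsk (by simpa using hsk') (by simpa using hne)
  have h2 : true ∈ (D.acceptExp n sk (some dom) [] [sk']).support := by
    rw [PMF.mem_support_iff]
    intro h0
    rw [Pr, h0, ENNReal.toReal_zero] at h1
    linarith
  simp only [DAA.acceptExp, pmf_bind_eq, pmf_pure_eq, PMF.mem_support_bind_iff, PMF.mem_support_pure_iff] at h2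
  obtain ⟨⟨pk, cred⟩, -, σ, hσ, hv⟩ := h2
  refine ((hcorrect.revocation n pk [] dom σ [sk'] (by simpa using hsk')).1 hv.symm).2 sk'
    (by simp) ?_
  obtain ⟨σ', hσ'⟩ := (D.sign n sk' cred (some dom) []).support_nonempty
  refine ⟨cred, [], σ', hσ', (hlink.link_iff n σ σ').2 ?_⟩
  rw [← hlink.nymGen_eq n sk cred dom [] hsk σ hσ, ← hlink.nymGen_eq n sk' cred dom [] hsk' σ' hσ',
    hnym]

theorem DAA.acceptExp_apply (D : DAA) (n : ℕ) (sk dom m : Bits) (RL : List Bits) :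
    D.acceptExp n sk (some dom) m RL true =
    ev (D.setup n) fun s => ev (randomBits (D.coins.eval n)) fun r =>
      ev (D.issue n s.2 (D.join n s.1 sk r)) fun cred => ev (D.sign n sk cred (some dom) m) fun σ =>
        ind (D.verify n s.1 m (some dom) σ RL = true) := by
  rw [apply_true_eq_ev]
  simp only [DAA.acceptExp, DAA.honestCred, pmf_bind_eq, pmf_pure_eq, ev_bind, ev_pure]

/-- Signatures of honest signers are rejected with probability at most `ν`. -/
theorem ev_rejectProb_le {n : ℕ} {ν : ℝ} {sk ρ τ dom₀ : Bits}
    (hacc : 1 - ν ≤ Pr (D.acceptExp n sk (some dom₀) [] [])) :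
    (ev (D.setup n) fun s => ev (randomBits (D.coins.eval n)) fun r =>
      ev (D.issue n s.2 (D.join n s.1 sk r)) fun cred =>
        rejectProb D ⟨n, s.1, ρ, τ, dom₀⟩ sk cred) ≤ ENNReal.ofReal ν := by
  have h1 : ENNReal.ofReal (1 - ν) ≤ _ := ENNReal.ofReal_le_ofReal hacc
  rw [ofReal_Pr, DAA.acceptExp_apply] at h1
  set a := ev (D.setup n) fun s => ev (randomBits (D.coins.eval n)) fun r =>
      ev (D.issue n s.2 (D.join n s.1 sk r)) fun cred => ev (D.sign n sk cred (some dom₀) [])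
        fun σ => ind (D.verify n s.1 [] (some dom₀) σ [] = true) with ha
  set b := ev (D.setup n) fun s => ev (randomBits (D.coins.eval n)) fun r =>
      ev (D.issue n s.2 (D.join n s.1 sk r)) fun cred =>
        rejectProb D ⟨n, s.1, ρ, τ, dom₀⟩ sk cred with hb
  -- Each signature is either accepted or rejected, so the two expectations are complementary.
  have h2 : a + b = 1 := by
    rw [ha, hb]
    have h3 : ∀ v : Bool, ind (v = true) + ind (v ≠ true) = 1 := fun v => by cases v <;> simp [ind]
    simp only [← ev_add, rejectProb, h3, ev_const]
  have ha1 : a ≠ ⊤ := ne_top_of_le_ne_top ENNReal.one_ne_top (h2 ▸ le_self_add)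
  have h3 : (1 : ℝ≥0∞) ≤ ENNReal.ofReal (1 - ν) + ENNReal.ofReal ν := by
    rw [← ENNReal.ofReal_one]
    refine le_trans (ENNReal.ofReal_le_ofReal (by linarith)) ENNReal.ofReal_add_le
  refine (ENNReal.add_le_add_iff_left ha1).1 ?_
  rw [h2]
  exact h3.trans (by gcongr)

/-- The initial error of the simulation is small on average. -/
theorem ev_initialError_le {n N : ℕ} {ν : ℝ} {ρ τ dom₀ : Bits}
    (hacc : ∀ sk, D.isKey n sk = true → 1 - ν ≤ Pr (D.acceptExp n sk (some dom₀) [] [])) :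
    (ev (D.setup n) fun s => initialError D ⟨n, s.1, ρ, τ, dom₀⟩ s.2 N) ≤
      ENNReal.ofReal ν + N * ⨆ k, D.freshKey n k := by
  simp only [initialError, ev_add, ev_const]
  gcongr
  rw [ev_comm]
  exact (ev_mono fun sk hsk => ev_rejectProb_le (hacc sk (D.isKey_of_freshKey n sk hsk))).trans
    (ev_const _ _).le

/-- The probability of a fresh key is small if keys cannot be guessed. -/
theorem iSup_freshKey_le {n : ℕ} {P : ℝ} (hP : 0 ≤ P) (hacc : ∀ sk, D.isKey n sk = true →
      1 / 2 ≤ Pr (D.acceptExp n sk (some []) [] []))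
    (hG : (ev (D.setup n) fun s => ev (D.freshKey n) fun sk => ev (randomBits (D.coins.eval n))
      fun r => ev (D.issue n s.2 (D.join n s.1 sk r)) fun cred => ev (D.freshKey n) fun sk' =>
        ev (D.sign n sk' cred (some []) []) fun σ =>
          ind (D.verify n s.1 [] (some []) σ [] = true)) ≤ ENNReal.ofReal P) :
    ⨆ k, D.freshKey n k ≤ ENNReal.ofReal (Real.sqrt (2 * P)) := by
  refine iSup_le fun k => ?_
  by_cases hk : D.freshKey n k = 0
  · rw [hk]; exact bot_le
  have h1 := ENNReal.ofReal_le_ofReal (hacc k (D.isKey_of_freshKey n k hk))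
  rw [ofReal_Pr, DAA.acceptExp_apply] at h1
  -- Both independent samples equal `k` with the square of its probability, and then an honestly
  -- made signature is accepted with probability at least `1 / 2`.
  have h2 : D.freshKey n k * (D.freshKey n k * ENNReal.ofReal (1 / 2)) ≤ ENNReal.ofReal P := by
    refine le_trans ?_ hG
    rw [ev_comm]
    refine le_trans ?_ (mul_le_ev _ _ k)
    gcongr
    refine (mul_le_mul_right h1 _).trans ?_
    simp only [← ev_const_mul]
    exact ev_mono fun s _ => ev_mono fun r _ => ev_mono fun cred _ =>
      le_trans (ev_const_mul _ _ _).le (mul_le_ev _ _ k)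
  have h3 : D.freshKey n k = ENNReal.ofReal (D.freshKey n k).toReal :=
    (ENNReal.ofReal_toReal ((D.freshKey n).apply_ne_top k)).symm
  set p := (D.freshKey n k).toReal with hp
  have hp0 : 0 ≤ p := ENNReal.toReal_nonneg
  rw [h3, ← ENNReal.ofReal_mul hp0, ← ENNReal.ofReal_mul hp0, ENNReal.ofReal_le_ofReal_iff hP] at h2
  rw [h3]
  exact ENNReal.ofReal_le_ofReal (Real.le_sqrt_of_sq_le (by nlinarith))

end

/-! ### Closure properties of negligible functions -/

section

/-- The function `n ^ k * √f` is the square root of `n ^ (2 * k) * f`, which tends to `0`. -/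
theorem Negligible.sqrt {f : ℕ → ℝ} (hf : Negligible f) (h0 : ∀ n, 0 ≤ f n) :
    Negligible fun n => Real.sqrt (f n) := by
  intro k
  have h1 := (hf (2 * k)).sqrt
  rw [Real.sqrt_zero] at h1
  refine h1.congr fun n => ?_
  rw [Real.sqrt_mul' _ (h0 n), pow_mul', Real.sqrt_sq (by positivity)]

theorem Negligible.poly_mul {f : ℕ → ℝ} (hf : Negligible f) (q : Polynomial ℕ) :
    Negligible fun n => ((q.eval n : ℕ) : ℝ) * f n := by
  have h1 := Asymptotics.SuperpolynomialDecay.polynomial_mul hf (q.map (Nat.castRingHom ℝ))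
  refine h1.congr fun n => ?_
  rw [Polynomial.eval_natCast_map]
  simp

end

/-! ### The bound for reference strings of the extractor -/

section

/-- Every number below `N` is guessed with probability at least `1 / (2 * N)`; this factor is the
loss from guessing the framed user. -/
theorem sum_range_le_guess (N : ℕ) (g : ℕ → ℝ≥0∞) :
    ∑ j ∈ Finset.range N, g j ≤ ((2 * N : ℕ) : ℝ≥0∞) * ev (guess N) g := by
  rw [← ev_const_mul, ev]
  refine le_trans (Finset.sum_le_sum fun j hj => ?_) (ENNReal.sum_le_tsum (Finset.range N))
  have hj' := Finset.mem_range.1 hj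
  have h0 : ((2 * N : ℕ) : ℝ≥0∞) ≠ 0 := by rw [Nat.cast_ne_zero]; omega
  calc g j = ((2 * N : ℕ) : ℝ≥0∞)⁻¹ * (((2 * N : ℕ) : ℝ≥0∞) * g j) := by
        rw [← mul_assoc, ENNReal.inv_mul_cancel h0 (ENNReal.natCast_ne_top _), one_mul]
    _ ≤ _ := by gcongr; exact le_guess hj'

variable {D : LinkableDAA} {h : ℕ → Bits → Bits} {Pf : ProofSystem (Bits × Bits) (Bits × Bits)}
  {E₁ : ℕ → PMF (Bits × Bits)} {E₂ : ℕ → Bits → Bits → Bits × Bits → Bits → PMF (Bits × Bits)}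

/-- The bound for the experiment with the reference strings of the extractor. -/
theorem ev_frameRest_le (hcorrect : D.toDAA.Correct) (hlink : D.InstantlyLinkable) {n M N : ℕ}
    (hinj : NymInjective D n) (hE₂ : ∀ e ∈ (E₁ n).support, ∀ x π,
      Pf.verifyProof n e.1 x π = true → ∀ w ∈ (E₂ n e.1 e.2 x π).support, D.joinRel n x w)
    {dom₀ : Bits} (hdom : ∀ d : Data, d.size ≤ M → ∀ U dom x,
      (decode d : Option (FrameQuery (Bits × Bits))) = some (.createComment U dom x) →
        dom.length < dom₀.length) (A : Adversary) (hN : A.clock.eval n = N)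
    (hM : ∀ s ∈ (D.setup n).support, ∀ e ∈ (E₁ n).support,
      (encode (n, ((n, e.1), s.1))).size + N ≤ M) {ν : ℝ}
    (hacc : ∀ sk, D.isKey n sk = true → 1 - ν ≤ Pr (D.acceptExp n sk (some dom₀) [] [])) :
    ev (E₁ n) (fun e => frameRest D h Pf A n e.1 true) ≤
      ((2 * N : ℕ) : ℝ≥0∞) *
        ((ev (D.setup n) fun s => ev (startDist E₁ N n s.1 s.2 dom₀) fun r =>
          wp (simOracle D h Pf E₂) (forgeryValue D ⟨n, s.1, [], [], []⟩) A.prog (forgeryFinal D h)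
            (st r.1) r.2 N) +
        ev (D.setup n) fun s => ev (startDist E₁ N n s.1 s.2 dom₀) fun r =>
          wp (simOracle D h Pf E₂) 0 A.prog (collisionFinal h) (st r.1) r.2 N) +
      N * (ENNReal.ofReal ν + N * ⨆ k, D.freshKey n k) := by
  -- For a fixed reference string and fixed issuer's keys, the sum over the possible numbers of the
  -- framed user becomes an average over the guess. The error does not depend on the number and is
  -- counted `N` times.
  have hone : ∀ e ∈ (E₁ n).support, ∀ s ∈ (D.setup n).support,
      ev (exec (frameOracle D h Pf ⟨n, s.1, e.1, e.2, dom₀⟩ s.2) A.prog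
        (st (encode (n, ((n, e.1), s.1))), .start, A.clock.eval n))
        (orZero (outValue (Framed D h ⟨n, s.1, e.1, e.2, dom₀⟩))) ≤
      ((2 * N : ℕ) : ℝ≥0∞) *
        ((ev (guess N) fun j => wp (simOracle D h Pf E₂) (forgeryValue D ⟨n, s.1, [], [], []⟩)
          A.prog (forgeryFinal D h) (st (encode (n, ((n, e.1), s.1))))
            (gameStart n s.1 s.2 dom₀ e j) N) +
        ev (guess N) fun j => wp (simOracle D h Pf E₂) 0 A.prog (collisionFinal h)
          (st (encode (n, ((n, e.1), s.1)))) (gameStart n s.1 s.2 dom₀ e j) N) +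
      N * initialError D ⟨n, s.1, e.1, e.2, dom₀⟩ s.2 N := by
    intro e he s hs
    rw [hN]
    refine (ev_framed_le A.prog _ N rfl).trans ?_
    refine (Finset.sum_le_sum fun j _ => ev_framedAt_le (E₂ := E₂) hcorrect hlink hinj (hE₂ e he)
      hdom A.prog _ (hM s hs e he)).trans ?_
    rw [Finset.sum_add_distrib, Finset.sum_const, Finset.card_range, nsmul_eq_mul, ← ev_add]
    gcongr
    exact sum_range_le_guess N _
  -- Reference string and issuer's keys are independent, but experiment and reductions sample them
  -- in opposite order.
  have hcomm : ∀ g : Bits × Bits → Bits × Bits → ℝ≥0∞,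
      (ev (E₁ n) fun e => ev (D.setup n) (g e)) = ev (D.setup n) fun s => ev (E₁ n) fun e => g e s :=
    fun g => ev_comm _ _ _
  simp_rw [fun e : Bits × Bits => frameRest_apply D h Pf A n e.1 e.2 dom₀]
  refine (ev_mono fun e he => ev_mono fun s hs => hone e he s hs).trans ?_
  simp only [ev_add, ev_const_mul]
  refine add_le_add (mul_le_mul_right (add_le_add ?_ ?_) _) (mul_le_mul_right ?_ _)
  · rw [hcomm]; simp only [startDist, ev_bind, ev_map]; exact le_rfl
  · rw [hcomm]; simp only [startDist, ev_bind, ev_map]; exact le_rfl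
  · exact (ev_mono fun e _ => ev_initialError_le (ρ := e.1) (τ := e.2) hacc).trans
      (ev_const _ _).le

end

/-! ### The bound for the experiment -/

section

variable {D : LinkableDAA} {h : ℕ → Bits → Bits} {Pf : ProofSystem (Bits × Bits) (Bits × Bits)}

/-- `δ` is the advantage of the experiment itself as a distinguisher of reference strings; no
efficiency is needed for it, as the proof system is secure against all algorithms. The restriction
`ν n ≤ 1 / 2` serves twice: it makes pseudonyms injective, and it gives the constant in the bound on
the probabilities of keys. -/
theorem exists_frameExp_le (hcorrect : D.toDAA.Correct) (hlink : D.InstantlyLinkable)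
    (hh : IsPolyTime h) (hpok : Pf.IsProofOfKnowledge D.toDAA.joinRel) (A : Adversary) :
    ∃ (δ ν : ℕ → ℝ) (B C G : Adversary), Negligible δ ∧ Negligible ν ∧ ∀ n, ν n ≤ 1 / 2 →
      Pr ((protocol D h Pf).frameExp A n) ≤ δ n +
        ((2 * A.clock.eval n : ℕ) * (Pr (D.traceExp B n) + Pr (collisionExp h C n)) +
          (A.clock.eval n : ℕ) * (|ν n| +
            (A.clock.eval n : ℕ) * Real.sqrt (2 * Pr (D.traceExp G n)))) := by
  obtain ⟨E₁, E₂, hE₁, hE₂, hind, hext⟩ := hpok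
  obtain ⟨ν, hν, hacc⟩ := hcorrect.accepted
  obtain ⟨M, hM, hMb⟩ := exists_start_size_le (E₁ := E₁) D hE₁ A.clock
  obtain ⟨q, hq⟩ := exists_long hM
  obtain ⟨B, hB⟩ := exists_trace_adversary (D := D) Pf hh hE₁ hE₂ A q
  obtain ⟨C, hC⟩ := exists_collision_adversary (D := D) Pf hh hE₁ hE₂ A q
  obtain ⟨G, hG⟩ := exists_guess_adversary D.toDAA
  refine ⟨_, ν, B, C, G, hind (frameRest D h Pf A), hν, fun n hn => ?_⟩
  have hacc' : ∀ sk dom m RL, D.isKey n sk = true → (∀ sk' ∈ RL, D.isKey n sk' = true) →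
      sk ∉ RL → 1 - ν n ≤ Pr (D.acceptExp n sk dom m RL) :=
    fun sk dom m RL h1 h2 h3 => le_trans (by rw [Nat.cast_one]) (hacc n sk dom m RL h1 h2 h3)
  have hinj : NymInjective D n := nymInjective_of_accepted hcorrect hlink (by linarith) hacc'
  have hrel : ∀ e ∈ (E₁ n).support, ∀ x π, Pf.verifyProof n e.1 x π = true →
      ∀ w ∈ (E₂ n e.1 e.2 x π).support, D.joinRel n x w := by
    intro e he x π hv w hw
    -- Extraction that succeeds with probability one succeeds on every outcome. The algorithm that
    -- always returns `(x, π)` yields this for a given proof, whatever the reference string.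
    have h1 := hext (fun _ _ => PMF.pure (x, π)) n
    simp only [pmf_bind_eq, pmf_pure_eq, PMF.pure_bind] at h1
    have h2 := eq_true_of_Pr_eq_one h1
      ((PMF.mem_support_bind_iff _ _ _).2 ⟨e, he, (PMF.mem_support_bind_iff _ _ _).2
        ⟨w, hw, (PMF.mem_support_pure_iff _ _).2 rfl⟩⟩)
    simp only [decide_eq_true_eq] at h2
    exact h2.resolve_left (by simp [hv])
  have hkey : ⨆ k, D.freshKey n k ≤ ENNReal.ofReal (Real.sqrt (2 * Pr (D.traceExp G n))) := by
    refine iSup_freshKey_le (Pr_nonneg _) (fun sk hsk => le_trans (by linarith)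
      (hacc' sk (some []) [] [] hsk (by simp) (by simp))) ?_
    rw [ofReal_Pr]
    exact (ev_mono fun s hs => hG n s hs).trans (D.le_traceExp_apply G n)
  have hmain := ev_frameRest_le (h := h) (E₂ := E₂) hcorrect hlink hinj hrel (hq n) A rfl
    (fun s hs e he => (hMb n s hs e he).2.1) (ν := ν n)
    fun sk hsk => hacc' sk _ [] [] hsk (by simp) (by simp)
  have hB' := (ev_mono fun s hs => hB n s hs).trans (D.le_traceExp_apply B n)
  have hC' := (hC n).trans (collisionExp_apply h C n).le
  have hfin : (do let (ρ, _) ← E₁ n; frameRest D h Pf A n ρ : PMF Bool) true ≤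
      ((2 * A.clock.eval n : ℕ) : ℝ≥0∞) * (D.traceExp B n true + collisionExp h C n true) +
        (A.clock.eval n : ℕ) * (ENNReal.ofReal |ν n| + (A.clock.eval n : ℕ) *
          ENNReal.ofReal (Real.sqrt (2 * Pr (D.traceExp G n)))) := by
    refine le_trans (le_of_eq ?_) (hmain.trans ?_)
    · simp only [apply_true_eq_ev, pmf_bind_eq, ev_bind]
    · gcongr
      exact le_abs_self _
  have hreal := hfin
  simp only [← ofReal_Pr, ← ENNReal.ofReal_natCast] at hreal
  rw [← ENNReal.ofReal_add (Pr_nonneg _) (Pr_nonneg _),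
    ← ENNReal.ofReal_mul (by positivity), ← ENNReal.ofReal_mul (by positivity),
    ← ENNReal.ofReal_add (by positivity) (by positivity), ← ENNReal.ofReal_mul (by positivity),
    ← ENNReal.ofReal_add (mul_nonneg (by positivity) (add_nonneg (Pr_nonneg _) (Pr_nonneg _)))
      (by positivity), ENNReal.ofReal_le_ofReal_iff (add_nonneg (mul_nonneg (by positivity)
        (add_nonneg (Pr_nonneg _) (Pr_nonneg _))) (by positivity))] at hreal
  have habs := le_abs_self (Pr (do let ρ ← Pf.setup n; frameRest D h Pf A n ρ) -
    Pr (do let (ρ, _) ← E₁ n; frameRest D h Pf A n ρ))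
  have heq : Pr ((protocol D h Pf).frameExp A n) =
      Pr (do let ρ ← Pf.setup n; frameRest D h Pf A n ρ) := by
    rw [frameExp_eq]; rfl
  rw [heq]
  linarith

end
end TrollThrottle
end

theorem mainTheorem2 (D : TrollThrottle.LinkableDAA)
    (h : ℕ → TrollThrottle.Bits → TrollThrottle.Bits)
    (Pf : TrollThrottle.ProofSystem (TrollThrottle.Bits × TrollThrottle.Bits)
      (TrollThrottle.Bits × TrollThrottle.Bits))
    (hcorrect : D.toDAA.Correct)
    (htrace : D.toDAA.UserControlledTraceable)
    (hlink : D.InstantlyLinkable)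
    (hcoll : TrollThrottle.CollisionResistant h)
    (hpok : Pf.IsProofOfKnowledge D.toDAA.joinRel) :
    (TrollThrottle.protocol D h Pf).NonFrameable := by
  intro A
  obtain ⟨δ, ν, B, C, G, hδ, hν, hle⟩ :=
    TrollThrottle.exists_frameExp_le hcorrect hlink hcoll.1 hpok A
  have hν' : Filter.Tendsto ν Filter.atTop (nhds 0) := by simpa using hν 0
  have hG : TrollThrottle.Negligible fun n => Real.sqrt (2 * TrollThrottle.Pr (D.traceExp G n)) :=
    TrollThrottle.Negligible.sqrt ((htrace G).const_mul 2)
      fun n => mul_nonneg zero_le_two (TrollThrottle.Pr_nonneg _)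
  have habs : TrollThrottle.Negligible fun n => |ν n| :=
    hν.trans_abs_le fun n => (abs_abs (ν n)).le
  have hsum := hδ.add (((TrollThrottle.Negligible.poly_mul ((htrace B).add (hcoll.2 C))
    (2 * A.clock))).add (TrollThrottle.Negligible.poly_mul
      (habs.add (hG.poly_mul A.clock)) A.clock))
  refine hsum.trans_eventually_abs_le ?_
  -- The bound is available only where `ν n ≤ 1 / 2`. A negligible function tends to `0`, so this
  -- excludes finitely many parameters, which do not affect negligibility.
  filter_upwards [hν'.eventually (ge_mem_nhds (show (0 : ℝ) < 1 / 2 by norm_num))] with n hn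
  rw [Function.comp, Function.comp, abs_of_nonneg (TrollThrottle.Pr_nonneg _)]
  refine (hle n hn).trans (le_trans (le_of_eq ?_) (le_abs_self _))
  simp
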